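/- **Theorem.** For $\mu>0$, $\beta>0$ let $T_\mu(\xi)=\frac{\tanh(\sqrt\mu|\xi|)}{\sqrt\mu|\xi|}$, $K_\mu(\xi)=T_\mu(\xi)(1+\beta\mu\xi^2)$, let $\mathcal T_\mu(D),\mathcal K_\mu(D)$ be the Fourier multipliers on $\mathbb R$ with these symbols, $\widehat{D^rf}(\xi)=|\xi|^r\hat f(\xi)$, $J^s=(1+D^2)^{s/2}$, $\|f\|_{H^s}=\|J^sf\|_{L^2}$, and, for real-valued $\zeta,v$, $$\|(\zeta,v)\|_{X^s_{\beta,\mu}}^2=\|\zeta\|_{H^s}^2+\beta\mu\|D^1\zeta\|_{H^s}^2+\|v\|_{H^s}^2+\sqrt\mu\,\|D^{1/2}v\|_{H^s}^2 .$$ Consider for $\varepsilon>0$ the system $$\begin{cases}\partial_t\zeta+\partial_xv+\varepsilon\,\mathcal T_\mu(D)\partial_x(\zeta v)=0\\ \partial_tv+\mathcal K_\mu(D)\partial_x\zeta+\varepsilon\,\mathcal T_\mu(D)(v\,\partial_xv)=0.\end{cases}\qquad(1)$$ Let $s>\frac32$ and $h_0\in(0,1)$. (a) For every $c_0>0$ there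 is $C>0$, depending only on $s,h_0,c_0$, and for every $B>0$ there is $c>0$, depending only on $s,h_0,c_0,B$, such that the following holds for all $\beta\in(0,B]$, $\mu\in(0,1)$, $\varepsilon>0$. Let $(\zeta_0,v_0)\in X^s_{\beta,\mu}(\mathbb R)$ be nonzero and satisfy the non-cavitation condition $1+\varepsilon\zeta_0(x)\ge h_0$ for all $x\in\mathbb R$, and let $0<\varepsilon\le c_0\,\|(\zeta_0,v_0)\|_{X^s_{\beta,\mu}}^{-1}$. Put $T=c\,\|(\zeta_0,v_0)\|_{X^s_{\beta,\mu}}^{-1}$. Then (1) with initial datum $(\zeta_0,v_0)$ has a unique solution $$(\zeta,v)\in C([0,T/\varepsilon];X^s_{\beta,\mu}(\mathbb R))\cap C^1([0,T/\varepsilon];X^{s-\frac32}_{\beta,\mu}(\mathbb R)),$$ and it satisfies $$\sup_{t\in[0,T/\varepsilon]}\|(\zeta,v)(t)\|_{X^s_{\beta,\mu}}\le C\,\|(\zeta_0,v_0)\|_{X^s_{\beta,\mu}} .$$ Moreover there is a ball in $X^s_{\beta,\mu}$ around $(\zeta_0,v_0)$ such that for every datum in it (1) has a unique solution in the same class on the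 same interval $[0,T/\varepsilon]$, and the flow map from this ball to $C([0,T/\varepsilon];X^s_{\beta,\mu}(\mathbb R))$ is continuous. (b) The energy $$\mathscr E_s(\eta,u)=\int_{\mathbb R}(J^s\eta)\,(1+\beta\mu D^2)J^s\eta\,dx+\int_{\mathbb R}(J^su)\,(\mathcal T_\mu^{-1}(D)+\eta)J^su\,dx$$ is coercive uniformly in $\beta$ and $\mu$: for every $h_1>0$ there are $m,M>0$, depending only on $s,h_0,h_1$, such that for all $\beta>0$, $\mu\in(0,1)$ and all $(\eta,u)\in X^s_{\beta,\mu}(\mathbb R)$ with $\eta\ge h_0-1$ and $\|(\eta,u)\|_{H^s\times H^s}\le h_1$, $$m\,\|(\eta,u)\|_{X^s_{\beta,\mu}}^2\le\mathscr E_s(\eta,u)\le M\,\|(\eta,u)\|_{X^s_{\beta,\mu}}^2 .$$ -/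

import Mathlib

open MeasureTheory Filter Topology Set
open scoped FourierTransform ENNReal

noncomputable section

namespace WhithamBoussinesq

/-- Real-valued square integrable functions on the line (modulo a.e. equality). All the Sobolev
spaces below have nonnegative order and are therefore subspaces of this space. -/
abbrev RealL2 : Type := Lp ℝ 2 (volume : Measure ℝ)

/-- The Plancherel–Fourier transform of a real-valued `f ∈ L²`, in Mathlib's normalization
`∫ exp(-2πi x k) f(x) dx`: the variable `k` is the ordinary frequency, so that the angular
frequency is `ξ = 2πk`, and the transform is an isometry of `L²`. -/
def hat (f : RealL2) : Lp ℂ 2 (volume : Measure ℝ) :=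
  𝓕 (Complex.ofRealCLM.compLp f)

/-- `IsMultiplier m f g` says that `g = m(D) f`, where `m` is a function of the angular
frequency `ξ = 2πk`. -/
def IsMultiplier (m : ℝ → ℂ) (f g : RealL2) : Prop :=
  ∀ᵐ k : ℝ, hat g k = m (2 * Real.pi * k) * hat f k

/-- `IsProduct f g p` says that `p` is the pointwise product of `f` and `g`. -/
def IsProduct (f g p : RealL2) : Prop :=
  ∀ᵐ x : ℝ, p x = f x * g x

/-- The symbol `tanh(√μ|ξ|) / (√μ|ξ|)`, with its limit value `1` at `ξ = 0`. -/
def symT (μ ξ : ℝ) : ℝ :=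
  if ξ = 0 then 1 else Real.tanh (√μ * |ξ|) / (√μ * |ξ|)

/-- The symbol `tanh(√μ|ξ|) / (√μ|ξ|) · (1 + βμξ²)`. -/
def symK (β μ ξ : ℝ) : ℝ := symT μ ξ * (1 + β * μ * ξ ^ 2)

/-- The symbol `iξ` of the derivative `∂ₓ`. -/
def symD (ξ : ℝ) : ℂ := Complex.I * (ξ : ℂ)

/-- `‖D^r f‖²_{H^s}`, the integral of `|ξ|^{2r} (1+ξ²)^s |f̂(ξ)|²` (`ξ = 2πk`), with value `∞`
when `D^r f` is not in `H^s`. -/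
def homSobolevSq (r s : ℝ) (f : RealL2) : ℝ≥0∞ :=
  ∫⁻ k : ℝ, ENNReal.ofReal
    (|2 * Real.pi * k| ^ (2 * r) * (1 + (2 * Real.pi * k) ^ 2) ^ s * ‖hat f k‖ ^ 2)

/-- `‖f‖²_{H^s}`, the integral of `(1+ξ²)^s |f̂(ξ)|²`. -/
def sobolevSq (s : ℝ) (f : RealL2) : ℝ≥0∞ :=
  ∫⁻ k : ℝ, ENNReal.ofReal ((1 + (2 * Real.pi * k) ^ 2) ^ s * ‖hat f k‖ ^ 2)

/-- The norm of `X^s_{β,μ}` (with value `∞` outside of the space): its square is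
`‖ζ‖²_{H^s} + βμ‖D¹ζ‖²_{H^s} + ‖v‖²_{H^s} + √μ‖D^{1/2}v‖²_{H^s}`. -/
def XNorm (s β μ : ℝ) (U : RealL2 × RealL2) : ℝ≥0∞ :=
  (sobolevSq s U.1 + ENNReal.ofReal (β * μ) * homSobolevSq 1 s U.1
    + sobolevSq s U.2 + ENNReal.ofReal (√μ) * homSobolevSq (1 / 2) s U.2) ^ (1 / 2 : ℝ)

/-- `U = (ζ, v)` belongs to `X^s_{β,μ}`. -/
def MemX (s β μ : ℝ) (U : RealL2 × RealL2) : Prop := XNorm s β μ U < ∞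

/-- `U ∈ C([0,τ]; X^s_{β,μ})`. Only the values of `U` on `[0,τ]` matter. -/
def ContinuousInX (s β μ τ : ℝ) (U : ℝ → RealL2 × RealL2) : Prop :=
  ∀ t ∈ Icc 0 τ, MemX s β μ (U t) ∧
    Tendsto (fun t' => XNorm s β μ (U t' - U t)) (𝓝[Icc 0 τ] t) (𝓝 0)

/-- At every time of `[0,τ]`, `U` has the derivative `V` with respect to the norm of
`X^s_{β,μ}` (one-sided at the endpoints). -/
def HasTimeDerivInX (s β μ τ : ℝ) (U V : ℝ → RealL2 × RealL2) : Prop :=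
  ∀ t ∈ Icc 0 τ,
    Tendsto (fun t' => XNorm s β μ ((t' - t)⁻¹ • (U t' - U t) - V t))
      (𝓝[Icc 0 τ \ {t}] t) (𝓝 0)

/-- The two equations
`∂ₜζ + ∂ₓv + ε T_μ(D)∂ₓ(ζv) = 0` and `∂ₜv + K_μ(D)∂ₓζ + ε T_μ(D)(v∂ₓv) = 0`
at a fixed time, for the state `U = (ζ, v)` and its time derivative `V = (∂ₜζ, ∂ₜv)`. -/
def Equations (β μ ε : ℝ) (U V : RealL2 × RealL2) : Prop :=
  ∃ dv p Tdp Kdζ q Tq : RealL2,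
    IsMultiplier symD U.2 dv ∧
    IsProduct U.1 U.2 p ∧
    IsMultiplier (fun ξ => (symT μ ξ : ℂ) * symD ξ) p Tdp ∧
    IsMultiplier (fun ξ => (symK β μ ξ : ℂ) * symD ξ) U.1 Kdζ ∧
    IsProduct U.2 dv q ∧
    IsMultiplier (fun ξ => (symT μ ξ : ℂ)) q Tq ∧
    V.1 + dv + ε • Tdp = 0 ∧
    V.2 + Kdζ + ε • Tq = 0

/-- `U` is a solution on `[0,τ]` with initial datum `U₀`, in the class
`C([0,τ]; X^s_{β,μ}) ∩ C¹([0,τ]; X^{s-3/2}_{β,μ})`. -/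
structure IsSolution (s β μ ε τ : ℝ) (U₀ : RealL2 × RealL2) (U : ℝ → RealL2 × RealL2) :
    Prop where
  initial : U 0 = U₀
  continuous : ContinuousInX s β μ τ U
  equation : ∃ V : ℝ → RealL2 × RealL2,
    ContinuousInX (s - 3 / 2) β μ τ V ∧
    HasTimeDerivInX (s - 3 / 2) β μ τ U V ∧
    ∀ t ∈ Icc 0 τ, Equations β μ ε (U t) (V t)

/-- `U` is, on `[0,τ]`, the only solution in the class above with initial datum `U₀`. -/
def IsUniqueSolution (s β μ ε τ : ℝ) (U₀ : RealL2 × RealL2) (U : ℝ → RealL2 × RealL2) : Prop :=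
  IsSolution s β μ ε τ U₀ U ∧
    ∀ U' : ℝ → RealL2 × RealL2, IsSolution s β μ ε τ U₀ U' → EqOn U' U (Icc 0 τ)

/-- The non-cavitation condition `1 + εζ ≥ h₀`. (An element of `H^s`, `s > 1/2`, has a continuous
representative, for which the inequality holds everywhere if and only if it holds a.e.) -/
def NonCavitation (h₀ ε : ℝ) (ζ : RealL2) : Prop :=
  ∀ᵐ x : ℝ, h₀ ≤ 1 + ε * ζ x

/-- The energy `∫ (1 + βμD²)(J^s η)² dx + ∫ (T_μ⁻¹(D) + η)(J^s u)² dx`, that is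
`(a, (1 + βμD²) a) + (b, T_μ⁻¹(D) b) + (b, η b)` with `a = J^s η`, `b = J^s u` and the scalar
product of `L²`; the first two terms are written on the Fourier side. -/
def energy (β μ : ℝ) (η a b : RealL2) : ℝ :=
  (∫ k : ℝ, (1 + β * μ * (2 * Real.pi * k) ^ 2) * ‖hat a k‖ ^ 2)
    + (∫ k : ℝ, (symT μ (2 * Real.pi * k))⁻¹ * ‖hat b k‖ ^ 2)
    + ∫ x : ℝ, η x * (b x) ^ 2

/-- The symbol `(1+ξ²)^{s/2}` of the Bessel potential `J^s`. -/
def symJ (s ξ : ℝ) : ℂ := (((1 + ξ ^ 2) ^ (s / 2) : ℝ) : ℂ)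

end WhithamBoussinesq

end

/-! ### The Fourier transform of real square integrable functions -/

noncomputable section

namespace WhithamBoussinesq

/-! The nonlinearity is quadratic, so `(εζ, εv)` solves the system with `ε = 1`. For data of size
`δ` it suffices to solve that system on `[0, c/δ]`, with `δ` bounded.

Write `A = 𝒯_μ ∂ₓ` and `Λ = 1 + βμD²`. Linearized about `(ζ, v)`, the system reads `∂ₜψ = -(∂ₓw +
A(ζw) + A(vψ))`, `∂ₜw = -(AΛψ + A(vw))`. Its energy is `⟨ψ, Λψ⟩ + ⟨w, (𝒯_μ⁻¹ + ζ)w⟩`. Since `∂ₓ =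
A𝒯_μ⁻¹`, the coupling in the first equation is `A(𝒯_μ⁻¹ + ζ)w`, and skew-symmetry of `A` cancels its
contribution against that of `AΛψ`. The transport terms leave commutators of `A` with `v` and `ζ`.
These are bounded on `L²` uniformly in `μ`, because `tanh(√μ ξ)/√μ` is 1-Lipschitz. The derivatives
in `Λ` cost an additional `μ^{-1/2}`, which the factor `βμ` pays for as long as `β ≤ B`. This is
`linear_energy_estimate`. Non-cavitation makes the energy coercive because `𝒯_μ⁻¹ ≥ 1`; the same
remark gives part (b), `energy_coercive`.

Applying a multiplier `J` with weight `m` to the nonlinear system gives the linearized system with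
forcing built from `J(fg) - fJg - gJf`. For admissible weights one derivative of this remainder is
still controlled at level `m` (`adm_of_growth`, `weighted_energy_estimate`). The growth rate is
linear in the size of the solution while that size stays bounded, so Gronwall and a bootstrap reach
time `c/δ` (`exists_regSol`). The argument is run on an ordinary differential equation obtained by
putting one and the same frequency cutoff into `A` and `∂ₓ`, which keeps the cancellation exact.

The bounds hold with the same constants for `⟨ξ⟩^s` and for all weights `wt s ρ L`, which amplify
frequencies beyond `ρ` by a factor up to `L`. A datum in `X^s` has a bounded amplified norm once `ρ`
is large, so high-frequency tails stay uniformly small. Closeness in `L²` then upgrades to closeness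
in `X^s` (`exists_XW_sub_le`), which gives continuity in time and of the flow map.

Closeness in `L²` comes from the energy of differences. The truncation of a weak solution solves the
regularized system up to a defect `O(n^{1-s})` (`exists_norm_sub_le`). The same comparison yields
convergence of the scheme, uniqueness, and Lipschitz dependence in `L²` (`exists_weakSol`). -/

theorem fourierInv_coe_of_integrable (G : Lp ℂ 2 (volume : Measure ℝ)) (hG : Integrable G) :
    (𝓕⁻ G : Lp ℂ 2 (volume : Measure ℝ)) =ᵐ[volume] 𝓕⁻ (G : ℝ → ℂ) := by
  have hcont : Continuous (𝓕⁻ (G : ℝ → ℂ)) := by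
    have := VectorFourier.fourierIntegral_continuous (μ := (volume : Measure ℝ))
      Real.continuous_fourierChar (L := -innerₗ ℝ) (by simp only [LinearMap.neg_apply, innerₗ_apply_apply]; fun_prop) hG
    exact this
  -- Testing against smooth compactly supported functions suffices. The left side is then evaluated
  -- as a tempered distribution and the right side by Fubini.
  refine ae_eq_of_integral_contDiff_smul_eq ((Lp.memLp _).locallyIntegrable (by norm_num))
    hcont.locallyIntegrable ?_
  intro g g_smooth g_cpt
  have hg₁ : HasCompactSupport (Complex.ofRealCLM ∘ g) := g_cpt.comp_left rfl
  have hg₂ : ContDiff ℝ (↑(⊤ : ℕ∞)) (Complex.ofRealCLM ∘ g) := by fun_prop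
  set φ := hg₁.toSchwartzMap hg₂
  have h1 := congrArg (fun T => T φ) (Lp.fourierInv_toTemperedDistribution_eq G)
  simp only [TemperedDistribution.fourierInv_apply, Lp.toTemperedDistribution_apply] at h1
  -- The transform attached to the pairing `-⟨x, k⟩` is the inverse one; this identity moves it from
  -- `G` to the test function.
  have h2 := VectorFourier.integral_fourierIntegral_smul_eq_flip (μ := (volume : Measure ℝ))
    (ν := (volume : Measure ℝ)) (L := -innerₗ ℝ) Real.continuous_fourierChar
    (by simp only [LinearMap.neg_apply, innerₗ_apply_apply]; fun_prop) φ.integrable hG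
  have h3 : ∫ x : ℝ, φ x • 𝓕⁻ (G : ℝ → ℂ) x = ∫ x : ℝ, (𝓕⁻ φ) x • G x := by
    rw [SchwartzMap.fourierInv_coe]
    refine Eq.trans ?_ h2.symm
    congr 1
    ext x
    congr 1
    simp [Real.fourierInv_eq, VectorFourier.fourierIntegral, mul_comm]
  rw [← h3] at h1
  simpa [φ] using h1.symm

theorem fourier_coe_of_integrable (G : Lp ℂ 2 (volume : Measure ℝ)) (hG : Integrable G) :
    (𝓕 G : Lp ℂ 2 (volume : Measure ℝ)) =ᵐ[volume] 𝓕 (G : ℝ → ℂ) := by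
  have hcont : Continuous (𝓕 (G : ℝ → ℂ)) := by
    have := VectorFourier.fourierIntegral_continuous (μ := (volume : Measure ℝ))
      Real.continuous_fourierChar (L := innerₗ ℝ) (by simp only [innerₗ_apply_apply]; fun_prop) hG
    exact this
  refine ae_eq_of_integral_contDiff_smul_eq ((Lp.memLp _).locallyIntegrable (by norm_num))
    hcont.locallyIntegrable ?_
  intro g g_smooth g_cpt
  have hg₁ : HasCompactSupport (Complex.ofRealCLM ∘ g) := g_cpt.comp_left rfl
  have hg₂ : ContDiff ℝ (↑(⊤ : ℕ∞)) (Complex.ofRealCLM ∘ g) := by fun_prop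
  set φ := hg₁.toSchwartzMap hg₂
  have h1 := congrArg (fun T => T φ) (Lp.fourier_toTemperedDistribution_eq G)
  simp only [TemperedDistribution.fourier_apply, Lp.toTemperedDistribution_apply] at h1
  have h2 := VectorFourier.integral_fourierIntegral_smul_eq_flip (μ := (volume : Measure ℝ))
    (ν := (volume : Measure ℝ)) (L := innerₗ ℝ) Real.continuous_fourierChar
    (by simp only [innerₗ_apply_apply]; fun_prop) φ.integrable hG
  have h3 : ∫ x : ℝ, φ x • 𝓕 (G : ℝ → ℂ) x = ∫ x : ℝ, (𝓕 φ) x • G x := by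
    rw [SchwartzMap.fourier_coe]
    refine Eq.trans ?_ h2.symm
    congr 1
    ext x
    congr 1
    simp [Real.fourier_eq, VectorFourier.fourierIntegral]
  rw [← h3] at h1
  simpa [φ] using h1.symm

/-- Complex conjugation on `L²`. -/
def conjL : Lp ℂ 2 (volume : Measure ℝ) →L[ℝ] Lp ℂ 2 (volume : Measure ℝ) :=
  ContinuousLinearMap.compLpL 2 volume (Complex.conjCLE : ℂ →L[ℝ] ℂ)

/-- Reflection on `L²`. -/
def reflL : Lp ℂ 2 (volume : Measure ℝ) →ₗᵢ[ℝ] Lp ℂ 2 (volume : Measure ℝ) :=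
  Lp.compMeasurePreservingₗᵢ ℝ (fun x : ℝ => -x) (Measure.measurePreserving_neg volume)

theorem coeFn_conjL (F : Lp ℂ 2 (volume : Measure ℝ)) :
    ∀ᵐ x, conjL F x = (starRingEnd ℂ) (F x) :=
  ContinuousLinearMap.coeFn_compLpL _ _

theorem coeFn_reflL (F : Lp ℂ 2 (volume : Measure ℝ)) :
    ∀ᵐ x, reflL F x = F (-x) :=
  Lp.coeFn_compMeasurePreserving F (Measure.measurePreserving_neg volume)

/-- For Schwartz functions conjugation passes under the integral and reverses the sign in the
exponential. Both sides are continuous on `L²`, so density concludes. -/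
theorem fourier_conjL (F : Lp ℂ 2 (volume : Measure ℝ)) :
    𝓕 (conjL F) = conjL (reflL (𝓕 F)) := by
  refine DenseRange.induction_on (p := fun F : Lp ℂ 2 (volume : Measure ℝ) =>
    𝓕 (conjL F) = conjL (reflL (𝓕 F)))
    (SchwartzMap.denseRange_toLpCLM (E := ℝ) (F := ℂ) (p := 2) ENNReal.ofNat_ne_top) F ?_ ?_
  · apply isClosed_eq
    · exact (Lp.fourierTransformₗᵢ ℝ ℂ).continuous.comp conjL.continuous
    · exact conjL.continuous.comp (reflL.continuous.comp (Lp.fourierTransformₗᵢ ℝ ℂ).continuous)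
  · intro φ
    set G : Lp ℂ 2 (volume : Measure ℝ) := SchwartzMap.toLpCLM ℝ ℂ 2 volume φ
    have hG : G =ᵐ[volume] φ := φ.coeFn_toLp 2 volume
    have hGi : Integrable G := φ.integrable.congr hG.symm
    have hci : Integrable (conjL G) :=
      ((Complex.conjCLE : ℂ →L[ℝ] ℂ).integrable_comp hGi).congr
        ((coeFn_conjL G).mono fun x hx => hx.symm)
    apply Lp.ext
    have h4 : ∀ᵐ x : ℝ, (𝓕 G : Lp ℂ 2 (volume : Measure ℝ)) (-x) = 𝓕 (G : ℝ → ℂ) (-x) :=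
      (Measure.measurePreserving_neg volume).quasiMeasurePreserving.ae
        (fourier_coe_of_integrable G hGi)
    filter_upwards [fourier_coe_of_integrable _ hci, coeFn_conjL (reflL (𝓕 G)),
      coeFn_reflL (𝓕 G), h4] with k h1 h2 h3 h4
    rw [h1, h2, h3, h4, Real.fourier_congr_ae (coeFn_conjL G), Real.fourier_eq, Real.fourier_eq,
      ← integral_conj]
    congr 1
    ext x
    simp [Circle.smul_def, Real.fourierChar_apply, ← Complex.exp_conj, Complex.conj_ofNat]

/-- Real functions as complex functions, as a continuous linear map of `L²`. -/
def ofRealL : RealL2 →L[ℝ] Lp ℂ 2 (volume : Measure ℝ) :=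
  ContinuousLinearMap.compLpL 2 volume Complex.ofRealCLM

/-- The real part, as a continuous linear map of `L²`. -/
def reL : Lp ℂ 2 (volume : Measure ℝ) →L[ℝ] RealL2 :=
  ContinuousLinearMap.compLpL 2 volume Complex.reCLM

theorem coeFn_ofRealL (f : RealL2) : ∀ᵐ x, ofRealL f x = (f x : ℂ) :=
  ContinuousLinearMap.coeFn_compLpL _ _

theorem coeFn_reL (F : Lp ℂ 2 (volume : Measure ℝ)) : ∀ᵐ x, reL F x = (F x).re :=
  ContinuousLinearMap.coeFn_compLpL _ _

/-- `hat` as a continuous real-linear map. -/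
def hatL : RealL2 →L[ℝ] Lp ℂ 2 (volume : Measure ℝ) :=
  ((Lp.fourierTransformₗᵢ ℝ ℂ).toContinuousLinearEquiv.toContinuousLinearMap.restrictScalars ℝ).comp
    ofRealL

theorem hat_add (f g : RealL2) : hat (f + g) = hat f + hat g := hatL.map_add f g

theorem hat_sub (f g : RealL2) : hat (f - g) = hat f - hat g := hatL.map_sub f g

theorem hat_neg (f : RealL2) : hat (-f) = -hat f := hatL.map_neg f

theorem hat_smul (c : ℝ) (f : RealL2) : hat (c • f) = c • hat f := hatL.map_smul c f

theorem norm_ofRealL (f : RealL2) : ‖ofRealL f‖ = ‖f‖ := by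
  apply le_antisymm
  · have := Lp.norm_le_mul_norm_of_ae_le_mul (c := 1) (f := ofRealL f) (g := f)
      ((coeFn_ofRealL f).mono fun x hx => by simp [hx])
    simpa using this
  · have := Lp.norm_le_mul_norm_of_ae_le_mul (c := 1) (f := f) (g := ofRealL f)
      ((coeFn_ofRealL f).mono fun x hx => by simp [hx])
    simpa using this

theorem norm_hat (f : RealL2) : ‖hat f‖ = ‖f‖ := by
  have : ‖hat f‖ = ‖ofRealL f‖ := (Lp.fourierTransformₗᵢ ℝ ℂ).norm_map _
  rw [this, norm_ofRealL]

theorem enorm_eq_eLpNorm_hat (f : RealL2) : ‖f‖ₑ = eLpNorm (hat f) 2 volume := by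
  rw [← Lp.enorm_def, ← ofReal_norm, ← ofReal_norm, norm_hat]

theorem hat_injective : Function.Injective hat := by
  intro f g h
  rw [← sub_eq_zero, ← norm_eq_zero, ← norm_hat, hat_sub, h, sub_self, norm_zero]

theorem eq_of_hat_ae_eq {f g : RealL2} (h : ∀ᵐ k, hat f k = hat g k) : f = g :=
  hat_injective (Lp.ext h)

/-- A real function is a fixed point of conjugation, and `fourier_conjL` transports this fixed-point
equation to the frequency side. -/
theorem hat_neg_freq (f : RealL2) : ∀ᵐ k, hat f (-k) = (starRingEnd ℂ) (hat f k) := by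
  have h0 : conjL (ofRealL f) = ofRealL f := by
    apply Lp.ext
    filter_upwards [coeFn_conjL (ofRealL f), coeFn_ofRealL f] with x h1 h2
    rw [h1, h2, Complex.conj_ofReal]
  have h1 : hat f = conjL (reflL (hat f)) := by
    conv_lhs => rw [show hat f = 𝓕 (ofRealL f) from rfl, ← h0, fourier_conjL]
    rfl
  have h2 : ∀ᵐ k, hat f k = conjL (reflL (hat f)) k := by rw [← h1]; exact ae_of_all _ fun _ => rfl
  filter_upwards [h2, coeFn_conjL (reflL (hat f)), coeFn_reflL (hat f)] with k h2 h3 h4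
  rw [h2, h3, h4, Complex.conj_conj]

/-- Converse of `hat_neg_freq`: Hermitian symmetry makes the inverse transform real, so taking the
real part loses nothing. This lets Hermitian symbols act on real functions. -/
theorem exists_hat_eq (G : Lp ℂ 2 (volume : Measure ℝ))
    (hG : ∀ᵐ k, G (-k) = (starRingEnd ℂ) (G k)) : hat (reL (𝓕⁻ G)) = G := by
  have h1 : conjL (reflL G) = G := by
    apply Lp.ext
    filter_upwards [coeFn_conjL (reflL G), coeFn_reflL G, hG] with k h1 h2 h3
    rw [h1, h2, h3, Complex.conj_conj]
  have h2 : conjL (𝓕⁻ G) = 𝓕⁻ G := by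
    apply (Lp.fourierTransformₗᵢ ℝ ℂ).injective
    change 𝓕 (conjL (𝓕⁻ G)) = 𝓕 (𝓕⁻ G)
    rw [fourier_conjL, FourierTransform.fourier_fourierInv_eq, h1]
  have h3 : ofRealL (reL (𝓕⁻ G)) = 𝓕⁻ G := by
    apply Lp.ext
    have h2' : ∀ᵐ k, conjL (𝓕⁻ G) k = (𝓕⁻ G : Lp ℂ 2 (volume : Measure ℝ)) k := by
      rw [h2]; exact ae_of_all _ fun _ => rfl
    filter_upwards [coeFn_ofRealL (reL (𝓕⁻ G)), coeFn_reL (𝓕⁻ G), h2', coeFn_conjL (𝓕⁻ G)]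
      with x h1 h2 h3 h4
    rw [h1, h2]
    rw [h4] at h3
    exact Complex.conj_eq_iff_re.mp h3
  change 𝓕 (ofRealL (reL (𝓕⁻ G))) = G
  rw [h3, FourierTransform.fourier_fourierInv_eq]

theorem inner_eq_re_integral_hat (f g : RealL2) :
    inner ℝ f g = (∫ k : ℝ, (starRingEnd ℂ) (hat f k) * hat g k).re := by
  have h1 : (inner ℂ (hat f) (hat g) : ℂ) = inner ℂ (ofRealL f) (ofRealL g) :=
    (Lp.fourierTransformₗᵢ ℝ ℂ).inner_map_map _ _
  have h2 : (inner ℂ (ofRealL f) (ofRealL g) : ℂ) = ((inner ℝ f g : ℝ) : ℂ) := by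
    rw [L2.inner_def, L2.inner_def, ← integral_complex_ofReal]
    apply integral_congr_ae
    filter_upwards [coeFn_ofRealL f, coeFn_ofRealL g] with x h1 h2
    simp [h1, h2]
  have h3 : (∫ k : ℝ, (starRingEnd ℂ) (hat f k) * hat g k) = inner ℂ (hat f) (hat g) := by
    rw [L2.inner_def]
    congr 1
    ext k
    simp [mul_comm]
  rw [h3, h1, h2, Complex.ofReal_re]

/-! ### Bounded Fourier multipliers on real functions -/

/-- Admissible symbols of bounded multipliers preserving real functions. -/
structure Good (m : ℝ → ℂ) : Prop where
  meas : Measurable m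
  bdd : ∃ C : ℝ, ∀ ξ, ‖m ξ‖ ≤ C
  herm : ∀ ξ, m (-ξ) = (starRingEnd ℂ) (m ξ)

theorem Good.memLp {m : ℝ → ℂ} (hm : Good m) :
    MemLp (fun k : ℝ => m (2 * Real.pi * k)) ∞ volume := by
  obtain ⟨C, hC⟩ := hm.bdd
  exact memLp_top_of_bound
    (hm.meas.comp (measurable_const.mul measurable_id)).aestronglyMeasurable C
    (ae_of_all _ fun k => hC _)

open Classical in
/-- The Fourier multiplier with symbol `m` (a function of the angular frequency). -/
def mult (m : ℝ → ℂ) : RealL2 →L[ℝ] RealL2 :=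
  if hm : Good m then
    reL.comp ((((Lp.fourierTransformₗᵢ ℝ ℂ).symm.toContinuousLinearEquiv.toContinuousLinearMap.comp
      ((ContinuousLinearMap.mul ℂ ℂ).holderL volume ∞ 2 2 hm.memLp.toLp)).restrictScalars ℝ).comp
        hatL)
  else 0

theorem hat_mult {m : ℝ → ℂ} (hm : Good m) (f : RealL2) :
    ∀ᵐ k, hat (mult m f) k = m (2 * Real.pi * k) * hat f k := by
  set G : Lp ℂ 2 (volume : Measure ℝ) :=
    (ContinuousLinearMap.mul ℂ ℂ).holderL volume ∞ 2 2 hm.memLp.toLp (hat f) with hGdef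
  have hG : ∀ᵐ k, G k = m (2 * Real.pi * k) * hat f k := by
    filter_upwards [(ContinuousLinearMap.mul ℂ ℂ).coeFn_holder (r := 2) hm.memLp.toLp (hat f),
      hm.memLp.coeFn_toLp] with k h1 h2
    rw [← h2]
    exact h1
  have h1 : mult m f = reL (𝓕⁻ G) := by
    rw [mult, dif_pos hm]; rfl
  have hG' : ∀ᵐ k, G (-k) = m (2 * Real.pi * (-k)) * hat f (-k) :=
    (Measure.measurePreserving_neg (volume : Measure ℝ)).quasiMeasurePreserving.ae hG
  have h2 : hat (mult m f) = G := by
    rw [h1]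
    apply exists_hat_eq
    filter_upwards [hG, hG', hat_neg_freq f] with k h1 h2 h3
    rw [h1, h2, h3, mul_neg, hm.herm, map_mul]
  rw [h2]; exact hG

theorem isMultiplier_mult {m : ℝ → ℂ} (hm : Good m) (f : RealL2) : IsMultiplier m f (mult m f) :=
  hat_mult hm f

/-! ### Convolution of nonnegative functions -/

/-- Convolution of functions with values in `[0,∞]`. -/
def lconv (F G : ℝ → ℝ≥0∞) (k : ℝ) : ℝ≥0∞ := ∫⁻ l, F (k - l) * G l

theorem measurable_lconv_integrand {F G : ℝ → ℝ≥0∞} (hF : Measurable F) (hG : Measurable G) :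
    Measurable (fun p : ℝ × ℝ => F (p.1 - p.2) * G p.2) :=
  (hF.comp (measurable_fst.sub measurable_snd)).mul (hG.comp measurable_snd)

theorem measurable_lconv {F G : ℝ → ℝ≥0∞} (hF : Measurable F) (hG : Measurable G) :
    Measurable (lconv F G) :=
  (measurable_lconv_integrand hF hG).lintegral_prod_right'

theorem lintegral_lconv {F G : ℝ → ℝ≥0∞} (hF : Measurable F) (hG : Measurable G) :
    ∫⁻ k, lconv F G k = (∫⁻ k, F k) * ∫⁻ k, G k := by
  unfold lconv
  rw [lintegral_lintegral_swap (measurable_lconv_integrand hF hG).aemeasurable]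
  have : ∀ l, ∫⁻ k, F (k - l) * G l = (∫⁻ k, F k) * G l := fun l => by
    rw [lintegral_mul_const _ (by fun_prop), lintegral_sub_right_eq_self F l]
  simp_rw [this]
  rw [lintegral_const_mul _ hG]

theorem lconv_comm (F G : ℝ → ℝ≥0∞) (k : ℝ) : lconv F G k = lconv G F k := by
  unfold lconv
  rw [← lintegral_sub_left_eq_self (fun l => F (k - l) * G l) k]
  simp [mul_comm]

/-- Cauchy–Schwarz after splitting `F = F^{1/2} F^{1/2}`. Integrating in `k` then gives Young's
inequality. -/
theorem lconv_sq_le {F G : ℝ → ℝ≥0∞} (hF : Measurable F) (hG : Measurable G) (k : ℝ) :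
    lconv F G k ^ 2 ≤ (∫⁻ l, F l) * lconv F (fun l => G l ^ 2) k := by
  have hm : Measurable fun l => F (k - l) := hF.comp (measurable_id.const_sub k)
  have h := ENNReal.lintegral_mul_le_Lp_mul_Lq (μ := (volume : Measure ℝ))
    Real.HolderConjugate.two_two
    (f := fun l => F (k - l) ^ (1 / 2 : ℝ)) (g := fun l => F (k - l) ^ (1 / 2 : ℝ) * G l)
    (hm.pow_const _).aemeasurable ((hm.pow_const _).mul hG).aemeasurable
  have e1 : ∀ l, (F (k - l) ^ (1 / 2 : ℝ)) ^ (2 : ℝ) = F (k - l) := fun l => by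
    rw [← ENNReal.rpow_mul]; norm_num
  have e2 : ∀ l, (F (k - l) ^ (1 / 2 : ℝ) * G l) ^ (2 : ℝ) = F (k - l) * G l ^ 2 := fun l => by
    rw [ENNReal.mul_rpow_of_nonneg _ _ (by norm_num), e1]; norm_num
  have e3 : ∀ l, ((fun l => F (k - l) ^ (1 / 2 : ℝ)) * fun l => F (k - l) ^ (1 / 2 : ℝ) * G l) l
      = F (k - l) * G l := fun l => by
    simp only [Pi.mul_apply]
    rw [← mul_assoc, ← sq, ← ENNReal.rpow_natCast, ← ENNReal.rpow_mul]
    norm_num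
  simp_rw [e1, e2, e3] at h
  rw [lintegral_sub_left_eq_self F k] at h
  calc lconv F G k ^ 2 ≤ ((∫⁻ l, F l) ^ (1 / 2 : ℝ) *
        (∫⁻ l, F (k - l) * G l ^ 2) ^ (1 / 2 : ℝ)) ^ 2 := pow_le_pow_left' h 2
    _ = _ := by
      rw [mul_pow, ← ENNReal.rpow_natCast, ← ENNReal.rpow_natCast, ← ENNReal.rpow_mul,
        ← ENNReal.rpow_mul]
      norm_num
      rfl

theorem eLpNorm_two_sq {E : Type*} [TopologicalSpace E] [ContinuousENorm E] (F : ℝ → E) :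
    eLpNorm F 2 volume ^ 2 = ∫⁻ k, ‖F k‖ₑ ^ 2 := by
  rw [eLpNorm_eq_lintegral_rpow_enorm_toReal (by norm_num) (by norm_num), ← ENNReal.rpow_natCast,
    ← ENNReal.rpow_mul]
  norm_num

/-- Young's inequality `L¹ * L² → L²`. -/
theorem eLpNorm_lconv_le {F G : ℝ → ℝ≥0∞} (hF : Measurable F) (hG : Measurable G) :
    eLpNorm (lconv F G) 2 volume ≤ (∫⁻ l, F l) * eLpNorm G 2 volume := by
  have h : eLpNorm (lconv F G) 2 volume ^ 2 ≤ ((∫⁻ l, F l) * eLpNorm G 2 volume) ^ 2 := by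
    rw [mul_pow, eLpNorm_two_sq, eLpNorm_two_sq]
    simp only [enorm_eq_self]
    calc ∫⁻ k, lconv F G k ^ 2 ≤ ∫⁻ k, (∫⁻ l, F l) * lconv F (fun l => G l ^ 2) k :=
          lintegral_mono fun k => lconv_sq_le hF hG k
      _ = _ := by
        rw [lintegral_const_mul _ (measurable_lconv hF (hG.pow_const 2)),
          lintegral_lconv hF (hG.pow_const 2), sq, mul_assoc]
  exact (ENNReal.pow_le_pow_left_iff (by norm_num)).1 h

/-! ### Weighted norms on the Fourier side -/

theorem measurable_hat (f : RealL2) : Measurable (fun k => hat f k) :=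
  (Lp.stronglyMeasurable (hat f)).measurable

/-- The weighted `L²` norm of the Fourier transform. -/
def wN (w : ℝ → ℝ) (f : RealL2) : ℝ≥0∞ :=
  eLpNorm (fun k : ℝ => (w (2 * Real.pi * k) : ℂ) * hat f k) 2 volume

/-- The weighted `L¹` norm of the Fourier transform. -/
def aN (w : ℝ → ℝ) (f : RealL2) : ℝ≥0∞ :=
  ∫⁻ k : ℝ, ‖(w (2 * Real.pi * k) : ℂ) * hat f k‖ₑ

theorem measurable_weight {w : ℝ → ℝ} (hw : Measurable w) (f : RealL2) :
    Measurable (fun k : ℝ => (w (2 * Real.pi * k) : ℂ) * hat f k) :=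
  (Complex.measurable_ofReal.comp (hw.comp (measurable_const.mul measurable_id))).mul
    (measurable_hat f)

theorem wN_one (f : RealL2) : wN (fun _ => 1) f = ‖f‖ₑ := by
  rw [enorm_eq_eLpNorm_hat, wN]; simp

theorem wN_add_le {w : ℝ → ℝ} (hw : Measurable w) (f g : RealL2) :
    wN w (f + g) ≤ wN w f + wN w g := by
  unfold wN
  refine le_trans (le_of_eq ?_) (eLpNorm_add_le (measurable_weight hw f).aestronglyMeasurable
    (measurable_weight hw g).aestronglyMeasurable (by norm_num))
  apply eLpNorm_congr_ae
  rw [hat_add]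
  filter_upwards [Lp.coeFn_add (hat f) (hat g)] with k hk
  rw [hk, Pi.add_apply, Pi.add_apply, mul_add]

theorem aN_add_le {w : ℝ → ℝ} (hw : Measurable w) (f g : RealL2) :
    aN w (f + g) ≤ aN w f + aN w g := by
  unfold aN
  rw [← lintegral_add_left (measurable_weight hw f).enorm]
  apply lintegral_mono_ae
  rw [hat_add]
  filter_upwards [Lp.coeFn_add (hat f) (hat g)] with k hk
  rw [hk, Pi.add_apply, mul_add]
  exact enorm_add_le _ _

theorem wN_smul (w : ℝ → ℝ) (c : ℝ) (f : RealL2) : wN w (c • f) = ‖c‖ₑ * wN w f := by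
  unfold wN
  rw [← eLpNorm_const_smul]
  apply eLpNorm_congr_ae
  rw [hat_smul]
  filter_upwards [Lp.coeFn_smul c (hat f)] with k hk
  simp [hk, mul_left_comm]

theorem aN_smul (w : ℝ → ℝ) (c : ℝ) (f : RealL2) : aN w (c • f) = ‖c‖ₑ * aN w f := by
  unfold aN
  rw [← lintegral_const_mul' _ _ (by simp)]
  apply lintegral_congr_ae
  rw [hat_smul]
  filter_upwards [Lp.coeFn_smul c (hat f)] with k hk
  simp only [hk, Pi.smul_apply, mul_smul_comm, enorm_smul]

theorem wN_neg (w : ℝ → ℝ) (f : RealL2) : wN w (-f) = wN w f := by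
  have := wN_smul w (-1) f
  simpa using this

theorem aN_neg (w : ℝ → ℝ) (f : RealL2) : aN w (-f) = aN w f := by
  have := aN_smul w (-1) f
  simpa using this

theorem wN_zero (w : ℝ → ℝ) : wN w 0 = 0 := by
  have := wN_smul w 0 0
  simpa using this

theorem wN_le_of_hat_le {w w' : ℝ → ℝ} {c : ℝ} {f g : RealL2}
    (h : ∀ᵐ k : ℝ, ‖(w (2 * Real.pi * k) : ℂ) * hat f k‖ ≤
      c * ‖(w' (2 * Real.pi * k) : ℂ) * hat g k‖) :
    wN w f ≤ ENNReal.ofReal c * wN w' g :=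
  eLpNorm_le_mul_eLpNorm_of_ae_le_mul h 2

theorem wN_mono {w w' : ℝ → ℝ} {c : ℝ} (h : ∀ ξ, |w ξ| ≤ c * |w' ξ|) (f : RealL2) :
    wN w f ≤ ENNReal.ofReal c * wN w' f := by
  apply wN_le_of_hat_le
  refine ae_of_all _ fun k => ?_
  rw [norm_mul, norm_mul, Complex.norm_real, Complex.norm_real, ← mul_assoc]
  exact mul_le_mul_of_nonneg_right (h _) (norm_nonneg _)

theorem aN_le_of_hat_le {w w' : ℝ → ℝ} {c : ℝ} {f g : RealL2}
    (h : ∀ᵐ k : ℝ, ‖(w (2 * Real.pi * k) : ℂ) * hat f k‖ ≤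
      c * ‖(w' (2 * Real.pi * k) : ℂ) * hat g k‖) :
    aN w f ≤ ENNReal.ofReal c * aN w' g := by
  unfold aN
  rw [← lintegral_const_mul' _ _ (by simp)]
  apply lintegral_mono_ae
  filter_upwards [h] with k hk
  rw [← ofReal_norm, ← ofReal_norm]
  rcases le_total 0 c with hc | hc
  · rw [← ENNReal.ofReal_mul hc]; exact ENNReal.ofReal_le_ofReal hk
  · rw [ENNReal.ofReal_of_nonpos (hk.trans (mul_nonpos_of_nonpos_of_nonneg hc (norm_nonneg _)))]
    exact zero_le

theorem aN_mono {w w' : ℝ → ℝ} {c : ℝ} (h : ∀ ξ, |w ξ| ≤ c * |w' ξ|) (f : RealL2) :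
    aN w f ≤ ENNReal.ofReal c * aN w' f := by
  apply aN_le_of_hat_le
  refine ae_of_all _ fun k => ?_
  rw [norm_mul, norm_mul, Complex.norm_real, Complex.norm_real, ← mul_assoc]
  exact mul_le_mul_of_nonneg_right (h _) (norm_nonneg _)

theorem aN_mult_le {w w' : ℝ → ℝ} {m : ℝ → ℂ} (hm : Good m) {c : ℝ}
    (h : ∀ ξ, |w ξ| * ‖m ξ‖ ≤ c * |w' ξ|) (f : RealL2) :
    aN w (mult m f) ≤ ENNReal.ofReal c * aN w' f := by
  apply aN_le_of_hat_le
  filter_upwards [hat_mult hm f] with k hk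
  rw [hk, norm_mul, norm_mul, norm_mul, Complex.norm_real, Complex.norm_real, ← mul_assoc,
    ← mul_assoc]
  exact mul_le_mul_of_nonneg_right (h _) (norm_nonneg _)

/-- Cauchy–Schwarz: the weighted `L¹` norm is bounded by weighted `L²` norms. -/
theorem aN_le_wN {w u v : ℝ → ℝ} (hu : Measurable u) (hv : Measurable v)
    (h : ∀ ξ, |w ξ| ≤ |u ξ| * |v ξ|) (f : RealL2) :
    aN w f ≤ eLpNorm (fun k : ℝ => u (2 * Real.pi * k)) 2 volume * wN v f := by
  have h2 := ENNReal.lintegral_mul_le_Lp_mul_Lq (μ := (volume : Measure ℝ))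
    Real.HolderConjugate.two_two
    (f := fun k : ℝ => ‖u (2 * Real.pi * k)‖ₑ)
    (g := fun k : ℝ => ‖(v (2 * Real.pi * k) : ℂ) * hat f k‖ₑ)
    (hu.comp (measurable_const.mul measurable_id)).enorm.aemeasurable
    (measurable_weight hv f).enorm.aemeasurable
  unfold wN
  rw [eLpNorm_eq_lintegral_rpow_enorm_toReal (by norm_num) (by norm_num),
    eLpNorm_eq_lintegral_rpow_enorm_toReal (by norm_num) (by norm_num)]
  simp only [ENNReal.toReal_ofNat]
  refine le_trans (lintegral_mono fun k => ?_) h2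
  simp only [Pi.mul_apply]
  rw [enorm_mul, enorm_mul, ← mul_assoc]
  gcongr
  rw [← ofReal_norm, ← ofReal_norm, ← ofReal_norm, ← ENNReal.ofReal_mul (norm_nonneg _)]
  apply ENNReal.ofReal_le_ofReal
  rw [Complex.norm_real, Complex.norm_real]
  exact h _

/-! ### Products -/

theorem integrable_conv (f g : RealL2) (k : ℝ) :
    Integrable (fun l : ℝ => hat f (k - l) * hat g l) := by
  have h1 : MemLp (fun l : ℝ => hat f (k - l)) 2 volume :=
    (Lp.memLp (hat f)).comp_measurePreserving (Measure.measurePreserving_sub_left volume k)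
  exact h1.integrable_mul (Lp.memLp (hat g))

/-- Pointwise form of the bilinear estimates. The two products of weights stand for the two ways of
sharing derivatives between the factors. -/
theorem enorm_integral_conv_le {f g : RealL2} {σ : ℝ → ℝ → ℂ} {w₁ w₂ w₃ w₄ : ℝ → ℝ}
    (h₁ : Measurable w₁) (h₂ : Measurable w₂) (k : ℝ)
    (hσ : ∀ l, ‖σ k l‖ ≤ |w₁ (2 * Real.pi * (k - l))| * |w₂ (2 * Real.pi * l)|
      + |w₃ (2 * Real.pi * (k - l))| * |w₄ (2 * Real.pi * l)|) :
    ‖∫ l : ℝ, σ k l * (hat f (k - l) * hat g l)‖ₑ ≤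
      lconv (fun k => ‖(w₁ (2 * Real.pi * k) : ℂ) * hat f k‖ₑ)
        (fun k => ‖(w₂ (2 * Real.pi * k) : ℂ) * hat g k‖ₑ) k +
      lconv (fun k => ‖(w₃ (2 * Real.pi * k) : ℂ) * hat f k‖ₑ)
        (fun k => ‖(w₄ (2 * Real.pi * k) : ℂ) * hat g k‖ₑ) k := by
  unfold lconv
  refine (enorm_integral_le_lintegral_enorm _).trans ?_
  rw [← lintegral_add_left]
  · refine lintegral_mono fun l => ?_
    have := ENNReal.ofReal_le_ofReal (hσ l)
    rw [ofReal_norm] at this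
    rw [enorm_mul, enorm_mul]
    simp only [enorm_mul]
    calc ‖σ k l‖ₑ * (‖hat f (k - l)‖ₑ * ‖hat g l‖ₑ) ≤ _ * (‖hat f (k - l)‖ₑ * ‖hat g l‖ₑ) :=
          mul_le_mul_left this _
      _ = _ := by
        rw [ENNReal.ofReal_add (by positivity) (by positivity), ENNReal.ofReal_mul (abs_nonneg _),
          ENNReal.ofReal_mul (abs_nonneg _)]
        simp only [← Real.norm_eq_abs, ofReal_norm]
        have e : ∀ x : ℝ, ‖(x : ℂ)‖ₑ = ‖x‖ₑ := fun x => by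
          rw [← ofReal_norm, Complex.norm_real, ofReal_norm]
        simp only [e]
        ring
  · exact ((measurable_weight h₁ f).enorm.comp (measurable_id.const_sub k)).mul
      (measurable_weight h₂ g).enorm

/-- The basic bilinear estimate: a bilinear expression with symbol `σ` is bounded in `L²`
if `σ` is bounded by products of weights. -/
theorem wN_le_of_conv {w : ℝ → ℝ} {f g q : RealL2} {σ : ℝ → ℝ → ℂ} {w₁ w₂ w₃ w₄ : ℝ → ℝ}
    (h₁ : Measurable w₁) (h₂ : Measurable w₂) (h₃ : Measurable w₃) (h₄ : Measurable w₄)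
    (hq : ∀ᵐ k : ℝ, (w (2 * Real.pi * k) : ℂ) * hat q k
      = ∫ l : ℝ, σ k l * (hat f (k - l) * hat g l))
    (hσ : ∀ k l, ‖σ k l‖ ≤ |w₁ (2 * Real.pi * (k - l))| * |w₂ (2 * Real.pi * l)|
      + |w₃ (2 * Real.pi * (k - l))| * |w₄ (2 * Real.pi * l)|) :
    wN w q ≤ aN w₁ f * wN w₂ g + wN w₃ f * aN w₄ g := by
  have m₁ := (measurable_weight h₁ f).enorm
  have m₂ := (measurable_weight h₂ g).enorm
  have m₃ := (measurable_weight h₃ f).enorm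
  have m₄ := (measurable_weight h₄ g).enorm
  have e1 : ∀ᵐ k : ℝ, ‖(w (2 * Real.pi * k) : ℂ) * hat q k‖ₑ ≤
      ‖lconv (fun k => ‖(w₁ (2 * Real.pi * k) : ℂ) * hat f k‖ₑ)
        (fun k => ‖(w₂ (2 * Real.pi * k) : ℂ) * hat g k‖ₑ) k +
      lconv (fun k => ‖(w₄ (2 * Real.pi * k) : ℂ) * hat g k‖ₑ)
        (fun k => ‖(w₃ (2 * Real.pi * k) : ℂ) * hat f k‖ₑ) k‖ₑ := by
    filter_upwards [hq] with k hk
    -- The second convolution is commuted so that the factor measured in `L¹` comes first, as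
    -- Young's inequality requires.
    rw [hk, enorm_eq_self, lconv_comm (fun k => ‖(w₄ (2 * Real.pi * k) : ℂ) * hat g k‖ₑ)]
    exact enorm_integral_conv_le h₁ h₂ k (hσ k)
  refine (eLpNorm_mono_enorm_ae e1).trans ?_
  refine (eLpNorm_add_le (measurable_lconv m₁ m₂).aestronglyMeasurable
    (measurable_lconv m₄ m₃).aestronglyMeasurable (by norm_num)).trans ?_
  refine add_le_add ((eLpNorm_lconv_le m₁ m₂).trans (le_of_eq ?_))
    ((eLpNorm_lconv_le m₄ m₃).trans (le_of_eq ?_))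
  · rw [eLpNorm_enorm]; rfl
  · rw [eLpNorm_enorm, mul_comm]; rfl

theorem aN_le_of_conv {w : ℝ → ℝ} {f g q : RealL2} {σ : ℝ → ℝ → ℂ} {w₁ w₂ w₃ w₄ : ℝ → ℝ}
    (h₁ : Measurable w₁) (h₂ : Measurable w₂) (h₃ : Measurable w₃) (h₄ : Measurable w₄)
    (hq : ∀ᵐ k : ℝ, (w (2 * Real.pi * k) : ℂ) * hat q k
      = ∫ l : ℝ, σ k l * (hat f (k - l) * hat g l))
    (hσ : ∀ k l, ‖σ k l‖ ≤ |w₁ (2 * Real.pi * (k - l))| * |w₂ (2 * Real.pi * l)|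
      + |w₃ (2 * Real.pi * (k - l))| * |w₄ (2 * Real.pi * l)|) :
    aN w q ≤ aN w₁ f * aN w₂ g + aN w₃ f * aN w₄ g := by
  have m₁ := (measurable_weight h₁ f).enorm
  have m₂ := (measurable_weight h₂ g).enorm
  have m₃ := (measurable_weight h₃ f).enorm
  have m₄ := (measurable_weight h₄ g).enorm
  unfold aN
  rw [← lintegral_lconv m₁ m₂, ← lintegral_lconv m₃ m₄,
    ← lintegral_add_left (measurable_lconv m₁ m₂)]
  apply lintegral_mono_ae
  filter_upwards [hq] with k hk
  rw [hk]
  exact enorm_integral_conv_le h₁ h₂ k (hσ k)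

/-- The Fourier transform of `f` is integrable. -/
def Wiener (f : RealL2) : Prop := aN (fun _ => 1) f < ∞

theorem Wiener.integrable {f : RealL2} (hf : Wiener f) : Integrable (hat f) := by
  refine ⟨(Lp.memLp (hat f)).1, ?_⟩
  unfold Wiener aN at hf
  simpa [HasFiniteIntegral] using hf

/-- `L²` inversion agrees with the absolutely convergent inverse integral. Pointwise bounds and the
product formula both rest on this. -/
theorem Wiener.coe_eq {f : RealL2} (hf : Wiener f) :
    ∀ᵐ x, ((f x : ℝ) : ℂ) = 𝓕⁻ (hat f : ℝ → ℂ) x := by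
  have h := fourierInv_coe_of_integrable (hat f) hf.integrable
  have h2 : (𝓕⁻ (hat f) : Lp ℂ 2 (volume : Measure ℝ)) = ofRealL f :=
    FourierTransform.fourierInv_fourier_eq _
  rw [h2] at h
  filter_upwards [h, coeFn_ofRealL f] with x h1 h2
  rw [← h2, h1]

theorem Wiener.abs_le {f : RealL2} (hf : Wiener f) :
    ∀ᵐ x, |f x| ≤ (aN (fun _ => 1) f).toReal := by
  filter_upwards [hf.coe_eq] with x hx
  rw [← Real.norm_eq_abs, ← Complex.norm_real, hx, Real.fourierInv_eq]
  refine (norm_integral_le_lintegral_norm _).trans (le_of_eq ?_)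
  congr 1
  unfold aN
  congr 1
  ext k
  rw [← ofReal_norm, Circle.norm_smul]
  simp

open Classical in
/-- The pointwise product, when it is square integrable. -/
def pr (f g : RealL2) : RealL2 :=
  if h : MemLp (fun x => f x * g x) 2 volume then h.toLp else 0

theorem isProduct_pr_of_memLp {f g : RealL2} (h : MemLp (fun x => f x * g x) 2 volume) :
    IsProduct f g (pr f g) := by
  unfold IsProduct pr
  rw [dif_pos h]
  exact h.coeFn_toLp

theorem Wiener.memLp_mul {f : RealL2} (hf : Wiener f) (g : RealL2) :
    MemLp (fun x => f x * g x) 2 volume := by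
  have h1 : MemLp (f : ℝ → ℝ) ∞ volume := memLp_top_of_bound (Lp.memLp f).1 _ hf.abs_le
  exact (Lp.memLp g).mul h1

theorem Wiener.isProduct {f : RealL2} (hf : Wiener f) (g : RealL2) : IsProduct f g (pr f g) :=
  isProduct_pr_of_memLp (hf.memLp_mul g)

/-- A product is determined by its values almost everywhere. The algebraic rules for `pr` below
therefore reduce to pointwise identities. -/
theorem IsProduct.eq_pr {f g p : RealL2} (h : IsProduct f g p) : p = pr f g := by
  have h1 : MemLp (fun x => f x * g x) 2 volume := (Lp.memLp p).ae_eq h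
  apply Lp.ext
  filter_upwards [h, isProduct_pr_of_memLp h1] with x h2 h3
  rw [h2, h3]

theorem pr_comm (f g : RealL2) : pr f g = pr g f := by
  have h : (fun x => f x * g x) = fun x => g x * f x := funext fun x => mul_comm _ _
  by_cases h1 : MemLp (fun x => f x * g x) 2 volume
  · apply IsProduct.eq_pr
    filter_upwards [isProduct_pr_of_memLp h1] with x hx
    rw [hx, mul_comm]
  · have h2 : ¬ MemLp (fun x => g x * f x) 2 volume := by rwa [← h]
    rw [pr, pr, dif_neg h1, dif_neg h2]

theorem norm_pr_le {f : RealL2} (hf : Wiener f) (g : RealL2) :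
    ‖pr f g‖ ≤ (aN (fun _ => 1) f).toReal * ‖g‖ := by
  apply Lp.norm_le_mul_norm_of_ae_le_mul
  filter_upwards [hf.isProduct g, hf.abs_le] with x h1 h2
  rw [h1, norm_mul]
  exact mul_le_mul_of_nonneg_right h2 (norm_nonneg _)

theorem Wiener.smul {f : RealL2} (c : ℝ) (hf : Wiener f) : Wiener (c • f) := by
  unfold Wiener; rw [aN_smul]; exact ENNReal.mul_lt_top (by simp) hf

theorem pr_add {f : RealL2} (hf : Wiener f) (g h : RealL2) : pr f (g + h) = pr f g + pr f h := by
  symm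
  apply IsProduct.eq_pr
  filter_upwards [hf.isProduct g, hf.isProduct h, Lp.coeFn_add g h,
    Lp.coeFn_add (pr f g) (pr f h)] with x h1 h2 h3 h4
  rw [h4, Pi.add_apply, h1, h2, h3, Pi.add_apply]; ring

theorem pr_smul {f : RealL2} (hf : Wiener f) (c : ℝ) (g : RealL2) :
    pr f (c • g) = c • pr f g := by
  symm
  apply IsProduct.eq_pr
  filter_upwards [hf.isProduct g, Lp.coeFn_smul c g, Lp.coeFn_smul c (pr f g)] with x h1 h2 h3
  rw [h3, Pi.smul_apply, h1, h2, Pi.smul_apply, smul_eq_mul, smul_eq_mul]; ring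

theorem add_pr {f g : RealL2} (hf : Wiener f) (hg : Wiener g) (h : RealL2) :
    pr (f + g) h = pr f h + pr g h := by
  symm
  apply IsProduct.eq_pr
  filter_upwards [hf.isProduct h, hg.isProduct h, Lp.coeFn_add f g,
    Lp.coeFn_add (pr f h) (pr g h)] with x h1 h2 h3 h4
  rw [h4, Pi.add_apply, h1, h2, h3, Pi.add_apply]; ring

theorem smul_pr {f : RealL2} (hf : Wiener f) (c : ℝ) (g : RealL2) :
    pr (c • f) g = c • pr f g := by
  symm
  apply IsProduct.eq_pr
  filter_upwards [hf.isProduct g, Lp.coeFn_smul c f, Lp.coeFn_smul c (pr f g)] with x h1 h2 h3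
  rw [h3, Pi.smul_apply, h1, h2, Pi.smul_apply, smul_eq_mul, smul_eq_mul]; ring

theorem inner_pr_left {f : RealL2} (hf : Wiener f) (g h : RealL2) :
    inner ℝ (pr f g) h = inner ℝ g (pr f h) := by
  rw [L2.inner_def, L2.inner_def]
  apply integral_congr_ae
  filter_upwards [hf.isProduct g, hf.isProduct h] with x h1 h2
  simp only [h1, h2, RCLike.inner_apply, conj_trivial]; ring

theorem pr_left_comm {f g : RealL2} (hf : Wiener f) (hg : Wiener g) (h : RealL2) :
    pr f (pr g h) = pr g (pr f h) := by
  apply IsProduct.eq_pr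
  filter_upwards [hf.isProduct h, hg.isProduct h, hf.isProduct (pr g h)] with x h1 h2 h3
  rw [h3, h1, h2]; ring

/-- The Fourier transform of a product is the convolution of the Fourier transforms. -/
theorem hat_pr {f g : RealL2} (hf : Wiener f) (hg : Wiener g) :
    ∀ᵐ k : ℝ, hat (pr f g) k = ∫ l : ℝ, hat f (k - l) * hat g l := by
  set C : ℝ → ℂ := fun k => ∫ l : ℝ, hat f (k - l) * hat g l with hC
  have hCc : C = convolution (hat g : ℝ → ℂ) (hat f : ℝ → ℂ) (ContinuousLinearMap.mul ℂ ℂ)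
      volume := by
    ext k
    simp only [hC, convolution, ContinuousLinearMap.mul_apply']
    congr 1; ext l; ring
  -- The convolution lies in `L¹` and, by Young, in `L²`. Its inverse transform is the product of
  -- the two inverse transforms, hence the product function, and applying the Fourier transform
  -- again identifies the two sides.
  have hCi : Integrable C := by
    rw [hCc]; exact hg.integrable.integrable_convolution _ hf.integrable
  have hC2 : MemLp C 2 volume := by
    refine ⟨hCi.1, ?_⟩
    have m1 := (measurable_hat f).enorm
    have m2 := (measurable_hat g).enorm
    have h1 : eLpNorm C 2 volume ≤
        eLpNorm (lconv (fun k => ‖hat f k‖ₑ) (fun k => ‖hat g k‖ₑ)) 2 volume := by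
      apply eLpNorm_mono_enorm
      intro k
      rw [enorm_eq_self]
      refine (enorm_integral_le_lintegral_enorm _).trans (le_of_eq ?_)
      simp only [enorm_mul, lconv]
    refine (h1.trans (eLpNorm_lconv_le m1 m2)).trans_lt (ENNReal.mul_lt_top hf.integrable.2 ?_)
    rw [eLpNorm_enorm]
    exact (Lp.memLp (hat g)).2
  set G : Lp ℂ 2 (volume : Measure ℝ) := hC2.toLp with hG
  have hGC : G =ᵐ[volume] C := hC2.coeFn_toLp
  have h1 := fourierInv_coe_of_integrable G (hCi.congr hGC.symm)
  have h2 : ∀ x, 𝓕⁻ (G : ℝ → ℂ) x = 𝓕⁻ (hat f : ℝ → ℂ) x * 𝓕⁻ (hat g : ℝ → ℂ) x := by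
    intro x
    rw [Real.fourierInv_eq_fourier_neg, Real.fourier_congr_ae hGC, hCc,
      Real.fourier_mul_convolution_eq hg.integrable hf.integrable,
      Real.fourierInv_eq_fourier_neg, Real.fourierInv_eq_fourier_neg, mul_comm]
  have h3 : ofRealL (pr f g) = 𝓕⁻ G := by
    apply Lp.ext
    filter_upwards [h1, coeFn_ofRealL (pr f g), hf.isProduct g, hf.coe_eq, hg.coe_eq]
      with x h1 h4 h5 h6 h7
    rw [h1, h2, h4, h5, Complex.ofReal_mul, h6, h7]
  have h4 : hat (pr f g) = G := by
    change 𝓕 (ofRealL (pr f g)) = G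
    rw [h3, FourierTransform.fourier_fourierInv_eq]
  rw [h4]
  exact hGC

theorem Wiener.pr {f g : RealL2} (hf : Wiener f) (hg : Wiener g) : Wiener (pr f g) := by
  have h := aN_le_of_conv (w := fun _ => 1) (q := WhithamBoussinesq.pr f g) (f := f) (g := g)
    (σ := fun _ _ => 1)
    (w₁ := fun _ => 1) (w₂ := fun _ => 1) (w₃ := fun _ => 0) (w₄ := fun _ => 0)
    measurable_const measurable_const measurable_const measurable_const
    (by filter_upwards [hat_pr hf hg] with k hk; simp [hk]) (by simp)
  refine h.trans_lt ?_
  have h0 : aN (fun _ => 0) f = 0 := by simp [aN]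
  rw [h0, zero_mul, add_zero]
  exact ENNReal.mul_lt_top hf hg

/-! ### Truncated multipliers -/

/-- Truncation of a symbol to the frequencies `|ξ| ≤ R`. -/
def cut (R : ℝ) (w : ℝ → ℝ) (ξ : ℝ) : ℝ := if |ξ| ≤ R then w ξ else 0

/-- Continuous even real symbols. -/
structure EvenS (w : ℝ → ℝ) : Prop where
  cont : Continuous w
  even : ∀ ξ, w (-ξ) = w ξ

/-- Continuous odd real symbols. -/
structure OddS (w : ℝ → ℝ) : Prop where
  cont : Continuous w
  odd : ∀ ξ, w (-ξ) = -w ξ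

theorem EvenS.mul {w u : ℝ → ℝ} (hw : EvenS w) (hu : EvenS u) : EvenS (fun ξ => w ξ * u ξ) :=
  ⟨hw.cont.mul hu.cont, fun ξ => by rw [hw.even, hu.even]⟩

theorem EvenS.mul_odd {w u : ℝ → ℝ} (hw : EvenS w) (hu : OddS u) : OddS (fun ξ => w ξ * u ξ) :=
  ⟨hw.cont.mul hu.cont, fun ξ => by rw [hw.even, hu.odd, mul_neg]⟩

theorem OddS.mul {w u : ℝ → ℝ} (hw : OddS w) (hu : OddS u) : EvenS (fun ξ => w ξ * u ξ) :=
  ⟨hw.cont.mul hu.cont, fun ξ => by rw [hw.odd, hu.odd, neg_mul_neg]⟩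

theorem EvenS.sqrt {w : ℝ → ℝ} (hw : EvenS w) : EvenS (fun ξ => √(w ξ)) :=
  ⟨hw.cont.sqrt, fun ξ => by rw [hw.even]⟩

theorem evenS_const (c : ℝ) : EvenS (fun _ => c) := ⟨continuous_const, fun _ => rfl⟩

theorem oddS_id : OddS (fun ξ => ξ) := ⟨continuous_id, fun _ => rfl⟩

theorem measurable_cut {R : ℝ} {w : ℝ → ℝ} (hw : Measurable w) : Measurable (cut R w) :=
  Measurable.ite (measurableSet_le (by fun_prop) measurable_const) hw measurable_const

theorem cut_mul (R : ℝ) (w u : ℝ → ℝ) (ξ : ℝ) :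
    cut R (fun ξ => w ξ * u ξ) ξ = cut R w ξ * cut R u ξ := by
  unfold cut; split_ifs <;> simp

theorem abs_cut_le (R : ℝ) (w : ℝ → ℝ) (ξ : ℝ) : |cut R w ξ| ≤ |w ξ| := by
  unfold cut; split_ifs <;> simp

theorem cut_bdd {w : ℝ → ℝ} (R : ℝ) (hw : Continuous w) : ∃ C, ∀ ξ, |cut R w ξ| ≤ C := by
  obtain ⟨C, hC⟩ := (isCompact_Icc (a := -R) (b := R)).exists_bound_of_continuousOn
    hw.continuousOn
  refine ⟨max C 0, fun ξ => ?_⟩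
  unfold cut
  split_ifs with h
  · exact (hC ξ (abs_le.1 h)).trans (le_max_left _ _)
  · simp

theorem EvenS.good {w : ℝ → ℝ} (hw : EvenS w) (R : ℝ) : Good (fun ξ => (cut R w ξ : ℂ)) := by
  refine ⟨Complex.measurable_ofReal.comp (measurable_cut hw.cont.measurable), ?_, fun ξ => ?_⟩
  · obtain ⟨C, hC⟩ := cut_bdd R hw.cont
    exact ⟨C, fun ξ => by rw [Complex.norm_real]; exact hC ξ⟩
  · simp [cut, hw.even, Complex.conj_ofReal]

theorem OddS.good {w : ℝ → ℝ} (hw : OddS w) (R : ℝ) :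
    Good (fun ξ => Complex.I * (cut R w ξ : ℂ)) := by
  refine ⟨measurable_const.mul
    (Complex.measurable_ofReal.comp (measurable_cut hw.cont.measurable)), ?_, fun ξ => ?_⟩
  · obtain ⟨C, hC⟩ := cut_bdd R hw.cont
    exact ⟨C, fun ξ => by rw [norm_mul, Complex.norm_I, one_mul, Complex.norm_real]; exact hC ξ⟩
  · by_cases h : |ξ| ≤ R <;> simp [cut, hw.odd, Complex.conj_ofReal, h]

/-- The truncated multiplier with real even symbol `w`. -/
def Rm (R : ℝ) (w : ℝ → ℝ) : RealL2 →L[ℝ] RealL2 := mult (fun ξ => (cut R w ξ : ℂ))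

/-- The truncated multiplier with imaginary odd symbol `i w`. -/
def Sm (R : ℝ) (w : ℝ → ℝ) : RealL2 →L[ℝ] RealL2 := mult (fun ξ => Complex.I * (cut R w ξ : ℂ))

theorem hat_Rm {w : ℝ → ℝ} (hw : EvenS w) (R : ℝ) (f : RealL2) :
    ∀ᵐ k, hat (Rm R w f) k = (cut R w (2 * Real.pi * k) : ℂ) * hat f k := hat_mult (hw.good R) f

theorem hat_Sm {w : ℝ → ℝ} (hw : OddS w) (R : ℝ) (f : RealL2) :
    ∀ᵐ k, hat (Sm R w f) k = Complex.I * (cut R w (2 * Real.pi * k) : ℂ) * hat f k :=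
  hat_mult (hw.good R) f

theorem Rm_Rm {w u : ℝ → ℝ} (hw : EvenS w) (hu : EvenS u) (R : ℝ) (f : RealL2) :
    Rm R w (Rm R u f) = Rm R (fun ξ => w ξ * u ξ) f := by
  apply eq_of_hat_ae_eq
  filter_upwards [hat_Rm hw R (Rm R u f), hat_Rm hu R f, hat_Rm (hw.mul hu) R f] with k h1 h2 h3
  rw [h1, h2, h3, cut_mul]; push_cast; ring

theorem Rm_Sm {w u : ℝ → ℝ} (hw : EvenS w) (hu : OddS u) (R : ℝ) (f : RealL2) :
    Rm R w (Sm R u f) = Sm R (fun ξ => w ξ * u ξ) f := by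
  apply eq_of_hat_ae_eq
  filter_upwards [hat_Rm hw R (Sm R u f), hat_Sm hu R f, hat_Sm (hw.mul_odd hu) R f]
    with k h1 h2 h3
  rw [h1, h2, h3, cut_mul]; push_cast; ring

theorem Sm_Rm {w u : ℝ → ℝ} (hw : EvenS w) (hu : OddS u) (R : ℝ) (f : RealL2) :
    Sm R u (Rm R w f) = Sm R (fun ξ => w ξ * u ξ) f := by
  apply eq_of_hat_ae_eq
  filter_upwards [hat_Sm hu R (Rm R w f), hat_Rm hw R f, hat_Sm (hw.mul_odd hu) R f]
    with k h1 h2 h3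
  rw [h1, h2, h3, cut_mul]; push_cast; ring

theorem Sm_Sm {w u : ℝ → ℝ} (hw : OddS w) (hu : OddS u) (R : ℝ) (f : RealL2) :
    Sm R w (Sm R u f) = -Rm R (fun ξ => w ξ * u ξ) f := by
  apply eq_of_hat_ae_eq
  rw [hat_neg]
  filter_upwards [hat_Sm hw R (Sm R u f), hat_Sm hu R f, hat_Rm (hw.mul hu) R f,
    Lp.coeFn_neg (hat (Rm R (fun ξ => w ξ * u ξ) f))] with k h1 h2 h3 h4
  rw [h4, Pi.neg_apply, h1, h2, h3, cut_mul]; push_cast; linear_combination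
    (-(cut R w (2 * Real.pi * k) : ℂ) * cut R u (2 * Real.pi * k) * hat f k) * (-1) * Complex.I_mul_I

theorem inner_Rm {w : ℝ → ℝ} (hw : EvenS w) (R : ℝ) (f g : RealL2) :
    inner ℝ (Rm R w f) g = inner ℝ f (Rm R w g) := by
  rw [inner_eq_re_integral_hat, inner_eq_re_integral_hat]
  congr 1
  apply integral_congr_ae
  filter_upwards [hat_Rm hw R f, hat_Rm hw R g] with k h1 h2
  rw [h1, h2, map_mul, Complex.conj_ofReal]; ring

theorem inner_Sm {w : ℝ → ℝ} (hw : OddS w) (R : ℝ) (f g : RealL2) :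
    inner ℝ (Sm R w f) g = -inner ℝ f (Sm R w g) := by
  rw [inner_eq_re_integral_hat, inner_eq_re_integral_hat, ← Complex.neg_re, ← integral_neg]
  congr 1
  apply integral_congr_ae
  filter_upwards [hat_Sm hw R f, hat_Sm hw R g] with k h1 h2
  rw [h1, h2, map_mul, map_mul, Complex.conj_ofReal, Complex.conj_I]; ring

/-- `f` is band-limited to `|ξ| ≤ R`. -/
def Band (R : ℝ) (f : RealL2) : Prop := Rm R (fun _ => 1) f = f

theorem Band.hat_eq_zero {R : ℝ} {f : RealL2} (hf : Band R f) :
    ∀ᵐ k : ℝ, R < |2 * Real.pi * k| → hat f k = 0 := by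
  have h := hat_Rm (evenS_const 1) R f
  rw [hf] at h
  filter_upwards [h] with k hk hR
  rw [hk, cut, if_neg (not_le.2 hR)]; simp

theorem band_iff {R : ℝ} {f : RealL2} :
    Band R f ↔ ∀ᵐ k : ℝ, R < |2 * Real.pi * k| → hat f k = 0 := by
  refine ⟨Band.hat_eq_zero, fun h => ?_⟩
  apply eq_of_hat_ae_eq
  filter_upwards [h, hat_Rm (evenS_const 1) R f] with k h1 h2
  rw [h2, cut]
  split_ifs with h3
  · simp
  · rw [h1 (not_le.1 h3)]; simp

theorem Band.mono {R R' : ℝ} {f : RealL2} (hf : Band R f) (h : R ≤ R') : Band R' f := by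
  rw [band_iff] at *
  filter_upwards [hf] with k hk hR using hk (h.trans_lt hR)

theorem band_Rm {w : ℝ → ℝ} (hw : EvenS w) (R : ℝ) (f : RealL2) : Band R (Rm R w f) := by
  unfold Band
  rw [Rm_Rm (evenS_const 1) hw]; simp

theorem band_Sm {w : ℝ → ℝ} (hw : OddS w) (R : ℝ) (f : RealL2) : Band R (Sm R w f) := by
  unfold Band
  rw [Rm_Sm (evenS_const 1) hw]; simp

theorem Band.add {R : ℝ} {f g : RealL2} (hf : Band R f) (hg : Band R g) : Band R (f + g) := by
  unfold Band at *; rw [map_add, hf, hg]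

theorem Band.neg {R : ℝ} {f : RealL2} (hf : Band R f) : Band R (-f) := by
  unfold Band at *; rw [map_neg, hf]

theorem Band.sub {R : ℝ} {f g : RealL2} (hf : Band R f) (hg : Band R g) : Band R (f - g) := by
  unfold Band at *; rw [map_sub, hf, hg]

theorem Band.smul {R : ℝ} {f : RealL2} (c : ℝ) (hf : Band R f) : Band R (c • f) := by
  unfold Band at *; rw [map_smul, hf]

/-- Cauchy–Schwarz on a bounded set of frequencies. The constant depends on `R`; it serves
finiteness and the Lipschitz continuity of the regularized field, never a uniform estimate. -/
theorem aN_le_of_band {w : ℝ → ℝ} (hw : Continuous w) (R : ℝ) :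
    ∃ K : ℝ, 0 ≤ K ∧ ∀ f, Band R f → aN w f ≤ ENNReal.ofReal K * ‖f‖ₑ := by
  set u : ℝ → ℝ := cut R w with hu
  have hum : Measurable u := measurable_cut hw.measurable
  obtain ⟨C, hC⟩ := cut_bdd R hw
  set N := eLpNorm (fun k : ℝ => u (2 * Real.pi * k)) 2 volume with hN
  have hNt : N < ∞ := by
    set S : Set ℝ := {k | |2 * Real.pi * k| ≤ R} with hS
    have hSm : MeasurableSet S := measurableSet_le (by fun_prop) measurable_const
    have hSv : volume S < ∞ := by
      refine (measure_mono (t := Icc (-(R / (2 * Real.pi))) (R / (2 * Real.pi)))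
        fun k hk => ?_).trans_lt measure_Icc_lt_top
      rw [mem_Icc, ← abs_le, le_div_iff₀ (by positivity)]
      rw [hS, mem_ofPred_eq, abs_mul, abs_of_pos (by positivity)] at hk
      linarith
    have : Fact (volume S < ∞) := ⟨hSv⟩
    have h1 : MemLp (fun k : ℝ => u (2 * Real.pi * k)) 2 (volume.restrict S) :=
      MemLp.of_bound (hum.comp (measurable_const.mul measurable_id)).aestronglyMeasurable C
        (ae_of_all _ fun k => hC _)
    have h2 : (fun k : ℝ => u (2 * Real.pi * k)) = S.indicator fun k => u (2 * Real.pi * k) := by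
      ext x
      by_cases hx : x ∈ S
      · rw [indicator_of_mem hx]
      · rw [indicator_of_notMem hx]; exact if_neg hx
    rw [hN, h2]
    exact ((memLp_indicator_iff_restrict hSm).2 h1).2
  refine ⟨N.toReal, ENNReal.toReal_nonneg, fun f hf => ?_⟩
  rw [ENNReal.ofReal_toReal hNt.ne, ← wN_one]
  refine le_trans (le_of_eq ?_) (aN_le_wN (w := u) hum measurable_const (fun ξ => by simp) f)
  unfold aN
  apply lintegral_congr_ae
  filter_upwards [hf.hat_eq_zero] with k hk
  by_cases h : |2 * Real.pi * k| ≤ R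
  · simp only [hu, cut, if_pos h]
  · rw [hk (not_le.1 h)]; simp

theorem Band.wiener {R : ℝ} {f : RealL2} (hf : Band R f) : Wiener f := by
  obtain ⟨K, _, h⟩ := aN_le_of_band (w := fun _ => 1) continuous_const R
  exact (h f hf).trans_lt (ENNReal.mul_lt_top (by simp) (by simp))

theorem norm_le_of_enorm_le {f : RealL2} {c : ℝ} (hc : 0 ≤ c) (h : ‖f‖ₑ ≤ ENNReal.ofReal c) :
    ‖f‖ ≤ c := by
  rw [← ofReal_norm] at h
  exact (ENNReal.ofReal_le_ofReal_iff hc).1 h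

theorem enorm_Rm {w : ℝ → ℝ} (hw : EvenS w) (R : ℝ) (f : RealL2) :
    ‖Rm R w f‖ₑ = wN (cut R w) f := by
  rw [enorm_eq_eLpNorm_hat]
  exact eLpNorm_congr_ae (hat_Rm hw R f)

theorem enorm_Sm {w : ℝ → ℝ} (hw : OddS w) (R : ℝ) (f : RealL2) :
    ‖Sm R w f‖ₑ = wN (cut R w) f := by
  rw [enorm_eq_eLpNorm_hat]
  apply eLpNorm_congr_norm_ae
  filter_upwards [hat_Sm hw R f] with k hk
  rw [hk, norm_mul, norm_mul, Complex.norm_I, one_mul, norm_mul]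

theorem wN_eq_of_band {R : ℝ} {w : ℝ → ℝ} {f : RealL2} (hf : Band R f) :
    wN (cut R w) f = wN w f := by
  apply eLpNorm_congr_ae
  filter_upwards [hf.hat_eq_zero] with k hk
  by_cases h : |2 * Real.pi * k| ≤ R
  · simp only [cut, if_pos h]
  · rw [hk (not_le.1 h)]; simp

theorem norm_Rm_le_Rm {w u : ℝ → ℝ} (hw : EvenS w) (hu : EvenS u) (R : ℝ)
    (h : ∀ ξ, |w ξ| ≤ |u ξ|) (f : RealL2) : ‖Rm R w f‖ ≤ ‖Rm R u f‖ := by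
  rw [← norm_hat, ← norm_hat (Rm R u f)]
  apply Lp.norm_le_norm_of_ae_le
  filter_upwards [hat_Rm hw R f, hat_Rm hu R f] with k h1 h2
  rw [h1, h2, norm_mul, norm_mul, Complex.norm_real, Complex.norm_real]
  apply mul_le_mul_of_nonneg_right _ (norm_nonneg _)
  simp only [cut]
  split_ifs
  · exact h _
  · simp

/-! ### Products of multipliers and commutator estimates -/

theorem hat_pr_mult {m₁ m₂ : ℝ → ℂ} (h₁ : Good m₁) (h₂ : Good m₂) {f g : RealL2}
    (hf : Wiener (mult m₁ f)) (hg : Wiener (mult m₂ g)) :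
    ∀ᵐ k : ℝ, hat (pr (mult m₁ f) (mult m₂ g)) k =
      ∫ l : ℝ, (m₁ (2 * Real.pi * (k - l)) * m₂ (2 * Real.pi * l)) * (hat f (k - l) * hat g l) := by
  filter_upwards [hat_pr hf hg] with k hk
  rw [hk]
  apply integral_congr_ae
  have h3 : ∀ᵐ l : ℝ, hat (mult m₁ f) (k - l) = m₁ (2 * Real.pi * (k - l)) * hat f (k - l) :=
    (Measure.measurePreserving_sub_left (volume : Measure ℝ) k).quasiMeasurePreserving.ae
      (hat_mult h₁ f)
  filter_upwards [h3, hat_mult h₂ g] with l h4 h5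
  rw [h4, h5]; ring

theorem integrable_mult_conv {m₁ m₂ : ℝ → ℂ} (h₁ : Good m₁) (h₂ : Good m₂) (f g : RealL2) (k : ℝ) :
    Integrable (fun l : ℝ =>
      (m₁ (2 * Real.pi * (k - l)) * m₂ (2 * Real.pi * l)) * (hat f (k - l) * hat g l)) := by
  refine (integrable_conv (mult m₁ f) (mult m₂ g) k).congr ?_
  have h3 : ∀ᵐ l : ℝ, hat (mult m₁ f) (k - l) = m₁ (2 * Real.pi * (k - l)) * hat f (k - l) :=
    (Measure.measurePreserving_sub_left (volume : Measure ℝ) k).quasiMeasurePreserving.ae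
      (hat_mult h₁ f)
  filter_upwards [h3, hat_mult h₂ g] with l h4 h5
  rw [h4, h5]; ring

theorem good_one : Good (fun _ => 1) := ⟨measurable_const, ⟨1, by simp⟩, by simp⟩

theorem mult_one (f : RealL2) : mult (fun _ => 1) f = f :=
  eq_of_hat_ae_eq (by filter_upwards [hat_mult good_one f] with k hk; rw [hk, one_mul])

/-- The bracket `(1 + ξ²)^{1/2}`. -/
def jb (ξ : ℝ) : ℝ := √(1 + ξ ^ 2)

theorem one_le_jb (ξ : ℝ) : 1 ≤ jb ξ := by
  rw [jb, Real.one_le_sqrt]; nlinarith [sq_nonneg ξ]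

theorem jb_pos (ξ : ℝ) : 0 < jb ξ := one_pos.trans_le (one_le_jb ξ)

theorem abs_le_jb (ξ : ℝ) : |ξ| ≤ jb ξ := by
  rw [jb]; apply Real.abs_le_sqrt; linarith

theorem evenS_jb : EvenS jb := by
  refine ⟨?_, fun ξ => by simp [jb]⟩
  unfold jb; fun_prop

theorem aN_one_le_jb (f : RealL2) : aN (fun _ => 1) f ≤ aN jb f := by
  have := aN_mono (w := fun _ => 1) (w' := jb) (c := 1)
    (fun ξ => by simpa [abs_of_pos (jb_pos ξ)] using one_le_jb ξ) f
  simpa using this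

theorem Wiener.of_jb {f : RealL2} {α : ℝ} (h : aN jb f ≤ ENNReal.ofReal α) : Wiener f :=
  ((aN_one_le_jb f).trans h).trans_lt (by simp)

theorem norm_pr_le_of_jb {f : RealL2} {α : ℝ} (hα : 0 ≤ α) (h : aN jb f ≤ ENNReal.ofReal α)
    (g : RealL2) : ‖pr f g‖ ≤ α * ‖g‖ := by
  refine (norm_pr_le (Wiener.of_jb h) g).trans (mul_le_mul_of_nonneg_right ?_ (norm_nonneg _))
  exact ENNReal.toReal_le_of_le_ofReal hα ((aN_one_le_jb f).trans h)

theorem wN_zero_weight (f : RealL2) : wN (fun _ => 0) f = 0 := by simp [wN]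

/-- Commutator of a multiplier with Lipschitz symbol and a multiplication operator. -/
theorem norm_commutator_le {a : ℝ → ℝ} (ha : OddS a) {R L : ℝ} (hL : 0 ≤ L)
    (hlip : ∀ ξ η, |cut R a ξ - cut R a η| ≤ L * |ξ - η|) {f g : RealL2} {α : ℝ} (hα : 0 ≤ α)
    (hf : aN jb f ≤ ENNReal.ofReal α) (hg : Wiener g) :
    ‖Sm R a (pr f g) - pr f (Sm R a g)‖ ≤ L * α * ‖g‖ := by
  have hfW := Wiener.of_jb hf
  apply norm_le_of_enorm_le (by positivity)
  rw [← wN_one]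
  -- The commutator has symbol `i(a(ξ) - a(η))`, of size at most `L|ξ - η| ≤ L⟨ξ - η⟩`. The
  -- derivative thus falls entirely on `f`.
  have h := wN_le_of_conv (w := fun _ => 1) (q := Sm R a (pr f g) - pr f (Sm R a g)) (f := f)
    (g := g) (σ := fun k l => Complex.I *
      ((cut R a (2 * Real.pi * k) - cut R a (2 * Real.pi * l) : ℝ) : ℂ))
    (w₁ := fun ξ => L * jb ξ) (w₂ := fun _ => 1) (w₃ := fun _ => 0) (w₄ := fun _ => 0)
    (measurable_const.mul evenS_jb.cont.measurable) measurable_const measurable_const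
    measurable_const ?_ ?_
  · rw [wN_zero_weight, zero_mul, add_zero, wN_one g] at h
    refine h.trans ?_
    have h2 := aN_mono (w := fun ξ => L * jb ξ) (w' := jb) (c := L)
      (fun ξ => by rw [abs_mul, abs_of_nonneg hL]) f
    rw [ENNReal.ofReal_mul (by positivity), ENNReal.ofReal_mul hL, ofReal_norm]
    gcongr
    exact h2.trans (by gcongr)
  · have h1 := hat_pr_mult good_one (ha.good R) (f := f) (g := g) (by rwa [mult_one])
      (band_Sm ha R g).wiener
    rw [mult_one] at h1
    rw [hat_sub]
    filter_upwards [Lp.coeFn_sub (hat (Sm R a (pr f g))) (hat (pr f (Sm R a g))), h1,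
      hat_Sm ha R (pr f g), hat_pr hfW hg] with k h2 h3 h4 h5
    have h3' : hat (pr f (Sm R a g)) k = _ := h3
    rw [h2, Pi.sub_apply, h4, h3', h5, ← integral_const_mul, ← integral_sub]
    · simp only [Complex.ofReal_one, one_mul]
      congr 1; ext l; push_cast; ring
    · exact (integrable_conv f g k).const_mul _
    · exact integrable_mult_conv good_one (ha.good R) f g k
  · intro k l
    rw [norm_mul, Complex.norm_I, one_mul, Complex.norm_real, Real.norm_eq_abs]
    refine (hlip _ _).trans ?_
    have e : 2 * Real.pi * k - 2 * Real.pi * l = 2 * Real.pi * (k - l) := by ring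
    rw [e, abs_mul L, abs_of_nonneg hL, abs_of_pos (jb_pos _)]
    simp only [abs_one, mul_one, abs_zero, mul_zero, add_zero]
    exact mul_le_mul_of_nonneg_left (abs_le_jb _) hL

/-- Commutator of the derivative and a multiplication operator, composed with a bounded
multiplier. -/
theorem norm_mult_derivative_commutator_le {a : ℝ → ℝ} (ha : OddS a) {R M : ℝ} (hM : 0 ≤ M)
    (hbd : ∀ ξ, |a ξ| ≤ M) {f g : RealL2} {α : ℝ} (hα : 0 ≤ α)
    (hf : aN jb f ≤ ENNReal.ofReal α) (hg : Band R g) :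
    ‖Sm R a (Sm R (fun ξ => ξ) (pr f g)) - Sm R a (pr f (Sm R (fun ξ => ξ) g))‖
      ≤ M * α * ‖g‖ := by
  have hfW := Wiener.of_jb hf
  apply norm_le_of_enorm_le (by positivity)
  rw [← wN_one]
  have hP := evenS_const 1
  -- Band-limitation of `g` inserts the cutoff at the frequency `l`. Without it the difference of
  -- truncated frequencies would not be bounded by the frequency of `f` when `|2πl| > R`.
  have h := wN_le_of_conv (w := fun _ => 1)
    (q := Sm R a (Sm R (fun ξ => ξ) (pr f g)) - Sm R a (pr f (Sm R (fun ξ => ξ) g))) (f := f)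
    (g := g) (σ := fun k l => - ((cut R a (2 * Real.pi * k)
      * (cut R (fun ξ => ξ) (2 * Real.pi * k) * cut R (fun _ => 1) (2 * Real.pi * l)
        - cut R (fun ξ => ξ) (2 * Real.pi * l)) : ℝ) : ℂ))
    (w₁ := fun ξ => M * jb ξ) (w₂ := fun _ => 1) (w₃ := fun _ => 0) (w₄ := fun _ => 0)
    (measurable_const.mul evenS_jb.cont.measurable) measurable_const measurable_const
    measurable_const ?_ ?_
  · rw [wN_zero_weight, zero_mul, add_zero, wN_one g] at h
    refine h.trans ?_
    have h2 := aN_mono (w := fun ξ => M * jb ξ) (w' := jb) (c := M)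
      (fun ξ => by rw [abs_mul, abs_of_nonneg hM]) f
    rw [ENNReal.ofReal_mul (by positivity), ENNReal.ofReal_mul hM, ofReal_norm]
    gcongr
    exact h2.trans (by gcongr)
  · have h1 := hat_pr_mult good_one (oddS_id.good R) (f := f) (g := g) (by rwa [mult_one])
      (band_Sm oddS_id R g).wiener
    have h0 := hat_pr_mult good_one (hP.good R) (f := f) (g := g) (by rwa [mult_one])
      (band_Rm hP R g).wiener
    rw [mult_one] at h1 h0
    change ∀ᵐ k : ℝ, hat (pr f (Rm R (fun _ => 1) g)) k = _ at h0
    rw [hg] at h0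
    rw [hat_sub]
    filter_upwards [Lp.coeFn_sub (hat (Sm R a (Sm R (fun ξ => ξ) (pr f g))))
      (hat (Sm R a (pr f (Sm R (fun ξ => ξ) g)))), h1, h0,
      hat_Sm ha R (Sm R (fun ξ => ξ) (pr f g)), hat_Sm oddS_id R (pr f g),
      hat_Sm ha R (pr f (Sm R (fun ξ => ξ) g))] with k h2 h3 h4 h5 h6 h7
    have h3' : hat (pr f (Sm R (fun ξ => ξ) g)) k = _ := h3
    rw [h2, Pi.sub_apply, h5, h7, h3', h6, h4, ← integral_const_mul, ← integral_const_mul,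
      ← integral_const_mul, ← integral_sub]
    · simp only [Complex.ofReal_one, one_mul]
      congr 1; ext l; push_cast
      linear_combination (cut R a (2 * Real.pi * k) * (cut R (fun ξ => ξ) (2 * Real.pi * k)
        * cut R (fun _ => 1) (2 * Real.pi * l) - cut R (fun ξ => ξ) (2 * Real.pi * l)) *
          (hat f (k - l) * hat g l) : ℂ) * Complex.I_mul_I
    · exact ((integrable_mult_conv good_one (hP.good R) f g k).const_mul _).const_mul _
    · exact (integrable_mult_conv good_one (oddS_id.good R) f g k).const_mul _
  · intro k l
    rw [norm_neg, Complex.norm_real, Real.norm_eq_abs, abs_mul, abs_mul M, abs_of_nonneg hM,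
      abs_of_pos (jb_pos _)]
    simp only [abs_one, mul_one, abs_zero, mul_zero, add_zero]
    have e : 2 * Real.pi * k - 2 * Real.pi * l = 2 * Real.pi * (k - l) := by ring
    by_cases h1 : |2 * Real.pi * k| ≤ R
    · refine mul_le_mul ((abs_cut_le _ _ _).trans (hbd _)) ?_ (abs_nonneg _) hM
      by_cases h2 : |2 * Real.pi * l| ≤ R
      · simp only [cut, if_pos h1, if_pos h2, mul_one]
        rw [e]; exact abs_le_jb _
      · simp only [cut, if_neg h2, mul_zero, sub_zero, abs_zero]
        exact (jb_pos _).le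
    · simp only [cut, if_neg h1, abs_zero, zero_mul]
      exact mul_nonneg hM (jb_pos _).le

/-! ### Properties of the symbols -/

theorem hasDerivAt_tanh (x : ℝ) : HasDerivAt Real.tanh (1 / Real.cosh x ^ 2) x := by
  have h := (Real.hasDerivAt_sinh x).div (Real.hasDerivAt_cosh x) (Real.cosh_pos x).ne'
  have e : Real.tanh = fun y => Real.sinh y / Real.cosh y :=
    funext fun y => Real.tanh_eq_sinh_div_cosh y
  rw [e]
  convert! h using 1
  congr 1
  have := Real.cosh_sq x
  nlinarith

theorem abs_tanh_sub_le (x y : ℝ) : |Real.tanh x - Real.tanh y| ≤ |x - y| := by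
  have h := Convex.norm_image_sub_le_of_norm_hasDerivWithin_le (f := Real.tanh)
    (f' := fun x => 1 / Real.cosh x ^ 2) (s := univ) (C := 1) (x := y) (y := x)
    (fun x _ => (hasDerivAt_tanh x).hasDerivWithinAt) (fun x _ => ?_) convex_univ
    (mem_univ _) (mem_univ _)
  · simpa using h
  · have := Real.one_le_cosh x
    rw [Real.norm_of_nonneg (by positivity), div_le_one (by positivity)]
    nlinarith

theorem tanh_pos {x : ℝ} (hx : 0 < x) : 0 < Real.tanh x := by
  rw [Real.tanh_eq_sinh_div_cosh]
  exact div_pos (Real.sinh_pos_iff.2 hx) (Real.cosh_pos x)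

theorem tanh_le_self {x : ℝ} (hx : 0 ≤ x) : Real.tanh x ≤ x := by
  have := abs_tanh_sub_le x 0
  rw [Real.tanh_zero, sub_zero, sub_zero, abs_of_nonneg hx] at this
  exact (le_abs_self _).trans this

/-- Multiplied out, this is `1 + 2x ≤ exp(2x)`. -/
theorem self_le_mul_tanh (x : ℝ) : x ≤ (1 + x) * Real.tanh x := by
  rw [Real.tanh_eq_sinh_div_cosh, mul_div_assoc', le_div_iff₀ (Real.cosh_pos x), Real.cosh_eq,
    Real.sinh_eq]
  have h1 := Real.add_one_le_exp (2 * x)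
  have h2 := Real.exp_pos (-x)
  have h3 : Real.exp x = Real.exp (2 * x) * Real.exp (-x) := by
    rw [← Real.exp_add]; ring_nf
  nlinarith

/-- The inverse `T_μ⁻¹` of the symbol of `𝒯_μ`. -/
def tau (μ ξ : ℝ) : ℝ := (symT μ ξ)⁻¹

/-- The symbol `ξ T_μ(ξ) = tanh(√μ ξ)/√μ`. -/
def aS (μ ξ : ℝ) : ℝ := ξ * symT μ ξ

/-- The symbol `1 + βμξ²`. -/
def lam (β μ ξ : ℝ) : ℝ := 1 + β * μ * ξ ^ 2

theorem symT_pos {μ : ℝ} (hμ : 0 < μ) (ξ : ℝ) : 0 < symT μ ξ := by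
  unfold symT
  split_ifs with h
  · exact one_pos
  · have : 0 < √μ * |ξ| := mul_pos (Real.sqrt_pos.2 hμ) (abs_pos.2 h)
    exact div_pos (tanh_pos this) this

theorem symT_le_one {μ : ℝ} (hμ : 0 < μ) (ξ : ℝ) : symT μ ξ ≤ 1 := by
  unfold symT
  split_ifs with h
  · exact le_rfl
  · have : 0 < √μ * |ξ| := mul_pos (Real.sqrt_pos.2 hμ) (abs_pos.2 h)
    exact div_le_one_of_le₀ (tanh_le_self this.le) this.le

theorem one_le_tau {μ : ℝ} (hμ : 0 < μ) (ξ : ℝ) : 1 ≤ tau μ ξ :=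
  (one_le_inv₀ (symT_pos hμ ξ)).2 (symT_le_one hμ ξ)

theorem tau_pos {μ : ℝ} (hμ : 0 < μ) (ξ : ℝ) : 0 < tau μ ξ := one_pos.trans_le (one_le_tau hμ ξ)

/-- `self_le_mul_tanh` at `√μ|ξ|`. Together with `le_two_tau` it makes `𝒯_μ⁻¹` comparable to `1 +
√μ|ξ|` with constants independent of `μ`, which is why `√μ‖D^{1/2}v‖²` is the right term in the
norm. -/
theorem tau_le {μ : ℝ} (hμ : 0 < μ) (ξ : ℝ) : tau μ ξ ≤ 1 + √μ * |ξ| := by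
  unfold tau symT
  split_ifs with h
  · simp [h]
  · have h0 : 0 < √μ * |ξ| := mul_pos (Real.sqrt_pos.2 hμ) (abs_pos.2 h)
    rw [inv_div, div_le_iff₀ (tanh_pos h0)]
    exact self_le_mul_tanh _

theorem le_two_tau {μ : ℝ} (hμ : 0 < μ) (ξ : ℝ) : 1 + √μ * |ξ| ≤ 2 * tau μ ξ := by
  have h1 := one_le_tau hμ ξ
  have h2 : √μ * |ξ| ≤ tau μ ξ := by
    unfold tau symT
    split_ifs with h
    · simp [h]
    · have h0 : 0 < √μ * |ξ| := mul_pos (Real.sqrt_pos.2 hμ) (abs_pos.2 h)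
      rw [inv_div, le_div_iff₀ (tanh_pos h0)]
      nlinarith [Real.tanh_lt_one (√μ * |ξ|)]
  linarith

theorem symT_mul_tau {μ : ℝ} (hμ : 0 < μ) (ξ : ℝ) : symT μ ξ * tau μ ξ = 1 :=
  mul_inv_cancel₀ (symT_pos hμ ξ).ne'

theorem tau_mul_aS {μ : ℝ} (hμ : 0 < μ) (ξ : ℝ) : tau μ ξ * aS μ ξ = ξ := by
  unfold aS
  rw [mul_comm, mul_assoc, symT_mul_tau hμ, mul_one]

theorem aS_eq {μ : ℝ} (hμ : 0 < μ) (ξ : ℝ) : aS μ ξ = Real.tanh (√μ * ξ) / √μ := by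
  have h0 : 0 < √μ := Real.sqrt_pos.2 hμ
  unfold aS symT
  split_ifs with h
  · simp [h]
  · rcases lt_or_gt_of_ne h with h | h
    · rw [abs_of_neg h, mul_neg, Real.tanh_neg, neg_div_neg_eq]; field_simp
    · rw [abs_of_pos h]; field_simp

/-- The rescaling `tanh(√μ ξ)/√μ` preserves the Lipschitz constant of `tanh`. This is the source of
uniformity in `μ` for the commutators. -/
theorem abs_aS_sub_le {μ : ℝ} (hμ : 0 < μ) (ξ η : ℝ) : |aS μ ξ - aS μ η| ≤ |ξ - η| := by
  have h0 : 0 < √μ := Real.sqrt_pos.2 hμ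
  rw [aS_eq hμ, aS_eq hμ, ← sub_div, abs_div, abs_of_pos h0, div_le_iff₀ h0]
  refine (abs_tanh_sub_le _ _).trans ?_
  rw [← mul_sub, abs_mul, abs_of_pos h0, mul_comm]

theorem aS_zero (μ : ℝ) : aS μ 0 = 0 := by simp [aS]

theorem abs_aS_le {μ : ℝ} (hμ : 0 < μ) (ξ : ℝ) : |aS μ ξ| ≤ |ξ| := by
  have := abs_aS_sub_le hμ ξ 0
  simpa [aS_zero] using this

/-- Saturation of `tanh`: at the price `μ^{-1/2}` the operator `𝒯_μ ∂ₓ` is bounded. This pays for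
the derivatives in `βμD²`. -/
theorem sqrt_mul_abs_aS_le {μ : ℝ} (hμ : 0 < μ) (ξ : ℝ) : √μ * |aS μ ξ| ≤ 1 := by
  have h0 : 0 < √μ := Real.sqrt_pos.2 hμ
  rw [aS_eq hμ, abs_div, abs_of_pos h0, mul_div_cancel₀ _ h0.ne']
  exact (Real.abs_tanh_lt_one _).le

theorem evenS_symT {μ : ℝ} (hμ : 0 < μ) : EvenS (symT μ) := by
  constructor
  · have h1 : symT μ = fun ξ => dslope Real.tanh 0 (√μ * |ξ|) := by
      ext ξ
      have h0 : 0 < √μ := Real.sqrt_pos.2 hμ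
      unfold symT
      split_ifs with h
      · rw [h, abs_zero, mul_zero, dslope_same, (hasDerivAt_tanh 0).deriv]; simp
      · rw [dslope_of_ne _ (mul_ne_zero h0.ne' (abs_ne_zero.2 h)), slope_def_field]; simp
    rw [h1]
    have h2 : Continuous (dslope Real.tanh 0) := by
      rw [← continuousOn_univ, continuousOn_dslope univ_mem]
      exact ⟨fun x _ => (hasDerivAt_tanh x).continuousAt.continuousWithinAt,
        (hasDerivAt_tanh 0).differentiableAt⟩
    exact h2.comp (by fun_prop)
  · intro ξ; simp [symT]

theorem evenS_tau {μ : ℝ} (hμ : 0 < μ) : EvenS (tau μ) :=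
  ⟨(evenS_symT hμ).cont.inv₀ fun ξ => (symT_pos hμ ξ).ne',
    fun ξ => by simp only [tau, (evenS_symT hμ).even]⟩

theorem oddS_aS {μ : ℝ} (hμ : 0 < μ) : OddS (aS μ) :=
  ⟨continuous_id.mul (evenS_symT hμ).cont,
    fun ξ => by simp only [aS, (evenS_symT hμ).even, neg_mul]⟩

theorem evenS_lam (β μ : ℝ) : EvenS (lam β μ) := by
  refine ⟨?_, fun ξ => by simp [lam]⟩
  unfold lam; fun_prop

theorem one_le_lam {β μ : ℝ} (hβ : 0 < β) (hμ : 0 < μ) (ξ : ℝ) : 1 ≤ lam β μ ξ := by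
  have : 0 ≤ β * μ * ξ ^ 2 := by positivity
  unfold lam; linarith

theorem lam_pos {β μ : ℝ} (hβ : 0 < β) (hμ : 0 < μ) (ξ : ℝ) : 0 < lam β μ ξ :=
  one_pos.trans_le (one_le_lam hβ hμ ξ)

theorem sqrt_lam_le {β μ : ℝ} (hβ : 0 < β) (hμ : 0 < μ) (ξ : ℝ) :
    √(lam β μ ξ) ≤ 1 + √β * √μ * |ξ| := by
  rw [Real.sqrt_le_left (by positivity), lam]
  have h1 := Real.sq_sqrt hβ.le
  have h2 := Real.sq_sqrt hμ.le
  have h3 := sq_abs ξ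
  have : (√β * √μ * |ξ|) ^ 2 = β * μ * ξ ^ 2 := by rw [mul_pow, mul_pow, h1, h2, h3]
  nlinarith [show 0 ≤ √β * √μ * |ξ| by positivity]

/-- The frequency cutoff, equal to `1` for `|ξ| ≤ n` and to `0` for `|ξ| ≥ 2n`. -/
def chi (n ξ : ℝ) : ℝ := max 0 (min 1 (2 - |ξ| / n))

theorem evenS_chi (n : ℝ) : EvenS (chi n) := by
  refine ⟨?_, fun ξ => by simp [chi]⟩
  unfold chi; fun_prop

theorem chi_nonneg (n ξ : ℝ) : 0 ≤ chi n ξ := le_max_left _ _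

theorem chi_le_one (n ξ : ℝ) : chi n ξ ≤ 1 := max_le zero_le_one (min_le_left _ _)

theorem abs_chi_le_one (n ξ : ℝ) : |chi n ξ| ≤ 1 := by
  rw [abs_of_nonneg (chi_nonneg n ξ)]; exact chi_le_one n ξ

theorem chi_eq_one {n ξ : ℝ} (hn : 0 < n) (h : |ξ| ≤ n) : chi n ξ = 1 := by
  have : |ξ| / n ≤ 1 := (div_le_one hn).2 h
  rw [chi, min_eq_left (by linarith), max_eq_right zero_le_one]

theorem chi_eq_zero {n ξ : ℝ} (hn : 0 < n) (h : 2 * n ≤ |ξ|) : chi n ξ = 0 := by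
  have : 2 ≤ |ξ| / n := (le_div_iff₀ hn).2 h
  rw [chi, max_eq_left]
  exact (min_le_right _ _).trans (by linarith)

theorem abs_chi_sub_le {n : ℝ} (hn : 0 < n) (ξ η : ℝ) : |chi n ξ - chi n η| ≤ |ξ - η| / n := by
  unfold chi
  refine (abs_max_sub_max_le_max _ _ _ _).trans ?_
  rw [sub_self, abs_zero, max_eq_right (abs_nonneg _)]
  refine (abs_min_sub_min_le_max _ _ _ _).trans ?_
  rw [sub_self, abs_zero, max_eq_right (abs_nonneg _)]
  have e : 2 - |ξ| / n - (2 - |η| / n) = (|η| - |ξ|) / n := by ring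
  rw [e, abs_div, abs_of_pos hn]
  refine div_le_div_of_nonneg_right ?_ hn.le
  rw [abs_sub_comm ξ η]
  exact abs_abs_sub_abs_le_abs_sub _ _

/-- A 1-Lipschitz symbol multiplied by the cutoff is 3-Lipschitz. -/
theorem abs_cut_mul_chi_sub_le {b : ℝ → ℝ} (hb : ∀ ξ η, |b ξ - b η| ≤ |ξ - η|) (hb0 : b 0 = 0)
    {n : ℝ} (hn : 0 < n) (ξ η : ℝ) :
    |cut (2 * n) (fun ξ => chi n ξ * b ξ) ξ - cut (2 * n) (fun ξ => chi n ξ * b ξ) η|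
      ≤ 3 * |ξ - η| := by
  have hc : ∀ ξ, cut (2 * n) (fun ξ => chi n ξ * b ξ) ξ = chi n ξ * b ξ := fun ξ => by
    unfold cut
    split_ifs with h
    · rfl
    · rw [chi_eq_zero hn (not_le.1 h).le, zero_mul]
  rw [hc, hc]
  -- If the smaller frequency is at most `2n`, then `|b η| ≤ 2n` compensates the Lipschitz constant
  -- `1/n` of the cutoff, giving `1 + 2 = 3`. Otherwise both values vanish.
  have key : ∀ ξ η : ℝ, |η| ≤ |ξ| → |chi n ξ * b ξ - chi n η * b η| ≤ 3 * |ξ - η| := by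
    intro ξ η h
    by_cases h2 : |η| ≤ 2 * n
    · have hbη : |b η| ≤ |η| := by simpa [hb0] using hb η 0
      have e : chi n ξ * b ξ - chi n η * b η
          = chi n ξ * (b ξ - b η) + (chi n ξ - chi n η) * b η := by ring
      have h3 : |chi n ξ - chi n η| * |b η| ≤ |ξ - η| / n * (2 * n) :=
        mul_le_mul (abs_chi_sub_le hn ξ η) (hbη.trans h2) (abs_nonneg _)
          (div_nonneg (abs_nonneg _) hn.le)
      have h4 : |ξ - η| / n * (2 * n) = 2 * |ξ - η| := by field_simp
      have h5 : |chi n ξ| * |b ξ - b η| ≤ 1 * |ξ - η| :=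
        mul_le_mul (abs_chi_le_one n ξ) (hb ξ η) (abs_nonneg _) zero_le_one
      rw [e]
      refine (abs_add_le _ _).trans ?_
      rw [abs_mul, abs_mul]
      linarith
    · rw [chi_eq_zero hn (not_le.1 h2).le, chi_eq_zero hn ((not_le.1 h2).le.trans h)]
      simp
  rcases le_total |η| |ξ| with h | h
  · exact key ξ η h
  · rw [abs_sub_comm, abs_sub_comm ξ]; exact key η ξ h

/-! ### The linear energy estimate -/

section Energy

variable {β μ n : ℝ}

/-- The regularized operator `𝒯_μ(D) ∂ₓ`. -/
def Aop (μ n : ℝ) : RealL2 →L[ℝ] RealL2 := Sm (2 * n) (fun ξ => chi n ξ * aS μ ξ)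

/-- The regularized derivative. -/
def Dop (n : ℝ) : RealL2 →L[ℝ] RealL2 := Sm (2 * n) (fun ξ => chi n ξ * ξ)

theorem oddS_chi_aS (hμ : 0 < μ) : OddS (fun ξ => chi n ξ * aS μ ξ) :=
  (evenS_chi n).mul_odd (oddS_aS hμ)

theorem oddS_chi_id : OddS (fun ξ => chi n ξ * ξ) := (evenS_chi n).mul_odd oddS_id

/-- The relation `𝒯_μ ∂ₓ 𝒯_μ⁻¹ = ∂ₓ` survives regularization exactly, since both operators carry the
same cutoff. The main cancellation depends on it. -/
theorem Aop_tau (hμ : 0 < μ) (f : RealL2) : Aop μ n (Rm (2 * n) (tau μ) f) = Dop n f := by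
  unfold Aop Dop
  rw [Sm_Rm (evenS_tau hμ) (oddS_chi_aS hμ)]
  congr 2
  ext ξ
  linear_combination chi n ξ * tau_mul_aS hμ ξ

theorem tau_Aop (hμ : 0 < μ) (f : RealL2) : Rm (2 * n) (tau μ) (Aop μ n f) = Dop n f := by
  unfold Aop Dop
  rw [Rm_Sm (evenS_tau hμ) (oddS_chi_aS hμ)]
  congr 2
  ext ξ
  linear_combination chi n ξ * tau_mul_aS hμ ξ

theorem norm_Aop_commutator_le (hμ : 0 < μ) (hn : 0 < n) {f g : RealL2} {α : ℝ} (hα : 0 ≤ α)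
    (hf : aN jb f ≤ ENNReal.ofReal α) (hg : Wiener g) :
    ‖Aop μ n (pr f g) - pr f (Aop μ n g)‖ ≤ 3 * α * ‖g‖ :=
  norm_commutator_le (oddS_chi_aS hμ) (by norm_num)
    (abs_cut_mul_chi_sub_le (abs_aS_sub_le hμ) (aS_zero μ) hn) hα hf hg

theorem norm_Dop_commutator_le (hn : 0 < n) {f g : RealL2} {α : ℝ} (hα : 0 ≤ α)
    (hf : aN jb f ≤ ENNReal.ofReal α) (hg : Wiener g) :
    ‖Dop n (pr f g) - pr f (Dop n g)‖ ≤ 3 * α * ‖g‖ :=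
  norm_commutator_le oddS_chi_id (by norm_num)
    (abs_cut_mul_chi_sub_le (fun _ _ => le_rfl) rfl hn) hα hf hg

/-- A skew-adjoint operator composed with a multiplication operator is skew up to the
commutator. -/
theorem abs_inner_skew_pr_le {S : RealL2 →L[ℝ] RealL2}
    (hS : ∀ x y, inner ℝ (S x) y = -inner ℝ x (S y)) {f g : RealL2} (hf : Wiener f) {c : ℝ}
    (hc : ‖S (pr f g) - pr f (S g)‖ ≤ c * ‖g‖) :
    2 * |inner ℝ (S (pr f g)) g| ≤ c * ‖g‖ ^ 2 := by
  have h1 : inner ℝ (S (pr f g)) g = -inner ℝ (pr f (S g)) g := by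
    rw [hS, inner_pr_left hf, real_inner_comm]
  have h2 := abs_real_inner_le_norm (S (pr f g) - pr f (S g)) g
  rw [inner_sub_left] at h2
  have h3 : inner ℝ (S (pr f g)) g - inner ℝ (pr f (S g)) g = 2 * inner ℝ (S (pr f g)) g := by
    linarith
  rw [h3, abs_mul, abs_two] at h2
  nlinarith [mul_le_mul_of_nonneg_right hc (norm_nonneg g)]

theorem norm_sq_sqrt_Rm {w : ℝ → ℝ} (hw : EvenS w) (h0 : ∀ ξ, 0 ≤ w ξ) (R : ℝ) (f : RealL2) :
    ‖Rm R (fun ξ => √(w ξ)) f‖ ^ 2 = inner ℝ f (Rm R w f) := by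
  rw [← real_inner_self_eq_norm_sq, inner_Rm hw.sqrt, Rm_Rm hw.sqrt hw.sqrt]
  congr 3
  ext ξ
  exact Real.mul_self_sqrt (h0 ξ)

theorem inner_Rm_eq_sqrt {w : ℝ → ℝ} (hw : EvenS w) (h0 : ∀ ξ, 0 ≤ w ξ) (R : ℝ) (f g : RealL2) :
    inner ℝ f (Rm R w g)
      = inner ℝ (Rm R (fun ξ => √(w ξ)) f) (Rm R (fun ξ => √(w ξ)) g) := by
  rw [inner_Rm hw.sqrt, Rm_Rm hw.sqrt hw.sqrt]
  congr 3
  ext ξ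
  exact (Real.mul_self_sqrt (h0 ξ)).symm

theorem norm_le_sqrt_Rm {w : ℝ → ℝ} (hw : EvenS w) (h0 : ∀ ξ, 1 ≤ w ξ) {R : ℝ} {f : RealL2}
    (hf : Band R f) : ‖f‖ ≤ ‖Rm R (fun ξ => √(w ξ)) f‖ := by
  have h := norm_Rm_le_Rm (evenS_const 1) hw.sqrt R (fun ξ => ?_) f
  · rwa [hf] at h
  · rw [abs_one, abs_of_nonneg (Real.sqrt_nonneg _), Real.one_le_sqrt]; exact h0 ξ

/-- `(1 + βμD²) ψ = ψ - βμ ∂ₓ² ψ` on band-limited functions. -/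
theorem Rm_lam {R : ℝ} {ψ : RealL2} (hψ : Band R ψ) :
    Rm R (lam β μ) ψ = ψ - (β * μ) • Sm R (fun ξ => ξ) (Sm R (fun ξ => ξ) ψ) := by
  have h : Rm R (lam β μ) ψ = Rm R (fun _ => 1) ψ
      + (β * μ) • Rm R (fun ξ => ξ * ξ) ψ := by
    apply eq_of_hat_ae_eq
    rw [hat_add, hat_smul]
    filter_upwards [hat_Rm (evenS_lam β μ) R ψ, hat_Rm (evenS_const 1) R ψ,
      hat_Rm (oddS_id.mul oddS_id) R ψ,
      Lp.coeFn_add (hat (Rm R (fun _ => 1) ψ)) ((β * μ) • hat (Rm R (fun ξ => ξ * ξ) ψ)),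
      Lp.coeFn_smul (β * μ) (hat (Rm R (fun ξ => ξ * ξ) ψ))] with k h1 h2 h3 h4 h5
    rw [h4, Pi.add_apply, h5, Pi.smul_apply, h1, h2, h3, Complex.real_smul]
    unfold cut lam
    split_ifs <;> push_cast <;> ring
  rw [h, hψ, Sm_Sm oddS_id oddS_id, smul_neg, sub_neg_eq_add]

/-- The left side is `α√β · x · (√(βμ) y)`. It remains to use `2√β ≤ 1 + B` and the
arithmetic-geometric inequality. -/
theorem mul_sqrt_inv_le {B α : ℝ} (hβ : 0 < β) (hB : β ≤ B) (hμ : 0 < μ) (hα : 0 ≤ α)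
    (x y : ℝ) : β * μ * ((√μ)⁻¹ * α * x * y) ≤ (1 + B) / 4 * α * (x ^ 2 + β * μ * y ^ 2) := by
  have e1 : μ * (√μ)⁻¹ = √μ := by rw [← div_eq_mul_inv, Real.div_sqrt]
  have e5 : (√β) ^ 2 = β := Real.sq_sqrt hβ.le
  have e6 : (√μ) ^ 2 = μ := Real.sq_sqrt hμ.le
  set z := √β * (√μ * y) with hz
  have e7 : β * μ * ((√μ)⁻¹ * α * x * y) = α * √β * (x * z) := by
    rw [hz]; linear_combination (β * α * x * y) * e1 - (α * x * √μ * y) * e5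
  have e8 : β * μ * y ^ 2 = z ^ 2 := by
    rw [hz, mul_pow, mul_pow, e5, e6]; ring
  have e9 : 2 * √β ≤ 1 + B := by nlinarith [sq_nonneg (√β - 1)]
  have e10 : 2 * (x * z) ≤ x ^ 2 + z ^ 2 := by nlinarith [sq_nonneg (x - z)]
  rw [e7, e8]
  have e11 : α * √β * (2 * (x * z)) ≤ α * √β * (x ^ 2 + z ^ 2) := by gcongr
  have e12 : α * (2 * √β) * (x ^ 2 + z ^ 2) ≤ α * (1 + B) * (x ^ 2 + z ^ 2) := by gcongr
  linarith

set_option maxHeartbeats 400000 in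
/-- The linear energy estimate, at a fixed time. -/
theorem linear_energy_estimate {B : ℝ} (hβ : 0 < β) (hB : β ≤ B) (hμ : 0 < μ) (hn : 0 < n)
    {ζ v ψ w f g dψ dw : RealL2} (hψ : Band (2 * n) ψ) (hw : Band (2 * n) w)
    (hg : Band (2 * n) g) {α : ℝ} (hα : 0 ≤ α)
    (hζα : aN jb ζ ≤ ENNReal.ofReal α) (hvα : aN jb v ≤ ENNReal.ofReal α)
    (hdψ : dψ = -(Dop n w + Aop μ n (pr ζ w) + Aop μ n (pr v ψ)) + f)
    (hdw : dw = -(Aop μ n (Rm (2 * n) (lam β μ) ψ) + Aop μ n (pr v w)) + g) {e r : ℝ}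
    (he : e = ‖Rm (2 * n) (fun ξ => √(lam β μ ξ)) ψ‖ ^ 2
      + ‖Rm (2 * n) (fun ξ => √(tau μ ξ)) w‖ ^ 2)
    (hf : ‖Rm (2 * n) (fun ξ => √(lam β μ ξ)) f‖ ≤ r)
    (hgr : ‖Rm (2 * n) (fun ξ => √(tau μ ξ)) g‖ ≤ r) :
    2 * inner ℝ dψ (Rm (2 * n) (lam β μ) ψ)
      + 2 * inner ℝ dw (Rm (2 * n) (tau μ) w + pr ζ w)
      ≤ (12 + B) * (1 + α) * α * e + 4 * (1 + α) * r * √e := by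
  have hB0 : 0 < B := hβ.trans_le hB
  set R := 2 * n with hR
  set A := Aop μ n with hA
  set D := Sm R (fun ξ => ξ) with hD
  set La := Rm R (lam β μ) with hLa
  set Ti := Rm R (tau μ) with hTi
  have hvW := Wiener.of_jb hvα
  have hζW := Wiener.of_jb hζα
  have hψW := hψ.wiener
  have hwW := hw.wiener
  have hAs : ∀ x y, inner ℝ (A x) y = -inner ℝ x (A y) := inner_Sm (oddS_chi_aS hμ) R
  have hDcs : ∀ x y, inner ℝ (Dop n x) y = -inner ℝ x (Dop n y) := inner_Sm oddS_chi_id R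
  have hDs : ∀ x y, inner ℝ (D x) y = -inner ℝ x (D y) := inner_Sm oddS_id R
  have hAD : ∀ x, A (D x) = D (A x) := fun x => by
    rw [hA, hD, Aop, Sm_Sm (oddS_chi_aS hμ) oddS_id, Sm_Sm oddS_id (oddS_chi_aS hμ)]
    have e : (fun ξ => chi n ξ * aS μ ξ * ξ) = fun ξ => ξ * (chi n ξ * aS μ ξ) := by ext; ring
    rw [e]
  set E₁ := ‖Rm R (fun ξ => √(lam β μ ξ)) ψ‖ with hE₁
  set E₂ := ‖Rm R (fun ξ => √(tau μ ξ)) w‖ with hE₂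
  have hE₁0 : 0 ≤ E₁ := norm_nonneg _
  have hE₂0 : 0 ≤ E₂ := norm_nonneg _
  have hr : 0 ≤ r := (norm_nonneg _).trans hf
  have hlam0 : ∀ ξ, 0 ≤ lam β μ ξ := fun ξ => (lam_pos hβ hμ ξ).le
  have htau0 : ∀ ξ, 0 ≤ tau μ ξ := fun ξ => (tau_pos hμ ξ).le
  have hE₁sq : E₁ ^ 2 = ‖ψ‖ ^ 2 + β * μ * ‖D ψ‖ ^ 2 := by
    rw [hE₁, norm_sq_sqrt_Rm (evenS_lam β μ) hlam0, Rm_lam hψ, inner_sub_right,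
      inner_smul_right, real_inner_self_eq_norm_sq]
    have := hDs ψ (D ψ)
    rw [real_inner_self_eq_norm_sq] at this
    rw [← hD]
    linear_combination (-(β * μ)) * this
  have hwE : ‖w‖ ≤ E₂ := norm_le_sqrt_Rm (evenS_tau hμ) (one_le_tau hμ) hw
  have hgE : ‖g‖ ≤ r := (norm_le_sqrt_Rm (evenS_tau hμ) (one_le_tau hμ) hg).trans hgr
  -- the main terms cancel
  have c1 : inner ℝ (Dop n w) (La ψ) = -inner ℝ (A (La ψ)) (Ti w) := by
    rw [hAs, neg_neg, real_inner_comm, hA, hTi, hR, Aop_tau hμ]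
  have c2 : inner ℝ (A (pr ζ w)) (La ψ) = -inner ℝ (A (La ψ)) (pr ζ w) := by
    rw [hAs, real_inner_comm]
  -- transport of `ψ`
  have t1 : |inner ℝ (A (pr v ψ)) (La ψ)| ≤ (3 / 2 + (1 + B) / 4) * α * E₁ ^ 2 := by
    have h1 := abs_inner_skew_pr_le hAs hvW (norm_Aop_commutator_le hμ hn hα hvα hψW)
    have hDψ : Band R (D ψ) := band_Sm oddS_id R ψ
    have h2 := abs_inner_skew_pr_le hAs hvW (norm_Aop_commutator_le hμ hn hα hvα hDψ.wiener)
    have h0 : 0 < √μ := Real.sqrt_pos.2 hμ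
    -- Here `A` is used as a bounded operator of norm `μ^{-1/2}`, acting on the commutator of `∂ₓ`
    -- with `v`.
    have h3 := norm_mult_derivative_commutator_le (oddS_chi_aS (n := n) hμ) (R := R)
      (M := (√μ)⁻¹) (by positivity) (fun ξ => by
        rw [abs_mul, inv_eq_one_div, le_div_iff₀ h0]
        have := sqrt_mul_abs_aS_le hμ ξ
        have := mul_le_mul (abs_chi_le_one n ξ) this (by positivity) zero_le_one
        linarith) hα hvα hψ
    have h4 := abs_real_inner_le_norm (A (D (pr v ψ)) - A (pr v (D ψ))) (D ψ)
    -- `Λ = 1 - βμ∂ₓ²` and one integration by parts reduce the term to two transport terms, in `ψ`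
    -- and in `∂ₓψ`, and a commutator with `∂ₓ`.
    have h5 : inner ℝ (A (pr v ψ)) (La ψ) = inner ℝ (A (pr v ψ)) ψ
        + β * μ * (inner ℝ (A (pr v (D ψ))) (D ψ)
          + inner ℝ (A (D (pr v ψ)) - A (pr v (D ψ))) (D ψ)) := by
      rw [hLa, Rm_lam hψ, inner_sub_right, inner_smul_right, inner_sub_left, hAD, hDs]
      ring
    have h6 : |inner ℝ (A (D (pr v ψ)) - A (pr v (D ψ))) (D ψ)| ≤ (√μ)⁻¹ * α * ‖ψ‖ * ‖D ψ‖ :=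
      h4.trans (mul_le_mul_of_nonneg_right h3 (norm_nonneg _))
    have h7 : β * μ * ((√μ)⁻¹ * α * ‖ψ‖ * ‖D ψ‖) ≤ (1 + B) / 4 * α * E₁ ^ 2 := by
      rw [hE₁sq]
      exact mul_sqrt_inv_le hβ hB hμ hα _ _
    have hβμ : 0 < β * μ := mul_pos hβ hμ
    have h8 : |inner ℝ (A (pr v ψ)) (La ψ)| ≤ |inner ℝ (A (pr v ψ)) ψ|
        + β * μ * (|inner ℝ (A (pr v (D ψ))) (D ψ)|
          + |inner ℝ (A (D (pr v ψ)) - A (pr v (D ψ))) (D ψ)|) := by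
      rw [h5]
      refine (abs_add_le _ _).trans ?_
      rw [abs_mul, abs_of_pos hβμ]
      gcongr
      exact abs_add_le _ _
    have h9 : β * μ * |inner ℝ (A (pr v (D ψ))) (D ψ)| ≤ β * μ * (3 * α * ‖D ψ‖ ^ 2 / 2) :=
      mul_le_mul_of_nonneg_left (by linarith) hβμ.le
    have h10 := mul_le_mul_of_nonneg_left h6 hβμ.le
    have h11 : (3 / 2 + (1 + B) / 4) * α * E₁ ^ 2 =
        3 / 2 * α * (‖ψ‖ ^ 2 + β * μ * ‖D ψ‖ ^ 2) + (1 + B) / 4 * α * E₁ ^ 2 := by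
      rw [← hE₁sq]; ring
    rw [h11]
    rw [mul_add] at h8
    linarith
  -- transport of `w`
  have t2 : |inner ℝ (A (pr v w)) (Ti w)| ≤ 3 / 2 * α * E₂ ^ 2 := by
    have h1 := abs_inner_skew_pr_le hDcs hvW (norm_Dop_commutator_le hn hα hvα hwW)
    -- Since `𝒯_μ⁻¹ A = ∂ₓ`, this is an ordinary transport term and only the commutator of `∂ₓ` with
    -- `v` remains.
    have h2 : inner ℝ (A (pr v w)) (Ti w) = inner ℝ (Dop n (pr v w)) w := by
      rw [hTi, ← inner_Rm (evenS_tau hμ), hA, hR, tau_Aop hμ]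
    rw [h2]
    have : α * ‖w‖ ^ 2 ≤ α * E₂ ^ 2 := by gcongr
    linarith
  -- Moving `A` across and commuting it with `v` and `ζ` reproduces the term `⟨Aw, vζw⟩` with the
  -- opposite sign. That term therefore equals minus half of the commutator terms, each bounded by
  -- `3α²‖w‖²`.
  have t3 : |inner ℝ (A (pr v w)) (pr ζ w)| ≤ 6 * α ^ 2 * E₂ ^ 2 := by
    set c := A (pr v w) - pr v (A w) with hc
    set c' := A (pr v (pr ζ w)) - pr v (A (pr ζ w)) with hc'
    set c'' := A (pr ζ w) - pr ζ (A w) with hc''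
    have n0 : ‖pr ζ w‖ ≤ α * ‖w‖ := norm_pr_le_of_jb hα hζα w
    have n1 : ‖c‖ ≤ 3 * α * ‖w‖ := norm_Aop_commutator_le hμ hn hα hvα hwW
    have n2 : ‖c'‖ ≤ 3 * α * (α * ‖w‖) :=
      (norm_Aop_commutator_le hμ hn hα hvα (hζW.pr hwW)).trans (by gcongr)
    have n3 : ‖c''‖ ≤ 3 * α * ‖w‖ := norm_Aop_commutator_le hμ hn hα hζα hwW
    have n4 : ‖pr v c''‖ ≤ α * (3 * α * ‖w‖) :=
      (norm_pr_le_of_jb hα hvα c'').trans (by gcongr)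
    have e1 : inner ℝ (A (pr v w)) (pr ζ w)
        = inner ℝ (A w) (pr v (pr ζ w)) + inner ℝ c (pr ζ w) := by
      rw [hc, inner_sub_left, inner_pr_left hvW]; ring
    have e2 : A (pr v (pr ζ w)) = pr v (pr ζ (A w)) + pr v c'' + c' := by
      rw [hc', ← pr_add hvW, hc'']; simp
    have e3 : inner ℝ (A w) (pr v (pr ζ w))
        = -(inner ℝ w (pr v (pr ζ (A w))) + inner ℝ w (pr v c'') + inner ℝ w c') := by
      rw [hAs, e2, inner_add_right, inner_add_right]
    have e4 : inner ℝ w (pr v (pr ζ (A w))) = inner ℝ (A w) (pr v (pr ζ w)) := by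
      rw [← inner_pr_left hvW, ← inner_pr_left hζW, real_inner_comm, pr_left_comm hζW hvW]
    have b1 := (abs_real_inner_le_norm c (pr ζ w)).trans
      (mul_le_mul n1 n0 (norm_nonneg _) (by positivity))
    have b2 := (abs_real_inner_le_norm w (pr v c'')).trans
      (mul_le_mul_of_nonneg_left n4 (norm_nonneg _))
    have b3 := (abs_real_inner_le_norm w c').trans
      (mul_le_mul_of_nonneg_left n2 (norm_nonneg _))
    have e5 : inner ℝ (A (pr v w)) (pr ζ w) = -(inner ℝ w (pr v c'') + inner ℝ w c') / 2
        + inner ℝ c (pr ζ w) := by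
      rw [e1]; rw [e4] at e3; linarith
    have b4 : |inner ℝ (A (pr v w)) (pr ζ w)| ≤ 6 * α ^ 2 * ‖w‖ ^ 2 := by
      rw [e5, abs_le]
      rw [abs_le] at b1 b2 b3
      constructor <;> linarith
    refine b4.trans ?_
    gcongr
  -- forcing
  have f1 : inner ℝ f (La ψ) ≤ r * E₁ := by
    rw [hLa, inner_Rm_eq_sqrt (evenS_lam β μ) hlam0]
    exact (real_inner_le_norm _ _).trans (mul_le_mul_of_nonneg_right hf hE₁0)
  have f2 : inner ℝ g (Ti w + pr ζ w) ≤ (1 + α) * (r * E₂) := by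
    rw [inner_add_right, hTi, inner_Rm_eq_sqrt (evenS_tau hμ) htau0]
    have h1 := (real_inner_le_norm (Rm R (fun ξ => √(tau μ ξ)) g)
      (Rm R (fun ξ => √(tau μ ξ)) w)).trans (mul_le_mul_of_nonneg_right hgr hE₂0)
    have h2 := (real_inner_le_norm g (pr ζ w)).trans
      (mul_le_mul hgE ((norm_pr_le_of_jb hα hζα w).trans
        (mul_le_mul_of_nonneg_left hwE hα)) (norm_nonneg _) hr)
    linarith
  have hEe₁ : E₁ ≤ √e := Real.le_sqrt_of_sq_le (by rw [he]; nlinarith)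
  have hEe₂ : E₂ ≤ √e := Real.le_sqrt_of_sq_le (by rw [he]; nlinarith)
  have s1 : inner ℝ dψ (La ψ) = inner ℝ (A (La ψ)) (Ti w) + inner ℝ (A (La ψ)) (pr ζ w)
      - inner ℝ (A (pr v ψ)) (La ψ) + inner ℝ f (La ψ) := by
    rw [hdψ, inner_add_left, inner_neg_left, inner_add_left, inner_add_left, c1, c2]; ring
  have s2 : inner ℝ dw (Ti w + pr ζ w) = -inner ℝ (A (La ψ)) (Ti w)
      - inner ℝ (A (La ψ)) (pr ζ w) - inner ℝ (A (pr v w)) (Ti w)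
      - inner ℝ (A (pr v w)) (pr ζ w) + inner ℝ g (Ti w + pr ζ w) := by
    rw [hdw, inner_add_left, inner_neg_left, inner_add_left]
    simp only [inner_add_right]; ring
  have u1 := (abs_le.1 t1).1
  have u2 := (abs_le.1 t2).1
  have u3 := (abs_le.1 t3).1
  -- The constant `12` is dictated by `2 · 6α²E₂²`; the terms linear in `α` fit below it.
  have k1 : 2 * ((3 / 2 + (1 + B) / 4) * α * E₁ ^ 2) + 2 * (3 / 2 * α * E₂ ^ 2)
      + 2 * (6 * α ^ 2 * E₂ ^ 2) ≤ (12 + B) * (1 + α) * α * e := by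
    rw [he]
    have p1 : 0 ≤ α * E₁ ^ 2 := by positivity
    have p2 : 0 ≤ α * E₂ ^ 2 := by positivity
    have p3 : 0 ≤ α ^ 2 * E₁ ^ 2 := by positivity
    have p4 : 0 ≤ α ^ 2 * E₂ ^ 2 := by positivity
    linarith [mul_nonneg hB0.le p1, mul_nonneg hB0.le p2, mul_nonneg hB0.le p3,
      mul_nonneg hB0.le p4]
  have k2 : 2 * (r * E₁) + 2 * ((1 + α) * (r * E₂)) ≤ 4 * (1 + α) * r * √e := by
    have q1 : r * E₁ ≤ r * √e := by gcongr
    have q2 : r * E₂ ≤ r * √e := by gcongr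
    have q3 : 0 ≤ r * √e := by positivity
    linarith [mul_le_mul_of_nonneg_left q2 (by positivity : 0 ≤ 1 + α), mul_nonneg hα q3]
  rw [s1, s2]
  linarith

end Energy

/-! ### Admissible weights -/

/-- Weights for which the bilinear remainder estimate holds with constant `C`. -/
structure Adm (m : ℝ → ℝ) (C : ℝ) : Prop where
  even : EvenS m
  pos : ∀ ξ, 0 < m ξ
  const_nonneg : 0 ≤ C
  -- The left side is the symbol of `∂ₓ(J(fg) - fJg - gJf)`. On the right each term puts the weight
  -- `m` on one factor and a single derivative on the other.
  est : ∀ ξ η, |ξ| * |m ξ - m η - m (ξ - η)| ≤ C * (jb (ξ - η) * m η + jb η * m (ξ - η))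

theorem jb_le_jb {ξ η : ℝ} (h : |ξ| ≤ |η|) : jb ξ ≤ jb η := by
  unfold jb
  have := sq_le_sq.2 h
  exact Real.sqrt_le_sqrt (by linarith)

theorem jb_sq (ξ : ℝ) : jb ξ ^ 2 = 1 + ξ ^ 2 := Real.sq_sqrt (by positivity)

theorem abs_jb_sub_le (ξ η : ℝ) : |jb ξ - jb η| ≤ |ξ - η| := by
  have h1 := jb_sq ξ
  have h2 := jb_sq η
  have h3 := jb_pos ξ
  have h4 := jb_pos η
  have h5 : (jb ξ - jb η) * (jb ξ + jb η) = (ξ - η) * (ξ + η) := by nlinarith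
  have h6 : |ξ + η| ≤ jb ξ + jb η :=
    (abs_add_le _ _).trans (add_le_add (abs_le_jb _) (abs_le_jb _))
  have h7 : |jb ξ - jb η| * (jb ξ + jb η) = |ξ - η| * |ξ + η| := by
    rw [← abs_mul, ← h5, abs_mul, abs_of_pos (add_pos h3 h4)]
  by_contra h
  push Not at h
  have h8 : |ξ - η| * |ξ + η| ≤ |ξ - η| * (jb ξ + jb η) :=
    mul_le_mul_of_nonneg_left h6 (abs_nonneg _)
  nlinarith [add_pos h3 h4]

/-- Bernoulli's inequality for `1/r`; the bound `r ≤ 2` controls the factor `r ^ p` that appears. -/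
theorem pow_sub_one_le {p : ℕ} {r : ℝ} (h1 : 1 ≤ r) (h2 : r ≤ 2) :
    r ^ p - 1 ≤ p * 2 ^ p * (r - 1) := by
  have hr : 0 < r := by linarith
  have hb := one_add_mul_le_pow (a := r⁻¹ - 1) (by linarith [inv_pos.2 hr]) p
  have e1 : (1 + (r⁻¹ - 1)) ^ p = (r ^ p)⁻¹ := by rw [add_sub_cancel, inv_pow]
  rw [e1] at hb
  have hrp : 0 < r ^ p := by positivity
  have hrp2 : r ^ p ≤ 2 ^ p := pow_le_pow_left₀ hr.le h2 p
  have h3 : r ^ p * (1 + p * (r⁻¹ - 1)) ≤ 1 := by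
    have := mul_le_mul_of_nonneg_left hb hrp.le
    rwa [mul_inv_cancel₀ hrp.ne'] at this
  have h4 : 1 - r⁻¹ ≤ r - 1 := by
    have : r * r⁻¹ = 1 := mul_inv_cancel₀ hr.ne'
    have h5 : r⁻¹ ≤ 1 := inv_le_one_of_one_le₀ h1
    nlinarith
  have h5 : 0 ≤ 1 - r⁻¹ := by linarith [inv_le_one_of_one_le₀ h1]
  calc r ^ p - 1 ≤ r ^ p * (p * (1 - r⁻¹)) := by linarith
    _ ≤ 2 ^ p * (p * (r - 1)) := by gcongr
    _ = _ := by ring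

/-- A criterion for admissibility: `m` grows at least like `⟨ξ⟩` and at most like `⟨ξ⟩^p`,
locally in scale. -/
theorem adm_of_growth {m : ℝ → ℝ} {p : ℕ} (he : EvenS m) (hpos : ∀ ξ, 0 < m ξ)
    (hlow : ∀ ξ η, |η| ≤ |ξ| → m η * jb ξ ≤ m ξ * jb η)
    (hup : ∀ ξ η, |η| ≤ |ξ| → m ξ * jb η ^ p ≤ m η * jb ξ ^ p) :
    Adm m (2 * (p * 2 ^ p + 1)) := by
  -- For `|ξ - η| ≤ |η|` the ratio `⟨ξ⟩/⟨η⟩` is at most `2` and differs from `1` by at most `⟨ξ -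
  -- η⟩/⟨η⟩`. Monotonicity and polynomial growth turn this into a relative Lipschitz bound for `m`.
  have hlip : ∀ ξ η, |ξ - η| ≤ |η| → jb η * |m ξ - m η| ≤ p * 2 ^ p * (jb (ξ - η) * m η) := by
    intro ξ η h
    have hη := jb_pos η
    have hξ := jb_pos ξ
    have hd := abs_jb_sub_le ξ η
    have hd2 := abs_le_jb (ξ - η)
    have h2p : (1 : ℝ) ≤ 2 ^ p := one_le_pow₀ (by norm_num)
    have hp0 : (0 : ℝ) ≤ p := Nat.cast_nonneg p
    rcases le_total |η| |ξ| with hc | hc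
    · have hmono : m η ≤ m ξ := by
        have h1 := hlow ξ η hc
        have h2 := jb_le_jb hc
        have h3 := mul_le_mul_of_nonneg_left h2 (hpos η).le
        exact le_of_mul_le_mul_right (h3.trans h1) hη
      set r := jb ξ / jb η with hr
      have hr1 : 1 ≤ r := (one_le_div hη).2 (jb_le_jb hc)
      have hr2 : r ≤ 2 := by
        rw [hr, div_le_iff₀ hη]
        have := (abs_le.1 hd).2
        have h3 : jb (ξ - η) ≤ jb η := jb_le_jb h
        have h4 := abs_le_jb (ξ - η)
        linarith
      have h1 : m ξ ≤ m η * r ^ p := by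
        rw [hr, div_pow, mul_div_assoc', le_div_iff₀ (by positivity)]
        exact hup ξ η hc
      rw [abs_of_nonneg (by linarith)]
      have h2 := pow_sub_one_le (p := p) hr1 hr2
      have h3 : jb η * (r - 1) ≤ jb (ξ - η) := by
        have e : jb η * r = jb ξ := mul_div_cancel₀ _ hη.ne'
        have := (abs_le.1 hd).2
        linarith
      calc jb η * (m ξ - m η) ≤ jb η * (m η * (r ^ p - 1)) := by gcongr; linarith
        _ ≤ jb η * (m η * (p * 2 ^ p * (r - 1))) := by gcongr; exact (hpos η).le
        _ = p * 2 ^ p * ((jb η * (r - 1)) * m η) := by ring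
        _ ≤ _ := by gcongr; exact (hpos η).le
    · have hmono : m ξ ≤ m η := by
        have h1 := hlow η ξ hc
        have h2 := jb_le_jb hc
        have h3 := mul_le_mul_of_nonneg_left h2 (hpos ξ).le
        exact le_of_mul_le_mul_right (h3.trans h1) hξ
      set t := jb ξ / jb η with ht
      have ht0 : 0 < t := by positivity
      have h1 : m η * t ^ p ≤ m ξ := by
        rw [ht, div_pow, mul_div_assoc', div_le_iff₀ (by positivity)]
        exact hup η ξ hc
      have hb := one_add_mul_le_pow (a := t - 1) (by linarith) p
      rw [add_sub_cancel] at hb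
      have h3 : jb η * (1 - t) ≤ jb (ξ - η) := by
        have e : jb η * t = jb ξ := mul_div_cancel₀ _ hη.ne'
        have := (abs_le.1 hd).1
        linarith
      rw [abs_sub_comm, abs_of_nonneg (by linarith)]
      have hmη := (hpos η).le
      calc jb η * (m η - m ξ) ≤ jb η * (m η * (1 - t ^ p)) := by gcongr; linarith
        _ ≤ jb η * (m η * (p * (1 - t))) := by gcongr; linarith
        _ = p * ((jb η * (1 - t)) * m η) := by ring
        _ ≤ p * (jb (ξ - η) * m η) := by gcongr
        _ ≤ p * 2 ^ p * (jb (ξ - η) * m η) := by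
          have : 0 ≤ jb (ξ - η) * m η := mul_nonneg (jb_pos _).le hmη
          gcongr
          nlinarith
  -- The interaction in which `η` is the higher input frequency. The leftover term `m(ξ - η)⟨η⟩` is
  -- absorbed because `m/⟨·⟩` is nondecreasing.
  have key : ∀ ξ η, |ξ - η| ≤ |η| → |ξ| * |m ξ - m η - m (ξ - η)|
      ≤ 2 * (p * 2 ^ p + 1) * (jb (ξ - η) * m η) := by
    intro ξ η h
    have h1 := hlip ξ η h
    have h2 : m (ξ - η) * jb η ≤ m η * jb (ξ - η) := hlow η (ξ - η) h
    have h3 : |ξ| ≤ 2 * jb η := by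
      have := abs_add_le (ξ - η) η
      rw [sub_add_cancel] at this
      linarith [abs_le_jb η]
    have h4 : |m ξ - m η - m (ξ - η)| ≤ |m ξ - m η| + m (ξ - η) := by
      have := abs_sub (m ξ - m η) (m (ξ - η))
      rwa [abs_of_pos (hpos (ξ - η))] at this
    calc |ξ| * |m ξ - m η - m (ξ - η)| ≤ 2 * jb η * (|m ξ - m η| + m (ξ - η)) :=
          mul_le_mul h3 h4 (abs_nonneg _) (by have := jb_pos η; positivity)
      _ = 2 * (jb η * |m ξ - m η| + m (ξ - η) * jb η) := by ring
      _ ≤ 2 * (p * 2 ^ p * (jb (ξ - η) * m η) + m η * jb (ξ - η)) := by gcongr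
      _ = _ := by ring
  refine ⟨he, hpos, by positivity, fun ξ η => ?_⟩
  have hp1 : 0 ≤ jb (ξ - η) * m η := mul_nonneg (jb_pos _).le (hpos _).le
  have hp2 : 0 ≤ jb η * m (ξ - η) := mul_nonneg (jb_pos _).le (hpos _).le
  have hC : (0 : ℝ) ≤ 2 * (p * 2 ^ p + 1) := by positivity
  -- The other interaction follows from the symmetry `η ↔ ξ - η`.
  rcases le_total |ξ - η| |η| with h | h
  · refine (key ξ η h).trans (mul_le_mul_of_nonneg_left (by linarith) hC)
  · have h1 := key ξ (ξ - η) (by rwa [sub_sub_cancel])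
    rw [sub_sub_cancel] at h1
    have e : m ξ - m η - m (ξ - η) = m ξ - m (ξ - η) - m η := by ring
    rw [e]
    exact h1.trans (mul_le_mul_of_nonneg_left (by linarith) hC)

/-- The Sobolev weight `⟨ξ⟩^s`, increased by a factor up to `L` at frequencies beyond `ρ`. -/
def wt (s ρ L ξ : ℝ) : ℝ := jb ξ ^ s * max 1 (min L (jb ξ / ρ))

theorem evenS_jb_rpow (s : ℝ) : EvenS (fun ξ => jb ξ ^ s) :=
  ⟨evenS_jb.cont.rpow_const fun ξ => Or.inl (jb_pos ξ).ne', fun ξ => by simp only [evenS_jb.even]⟩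

theorem evenS_wt (s ρ L : ℝ) : EvenS (wt s ρ L) := by
  refine (evenS_jb_rpow s).mul ⟨?_, fun ξ => by simp only [evenS_jb.even]⟩
  exact continuous_const.max (continuous_const.min (evenS_jb.cont.div_const ρ))

theorem jb_rpow_le_wt (s ρ L ξ : ℝ) : jb ξ ^ s ≤ wt s ρ L ξ :=
  le_mul_of_one_le_right (Real.rpow_nonneg (jb_pos ξ).le s) (le_max_left _ _)

theorem wt_pos (s ρ L ξ : ℝ) : 0 < wt s ρ L ξ :=
  (Real.rpow_pos_of_pos (jb_pos ξ) s).trans_le (jb_rpow_le_wt s ρ L ξ)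

theorem wt_one (s : ℝ) : wt s 1 1 = fun ξ => jb ξ ^ s := by
  ext ξ
  simp [wt]

theorem wt_le {s ρ L : ℝ} (hL : 1 ≤ L) (ξ : ℝ) : wt s ρ L ξ ≤ L * jb ξ ^ s := by
  rw [wt, mul_comm]
  exact mul_le_mul_of_nonneg_right (max_le hL (min_le_left _ _))
    (Real.rpow_nonneg (jb_pos ξ).le s)

theorem wt_eq_of_le {s ρ L ξ : ℝ} (hρ : 0 < ρ) (h : jb ξ ≤ ρ) : wt s ρ L ξ = jb ξ ^ s := by
  rw [wt, max_eq_left, mul_one]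
  exact (min_le_right _ _).trans ((div_le_one hρ).2 h)

theorem le_wt_of_le {s ρ L ξ : ℝ} (hρ : 0 < ρ) (h : L * ρ ≤ jb ξ) :
    L * jb ξ ^ s ≤ wt s ρ L ξ := by
  rw [wt, mul_comm]
  refine mul_le_mul_of_nonneg_left ?_ (Real.rpow_nonneg (jb_pos ξ).le s)
  rw [min_eq_left ((le_div_iff₀ hρ).2 h)]
  exact le_max_right _ _

/-- The amplifying factor is nondecreasing in `⟨ξ⟩` and grows at most linearly, whatever `ρ` and `L`
are. The growth criterion therefore holds with one exponent `p ≥ s + 1`, and the constant does not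
see `ρ` or `L`. This uniformity is what propagates high-frequency tails. -/
theorem adm_wt {s : ℝ} (hs : 1 ≤ s) : ∃ C : ℝ, ∀ ρ L : ℝ, 0 < ρ → 1 ≤ L → Adm (wt s ρ L) C := by
  obtain ⟨p, hp⟩ := exists_nat_ge (s + 1)
  refine ⟨_, fun ρ L hρ hL => adm_of_growth (p := p) (evenS_wt s ρ L) (wt_pos s ρ L) ?_ ?_⟩
  · intro ξ η h
    have h1 := jb_le_jb h
    have hη := jb_pos η
    have hξ := jb_pos ξ
    have e : ∀ x, jb x ^ s = jb x ^ (s - 1) * jb x := fun x => by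
      rw [← Real.rpow_add_one (jb_pos x).ne', sub_add_cancel]
    have h2 : jb η ^ (s - 1) ≤ jb ξ ^ (s - 1) := Real.rpow_le_rpow hη.le h1 (by linarith)
    have h3 : max 1 (min L (jb η / ρ)) ≤ max 1 (min L (jb ξ / ρ)) := by gcongr
    unfold wt
    rw [e η, e ξ]
    have h4 : jb η ^ (s - 1) * max 1 (min L (jb η / ρ)) ≤
        jb ξ ^ (s - 1) * max 1 (min L (jb ξ / ρ)) :=
      mul_le_mul h2 h3 (le_trans zero_le_one (le_max_left _ _))
        (Real.rpow_nonneg hξ.le _)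
    have h5 := mul_le_mul_of_nonneg_right h4 (mul_pos hη hξ).le
    linarith
  · intro ξ η h
    have hη := jb_pos η
    have hξ := jb_pos ξ
    set r := jb ξ / jb η with hr
    have hr1 : 1 ≤ r := (one_le_div hη).2 (jb_le_jb h)
    have hr0 : 0 < r := by linarith
    have e : jb ξ = r * jb η := (div_mul_cancel₀ _ hη.ne').symm
    have h1 : jb ξ ^ s = r ^ s * jb η ^ s := by
      rw [e, Real.mul_rpow hr0.le hη.le]
    have h2 : max 1 (min L (jb ξ / ρ)) ≤ r * max 1 (min L (jb η / ρ)) := by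
      have h5 : 1 ≤ max 1 (min L (jb η / ρ)) := le_max_left _ _
      apply max_le
      · nlinarith
      · rcases le_total L (jb η / ρ) with h6 | h6
        · rw [min_eq_left h6, max_eq_right hL]
          exact (min_le_left _ _).trans (by nlinarith)
        · refine (min_le_right _ _).trans ?_
          rw [e, mul_div_assoc, min_eq_right h6]
          exact mul_le_mul_of_nonneg_left (le_max_right _ _) hr0.le
    have h3 : r ^ s * r ≤ r ^ p := by
      rw [← Real.rpow_add_one hr0.ne', ← Real.rpow_natCast]
      exact Real.rpow_le_rpow_of_exponent_le hr1 hp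
    have h4 : jb ξ ^ p = r ^ p * jb η ^ p := by rw [e, mul_pow]
    unfold wt
    rw [h1, h4]
    have h7 := Real.rpow_nonneg hη.le s
    have h8 : 0 ≤ max 1 (min L (jb η / ρ)) := le_trans zero_le_one (le_max_left _ _)
    calc r ^ s * jb η ^ s * max 1 (min L (jb ξ / ρ)) * jb η ^ p
        ≤ r ^ s * jb η ^ s * (r * max 1 (min L (jb η / ρ))) * jb η ^ p := by gcongr
      _ = jb η ^ s * max 1 (min L (jb η / ρ)) * ((r ^ s * r) * jb η ^ p) := by ring
      _ ≤ jb η ^ s * max 1 (min L (jb η / ρ)) * (r ^ p * jb η ^ p) := by gcongr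

/-! ### Bilinear estimates -/

theorem Band.eq_mult {R : ℝ} {f : RealL2} (hf : Band R f) :
    mult (fun ξ => (cut R (fun _ => 1) ξ : ℂ)) f = f := hf

/-- The remainder `J(fg) - f Jg - g Jf`, for the multiplier `J` with symbol `m`. -/
def rem (R : ℝ) (m : ℝ → ℝ) (f g : RealL2) : RealL2 :=
  Rm R m (pr f g) - pr f (Rm R m g) - pr g (Rm R m f)

theorem hat_rem {R : ℝ} {m : ℝ → ℝ} (hm : EvenS m) {f g : RealL2} (hf : Band R f)
    (hg : Band R g) : ∀ᵐ k : ℝ, hat (rem R m f g) k = ∫ l : ℝ,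
      (((cut R m (2 * Real.pi * k) - m (2 * Real.pi * l) - m (2 * Real.pi * (k - l)))
        * (cut R (fun _ => 1) (2 * Real.pi * (k - l)) * cut R (fun _ => 1) (2 * Real.pi * l)) : ℝ)
          : ℂ) * (hat f (k - l) * hat g l) := by
  have hP := (evenS_const 1).good R
  have hM := hm.good R
  have h1 := hat_pr_mult hP hP (f := f) (g := g) (by rw [hf.eq_mult]; exact hf.wiener)
    (by rw [hg.eq_mult]; exact hg.wiener)
  have h2 := hat_pr_mult hP hM (f := f) (g := g) (by rw [hf.eq_mult]; exact hf.wiener)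
    (band_Rm hm R g).wiener
  have h3 := hat_pr_mult hM hP (f := f) (g := g) (band_Rm hm R f).wiener
    (by rw [hg.eq_mult]; exact hg.wiener)
  rw [hf.eq_mult, hg.eq_mult] at h1
  rw [hf.eq_mult] at h2
  rw [hg.eq_mult, pr_comm] at h3
  unfold rem
  rw [hat_sub, hat_sub]
  filter_upwards [h1, h2, h3, hat_Rm hm R (pr f g),
    Lp.coeFn_sub (hat (Rm R m (pr f g)) - hat (pr f (Rm R m g))) (hat (pr g (Rm R m f))),
    Lp.coeFn_sub (hat (Rm R m (pr f g))) (hat (pr f (Rm R m g)))] with k h1 h2 h3 h4 h5 h6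
  have h2' : hat (pr f (Rm R m g)) k = _ := h2
  have h3' : hat (pr g (Rm R m f)) k = _ := h3
  rw [h5, Pi.sub_apply, h6, Pi.sub_apply, h4, h1, h2', h3', ← integral_const_mul,
    ← integral_sub, ← integral_sub]
  · congr 1
    ext l
    have e1 : ∀ ξ, cut R m ξ = m ξ * cut R (fun _ => 1) ξ := fun ξ => by
      unfold cut; split_ifs <;> simp
    rw [e1 (2 * Real.pi * l), e1 (2 * Real.pi * (k - l))]
    push_cast; ring
  · exact ((integrable_mult_conv hP hP f g k).const_mul _).sub (integrable_mult_conv hP hM f g k)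
  · exact integrable_mult_conv hM hP f g k
  · exact (integrable_mult_conv hP hP f g k).const_mul _
  · exact integrable_mult_conv hP hM f g k

/-- The bilinear estimate for the symbol bounded in `Adm.est`; the frequency cutoffs can only
decrease it. -/
theorem enorm_derivative_rem_le {R : ℝ} {m : ℝ → ℝ} {C : ℝ} (hm : Adm m C) {f g : RealL2}
    (hf : Band R f) (hg : Band R g) :
    ‖Sm R (fun ξ => ξ) (rem R m f g)‖ₑ
      ≤ ENNReal.ofReal C * (aN jb f * wN m g + wN m f * aN jb g) := by
  have hmm := hm.even.cont.measurable
  have hjm := evenS_jb.cont.measurable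
  have hC := hm.const_nonneg
  rw [← wN_one]
  refine (wN_le_of_conv (w := fun _ => 1) (q := Sm R (fun ξ => ξ) (rem R m f g)) (f := f)
    (g := g) (σ := fun k l => Complex.I * (cut R (fun ξ => ξ) (2 * Real.pi * k) : ℂ) *
      (((cut R m (2 * Real.pi * k) - m (2 * Real.pi * l) - m (2 * Real.pi * (k - l)))
        * (cut R (fun _ => 1) (2 * Real.pi * (k - l)) * cut R (fun _ => 1) (2 * Real.pi * l)) : ℝ)
          : ℂ)) (w₁ := fun ξ => C * jb ξ) (w₂ := m) (w₃ := fun ξ => C * m ξ) (w₄ := jb)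
    (measurable_const.mul hjm) hmm (measurable_const.mul hmm) hjm ?_ ?_).trans ?_
  · filter_upwards [hat_rem hm.even hf hg, hat_Sm oddS_id R (rem R m f g)] with k h1 h2
    rw [h2, h1, ← integral_const_mul, Complex.ofReal_one, one_mul]
    congr 1; ext l; ring
  · intro k l
    rw [norm_mul, norm_mul, Complex.norm_I, one_mul, Complex.norm_real, Complex.norm_real,
      Real.norm_eq_abs, Real.norm_eq_abs]
    simp only [abs_mul, abs_of_nonneg hC, abs_of_pos (jb_pos _), abs_of_pos (hm.pos _)]
    have hrhs : 0 ≤ C * jb (2 * Real.pi * (k - l)) * m (2 * Real.pi * l) +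
        C * m (2 * Real.pi * (k - l)) * jb (2 * Real.pi * l) := by
      have := (jb_pos (2 * Real.pi * (k - l))).le
      have := (jb_pos (2 * Real.pi * l)).le
      have := (hm.pos (2 * Real.pi * (k - l))).le
      have := (hm.pos (2 * Real.pi * l)).le
      positivity
    by_cases h : |2 * Real.pi * k| ≤ R
    · have e := hm.est (2 * Real.pi * k) (2 * Real.pi * l)
      rw [show 2 * Real.pi * k - 2 * Real.pi * l = 2 * Real.pi * (k - l) by ring] at e
      have c1 : ∀ ξ, |cut R (fun _ => (1 : ℝ)) ξ| ≤ 1 := fun ξ =>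
        (abs_cut_le R _ ξ).trans (by simp)
      have c2 : |cut R (fun _ => (1 : ℝ)) (2 * Real.pi * (k - l))| *
          |cut R (fun _ => (1 : ℝ)) (2 * Real.pi * l)| ≤ 1 :=
        mul_le_one₀ (c1 _) (abs_nonneg _) (c1 _)
      simp only [cut, if_pos h] at c2 ⊢
      rw [← mul_assoc]
      refine (mul_le_of_le_one_right (by positivity) c2).trans (e.trans (le_of_eq ?_))
      ring
    · have : cut R (fun ξ => ξ) (2 * Real.pi * k) = 0 := if_neg h
      rw [this, abs_zero, zero_mul]
      exact hrhs
  · have h1 := aN_mono (w := fun ξ => C * jb ξ) (w' := jb) (c := C)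
      (fun ξ => by rw [abs_mul, abs_of_nonneg hC]) f
    have h2 := wN_mono (w := fun ξ => C * m ξ) (w' := m) (c := C)
      (fun ξ => by rw [abs_mul, abs_of_nonneg hC]) f
    calc _ ≤ ENNReal.ofReal C * aN jb f * wN m g + ENNReal.ofReal C * wN m f * aN jb g := by
          gcongr
      _ = _ := by ring

theorem norm_derivative_rem_le {R : ℝ} {m : ℝ → ℝ} {C : ℝ} (hm : Adm m C) {f g : RealL2}
    (hf : Band R f) (hg : Band R g) {α : ℝ} (hα : 0 ≤ α) (hfα : aN jb f ≤ ENNReal.ofReal α)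
    (hgα : aN jb g ≤ ENNReal.ofReal α) :
    ‖Sm R (fun ξ => ξ) (rem R m f g)‖ ≤ C * α * (‖Rm R m f‖ + ‖Rm R m g‖) := by
  have hC := hm.const_nonneg
  apply norm_le_of_enorm_le (by positivity)
  refine (enorm_derivative_rem_le hm hf hg).trans ?_
  rw [← wN_eq_of_band hf, ← wN_eq_of_band hg, ← enorm_Rm hm.even, ← enorm_Rm hm.even,
    ← ofReal_norm, ← ofReal_norm, mul_assoc, ENNReal.ofReal_mul hC]
  gcongr
  rw [mul_add, ENNReal.ofReal_add (by positivity) (by positivity), ENNReal.ofReal_mul hα,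
    ENNReal.ofReal_mul hα, add_comm, mul_comm (ENNReal.ofReal ‖Rm R m f‖)]
  gcongr

/-- The derivative of a product in `L²`. -/
theorem norm_derivative_pr_le {R : ℝ} {f g : RealL2} {α : ℝ} (hα : 0 ≤ α)
    (hfα : aN jb f ≤ ENNReal.ofReal α) (hgα : aN jb g ≤ ENNReal.ofReal α) :
    ‖Sm R (fun ξ => ξ) (pr f g)‖ ≤ α * (‖f‖ + ‖g‖) := by
  have hjm := evenS_jb.cont.measurable
  apply norm_le_of_enorm_le (by positivity)
  rw [← wN_one]
  refine (wN_le_of_conv (w := fun _ => 1) (q := Sm R (fun ξ => ξ) (pr f g)) (f := f)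
    (g := g) (σ := fun k l => Complex.I * (cut R (fun ξ => ξ) (2 * Real.pi * k) : ℂ))
    (w₁ := jb) (w₂ := fun _ => 1) (w₃ := fun _ => 1) (w₄ := jb)
    hjm measurable_const measurable_const hjm ?_ ?_).trans ?_
  · filter_upwards [hat_pr (Wiener.of_jb hfα) (Wiener.of_jb hgα), hat_Sm oddS_id R (pr f g)]
      with k h1 h2
    rw [h2, h1, ← integral_const_mul, Complex.ofReal_one, one_mul]
  · intro k l
    rw [norm_mul, Complex.norm_I, one_mul, Complex.norm_real, Real.norm_eq_abs]
    refine (abs_cut_le _ _ _).trans ?_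
    rw [abs_one, mul_one, one_mul, abs_of_pos (jb_pos _), abs_of_pos (jb_pos _)]
    have e : 2 * Real.pi * k = 2 * Real.pi * (k - l) + 2 * Real.pi * l := by ring
    rw [e]
    exact (abs_add_le _ _).trans (add_le_add (abs_le_jb _) (abs_le_jb _))
  · rw [wN_one, wN_one, mul_add, ENNReal.ofReal_add (by positivity) (by positivity),
      ENNReal.ofReal_mul hα, ENNReal.ofReal_mul hα, ofReal_norm, ofReal_norm, add_comm,
      mul_comm ‖f‖ₑ]
    gcongr

/-- `|aS| ≤ |ξ| ≤ ⟨ξ - η⟩ + ⟨η⟩`. This controls the quadratic part of `∂ₜζ` pointwise, as needed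
when the energy is differentiated and when non-cavitation is propagated. -/
theorem aN_Aop_pr_le {μ n : ℝ} (hμ : 0 < μ) {f g : RealL2} {α : ℝ} (hα : 0 ≤ α)
    (hfα : aN jb f ≤ ENNReal.ofReal α) (hgα : aN jb g ≤ ENNReal.ofReal α) :
    aN (fun _ => 1) (Aop μ n (pr f g)) ≤ ENNReal.ofReal (2 * α ^ 2) := by
  have hjm := evenS_jb.cont.measurable
  refine (aN_le_of_conv (w := fun _ => 1) (q := Aop μ n (pr f g)) (f := f)
    (g := g) (σ := fun k l => Complex.I *
      (cut (2 * n) (fun ξ => chi n ξ * aS μ ξ) (2 * Real.pi * k) : ℂ))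
    (w₁ := jb) (w₂ := fun _ => 1) (w₃ := fun _ => 1) (w₄ := jb)
    hjm measurable_const measurable_const hjm ?_ ?_).trans ?_
  · filter_upwards [hat_pr (Wiener.of_jb hfα) (Wiener.of_jb hgα),
      hat_Sm (oddS_chi_aS hμ) (2 * n) (pr f g)] with k h1 h2
    rw [Aop, h2, h1, ← integral_const_mul, Complex.ofReal_one, one_mul]
  · intro k l
    rw [norm_mul, Complex.norm_I, one_mul, Complex.norm_real, Real.norm_eq_abs]
    refine (abs_cut_le _ _ _).trans ?_
    rw [abs_one, mul_one, one_mul, abs_of_pos (jb_pos _), abs_of_pos (jb_pos _), abs_mul]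
    have h1 := mul_le_mul (abs_chi_le_one n (2 * Real.pi * k)) (abs_aS_le hμ (2 * Real.pi * k))
      (abs_nonneg _) zero_le_one
    rw [one_mul] at h1
    refine h1.trans ?_
    have e : 2 * Real.pi * k = 2 * Real.pi * (k - l) + 2 * Real.pi * l := by ring
    rw [e]
    exact (abs_add_le _ _).trans (add_le_add (abs_le_jb _) (abs_le_jb _))
  · have h1 := (aN_one_le_jb f).trans hfα
    have h2 := (aN_one_le_jb g).trans hgα
    rw [show 2 * α ^ 2 = α * α + α * α by ring, ENNReal.ofReal_add (by positivity)
      (by positivity), ENNReal.ofReal_mul hα]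
    gcongr

/-! ### The smoothing operator in the energy norm -/

/-- `√Λ |aS| ≤ |aS| + √β|ξ|(√μ|aS|) ≤ (1 + √β)|ξ|`: the smoothing of `𝒯_μ` compensates the weight
`√Λ`, with a constant depending on the bound for `β` only. -/
theorem norm_lam_Aop_le {β μ n B : ℝ} (hβ : 0 < β) (hB : β ≤ B) (hμ : 0 < μ) (q : RealL2) :
    ‖Rm (2 * n) (fun ξ => √(lam β μ ξ)) (Aop μ n q)‖
      ≤ (2 + B) * ‖Sm (2 * n) (fun ξ => ξ) q‖ := by
  have hL := (evenS_lam β μ).sqrt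
  rw [Aop, Rm_Sm hL (oddS_chi_aS hμ), ← norm_hat, ← norm_hat (Sm (2 * n) (fun ξ => ξ) q)]
  apply Lp.norm_le_mul_norm_of_ae_le_mul
  filter_upwards [hat_Sm (hL.mul_odd (oddS_chi_aS hμ)) (2 * n) q, hat_Sm oddS_id (2 * n) q]
    with k h1 h2
  rw [h1, h2, norm_mul, norm_mul, norm_mul, norm_mul, ← mul_assoc]
  refine mul_le_mul_of_nonneg_right ?_ (norm_nonneg _)
  rw [Complex.norm_I, one_mul, one_mul, Complex.norm_real, Complex.norm_real, Real.norm_eq_abs,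
    Real.norm_eq_abs]
  unfold cut
  split_ifs
  · set ξ := 2 * Real.pi * k
    rw [abs_mul, abs_mul, abs_of_nonneg (Real.sqrt_nonneg _)]
    have h1 := sqrt_lam_le hβ hμ ξ
    have h2 := abs_aS_le hμ ξ
    have h3 := sqrt_mul_abs_aS_le hμ ξ
    have h4 := abs_chi_le_one n ξ
    have h5 : √β ≤ 1 + B := by nlinarith [Real.sq_sqrt hβ.le, sq_nonneg (√β - 1)]
    have h6 : √(lam β μ ξ) * |aS μ ξ| ≤ (2 + B) * |ξ| := by
      calc √(lam β μ ξ) * |aS μ ξ| ≤ (1 + √β * √μ * |ξ|) * |aS μ ξ| := by gcongr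
        _ = |aS μ ξ| + √β * |ξ| * (√μ * |aS μ ξ|) := by ring
        _ ≤ |ξ| + √β * |ξ| * 1 := by gcongr
        _ ≤ |ξ| + (1 + B) * |ξ| * 1 := by gcongr
        _ = _ := by ring
    calc √(lam β μ ξ) * (|chi n ξ| * |aS μ ξ|) = |chi n ξ| * (√(lam β μ ξ) * |aS μ ξ|) := by ring
      _ ≤ 1 * ((2 + B) * |ξ|) := by gcongr
      _ = _ := one_mul _
  · simp

/-- `√τ ≤ τ` because `τ ≥ 1`, and `τ · aS = ξ`. -/
theorem norm_tau_Aop_le {μ n : ℝ} (hμ : 0 < μ) (q : RealL2) :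
    ‖Rm (2 * n) (fun ξ => √(tau μ ξ)) (Aop μ n q)‖ ≤ ‖Sm (2 * n) (fun ξ => ξ) q‖ := by
  have hL := (evenS_tau hμ).sqrt
  rw [Aop, Rm_Sm hL (oddS_chi_aS hμ), ← norm_hat, ← norm_hat (Sm (2 * n) (fun ξ => ξ) q)]
  apply Lp.norm_le_norm_of_ae_le
  filter_upwards [hat_Sm (hL.mul_odd (oddS_chi_aS hμ)) (2 * n) q, hat_Sm oddS_id (2 * n) q]
    with k h1 h2
  rw [h1, h2, norm_mul, norm_mul, norm_mul, norm_mul]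
  refine mul_le_mul_of_nonneg_right ?_ (norm_nonneg _)
  rw [Complex.norm_I, one_mul, one_mul, Complex.norm_real, Complex.norm_real, Real.norm_eq_abs,
    Real.norm_eq_abs]
  unfold cut
  split_ifs
  · set ξ := 2 * Real.pi * k
    rw [abs_mul, abs_mul, abs_of_nonneg (Real.sqrt_nonneg _)]
    have h4 := abs_chi_le_one n ξ
    have h5 : √(tau μ ξ) ≤ tau μ ξ := by
      rw [Real.sqrt_le_left (tau_pos hμ ξ).le]
      nlinarith [one_le_tau hμ ξ]
    have h6 : tau μ ξ * |aS μ ξ| = |ξ| := by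
      calc tau μ ξ * |aS μ ξ| = |tau μ ξ * aS μ ξ| := by
            rw [abs_mul, abs_of_pos (tau_pos hμ ξ)]
        _ = |ξ| := by rw [tau_mul_aS hμ]
    calc √(tau μ ξ) * (|chi n ξ| * |aS μ ξ|) = |chi n ξ| * (√(tau μ ξ) * |aS μ ξ|) := by ring
      _ ≤ 1 * (tau μ ξ * |aS μ ξ|) := by gcongr
      _ = _ := by rw [one_mul, h6]
  · simp

/-! ### The regularized vector field -/

/-- The bilinear operator `(f, g) ↦ (P f) g`, with `P` the projection on frequencies `≤ R`. -/
def Pb (R : ℝ) : RealL2 →L[ℝ] RealL2 →L[ℝ] RealL2 :=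
  LinearMap.mkContinuous₂
    (LinearMap.mk₂ ℝ (fun f g => pr (Rm R (fun _ => 1) f) g)
      (fun f f' g => by
        rw [map_add, add_pr (band_Rm (evenS_const 1) R f).wiener
          (band_Rm (evenS_const 1) R f').wiener])
      (fun c f g => by rw [map_smul, smul_pr (band_Rm (evenS_const 1) R f).wiener])
      (fun f g g' => by rw [pr_add (band_Rm (evenS_const 1) R f).wiener])
      (fun c f g => by rw [pr_smul (band_Rm (evenS_const 1) R f).wiener]))
    ((aN_le_of_band (w := fun _ => 1) continuous_const R).choose * ‖Rm R (fun _ => 1)‖)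
    (fun f g => by
      obtain ⟨h0, h1⟩ := (aN_le_of_band (w := fun _ => 1) continuous_const R).choose_spec
      set K := (aN_le_of_band (w := fun _ => 1) continuous_const R).choose
      have hb := band_Rm (evenS_const 1) R f
      have h2 : (aN (fun _ => 1) (Rm R (fun _ => 1) f)).toReal ≤ K * ‖Rm R (fun _ => 1) f‖ := by
        apply ENNReal.toReal_le_of_le_ofReal (by positivity)
        rw [ENNReal.ofReal_mul h0, ofReal_norm]
        exact h1 _ hb
      refine (norm_pr_le hb.wiener g).trans ?_
      refine mul_le_mul_of_nonneg_right (h2.trans ?_) (norm_nonneg _)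
      rw [mul_assoc]
      exact mul_le_mul_of_nonneg_left (ContinuousLinearMap.le_opNorm _ _) h0)

theorem Pb_apply (R : ℝ) (f g : RealL2) : Pb R f g = pr (Rm R (fun _ => 1) f) g := rfl

theorem Pb_eq {R : ℝ} {f : RealL2} (hf : Band R f) (g : RealL2) : Pb R f g = pr f g := by
  rw [Pb_apply, hf]

theorem inner_Pb (R : ℝ) (f g h : RealL2) : inner ℝ (Pb R f g) h = inner ℝ g (Pb R f h) :=
  inner_pr_left (band_Rm (evenS_const 1) R f).wiener g h

/-- The vector field of the regularized system. -/
def vf (β μ n : ℝ) (U : RealL2 × RealL2) : RealL2 × RealL2 :=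
  -- The normalization is `ε = 1`, and `v∂ₓv` is written as `½∂ₓ(v²)`; hence the factor `1/2` in the
  -- second component.
  (-(Dop n U.2 + Aop μ n (Pb (2 * n) U.1 U.2)),
    -(Aop μ n (Rm (2 * n) (lam β μ) U.1) + (1 / 2 : ℝ) • Aop μ n (Pb (2 * n) U.2 U.2)))

theorem band_vf {β μ n : ℝ} (hμ : 0 < μ) (U : RealL2 × RealL2) :
    Band (2 * n) (vf β μ n U).1 ∧ Band (2 * n) (vf β μ n U).2 :=
  ⟨((band_Sm oddS_chi_id _ _).add (band_Sm (oddS_chi_aS hμ) _ _)).neg,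
    ((band_Sm (oddS_chi_aS hμ) _ _).add ((band_Sm (oddS_chi_aS hμ) _ _).smul _)).neg⟩

/-! ### The energy functional -/

/-- The quadratic energy of `(ψ, w)` with background `ζ`. -/
def EnL (β μ R : ℝ) (ζ ψ w : RealL2) : ℝ :=
  inner ℝ ψ (Rm R (lam β μ) ψ) + inner ℝ w (Rm R (tau μ) w) + inner ℝ (Pb R ζ w) w

/-- The square of the truncated energy norm. -/
def eN (β μ R : ℝ) (ψ w : RealL2) : ℝ :=
  ‖Rm R (fun ξ => √(lam β μ ξ)) ψ‖ ^ 2 + ‖Rm R (fun ξ => √(tau μ ξ)) w‖ ^ 2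

theorem eN_nonneg (β μ R : ℝ) (ψ w : RealL2) : 0 ≤ eN β μ R ψ w := by unfold eN; positivity

theorem EnL_eq {β μ R : ℝ} (hβ : 0 < β) (hμ : 0 < μ) (ζ ψ w : RealL2) :
    EnL β μ R ζ ψ w = eN β μ R ψ w + inner ℝ (Pb R ζ w) w := by
  rw [EnL, eN, norm_sq_sqrt_Rm (evenS_lam β μ) (fun ξ => (lam_pos hβ hμ ξ).le),
    norm_sq_sqrt_Rm (evenS_tau hμ) (fun ξ => (tau_pos hμ ξ).le)]

theorem le_inner_pr {h : ℝ} {ζ : RealL2} (hζ : Wiener ζ) (hh : ∀ᵐ x, h ≤ ζ x) (w : RealL2) :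
    h * ‖w‖ ^ 2 ≤ inner ℝ (pr ζ w) w := by
  have hi : Integrable fun x => (w x) ^ 2 := (Lp.memLp w).integrable_sq
  have h1 : inner ℝ (pr ζ w) w = ∫ x, ζ x * (w x) ^ 2 := by
    rw [L2.inner_def]
    apply integral_congr_ae
    filter_upwards [hζ.isProduct w] with x hx
    simp only [hx, RCLike.inner_apply, conj_trivial]; ring
  have h2 : ‖w‖ ^ 2 = ∫ x, (w x) ^ 2 := by
    rw [← real_inner_self_eq_norm_sq, L2.inner_def]
    congr 1; ext x
    simp only [RCLike.inner_apply, conj_trivial]; ring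
  rw [h1, h2, ← integral_const_mul]
  apply integral_mono_ae (hi.const_mul h)
  · have := ((memLp_two_iff_integrable_sq (hζ.memLp_mul w).1).1 (hζ.memLp_mul w))
    have h4 : MemLp (fun x => ζ x) ∞ volume := memLp_top_of_bound (Lp.memLp ζ).1 _ hζ.abs_le
    have h5 : Integrable (fun x => w x * (ζ x * w x)) :=
      (Lp.memLp w).integrable_mul (hζ.memLp_mul w)
    exact h5.congr (ae_of_all _ fun x => by ring)
  · filter_upwards [hh] with x hx
    exact mul_le_mul_of_nonneg_right hx (sq_nonneg _)

/-- Non-cavitation gives `𝒯_μ⁻¹ + ζ ≥ 𝒯_μ⁻¹ - (1 - h)`, which is at least `h𝒯_μ⁻¹` because `𝒯_μ⁻¹ ≥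
1`. -/
theorem le_EnL {β μ R h : ℝ} (hβ : 0 < β) (hμ : 0 < μ) (h1 : h ≤ 1) {ζ ψ w : RealL2}
    (hζ : Band R ζ) (hw : Band R w) (hh : ∀ᵐ x, h - 1 ≤ ζ x) :
    h * eN β μ R ψ w ≤ EnL β μ R ζ ψ w := by
  rw [EnL_eq hβ hμ, Pb_eq hζ]
  have h2 := le_inner_pr hζ.wiener hh w
  have h3 := norm_le_sqrt_Rm (evenS_tau hμ) (one_le_tau hμ) hw
  have h4 : ‖w‖ ^ 2 ≤ ‖Rm R (fun ξ => √(tau μ ξ)) w‖ ^ 2 := by gcongr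
  unfold eN
  nlinarith [sq_nonneg ‖Rm R (fun ξ => √(lam β μ ξ)) ψ‖]

theorem EnL_le {β μ R α : ℝ} (hβ : 0 < β) (hμ : 0 < μ) {ζ ψ w : RealL2} (hα : 0 ≤ α)
    (hζ : Band R ζ) (hw : Band R w) (hζα : aN jb ζ ≤ ENNReal.ofReal α) :
    EnL β μ R ζ ψ w ≤ (1 + α) * eN β μ R ψ w := by
  rw [EnL_eq hβ hμ, Pb_eq hζ]
  have h2 := (real_inner_le_norm (pr ζ w) w).trans
    (mul_le_mul_of_nonneg_right (norm_pr_le_of_jb hα hζα w) (norm_nonneg _))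
  have h3 := norm_le_sqrt_Rm (evenS_tau hμ) (one_le_tau hμ) hw
  have h4 : ‖w‖ ^ 2 ≤ eN β μ R ψ w := by
    have : ‖w‖ ^ 2 ≤ ‖Rm R (fun ξ => √(tau μ ξ)) w‖ ^ 2 := by gcongr
    unfold eN
    nlinarith [sq_nonneg ‖Rm R (fun ξ => √(lam β μ ξ)) ψ‖]
  nlinarith

/-- All the operators are symmetric, so both arguments contribute equally. The last term comes from
the moving background. -/
theorem hasDerivWithinAt_EnL {β μ R : ℝ} (hμ : 0 < μ) {ζ ψ w : ℝ → RealL2}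
    {dζ dψ dw : RealL2} {s : Set ℝ} {t : ℝ} (hζ : HasDerivWithinAt ζ dζ s t)
    (hψ : HasDerivWithinAt ψ dψ s t) (hw : HasDerivWithinAt w dw s t) :
    HasDerivWithinAt (fun r => EnL β μ R (ζ r) (ψ r) (w r))
      (2 * inner ℝ dψ (Rm R (lam β μ) (ψ t)) +
        2 * inner ℝ dw (Rm R (tau μ) (w t) + Pb R (ζ t) (w t))
        + inner ℝ (Pb R dζ (w t)) (w t)) s t := by
  have h1 := hψ.inner ℝ ((Rm R (lam β μ)).hasFDerivAt.comp_hasDerivWithinAt t hψ)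
  have h2 := hw.inner ℝ ((Rm R (tau μ)).hasFDerivAt.comp_hasDerivWithinAt t hw)
  have h3 := (((Pb R).hasFDerivAt.comp_hasDerivWithinAt t hζ).clm_apply hw).inner ℝ hw
  refine ((h1.add h2).add h3).congr_deriv ?_
  simp only [Function.comp_apply, inner_add_left, inner_add_right]
  have e1 : inner ℝ (ψ t) (Rm R (lam β μ) dψ) = inner ℝ dψ (Rm R (lam β μ) (ψ t)) := by
    rw [← inner_Rm (evenS_lam β μ), real_inner_comm]
  have e2 : inner ℝ (w t) (Rm R (tau μ) dw) = inner ℝ dw (Rm R (tau μ) (w t)) := by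
    rw [← inner_Rm (evenS_tau hμ), real_inner_comm]
  have e3 : inner ℝ (Pb R (ζ t) dw) (w t) = inner ℝ dw (Pb R (ζ t) (w t)) := inner_Pb _ _ _ _
  have e4 : inner ℝ (Pb R (ζ t) (w t)) dw = inner ℝ dw (Pb R (ζ t) (w t)) :=
    real_inner_comm _ _
  rw [e1, e2, e3, e4]
  ring

/-- Gronwall's inequality. -/
theorem le_exp_mul_of_deriv_le {y y' : ℝ → ℝ} {κ τ : ℝ}
    (hy : ∀ t ∈ Icc 0 τ, HasDerivWithinAt y (y' t) (Icc 0 τ) t)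
    (hle : ∀ t ∈ Icc 0 τ, y' t ≤ κ * y t) {t : ℝ} (ht : t ∈ Icc 0 τ) :
    y t ≤ Real.exp (κ * t) * y 0 := by
  have hd : ∀ r ∈ Icc 0 τ, HasDerivWithinAt (fun r => Real.exp (-(κ * r)) * y r)
      (Real.exp (-(κ * r)) * (-κ) * y r + Real.exp (-(κ * r)) * y' r) (Icc 0 τ) r := by
    intro r hr
    have h1 : HasDerivAt (fun r => Real.exp (-(κ * r))) (Real.exp (-(κ * r)) * (-κ)) r := by
      have := (((hasDerivAt_id r).const_mul κ).neg).exp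
      simpa using this
    exact h1.hasDerivWithinAt.mul (hy r hr)
  have hanti : AntitoneOn (fun r => Real.exp (-(κ * r)) * y r) (Icc 0 τ) := by
    apply antitoneOn_of_hasDerivWithinAt_nonpos (convex_Icc 0 τ)
      (f' := fun r => Real.exp (-(κ * r)) * (-κ) * y r + Real.exp (-(κ * r)) * y' r)
    · exact fun r hr => (hd r hr).continuousWithinAt
    · exact fun r hr => (hd r (interior_subset hr)).mono interior_subset
    · intro r hr
      have := hle r (interior_subset hr)
      have h2 := Real.exp_pos (-(κ * r))
      nlinarith
  have h3 := hanti (left_mem_Icc.2 (ht.1.trans ht.2)) ht ht.1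
  simp only [mul_zero, neg_zero, Real.exp_zero, one_mul] at h3
  rw [Real.exp_neg, inv_mul_le_iff₀ (Real.exp_pos _)] at h3
  exact h3

/-! ### Energy estimates for the regularized system -/

theorem aN_vf_fst_le {β μ n α : ℝ} (hμ : 0 < μ) (hα : 0 ≤ α)
    {U : RealL2 × RealL2} (h1 : Band (2 * n) U.1) (hα1 : aN jb U.1 ≤ ENNReal.ofReal α)
    (hα2 : aN jb U.2 ≤ ENNReal.ofReal α) :
    aN (fun _ => 1) (vf β μ n U).1 ≤ ENNReal.ofReal (α + 2 * α ^ 2) := by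
  unfold vf
  rw [aN_neg, Pb_eq h1, ENNReal.ofReal_add hα (by positivity)]
  refine (aN_add_le measurable_const _ _).trans (add_le_add ?_ (aN_Aop_pr_le hμ hα hα1 hα2))
  refine (aN_mult_le (w' := jb) (c := 1) (oddS_chi_id.good _) (fun ξ => ?_) U.2).trans ?_
  · rw [abs_one, one_mul, one_mul, norm_mul, Complex.norm_I, one_mul, Complex.norm_real,
      Real.norm_eq_abs, abs_of_pos (jb_pos ξ)]
    refine (abs_cut_le _ _ _).trans ?_
    rw [abs_mul]
    have := mul_le_mul (abs_chi_le_one n ξ) (abs_le_jb ξ) (abs_nonneg _) zero_le_one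
    linarith
  · rw [ENNReal.ofReal_one, one_mul]; exact hα2

theorem abs_inner_Pb_le {R α : ℝ} (hα : 0 ≤ α) {f : RealL2} (hf : Band R f)
    (hfα : aN (fun _ => 1) f ≤ ENNReal.ofReal α) (w : RealL2) :
    inner ℝ (Pb R f w) w ≤ α * ‖w‖ ^ 2 := by
  rw [Pb_eq hf]
  have h1 := norm_pr_le hf.wiener w
  have h2 : (aN (fun _ => 1) f).toReal ≤ α := ENNReal.toReal_le_of_le_ofReal hα hfα
  have h3 := real_inner_le_norm (pr f w) w
  nlinarith [mul_le_mul_of_nonneg_right h2 (norm_nonneg w), norm_nonneg w]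

/-- Sum of the norms is bounded by the energy norm. -/
theorem norm_add_norm_le_eN {β μ R : ℝ} (hβ : 0 < β) (hμ : 0 < μ) {ψ w : RealL2}
    (hψ : Band R ψ) (hw : Band R w) : ‖ψ‖ + ‖w‖ ≤ 2 * √(eN β μ R ψ w) := by
  have h1 := norm_le_sqrt_Rm (evenS_lam β μ) (one_le_lam hβ hμ) hψ
  have h2 := norm_le_sqrt_Rm (evenS_tau hμ) (one_le_tau hμ) hw
  have h3 : ‖ψ‖ ≤ √(eN β μ R ψ w) := h1.trans (Real.le_sqrt_of_sq_le (by
    unfold eN; linarith [sq_nonneg ‖Rm R (fun ξ => √(tau μ ξ)) w‖]))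
  have h4 : ‖w‖ ≤ √(eN β μ R ψ w) := h2.trans (Real.le_sqrt_of_sq_le (by
    unfold eN; linarith [sq_nonneg ‖Rm R (fun ξ => √(lam β μ ξ)) ψ‖]))
  linarith

theorem Aop_pr_add {μ n : ℝ} {f g x q : RealL2} (h : x = f + g + q) :
    Aop μ n x = Aop μ n f + Aop μ n g + Aop μ n q := by
  rw [h, map_add, map_add]

/-- The energy estimate with a weight, at a fixed time. -/
theorem weighted_energy_estimate {β μ n B C α : ℝ} (hβ : 0 < β) (hB : β ≤ B) (hμ : 0 < μ)
    (hn : 0 < n) {m : ℝ → ℝ} (hm : Adm m C) (hα : 0 ≤ α) {U : RealL2 × RealL2}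
    (h1 : Band (2 * n) U.1) (h2 : Band (2 * n) U.2) (hα1 : aN jb U.1 ≤ ENNReal.ofReal α)
    (hα2 : aN jb U.2 ≤ ENNReal.ofReal α) :
    2 * inner ℝ (Rm (2 * n) m (vf β μ n U).1) (Rm (2 * n) (lam β μ) (Rm (2 * n) m U.1)) +
      2 * inner ℝ (Rm (2 * n) m (vf β μ n U).2)
        (Rm (2 * n) (tau μ) (Rm (2 * n) m U.2) + Pb (2 * n) U.1 (Rm (2 * n) m U.2)) +
      inner ℝ (Pb (2 * n) (vf β μ n U).1 (Rm (2 * n) m U.2)) (Rm (2 * n) m U.2)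
      ≤ (14 + B + 8 * (2 + B) * C) * (1 + α) * α *
        eN β μ (2 * n) (Rm (2 * n) m U.1) (Rm (2 * n) m U.2) := by
  obtain ⟨ζ, v⟩ := U
  simp only at h1 h2 hα1 hα2 ⊢
  have hC := hm.const_nonneg
  have hB0 : 0 < B := hβ.trans_le hB
  set R := 2 * n with hR
  set J := Rm R m with hJ
  have hψ : Band R (J ζ) := band_Rm hm.even R ζ
  have hw : Band R (J v) := band_Rm hm.even R v
  set e := eN β μ R (J ζ) (J v) with he
  have he0 : 0 ≤ e := eN_nonneg _ _ _ _ _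
  have hJA : ∀ x, J (Aop μ n x) = Aop μ n (J x) := fun x => by
    rw [hJ, Aop, Rm_Sm hm.even (oddS_chi_aS hμ), Sm_Rm hm.even (oddS_chi_aS hμ)]
  have hJD : ∀ x, J (Dop n x) = Dop n (J x) := fun x => by
    rw [hJ, Dop, Rm_Sm hm.even oddS_chi_id, Sm_Rm hm.even oddS_chi_id]
  have hJL : ∀ x, J (Rm R (lam β μ) x) = Rm R (lam β μ) (J x) := fun x => by
    rw [hJ, Rm_Rm hm.even (evenS_lam β μ), Rm_Rm (evenS_lam β μ) hm.even]
    simp only [mul_comm]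
  -- Leibniz rule with remainder: `(Jζ, Jv)` solves the linearized system with background `(ζ, v)`
  -- and forcing built from `rem`.
  have q1 : J (pr ζ v) = pr ζ (J v) + pr v (J ζ) + rem R m ζ v := by
    unfold rem; abel
  have q2 : J (pr v v) = pr v (J v) + pr v (J v) + rem R m v v := by
    unfold rem; abel
  set f := -Aop μ n (rem R m ζ v) with hf
  set g := -((1 / 2 : ℝ) • Aop μ n (rem R m v v)) with hg
  have hd1 : J (vf β μ n (ζ, v)).1
      = -(Dop n (J v) + Aop μ n (pr ζ (J v)) + Aop μ n (pr v (J ζ))) + f := by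
    simp only [vf]
    rw [← hR, Pb_eq h1, map_neg, map_add, hJD, hJA, Aop_pr_add q1, hf]
    abel
  have hd2 : J (vf β μ n (ζ, v)).2
      = -(Aop μ n (Rm R (lam β μ) (J ζ)) + Aop μ n (pr v (J v))) + g := by
    simp only [vf]
    rw [← hR, Pb_eq h2, map_neg, map_add, map_smul, hJA, hJA, hJL, Aop_pr_add q2, hg]
    module
  have hsum := norm_add_norm_le_eN hβ hμ hψ hw
  have hse : 0 ≤ √e := Real.sqrt_nonneg e
  -- `Cα(‖Jζ‖ + ‖Jv‖)` bounds the derivative of the remainder, the sum of norms is at most `2√e`,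
  -- and `2 + B` is the norm of `√Λ A` relative to `∂ₓ`.
  set r := (2 + B) * (C * α * (2 * √e)) with hr
  have hnf : ‖Rm R (fun ξ => √(lam β μ ξ)) f‖ ≤ r := by
    rw [hf, map_neg, norm_neg]
    refine (norm_lam_Aop_le hβ hB hμ _).trans ?_
    have := norm_derivative_rem_le hm h1 h2 hα hα1 hα2
    have h5 : C * α * (‖J ζ‖ + ‖J v‖) ≤ C * α * (2 * √e) := by gcongr
    exact mul_le_mul_of_nonneg_left (this.trans h5) (by linarith)
  have hng : ‖Rm R (fun ξ => √(tau μ ξ)) g‖ ≤ r := by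
    rw [hg, map_neg, norm_neg, map_smul, norm_smul]
    have h3 := norm_tau_Aop_le (n := n) hμ (rem R m v v)
    have h4 := norm_derivative_rem_le hm h2 h2 hα hα2 hα2
    have h5 : C * α * (‖J v‖ + ‖J v‖) ≤ 2 * (C * α * (2 * √e)) := by
      have : ‖J v‖ + ‖J v‖ ≤ 2 * (2 * √e) := by linarith [norm_nonneg (J ζ)]
      calc C * α * (‖J v‖ + ‖J v‖) ≤ C * α * (2 * (2 * √e)) := by gcongr
        _ = _ := by ring
    have h6 : 0 ≤ C * α * (2 * √e) := by positivity
    rw [Real.norm_of_nonneg (by norm_num)]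
    have h7 := (h3.trans h4).trans h5
    rw [hr]
    nlinarith
  have main := linear_energy_estimate hβ hB hμ hn hψ hw
    (((band_Sm (oddS_chi_aS hμ) _ _).smul _).neg : Band (2 * n) g) hα hα1 hα2 hd1 hd2
    (e := e) rfl hnf hng
  rw [Pb_eq h1]
  -- The contribution of the time derivative of the background `ζ`, bounded pointwise by `α + 2α²`.
  have ht := abs_inner_Pb_le (R := R) (by positivity) (band_vf (β := β) hμ (ζ, v)).1
    (aN_vf_fst_le (β := β) hμ hα (U := (ζ, v)) h1 hα1 hα2) (J v)
  have hw2 : ‖J v‖ ^ 2 ≤ e := by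
    have h3 := norm_le_sqrt_Rm (evenS_tau hμ) (one_le_tau hμ) hw
    have : ‖J v‖ ^ 2 ≤ ‖Rm R (fun ξ => √(tau μ ξ)) (J v)‖ ^ 2 := by gcongr
    rw [he, eN]
    linarith [sq_nonneg ‖Rm R (fun ξ => √(lam β μ ξ)) (J ζ)‖]
  have ht2 : (α + 2 * α ^ 2) * ‖J v‖ ^ 2 ≤ (α + 2 * α ^ 2) * e := by gcongr
  have hsq : √e * √e = e := Real.mul_self_sqrt he0
  have hr2 : 4 * (1 + α) * r * √e = 8 * (2 + B) * C * (1 + α) * α * e := by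
    rw [hr]; linear_combination 8 * (2 + B) * C * (1 + α) * α * hsq
  rw [hr2] at main
  have : 0 ≤ α * e := by positivity
  linarith

theorem hasDerivWithinAt_clm {L : RealL2 →L[ℝ] RealL2} {f : ℝ → RealL2} {f' : RealL2}
    {s : Set ℝ} {t : ℝ} (h : HasDerivWithinAt f f' s t) :
    HasDerivWithinAt (fun r => L (f r)) (L f') s t :=
  L.hasFDerivAt.comp_hasDerivWithinAt t h

/-- Propagation of weighted norms along solutions of the regularized system. -/
theorem weighted_energy_bound {β μ n B C α α₀ h τ : ℝ} (hβ : 0 < β) (hB : β ≤ B) (hμ : 0 < μ)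
    (hn : 0 < n) {m : ℝ → ℝ} (hm : Adm m C) (hα : 0 ≤ α) (hα₀ : 0 ≤ α₀) (hh : 0 < h) (hh1 : h ≤ 1)
    {U : ℝ → RealL2 × RealL2}
    (hU : ∀ t ∈ Icc 0 τ, HasDerivWithinAt U (vf β μ n (U t)) (Icc 0 τ) t)
    (h1 : ∀ t ∈ Icc 0 τ, Band (2 * n) (U t).1) (h2 : ∀ t ∈ Icc 0 τ, Band (2 * n) (U t).2)
    (hα1 : ∀ t ∈ Icc 0 τ, aN jb (U t).1 ≤ ENNReal.ofReal α)
    (hα2 : ∀ t ∈ Icc 0 τ, aN jb (U t).2 ≤ ENNReal.ofReal α)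
    (hpos : ∀ t ∈ Icc 0 τ, ∀ᵐ x, h - 1 ≤ (U t).1 x)
    (h0 : aN jb (U 0).1 ≤ ENNReal.ofReal α₀) {t : ℝ} (ht : t ∈ Icc 0 τ) :
    h * eN β μ (2 * n) (Rm (2 * n) m (U t).1) (Rm (2 * n) m (U t).2) ≤
      Real.exp ((14 + B + 8 * (2 + B) * C) * (1 + α) * α / h * t) * ((1 + α₀) *
        eN β μ (2 * n) (Rm (2 * n) m (U 0).1) (Rm (2 * n) m (U 0).2)) := by
  have hC := hm.const_nonneg
  have hB0 : 0 < B := hβ.trans_le hB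
  set J := Rm (2 * n) m with hJ
  have hw : ∀ x, Band (2 * n) (J x) := fun x => band_Rm hm.even _ x
  have h00 : (0 : ℝ) ∈ Icc 0 τ := left_mem_Icc.2 (ht.1.trans ht.2)
  -- Dividing by `h` converts the norm in the differential inequality into the energy. For bounded
  -- `α` the rate is linear in `α`, which is the origin of a lifespan inversely proportional to the
  -- size.
  have hE := le_exp_mul_of_deriv_le
    (y := fun t => EnL β μ (2 * n) (U t).1 (J (U t).1) (J (U t).2))
    (κ := (14 + B + 8 * (2 + B) * C) * (1 + α) * α / h)
    (fun t ht => hasDerivWithinAt_EnL hμ (hU t ht).fst (hasDerivWithinAt_clm (hU t ht).fst)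
      (hasDerivWithinAt_clm (hU t ht).snd)) (fun t ht => ?_) ht
  · refine (le_EnL hβ hμ hh1 (h1 t ht) (hw _) (hpos t ht)).trans (hE.trans ?_)
    exact mul_le_mul_of_nonneg_left (EnL_le hβ hμ hα₀ (h1 0 h00) (hw _) h0) (Real.exp_pos _).le
  · refine (weighted_energy_estimate hβ hB hμ hn hm hα (h1 t ht) (h2 t ht) (hα1 t ht)
      (hα2 t ht)).trans ?_
    have h3 := le_EnL (ψ := J (U t).1) hβ hμ hh1 (h1 t ht) (hw (U t).2) (hpos t ht)
    rw [div_mul_eq_mul_div, le_div_iff₀ hh]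
    have hK : 0 ≤ (14 + B + 8 * (2 + B) * C) * (1 + α) * α := by positivity
    nlinarith [mul_le_mul_of_nonneg_left h3 hK]

/-- The energy estimate for the difference of two approximate solutions, at a fixed time. -/
theorem difference_energy_estimate {β μ n B α ρ : ℝ} (hβ : 0 < β) (hB : β ≤ B) (hμ : 0 < μ)
    (hn : 0 < n) (hα : 0 ≤ α) {U V d : RealL2 × RealL2}
    (h1 : Band (2 * n) U.1) (h2 : Band (2 * n) U.2) (h3 : Band (2 * n) V.1)
    (h4 : Band (2 * n) V.2) (hα1 : aN jb U.1 ≤ ENNReal.ofReal α)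
    (hα2 : aN jb U.2 ≤ ENNReal.ofReal α) (hα3 : aN jb V.1 ≤ ENNReal.ofReal α)
    (hα4 : aN jb V.2 ≤ ENNReal.ofReal α) (hd2 : Band (2 * n) d.2)
    (hρ1 : ‖Rm (2 * n) (fun ξ => √(lam β μ ξ)) d.1‖ ≤ ρ)
    (hρ2 : ‖Rm (2 * n) (fun ξ => √(tau μ ξ)) d.2‖ ≤ ρ) :
    2 * inner ℝ ((vf β μ n U).1 - ((vf β μ n V).1 + d.1)) (Rm (2 * n) (lam β μ) (U.1 - V.1)) +
      2 * inner ℝ ((vf β μ n U).2 - ((vf β μ n V).2 + d.2))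
        (Rm (2 * n) (tau μ) (U.2 - V.2) + Pb (2 * n) U.1 (U.2 - V.2)) +
      inner ℝ (Pb (2 * n) (vf β μ n U).1 (U.2 - V.2)) (U.2 - V.2)
      ≤ (1 + α) ^ 2 * ((50 + 20 * B) * eN β μ (2 * n) (U.1 - V.1) (U.2 - V.2) + ρ ^ 2) := by
  obtain ⟨ζ, v⟩ := U
  obtain ⟨ζ', v'⟩ := V
  obtain ⟨d₁, d₂⟩ := d
  simp only at h1 h2 h3 h4 hα1 hα2 hα3 hα4 hd2 hρ1 hρ2 ⊢
  have hB0 : 0 < B := hβ.trans_le hB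
  set R := 2 * n with hR
  set ψ := ζ - ζ' with hψdef
  set w := v - v' with hwdef
  have hψ : Band R ψ := h1.sub h3
  have hw : Band R w := h2.sub h4
  set e := eN β μ R ψ w with he
  have he0 : 0 ≤ e := eN_nonneg _ _ _ _ _
  have hse : 0 ≤ √e := Real.sqrt_nonneg e
  have hsq : √e * √e = e := Real.mul_self_sqrt he0
  have hsum : ‖ψ‖ + ‖w‖ ≤ 2 * √e := norm_add_norm_le_eN hβ hμ hψ hw
  have hψα : aN jb ψ ≤ ENNReal.ofReal (2 * α) := by
    rw [hψdef, sub_eq_add_neg, two_mul, ENNReal.ofReal_add hα hα]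
    exact (aN_add_le evenS_jb.cont.measurable _ _).trans
      (add_le_add hα1 (by rw [aN_neg]; exact hα3))
  have hwα : aN jb w ≤ ENNReal.ofReal (2 * α) := by
    rw [hwdef, sub_eq_add_neg, two_mul, ENNReal.ofReal_add hα hα]
    exact (aN_add_le evenS_jb.cont.measurable _ _).trans
      (add_le_add hα2 (by rw [aN_neg]; exact hα4))
  have eζ : ζ' = ζ + (-1 : ℝ) • ψ := by rw [hψdef]; module
  have ev : v' = v + (-1 : ℝ) • w := by rw [hwdef]; module
  have hψs := hψ.wiener.smul (-1)
  have hws := hw.wiener.smul (-1)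
  -- The products are expanded around the first solution, so that its `ζ` is the background of the
  -- energy. The quadratic terms in the difference go into the forcing.
  have q1 : pr ζ v - pr ζ' v' = pr ζ w + pr v ψ - pr ψ w := by
    rw [eζ, ev, add_pr h1.wiener hψs, pr_add h1.wiener, pr_add hψs, pr_smul h1.wiener,
      pr_smul hψs, smul_pr hψ.wiener, smul_pr hψ.wiener, pr_comm v ψ]
    module
  have q2 : pr v v - pr v' v' = (2 : ℝ) • pr v w - pr w w := by
    rw [ev, add_pr h2.wiener hws, pr_add h2.wiener, pr_add hws, pr_smul h2.wiener,
      pr_smul hws, smul_pr hw.wiener, smul_pr hw.wiener, pr_comm w v]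
    module
  set f := Aop μ n (pr ψ w) - d₁ with hf
  set g := (1 / 2 : ℝ) • Aop μ n (pr w w) - d₂ with hg
  have hd1 : (vf β μ n (ζ, v)).1 - ((vf β μ n (ζ', v')).1 + d₁)
      = -(Dop n w + Aop μ n (pr ζ w) + Aop μ n (pr v ψ)) + f := by
    simp only [vf]
    have e1 : Aop μ n (pr ζ v) = Aop μ n (pr ζ' v')
        + (Aop μ n (pr ζ w) + Aop μ n (pr v ψ) - Aop μ n (pr ψ w)) := by
      rw [← map_add, ← map_sub, ← map_add, ← q1]; congr 1; abel
    have e2 : Dop n v = Dop n v' + Dop n w := by rw [← map_add]; congr 1; rw [hwdef]; abel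
    rw [← hR, Pb_eq h1, Pb_eq h3, hf, e1, e2]
    abel
  have hd2' : (vf β μ n (ζ, v)).2 - ((vf β μ n (ζ', v')).2 + d₂)
      = -(Aop μ n (Rm R (lam β μ) ψ) + Aop μ n (pr v w)) + g := by
    simp only [vf]
    have e1 : Aop μ n (pr v v) = Aop μ n (pr v' v')
        + ((2 : ℝ) • Aop μ n (pr v w) - Aop μ n (pr w w)) := by
      rw [← map_smul, ← map_sub, ← map_add, ← q2]; congr 1; abel
    have e2 : Aop μ n (Rm R (lam β μ) ζ)
        = Aop μ n (Rm R (lam β μ) ζ') + Aop μ n (Rm R (lam β μ) ψ) := by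
      rw [← map_add, ← map_add]; congr 2; rw [hψdef]; abel
    rw [← hR, Pb_eq h2, Pb_eq h4, hg, e1, e2]
    module
  set r := (2 + B) * (2 * α * (2 * √e)) + ρ with hr
  have h2α : 0 ≤ 2 * α := by linarith
  have hp1 : ‖Sm R (fun ξ => ξ) (pr ψ w)‖ ≤ 2 * α * (2 * √e) :=
    (norm_derivative_pr_le h2α hψα hwα).trans (by gcongr)
  have hp2 : ‖Sm R (fun ξ => ξ) (pr w w)‖ ≤ 2 * (2 * α * (2 * √e)) := by
    refine (norm_derivative_pr_le h2α hwα hwα).trans ?_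
    have : ‖w‖ + ‖w‖ ≤ 2 * (2 * √e) := by linarith [norm_nonneg ψ]
    calc 2 * α * (‖w‖ + ‖w‖) ≤ 2 * α * (2 * (2 * √e)) := by gcongr
      _ = _ := by ring
  have hnf : ‖Rm R (fun ξ => √(lam β μ ξ)) f‖ ≤ r := by
    rw [hf, map_sub]
    refine (norm_sub_le _ _).trans (add_le_add ((norm_lam_Aop_le hβ hB hμ _).trans ?_) hρ1)
    exact mul_le_mul_of_nonneg_left hp1 (by linarith)
  have hng : ‖Rm R (fun ξ => √(tau μ ξ)) g‖ ≤ r := by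
    rw [hg, map_sub]
    refine (norm_sub_le _ _).trans (add_le_add ?_ hρ2)
    rw [map_smul, norm_smul, Real.norm_of_nonneg (by norm_num)]
    have h5 := (norm_tau_Aop_le (n := n) hμ (pr w w)).trans hp2
    have h6 : 0 ≤ 2 * α * (2 * √e) := by positivity
    nlinarith
  have main := linear_energy_estimate hβ hB hμ hn hψ hw
    (((band_Sm (oddS_chi_aS hμ) _ _).smul _).sub hd2 : Band (2 * n) g) hα hα1 hα2 hd1 hd2'
    (e := e) rfl hnf hng
  rw [Pb_eq h1]
  have ht := abs_inner_Pb_le (R := R) (by positivity) (band_vf (β := β) hμ (ζ, v)).1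
    (aN_vf_fst_le (β := β) hμ hα (U := (ζ, v)) h1 hα1 hα2) w
  have hw2 : ‖w‖ ^ 2 ≤ e := by
    have h3 := norm_le_sqrt_Rm (evenS_tau hμ) (one_le_tau hμ) hw
    have : ‖w‖ ^ 2 ≤ ‖Rm R (fun ξ => √(tau μ ξ)) w‖ ^ 2 := by gcongr
    rw [he, eN]
    linarith [sq_nonneg ‖Rm R (fun ξ => √(lam β μ ξ)) ψ‖]
  have ht2 : (α + 2 * α ^ 2) * ‖w‖ ^ 2 ≤ (α + 2 * α ^ 2) * e := by gcongr
  have hr2 : 4 * (1 + α) * r * √e = 16 * (2 + B) * (1 + α) * α * e + 4 * (1 + α) * (ρ * √e) := by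
    rw [hr]; linear_combination 16 * (2 + B) * (1 + α) * α * hsq
  -- Young's inequality in the form `(2√e - ρ)² ≥ 0` separates the defect from the energy.
  have hr3 : 4 * (1 + α) * (ρ * √e) ≤ (1 + α) * (4 * e + ρ ^ 2) := by
    have : 4 * (ρ * √e) ≤ 4 * e + ρ ^ 2 := by nlinarith [sq_nonneg (2 * √e - ρ)]
    have := mul_le_mul_of_nonneg_left this (by linarith : 0 ≤ 1 + α)
    linarith
  rw [hr2] at main
  have p1 : 0 ≤ α * e := by positivity
  have p2 : 0 ≤ α ^ 2 * e := by positivity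
  have p3 : 0 ≤ B * (α * e) := by positivity
  have p4 : 0 ≤ B * (α ^ 2 * e) := by positivity
  have p5 : 0 ≤ B * e := by positivity
  have p6 : 0 ≤ α * ρ ^ 2 := by positivity
  have p7 : 0 ≤ α ^ 2 * ρ ^ 2 := by positivity
  linarith

/-! ### Weighted norms: limits, products and truncation -/

theorem wN_mono_of_abs_le {w w' : ℝ → ℝ} (h : ∀ ξ, |w ξ| ≤ |w' ξ|) (f : RealL2) :
    wN w f ≤ wN w' f := by
  have := wN_mono (w := w) (w' := w') (c := 1) (fun ξ => by simpa using h ξ) f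
  rwa [ENNReal.ofReal_one, one_mul] at this

/-- Fatou's lemma along an exhaustion of the frequencies. -/
theorem wN_le_of_cut {w : ℝ → ℝ} (hw : Measurable w) {f : RealL2} {c : ℝ≥0∞}
    (h : ∀ R : ℝ, wN (cut R w) f ≤ c) : wN w f ≤ c := by
  refine (Lp.eLpNorm_lim_le_liminf_eLpNorm
    (f := fun (n : ℕ) (k : ℝ) => (cut n w (2 * Real.pi * k) : ℂ) * hat f k)
    (fun n => (measurable_weight (measurable_cut hw) f).aestronglyMeasurable) _
    (ae_of_all _ fun k => ?_)).trans
    (liminf_le_of_le (by isBoundedDefault) fun b hb => ?_)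
  · apply tendsto_const_nhds.congr'
    filter_upwards [eventually_ge_atTop ⌈|2 * Real.pi * k|⌉₊] with n hn
    rw [cut, if_pos (Nat.ceil_le.1 hn)]
  · obtain ⟨n, hn⟩ := hb.exists
    exact hn.trans (h n)

theorem wN_le_add {w w₁ w₂ : ℝ → ℝ} (h₁ : Measurable w₁) (h₂ : Measurable w₂)
    (h : ∀ ξ, |w ξ| ≤ |w₁ ξ| + |w₂ ξ|) (f : RealL2) : wN w f ≤ wN w₁ f + wN w₂ f := by
  unfold wN
  refine le_trans (eLpNorm_mono_enorm fun k => ?_)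
    ((eLpNorm_add_le (measurable_weight h₁ f).enorm.aestronglyMeasurable
    (measurable_weight h₂ f).enorm.aestronglyMeasurable (by norm_num)).trans
    (le_of_eq (by rw [eLpNorm_enorm, eLpNorm_enorm])))
  rw [Pi.add_apply, enorm_eq_self, ← ofReal_norm, ← ofReal_norm, ← ofReal_norm,
    ← ENNReal.ofReal_add (norm_nonneg _) (norm_nonneg _)]
  apply ENNReal.ofReal_le_ofReal
  rw [norm_mul, norm_mul, norm_mul, Complex.norm_real, Complex.norm_real, Complex.norm_real,
    ← add_mul]
  exact mul_le_mul_of_nonneg_right (h _) (norm_nonneg _)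

/-- `⟨ξ⟩^{1-s}` is square integrable because `s > 3/2`, so Cauchy–Schwarz bounds the `L¹` norm of
`⟨ξ⟩f̂`. This is the control of `f` and its derivative in the supremum norm. -/
theorem exists_aN_jb_le {s : ℝ} (hs : 3 / 2 < s) : ∃ K : ℝ, 1 ≤ K ∧ ∀ f : RealL2,
    aN jb f ≤ ENNReal.ofReal K * wN (fun ξ => jb ξ ^ s) f := by
  set N := eLpNorm (fun k : ℝ => jb (2 * Real.pi * k) ^ (1 - s)) 2 volume with hN
  have hm : Measurable (fun ξ => jb ξ ^ (1 - s)) := (evenS_jb_rpow _).cont.measurable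
  have hNt : N < ∞ := by
    have hi : Integrable (fun k : ℝ => (jb (2 * Real.pi * k) ^ (1 - s)) ^ 2) := by
      have h1 := integrable_rpow_neg_one_add_norm_sq (E := ℝ) (μ := volume) (r := 2 * s - 2)
        (by simp; linarith)
      refine (h1.comp_mul_left' (R := 2 * Real.pi) (by positivity)).congr
        (ae_of_all _ fun k => ?_)
      simp only [jb]
      have h0 : 0 ≤ 1 + (2 * Real.pi * k) ^ 2 := by positivity
      rw [Real.norm_eq_abs, sq_abs, Real.sqrt_eq_rpow, ← Real.rpow_mul h0,
        ← Real.rpow_natCast (_ ^ (_ : ℝ)), ← Real.rpow_mul h0]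
      congr 1; push_cast; ring
    exact ((memLp_two_iff_integrable_sq
      (hm.comp (measurable_const.mul measurable_id)).aestronglyMeasurable).2 hi).2
  refine ⟨max 1 N.toReal, le_max_left _ _, fun f => ?_⟩
  refine (aN_le_wN hm (evenS_jb_rpow s).cont.measurable (fun ξ => ?_) f).trans ?_
  · rw [← abs_mul, ← Real.rpow_add (jb_pos ξ), sub_add_cancel, Real.rpow_one]
  · refine mul_le_mul_left ?_ _
    exact (ENNReal.ofReal_toReal hNt.ne).ge.trans
      (ENNReal.ofReal_le_ofReal (le_max_right _ _))

theorem jb_add_le (ξ η : ℝ) : jb (ξ + η) ≤ jb ξ + jb η := by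
  have h1 := (abs_le.1 (abs_jb_sub_le (ξ + η) η)).2
  rw [add_sub_cancel_right] at h1
  linarith [abs_le_jb ξ]

theorem add_rpow_le {s x y : ℝ} (hs : 0 ≤ s) (hx : 0 < x) (hy : 0 < y) :
    (x + y) ^ s ≤ 2 ^ s * (x ^ s + y ^ s) := by
  have key : ∀ {a b : ℝ}, 0 < a → 0 < b → a ≤ b → (a + b) ^ s ≤ 2 ^ s * (a ^ s + b ^ s) := by
    intro a b ha hb hab
    calc (a + b) ^ s ≤ (2 * b) ^ s := Real.rpow_le_rpow (by linarith) (by linarith) hs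
      _ = 2 ^ s * b ^ s := Real.mul_rpow (by norm_num) hb.le
      _ ≤ _ := by gcongr; linarith [Real.rpow_nonneg ha.le s]
  rcases le_total x y with h | h
  · exact key hx hy h
  · rw [add_comm x, add_comm (x ^ s)]; exact key hy hx h

/-- The algebra property. -/
theorem wN_pr_le {s : ℝ} (hs : 0 ≤ s) {f g : RealL2} (hf : Wiener f) (hg : Wiener g) :
    wN (fun ξ => jb ξ ^ s) (pr f g) ≤ ENNReal.ofReal (2 ^ s) *
      (aN (fun _ => 1) f * wN (fun ξ => jb ξ ^ s) g
        + wN (fun ξ => jb ξ ^ s) f * aN (fun _ => 1) g) := by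
  have hj := (evenS_jb_rpow s).cont.measurable
  have h2 : (0 : ℝ) < 2 ^ s := by positivity
  have hw : wN (fun ξ => (2 ^ s)⁻¹ * jb ξ ^ s) (pr f g) ≤
      aN (fun _ => 1) f * wN (fun ξ => jb ξ ^ s) g
        + wN (fun ξ => jb ξ ^ s) f * aN (fun _ => 1) g := by
    refine wN_le_of_conv (σ := fun k _ => (((2 ^ s)⁻¹ * jb (2 * Real.pi * k) ^ s : ℝ) : ℂ))
      measurable_const hj hj measurable_const ?_ ?_
    · filter_upwards [hat_pr hf hg] with k hk
      rw [hk, ← integral_const_mul]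
    · intro k l
      have e : 2 * Real.pi * k = 2 * Real.pi * (k - l) + 2 * Real.pi * l := by ring
      rw [e]
      generalize 2 * Real.pi * (k - l) = ξ
      generalize 2 * Real.pi * l = η
      have p1 := jb_pos ξ
      have p2 := jb_pos η
      have p3 := jb_pos (ξ + η)
      have p4 : 0 < jb η ^ s := by positivity
      have p5 : 0 < jb ξ ^ s := by positivity
      rw [Complex.norm_real, Real.norm_of_nonneg (by positivity), abs_one, one_mul, mul_one,
        abs_of_pos p4, abs_of_pos p5, inv_mul_le_iff₀ h2, add_comm (jb η ^ s)]
      exact (Real.rpow_le_rpow p3.le (jb_add_le _ _) hs).trans (add_rpow_le hs p1 p2)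
  refine le_trans ?_ (mul_le_mul_right hw _)
  refine wN_mono (fun ξ => ?_) _
  have := jb_pos ξ
  rw [abs_of_pos (by positivity), abs_of_pos (by positivity), mul_inv_cancel_left₀ h2.ne']

/-- Truncating the factors of a product, instead of the product, makes a small error. -/
theorem wN_trunc_pr_le {s n : ℝ} (hs : 1 ≤ s) (hn : 0 < n) {f g : RealL2} (hf : Wiener f)
    (hg : Wiener g) :
    wN jb (Rm n (fun _ => 1) (pr f g) - pr (Rm n (fun _ => 1) f) (Rm n (fun _ => 1) g)) ≤
      ENNReal.ofReal (2 * (n / 2) ^ (1 - s)) *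
      (aN (fun _ => 1) f * wN (fun ξ => jb ξ ^ s) g
        + wN (fun ξ => jb ξ ^ s) f * aN (fun _ => 1) g) := by
  have hj := (evenS_jb_rpow s).cont.measurable
  set N := 2 * (n / 2) ^ (1 - s) with hN
  have hN0 : 0 < N := by positivity
  set P : ℝ → ℝ := cut n (fun _ => 1) with hP
  have hPg := (evenS_const 1).good n
  have hw : wN (fun ξ => N⁻¹ * jb ξ)
      (Rm n (fun _ => 1) (pr f g) - pr (Rm n (fun _ => 1) f) (Rm n (fun _ => 1) g)) ≤
      aN (fun _ => 1) f * wN (fun ξ => jb ξ ^ s) g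
        + wN (fun ξ => jb ξ ^ s) f * aN (fun _ => 1) g := by
    refine wN_le_of_conv (f := f) (g := g)
      (σ := fun k l => ((N⁻¹ * jb (2 * Real.pi * k) * (P (2 * Real.pi * k) -
        P (2 * Real.pi * (k - l)) * P (2 * Real.pi * l)) : ℝ) : ℂ))
      measurable_const hj hj measurable_const ?_ ?_
    · have h1 := hat_pr_mult hPg hPg (f := f) (g := g) (band_Rm (evenS_const 1) n f).wiener
        (band_Rm (evenS_const 1) n g).wiener
      rw [hat_sub]
      filter_upwards [hat_pr hf hg, h1, hat_Rm (evenS_const 1) n (pr f g),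
        Lp.coeFn_sub (hat (Rm n (fun _ => 1) (pr f g)))
          (hat (pr (Rm n (fun _ => 1) f) (Rm n (fun _ => 1) g)))] with k e1 e2 e3 e4
      have e2' : hat (pr (Rm n (fun _ => 1) f) (Rm n (fun _ => 1) g)) k = _ := e2
      rw [e4, Pi.sub_apply, e3, e1, e2', ← integral_const_mul, ← integral_sub,
        ← integral_const_mul]
      · congr 1; ext l; push_cast; ring
      · exact (integrable_conv f g k).const_mul _
      · exact integrable_mult_conv hPg hPg f g k
    · intro k l
      have e : 2 * Real.pi * k = 2 * Real.pi * (k - l) + 2 * Real.pi * l := by ring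
      rw [e]
      generalize 2 * Real.pi * (k - l) = ξ
      generalize 2 * Real.pi * l = η
      have p1 := jb_pos ξ
      have p2 := jb_pos η
      have p3 := jb_pos (ξ + η)
      have p4 : 0 < jb η ^ s := by positivity
      have p5 : 0 < jb ξ ^ s := by positivity
      have p6 : 0 < N⁻¹ * jb (ξ + η) := by positivity
      rw [Complex.norm_real, Real.norm_eq_abs, abs_mul, abs_of_pos p6, abs_one,
        one_mul, mul_one, abs_of_pos p4, abs_of_pos p5, mul_assoc, inv_mul_le_iff₀ hN0]
      have hsum : 0 ≤ jb η ^ s + jb ξ ^ s := by positivity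
      -- Two frequencies below `n/2` have a sum below `n`, and then nothing is truncated. Otherwise
      -- the larger bracket `b` is at least `n/2`, and `b = b^{1-s} b^s ≤ (n/2)^{1-s} b^s`.
      by_cases hsm : |ξ| ≤ n / 2 ∧ |η| ≤ n / 2
      · have h3 : |ξ + η| ≤ n := (abs_add_le _ _).trans (by linarith [hsm.1, hsm.2])
        have : P (ξ + η) - P ξ * P η = 0 := by
          simp only [hP, cut]
          rw [if_pos h3, if_pos (by linarith [hsm.1] : |ξ| ≤ n),
            if_pos (by linarith [hsm.2] : |η| ≤ n)]
          ring
        rw [this, abs_zero, mul_zero]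
        positivity
      · have h01 : ∀ x, P x = 0 ∨ P x = 1 := fun x => by
          simp only [hP, cut]; split_ifs <;> simp
        have hb : |P (ξ + η) - P ξ * P η| ≤ 1 := by
          rcases h01 (ξ + η) with a | a <;> rcases h01 ξ with b | b <;>
            rcases h01 η with c | c <;> rw [a, b, c] <;> norm_num
        have key : ∀ {a b : ℝ}, 0 < a → a ≤ b → n / 2 ≤ b →
            a + b ≤ N * b ^ s := by
          intro a b ha hab hnb
          have hb0 : 0 < b := ha.trans_le hab
          have h4 : b ^ (1 - s) ≤ (n / 2) ^ (1 - s) :=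
            Real.rpow_le_rpow_of_nonpos (by positivity) hnb (by linarith)
          have h5 : b = b ^ (1 - s) * b ^ s := by
            rw [← Real.rpow_add hb0]; simp
          calc a + b ≤ 2 * b := by linarith
            _ = 2 * (b ^ (1 - s) * b ^ s) := by rw [← h5]
            _ ≤ 2 * ((n / 2) ^ (1 - s) * b ^ s) := by gcongr
            _ = _ := by rw [hN]; ring
        have hmax : n / 2 ≤ jb ξ ∨ n / 2 ≤ jb η := by
          rcases not_and_or.1 hsm with h | h
          · exact Or.inl ((not_le.1 h).le.trans (abs_le_jb _))
          · exact Or.inr ((not_le.1 h).le.trans (abs_le_jb _))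
        have h6 : jb ξ + jb η ≤ N * (jb η ^ s + jb ξ ^ s) := by
          have q1 : 0 ≤ N * jb ξ ^ s := by positivity
          have q2 : 0 ≤ N * jb η ^ s := by positivity
          rcases le_total (jb ξ) (jb η) with h | h
          · have := key p1 h (hmax.elim (fun h' => h'.trans h) id)
            linarith
          · have := key p2 h (hmax.elim id (fun h' => h'.trans h))
            linarith
        calc jb (ξ + η) * |P (ξ + η) - P ξ * P η| ≤ jb (ξ + η) * 1 := by gcongr
          _ ≤ jb ξ + jb η := by rw [mul_one]; exact jb_add_le _ _
          _ ≤ _ := h6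
  refine le_trans ?_ (mul_le_mul_right hw _)
  refine wN_mono (fun ξ => ?_) _
  have := jb_pos ξ
  rw [abs_of_pos (by positivity), abs_of_pos (by positivity), mul_inv_cancel_left₀ hN0.ne']

/-! ### The norm of pairs -/

/-- The energy norm of `(ζ, v)` with weight `m`. -/
def XW (β μ : ℝ) (m : ℝ → ℝ) (U : RealL2 × RealL2) : ℝ≥0∞ :=
  wN (fun ξ => m ξ * √(lam β μ ξ)) U.1 + wN (fun ξ => m ξ * √(tau μ ξ)) U.2

theorem evenS_mul_sqrt_lam (β μ : ℝ) {m : ℝ → ℝ} (hm : EvenS m) :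
    EvenS (fun ξ => m ξ * √(lam β μ ξ)) := hm.mul (evenS_lam β μ).sqrt

theorem evenS_mul_sqrt_tau {μ : ℝ} (hμ : 0 < μ) {m : ℝ → ℝ} (hm : EvenS m) :
    EvenS (fun ξ => m ξ * √(tau μ ξ)) := hm.mul (evenS_tau hμ).sqrt

section XW
variable {β μ : ℝ} {m m' : ℝ → ℝ}

theorem XW_add_le (hμ : 0 < μ) (hm : EvenS m) (U V : RealL2 × RealL2) :
    XW β μ m (U + V) ≤ XW β μ m U + XW β μ m V := by
  unfold XW
  refine (add_le_add (wN_add_le (evenS_mul_sqrt_lam β μ hm).cont.measurable _ _)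
    (wN_add_le (evenS_mul_sqrt_tau hμ hm).cont.measurable _ _)).trans (le_of_eq (by ring))

theorem XW_smul (c : ℝ) (U : RealL2 × RealL2) : XW β μ m (c • U) = ‖c‖ₑ * XW β μ m U := by
  unfold XW
  rw [Prod.smul_fst, Prod.smul_snd, wN_smul, wN_smul, mul_add]

theorem XW_neg (U : RealL2 × RealL2) : XW β μ m (-U) = XW β μ m U := by
  have := XW_smul (β := β) (μ := μ) (m := m) (-1) U
  simpa using this

theorem XW_sub_comm (U V : RealL2 × RealL2) : XW β μ m (U - V) = XW β μ m (V - U) := by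
  rw [← XW_neg, neg_sub]

theorem XW_sub_le (hμ : 0 < μ) (hm : EvenS m) (U V : RealL2 × RealL2) :
    XW β μ m (U - V) ≤ XW β μ m U + XW β μ m V := by
  rw [sub_eq_add_neg, ← XW_neg V]; exact XW_add_le hμ hm _ _

theorem XW_le_add_sub (hμ : 0 < μ) (hm : EvenS m) (U V : RealL2 × RealL2) :
    XW β μ m U ≤ XW β μ m V + XW β μ m (U - V) := by
  have := XW_add_le (β := β) hμ hm V (U - V)
  rwa [add_sub_cancel] at this

theorem XW_mono {c : ℝ} (h : ∀ ξ, |m ξ| ≤ c * |m' ξ|) (U : RealL2 × RealL2) :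
    XW β μ m U ≤ ENNReal.ofReal c * XW β μ m' U := by
  unfold XW
  rw [mul_add]
  refine add_le_add (wN_mono (fun ξ => ?_) _) (wN_mono (fun ξ => ?_) _) <;>
  · rw [abs_mul, abs_mul, ← mul_assoc]
    exact mul_le_mul_of_nonneg_right (h ξ) (abs_nonneg _)

theorem XW_mono_of_le (hm0 : ∀ ξ, 0 ≤ m ξ) (h : ∀ ξ, m ξ ≤ m' ξ) (U : RealL2 × RealL2) :
    XW β μ m U ≤ XW β μ m' U := by
  have := XW_mono (β := β) (μ := μ) (m := m) (m' := m') (c := 1) (fun ξ => by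
    rw [one_mul]; exact abs_le_abs_of_nonneg (hm0 ξ) (h ξ)) U
  simpa using this

/-- Lower semicontinuity: each truncated norm is continuous on `L²`, and the full norm is recovered
as the truncations are removed. -/
theorem XW_le_of_tendsto (hμ : 0 < μ) (hm : EvenS m) {U : ℕ → RealL2 × RealL2}
    {W : RealL2 × RealL2} {c : ℝ≥0∞} (hU : Tendsto U atTop (𝓝 W))
    (h : ∀ᶠ n in atTop, XW β μ m (U n) ≤ c) : XW β μ m W ≤ c := by
  have hW : Tendsto U atTop (𝓝 (W.1, W.2)) := hU
  have h1 : ∀ R : ℝ, ‖Rm R (fun ξ => m ξ * √(lam β μ ξ)) W.1‖ₑ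
      + ‖Rm R (fun ξ => m ξ * √(tau μ ξ)) W.2‖ₑ ≤ c := fun R => by
    refine le_of_tendsto ((((Rm R _).continuous.tendsto _).comp
      ((continuous_fst.tendsto _).comp hU)).enorm.add (((Rm R _).continuous.tendsto _).comp
      ((continuous_snd.tendsto _).comp hU)).enorm) ?_
    filter_upwards [h] with n hn
    refine le_trans ?_ hn
    simp only [Function.comp_apply]
    rw [enorm_Rm (evenS_mul_sqrt_lam β μ hm), enorm_Rm (evenS_mul_sqrt_tau hμ hm)]
    unfold XW
    refine add_le_add ?_ ?_ <;>
    · exact wN_mono_of_abs_le (abs_cut_le _ _) _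
  have mono : ∀ (w : ℝ → ℝ) {R R' : ℝ}, R ≤ R' → ∀ f, wN (cut R w) f ≤ wN (cut R' w) f := by
    intro w R R' hR f
    refine wN_mono_of_abs_le (fun ξ => ?_) _
    unfold cut
    split_ifs with h2 h3 h3
    · simp
    · exact absurd (h2.trans hR) h3
    · simp
    · simp
  unfold XW
  by_cases hc : c = ∞
  · rw [hc]; exact le_top
  -- The two components need independent cutoffs, because their limits are taken one after the
  -- other. Monotonicity in the radius reduces to a common cutoff.
  have h2 : ∀ R R' : ℝ, wN (cut R fun ξ => m ξ * √(lam β μ ξ)) W.1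
      + wN (cut R' fun ξ => m ξ * √(tau μ ξ)) W.2 ≤ c := fun R R' => by
    refine le_trans (add_le_add (mono _ (le_max_left R R') _) (mono _ (le_max_right R R') _)) ?_
    rw [← enorm_Rm (evenS_mul_sqrt_lam β μ hm), ← enorm_Rm (evenS_mul_sqrt_tau hμ hm)]
    exact h1 _
  have h3 : ∀ R, wN (fun ξ => m ξ * √(lam β μ ξ)) W.1
      ≤ c - wN (cut R fun ξ => m ξ * √(tau μ ξ)) W.2 := fun R =>
    wN_le_of_cut (evenS_mul_sqrt_lam β μ hm).cont.measurable fun R' =>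
      ENNReal.le_sub_of_add_le_right
        (((le_add_self).trans (h2 R' R)).trans_lt (lt_top_iff_ne_top.2 hc)).ne (h2 R' R)
  have h4 : wN (fun ξ => m ξ * √(lam β μ ξ)) W.1 ≤ c := (h3 0).trans tsub_le_self
  have h5 := wN_le_of_cut (f := W.2) (c := c - wN (fun ξ => m ξ * √(lam β μ ξ)) W.1)
    (evenS_mul_sqrt_tau hμ hm).cont.measurable fun R => by
      refine ENNReal.le_sub_of_add_le_left (h4.trans_lt (lt_top_iff_ne_top.2 hc)).ne ?_
      exact (add_le_add_left (h3 R) _).trans (le_of_eq (tsub_add_cancel_of_le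
        ((le_add_self).trans (h2 0 R))))
  exact (add_le_add_right h5 _).trans (le_of_eq (add_tsub_cancel_of_le h4))

theorem wN_fst_le_XW (hβ : 0 < β) (hμ : 0 < μ) (U : RealL2 × RealL2) :
    wN m U.1 ≤ XW β μ m U := by
  refine le_trans ?_ le_self_add
  refine wN_mono_of_abs_le (fun ξ => ?_) _
  rw [abs_mul, abs_of_nonneg (Real.sqrt_nonneg _)]
  exact le_mul_of_one_le_right (abs_nonneg _) (Real.one_le_sqrt.2 (one_le_lam hβ hμ ξ))

theorem wN_snd_le_XW (hμ : 0 < μ) (U : RealL2 × RealL2) :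
    wN m U.2 ≤ XW β μ m U := by
  refine le_trans ?_ le_add_self
  refine wN_mono_of_abs_le (fun ξ => ?_) _
  rw [abs_mul, abs_of_nonneg (Real.sqrt_nonneg _)]
  exact le_mul_of_one_le_right (abs_nonneg _) (Real.one_le_sqrt.2 (one_le_tau hμ ξ))

/-- The size of `U` is controlled by low frequencies and by the weight `wt s ρ L`. -/
theorem XW_le_low_add_high (hμ : 0 < μ) (β s : ℝ) {ρ L : ℝ} (hρ : 0 < ρ) (hL : 0 < L) :
    ∃ K : ℝ, 0 ≤ K ∧ ∀ U : RealL2 × RealL2, XW β μ (fun ξ => jb ξ ^ s) U ≤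
      ENNReal.ofReal K * (‖U.1‖ₑ + ‖U.2‖ₑ) + ENNReal.ofReal L⁻¹ * XW β μ (wt s ρ L) U := by
  have hj := evenS_jb_rpow s
  have key : ∀ {u : ℝ → ℝ}, EvenS u → ∃ K : ℝ, 0 ≤ K ∧ ∀ f, wN (fun ξ => jb ξ ^ s * u ξ) f ≤
      ENNReal.ofReal K * ‖f‖ₑ + ENNReal.ofReal L⁻¹ * wN (fun ξ => wt s ρ L ξ * u ξ) f := by
    intro u hu
    -- Below `Lρ` the weight is bounded by a constant; above it `wt s ρ L ≥ L⟨ξ⟩^s`.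
    obtain ⟨C, hC⟩ := cut_bdd (L * ρ) (hj.mul hu).cont
    refine ⟨C, (abs_nonneg _).trans (hC 0), fun f => ?_⟩
    refine (wN_le_add (w₁ := fun _ => C) (w₂ := fun ξ => L⁻¹ * (wt s ρ L ξ * u ξ))
      measurable_const (((evenS_wt s ρ L).mul hu).cont.measurable.const_mul _)
      (fun ξ => ?_) f).trans (add_le_add ?_ ?_)
    · by_cases h : |ξ| ≤ L * ρ
      · have := hC ξ
        rw [cut, if_pos h] at this
        exact (this.trans (le_abs_self C)).trans (le_add_of_nonneg_right (abs_nonneg _))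
      · have h2 := le_wt_of_le (s := s) hρ ((not_le.1 h).le.trans (abs_le_jb ξ))
        refine le_add_of_nonneg_of_le (abs_nonneg _) ?_
        have p := jb_pos ξ
        rw [abs_mul, abs_mul, abs_mul, abs_of_pos (inv_pos.2 hL), abs_of_pos (wt_pos s ρ L ξ),
          abs_of_pos (by positivity), ← mul_assoc]
        refine mul_le_mul_of_nonneg_right ?_ (abs_nonneg _)
        rwa [le_inv_mul_iff₀ hL]
    · rw [← wN_one]
      refine wN_mono (fun ξ => ?_) f
      rw [abs_one, mul_one, abs_of_nonneg ((abs_nonneg _).trans (hC 0))]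
    · refine wN_mono (fun ξ => ?_) f
      rw [abs_mul, abs_of_pos (inv_pos.2 hL)]
  obtain ⟨K₁, h1, h1'⟩ := key (evenS_lam β μ).sqrt
  obtain ⟨K₂, h2, h2'⟩ := key (evenS_tau hμ).sqrt
  refine ⟨K₁ + K₂, by positivity, fun U => ?_⟩
  unfold XW
  refine (add_le_add (h1' U.1) (h2' U.2)).trans ?_
  rw [mul_add, mul_add, ENNReal.ofReal_add h1 h2, add_mul, add_mul]
  calc _ = ENNReal.ofReal K₁ * ‖U.1‖ₑ + ENNReal.ofReal K₂ * ‖U.2‖ₑ + _ := by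
        rw [add_add_add_comm]
    _ ≤ _ := by
      gcongr
      · exact le_self_add
      · exact le_add_self

/-- The norms differ only beyond `ρ`, and by dominated convergence the tail, even multiplied by `L`,
vanishes as `ρ → ∞`. The choice of `ρ` depends on `f`, hence on the individual datum. -/
theorem exists_wN_wt_le {s : ℝ} {u : ℝ → ℝ} (hu : EvenS u) {f : RealL2}
    (hf : wN (fun ξ => jb ξ ^ s * u ξ) f < ∞) (L : ℝ) (hL : 1 ≤ L) {ε : ℝ≥0∞} (hε : 0 < ε) :
    ∃ ρ₀ : ℝ, ∀ ρ, ρ₀ ≤ ρ → 0 < ρ → wN (fun ξ => wt s ρ L ξ * u ξ) f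
      ≤ wN (fun ξ => jb ξ ^ s * u ξ) f + ε := by
  set w : ℝ → ℝ := fun ξ => jb ξ ^ s * u ξ with hw
  have hwm : Measurable w := ((evenS_jb_rpow s).mul hu).cont.measurable
  set T : ℝ → ℝ → ℝ := fun ρ ξ => if ρ < jb ξ then L * w ξ else 0 with hT
  have hTm : ∀ ρ, Measurable (T ρ) := fun ρ =>
    Measurable.ite (measurableSet_lt measurable_const evenS_jb.cont.measurable)
      (hwm.const_mul L) measurable_const
  have hlim : Tendsto (fun ρ => ∫⁻ k : ℝ, ‖(T ρ (2 * Real.pi * k) : ℂ) * hat f k‖ₑ ^ 2) atTop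
      (𝓝 (∫⁻ _ : ℝ, 0)) := by
    apply tendsto_lintegral_filter_of_dominated_convergence
      (fun k : ℝ => ‖((L * w (2 * Real.pi * k) : ℝ) : ℂ) * hat f k‖ₑ ^ 2)
    · exact Eventually.of_forall fun ρ => ((measurable_weight (hTm ρ) f).enorm.pow_const 2)
    · refine Eventually.of_forall fun ρ => ae_of_all _ fun k => ?_
      gcongr
      rw [← ofReal_norm, ← ofReal_norm]
      apply ENNReal.ofReal_le_ofReal
      simp only [hT]
      split_ifs
      · exact le_rfl
      · simp only [Complex.ofReal_zero, zero_mul, norm_zero]; positivity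
    · rw [← eLpNorm_two_sq]
      have h1 : wN (fun ξ => L * w ξ) f < ∞ := by
        refine (wN_mono (c := |L|) (w' := w) (fun ξ => (abs_mul _ _).le) f).trans_lt ?_
        exact ENNReal.mul_lt_top (by simp) hf
      exact (ENNReal.pow_lt_top h1).ne
    · refine ae_of_all _ fun k => tendsto_const_nhds.congr' ?_
      filter_upwards [eventually_ge_atTop (jb (2 * Real.pi * k))] with ρ hρ
      simp only [hT]
      rw [if_neg (not_lt.2 hρ)]; simp
  rw [lintegral_zero] at hlim
  have h2 : ∀ᶠ ρ in atTop, wN (T ρ) f ≤ ε := by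
    have : ∀ᶠ ρ in atTop, ∫⁻ k : ℝ, ‖(T ρ (2 * Real.pi * k) : ℂ) * hat f k‖ₑ ^ 2 ≤ ε ^ 2 :=
      hlim.eventually_le_const (pos_iff_ne_zero.2 (pow_ne_zero 2 hε.ne'))
    filter_upwards [this] with ρ hρ
    rw [← eLpNorm_two_sq] at hρ
    exact (ENNReal.pow_le_pow_left_iff two_ne_zero).1 hρ
  obtain ⟨ρ₀, hρ₀⟩ := eventually_atTop.1 h2
  refine ⟨ρ₀, fun ρ h hρ => ?_⟩
  refine (wN_le_add hwm (hTm ρ) (fun ξ => ?_) f).trans (by gcongr; exact hρ₀ ρ h)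
  simp only [hT, hw]
  split_ifs with h3
  · refine le_add_of_nonneg_of_le (abs_nonneg _) ?_
    rw [abs_mul, ← mul_assoc, abs_mul]
    refine mul_le_mul_of_nonneg_right ?_ (abs_nonneg _)
    have p := jb_pos ξ
    rw [abs_of_pos (wt_pos s ρ L ξ), abs_of_pos (by positivity)]
    exact wt_le hL ξ
  · rw [wt_eq_of_le hρ (not_lt.1 h3)]; simp

theorem exists_XW_wt_le (hμ : 0 < μ) {s : ℝ} {U : RealL2 × RealL2}
    (hU : XW β μ (fun ξ => jb ξ ^ s) U < ∞) {L : ℝ} (hL : 1 ≤ L) :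
    ∃ ρ : ℝ, 0 < ρ ∧ XW β μ (wt s ρ L) U ≤ XW β μ (fun ξ => jb ξ ^ s) U + 1 := by
  unfold XW at hU
  rw [ENNReal.add_lt_top] at hU
  obtain ⟨ρ₁, h1⟩ := exists_wN_wt_le (evenS_lam β μ).sqrt hU.1 L hL
    (ε := ENNReal.ofReal (1 / 2)) (by simp)
  obtain ⟨ρ₂, h2⟩ := exists_wN_wt_le (evenS_tau hμ).sqrt hU.2 L hL
    (ε := ENNReal.ofReal (1 / 2)) (by simp)
  have hpos : 0 < max 1 (max ρ₁ ρ₂) := one_pos.trans_le (le_max_left _ _)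
  refine ⟨max 1 (max ρ₁ ρ₂), hpos, ?_⟩
  unfold XW
  refine (add_le_add (h1 _ ((le_max_left _ _).trans (le_max_right _ _)) hpos)
    (h2 _ ((le_max_right _ _).trans (le_max_right _ _)) hpos)).trans (le_of_eq ?_)
  rw [add_add_add_comm, ← ENNReal.ofReal_add (by norm_num) (by norm_num)]
  norm_num

end XW

/-! ### Ordinary differential equations -/

section ODE
variable {E : Type*} [NormedAddCommGroup E] [NormedSpace ℝ E]

/-- The radial retraction on the ball of radius `r`. -/
def radial (r : ℝ) (x : E) : E := (r / max r ‖x‖) • x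

theorem radial_eq {r : ℝ} (hr : 0 < r) {x : E} (hx : ‖x‖ ≤ r) : radial r x = x := by
  rw [radial, max_eq_left hx, div_self hr.ne', one_smul]

theorem norm_radial_le {r : ℝ} (hr : 0 < r) (x : E) : ‖radial r x‖ ≤ r := by
  have h : 0 < max r ‖x‖ := hr.trans_le (le_max_left _ _)
  rw [radial, norm_smul, Real.norm_of_nonneg (by positivity), div_mul_eq_mul_div, div_le_iff₀ h]
  exact mul_le_mul_of_nonneg_left (le_max_right _ _) hr.le

theorem norm_radial_sub_le {r : ℝ} (hr : 0 < r) (x y : E) :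
    ‖radial r x - radial r y‖ ≤ 2 * ‖x - y‖ := by
  unfold radial
  set M := max r ‖x‖ with hM
  set N := max r ‖y‖ with hN
  have h1 : 0 < M := hr.trans_le (le_max_left _ _)
  have h2 : 0 < N := hr.trans_le (le_max_left _ _)
  have e : (r / M) • x - (r / N) • y = (r / M) • (x - y) + ((r / M) * ((N - M) / N)) • y := by
    have : r / N = r / M - (r / M) * ((N - M) / N) := by field_simp; ring
    rw [this]; module
  have h3 : |N - M| ≤ ‖x - y‖ := by
    rw [abs_sub_comm]
    refine (abs_max_sub_max_le_max _ _ _ _).trans ?_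
    rw [sub_self, abs_zero, max_eq_right (abs_nonneg _)]
    exact abs_norm_sub_norm_le x y
  have h4 : r / M ≤ 1 := (div_le_one h1).2 (le_max_left _ _)
  have h5 : ‖y‖ / N ≤ 1 := (div_le_one h2).2 (le_max_right _ _)
  have h0 : 0 ≤ r / M := by positivity
  rw [e]
  refine (norm_add_le _ _).trans ?_
  rw [norm_smul, norm_smul, Real.norm_of_nonneg h0, norm_mul, Real.norm_of_nonneg h0, norm_div,
    Real.norm_of_nonneg h2.le, Real.norm_eq_abs]
  have h6 : r / M * ‖x - y‖ ≤ 1 * ‖x - y‖ := by gcongr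
  have h7 : r / M * (|N - M| / N) * ‖y‖ ≤ 1 * (‖x - y‖ * 1) := by
    calc r / M * (|N - M| / N) * ‖y‖ = r / M * (|N - M| * (‖y‖ / N)) := by ring
      _ ≤ _ := by gcongr
  linarith

/-- A globally bounded field cannot leave the ball of radius `Lτ`, so Picard–Lindelöf applies on the
whole interval. -/
theorem exists_solution_of_lipschitz [CompleteSpace E] {f : E → E} {K L : ℝ}
    (hK : ∀ x y, ‖f x - f y‖ ≤ K * ‖x - y‖) (hL : ∀ x, ‖f x‖ ≤ L) (x₀ : E) {τ : ℝ} (hτ : 0 ≤ τ) :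
    ∃ u : ℝ → E, u 0 = x₀ ∧ ∀ t ∈ Icc 0 τ, HasDerivWithinAt u (f (u t)) (Icc 0 τ) t := by
  have hlip : LipschitzWith K.toNNReal f := LipschitzWith.of_dist_le_mul fun x y => by
    rw [dist_eq_norm, dist_eq_norm]
    exact (hK x y).trans (mul_le_mul_of_nonneg_right (Real.le_coe_toNNReal K) (norm_nonneg _))
  have hP : IsPicardLindelof (fun _ => f) (⟨0, left_mem_Icc.2 hτ⟩ : Icc (0 : ℝ) τ) x₀
      (L.toNNReal * τ.toNNReal) 0 L.toNNReal K.toNNReal := by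
    refine ⟨fun _ _ => hlip.lipschitzOnWith, fun _ _ => continuousOn_const,
      fun _ _ x _ => (hL x).trans (Real.le_coe_toNNReal L), ?_⟩
    simp [hτ]
  exact hP.exists_eq_forall_mem_Icc_hasDerivWithinAt₀

/-- The times up to which `y ≤ 2N` form a closed set. The improvement to `y ≤ N` and continuity
extend it to the right. -/
theorem le_of_bootstrap {y : ℝ → ℝ} {τ N : ℝ} (hN : 0 < N) (hc : ContinuousOn y (Icc 0 τ))
    (h0 : y 0 ≤ N) (h : ∀ t ∈ Icc 0 τ, (∀ r ∈ Icc 0 t, y r ≤ 2 * N) → y t ≤ N) :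
    ∀ t ∈ Icc 0 τ, y t ≤ N := by
  have hsub : Icc 0 τ ⊆ {t | y t ≤ 2 * N} := by
    refine IsClosed.Icc_subset_of_forall_mem_nhdsGT_of_Icc_subset ?_ ?_ ?_
    · have := hc.preimage_isClosed_of_isClosed isClosed_Icc (isClosed_Iic (a := 2 * N))
      rwa [inter_comm] at this
    · simp only [mem_ofPred_eq]; linarith
    · intro t ht hsub
      have h1 := h t ⟨ht.1, ht.2.le⟩ (fun r hr => hsub hr)
      have h2 : ∀ᶠ r in 𝓝[Icc 0 τ] t, y r < 2 * N :=
        (hc t ⟨ht.1, ht.2.le⟩).eventually_lt_const (by linarith)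
      have h3 : 𝓝[>] t ≤ 𝓝[Icc 0 τ] t := by
        apply nhdsWithin_le_of_mem
        filter_upwards [Icc_mem_nhdsGT ht.2] with r hr using ⟨ht.1.trans hr.1, hr.2⟩
      exact (h2.filter_mono h3).mono fun r hr => hr.le
  exact fun t ht => h t ht fun r hr => hsub ⟨hr.1, hr.2.trans ht.2⟩

theorem norm_sub_le_of_deriv {f f' : ℝ → E} {τ C : ℝ}
    (hf : ∀ t ∈ Icc 0 τ, HasDerivWithinAt f (f' t) (Icc 0 τ) t) (hC : ∀ t ∈ Icc 0 τ, ‖f' t‖ ≤ C)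
    {t : ℝ} (ht : t ∈ Icc 0 τ) : ‖f t - f 0‖ ≤ C * t := by
  have := (convex_Icc 0 τ).norm_image_sub_le_of_norm_hasDerivWithin_le hf hC
    (left_mem_Icc.2 (ht.1.trans ht.2)) ht
  rwa [sub_zero, Real.norm_of_nonneg ht.1] at this

end ODE

/-! ### Frequency truncation of pairs -/

/-- The projection of pairs on frequencies `≤ n`. -/
def PX (n : ℝ) : RealL2 × RealL2 →L[ℝ] RealL2 × RealL2 :=
  (Rm n (fun _ => 1)).prodMap (Rm n (fun _ => 1))

theorem PX_apply (n : ℝ) (U : RealL2 × RealL2) :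
    PX n U = (Rm n (fun _ => 1) U.1, Rm n (fun _ => 1) U.2) := rfl

theorem wN_proj_le (w : ℝ → ℝ) (n : ℝ) (f : RealL2) : wN w (Rm n (fun _ => 1) f) ≤ wN w f := by
  have := wN_le_of_hat_le (w := w) (w' := w) (c := 1) (f := Rm n (fun _ => 1) f) (g := f) (by
    filter_upwards [hat_Rm (evenS_const 1) n f] with k hk
    rw [hk, one_mul, norm_mul, norm_mul, norm_mul, Complex.norm_real, Complex.norm_real]
    refine mul_le_mul_of_nonneg_left (mul_le_of_le_one_left (norm_nonneg _) ?_) (norm_nonneg _)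
    simpa using abs_cut_le n (fun _ => 1) (2 * Real.pi * k))
  rwa [ENNReal.ofReal_one, one_mul] at this

theorem XW_PX_le (β μ : ℝ) (m : ℝ → ℝ) (n : ℝ) (U : RealL2 × RealL2) :
    XW β μ m (PX n U) ≤ XW β μ m U :=
  add_le_add (wN_proj_le _ _ _) (wN_proj_le _ _ _)

/-- Beyond frequency `n` one has `1 ≤ ⟨ξ⟩/n`. Truncating the datum thus changes it little in the
supremum norm, which preserves non-cavitation for large `n`. -/
theorem aN_one_sub_proj_le {n : ℝ} (hn : 0 < n) (f : RealL2) :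
    aN (fun _ => 1) (f - Rm n (fun _ => 1) f) ≤ ENNReal.ofReal n⁻¹ * aN jb f := by
  refine aN_le_of_hat_le ?_
  rw [hat_sub]
  filter_upwards [hat_Rm (evenS_const 1) n f,
    Lp.coeFn_sub (hat f) (hat (Rm n (fun _ => 1) f))] with k h1 h2
  rw [h2, Pi.sub_apply, h1, cut]
  split_ifs with h
  · simp only [Complex.ofReal_one, one_mul, sub_self, norm_zero]; positivity
  · rw [Complex.ofReal_one, Complex.ofReal_zero, zero_mul, sub_zero, one_mul, norm_mul,
      Complex.norm_real, Real.norm_of_nonneg (jb_pos _).le, ← mul_assoc]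
    refine le_mul_of_one_le_left (norm_nonneg _) ?_
    rw [← div_eq_inv_mul, one_le_div hn]
    exact (not_le.1 h).le.trans (abs_le_jb _)

/-! ### Energies and norms -/

theorem sqrt_eN_le {β μ : ℝ} (hμ : 0 < μ) {m : ℝ → ℝ} (hm : EvenS m) (R : ℝ) {x : ℝ}
    {U : RealL2 × RealL2} (hx : 0 ≤ x) (hU : XW β μ m U ≤ ENNReal.ofReal x) :
    eN β μ R (Rm R m U.1) (Rm R m U.2) ≤ x ^ 2 := by
  unfold eN
  have key : ∀ {u : ℝ → ℝ}, EvenS u → ∀ f, ‖Rm R u (Rm R m f)‖ₑ ≤ wN (fun ξ => m ξ * u ξ) f := by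
    intro u hu f
    rw [Rm_Rm hu hm, enorm_Rm (hu.mul hm)]
    refine wN_mono_of_abs_le (fun ξ => (abs_cut_le _ _ _).trans (by rw [mul_comm])) f
  have h := (add_le_add (key (evenS_lam β μ).sqrt U.1) (key (evenS_tau hμ).sqrt U.2)).trans hU
  rw [← ofReal_norm, ← ofReal_norm, ← ENNReal.ofReal_add (norm_nonneg _) (norm_nonneg _),
    ENNReal.ofReal_le_ofReal_iff hx] at h
  set a := ‖Rm R (fun ξ => √(lam β μ ξ)) (Rm R m U.1)‖
  set b := ‖Rm R (fun ξ => √(tau μ ξ)) (Rm R m U.2)‖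
  have ha : 0 ≤ a := norm_nonneg _
  have hb : 0 ≤ b := norm_nonneg _
  nlinarith [mul_nonneg ha hb]

theorem XW_le_of_eN {β μ : ℝ} (hμ : 0 < μ) {m : ℝ → ℝ} (hm : EvenS m) {R y : ℝ}
    {U : RealL2 × RealL2} (h1 : Band R U.1) (h2 : Band R U.2) (hy : 0 ≤ y)
    (hU : eN β μ R (Rm R m U.1) (Rm R m U.2) ≤ y ^ 2) :
    XW β μ m U ≤ ENNReal.ofReal (2 * y) := by
  unfold eN at hU
  have key : ∀ {u : ℝ → ℝ}, EvenS u → ∀ {f}, Band R f → ‖Rm R u (Rm R m f)‖ ^ 2 ≤ y ^ 2 →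
      wN (fun ξ => m ξ * u ξ) f ≤ ENNReal.ofReal y := by
    intro u hu f hf h
    rw [← wN_eq_of_band hf, ← enorm_Rm (hm.mul hu)]
    have e : Rm R (fun ξ => m ξ * u ξ) f = Rm R u (Rm R m f) := by
      rw [Rm_Rm hu hm]; simp only [mul_comm]
    rw [e, ← ofReal_norm]
    exact ENNReal.ofReal_le_ofReal ((sq_le_sq₀ (norm_nonneg _) hy).1 h)
  unfold XW
  rw [two_mul, ENNReal.ofReal_add hy hy]
  exact add_le_add
    (key (evenS_lam β μ).sqrt h1 (by linarith [sq_nonneg ‖Rm R (fun ξ => √(tau μ ξ)) (Rm R m U.2)‖]))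
    (key (evenS_tau hμ).sqrt h2 (by linarith [sq_nonneg ‖Rm R (fun ξ => √(lam β μ ξ)) (Rm R m U.1)‖]))

theorem norm_le_of_XW {β μ : ℝ} (hβ : 0 < β) (hμ : 0 < μ) {m : ℝ → ℝ} (hm : ∀ ξ, 1 ≤ m ξ) {x : ℝ}
    {U : RealL2 × RealL2} (hx : 0 ≤ x) (hU : XW β μ m U ≤ ENNReal.ofReal x) : ‖U‖ ≤ x := by
  have h : ∀ f, ‖f‖ₑ ≤ wN m f := fun f => by
    rw [← wN_one]
    exact wN_mono_of_abs_le (fun ξ => abs_le_abs_of_nonneg zero_le_one (hm ξ)) f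
  exact max_le (norm_le_of_enorm_le hx ((h _).trans ((wN_fst_le_XW hβ hμ U).trans hU)))
    (norm_le_of_enorm_le hx ((h _).trans ((wN_snd_le_XW hμ U).trans hU)))

theorem one_le_jb_rpow {s : ℝ} (hs : 0 ≤ s) (ξ : ℝ) : 1 ≤ jb ξ ^ s :=
  Real.one_le_rpow (one_le_jb ξ) hs

theorem le_of_aN_sub_le {f g : RealL2} {a b : ℝ} (hb : 0 ≤ b) (hf : ∀ᵐ x, a ≤ f x)
    (h : aN (fun _ => 1) (f - g) ≤ ENNReal.ofReal b) : ∀ᵐ x, a - b ≤ g x := by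
  have hW : Wiener (f - g) := h.trans_lt (by simp)
  filter_upwards [hf, hW.abs_le, Lp.coeFn_sub f g] with x h1 h2 h3
  have h4 := h2.trans (ENNReal.toReal_le_of_le_ofReal hb h)
  rw [h3, Pi.sub_apply] at h4
  linarith [(abs_le.1 h4).2]

/-! ### The regularized flow -/

/-- The truncated Fourier transform as a map to `L¹`. -/
theorem exists_fourier_L1 (R : ℝ) : ∃ T : RealL2 →L[ℝ] Lp ℂ 1 (volume : Measure ℝ),
    ∀ f, Band R f → ‖T f‖ₑ = aN (fun _ => 1) f := by
  have hu : MemLp (fun k : ℝ => (cut R (fun _ => 1) (2 * Real.pi * k) : ℂ)) 2 volume := by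
    have hm : Measurable (cut R (fun _ => 1)) := measurable_cut measurable_const
    have e : (fun k : ℝ => (cut R (fun _ => 1) (2 * Real.pi * k) : ℂ))
        = ({k : ℝ | |2 * Real.pi * k| ≤ R} : Set ℝ).indicator (fun _ => (1 : ℂ)) := by
      ext k
      simp only [cut, indicator, mem_ofPred_eq]
      split_ifs <;> simp
    rw [e]
    refine memLp_indicator_const 2 ?_ _ (Or.inr (ne_of_lt ?_))
    · exact measurableSet_le (by fun_prop) measurable_const
    · have hsub : {k : ℝ | |2 * Real.pi * k| ≤ R} ⊆ Icc (-(R / (2 * Real.pi))) (R / (2 * Real.pi)) := by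
        intro k hk
        have hp : 0 < 2 * Real.pi := by positivity
        rw [mem_ofPred_eq, abs_mul, abs_of_pos hp] at hk
        exact abs_le.1 ((le_div_iff₀ hp).2 (by linarith))
      exact (measure_mono hsub).trans_lt (by simp)
  refine ⟨(((ContinuousLinearMap.mul ℂ ℂ).holderL volume 2 2 1 hu.toLp).restrictScalars ℝ).comp
    hatL, fun f hf => ?_⟩
  rw [Lp.enorm_def, eLpNorm_one_eq_lintegral_enorm, aN]
  apply lintegral_congr_ae
  filter_upwards [(ContinuousLinearMap.mul ℂ ℂ).coeFn_holder (r := 1) hu.toLp (hat f),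
    hu.coeFn_toLp, hf.hat_eq_zero] with k h1 h2 h3
  have h1' : ((((ContinuousLinearMap.mul ℂ ℂ).holderL volume 2 2 1 hu.toLp).restrictScalars ℝ).comp
    hatL) f k = _ := h1
  rw [h1', h2]
  by_cases h : |2 * Real.pi * k| ≤ R
  · rw [cut, if_pos h]; simp
  · simp [h3 (not_le.1 h)]

section Regularized
variable {β μ n : ℝ}

theorem vf_zero : vf β μ n 0 = 0 := by simp [vf]

theorem norm_bilin_sub_le {E F G : Type*} [NormedAddCommGroup E] [NormedSpace ℝ E]
    [NormedAddCommGroup F] [NormedSpace ℝ F] [NormedAddCommGroup G] [NormedSpace ℝ G]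
    (Q : E →L[ℝ] F →L[ℝ] G) {r d : ℝ} {a a' : E} {b b' : F} (ha : ‖a - a'‖ ≤ d)
    (hb : ‖b - b'‖ ≤ d) (h1 : ‖a'‖ ≤ r) (h2 : ‖b‖ ≤ r) :
    ‖Q a b - Q a' b'‖ ≤ 2 * ‖Q‖ * r * d := by
  have e : Q a b - Q a' b' = Q (a - a') b + Q a' (b - b') := by
    rw [map_sub, map_sub, sub_apply]; abel
  have hr : 0 ≤ r := (norm_nonneg _).trans h1
  have hd : 0 ≤ d := (norm_nonneg _).trans ha
  rw [e]
  refine (norm_add_le _ _).trans ?_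
  have i1 : ‖Q (a - a') b‖ ≤ ‖Q‖ * d * r := (Q.le_opNorm₂ _ _).trans (by gcongr)
  have i2 : ‖Q a' (b - b')‖ ≤ ‖Q‖ * r * d := (Q.le_opNorm₂ _ _).trans (by gcongr)
  linarith

theorem exists_vf_lipschitz (β μ n : ℝ) {r : ℝ} (hr : 0 ≤ r) : ∃ K : ℝ, 0 ≤ K ∧
    ∀ U V : RealL2 × RealL2, ‖U‖ ≤ r → ‖V‖ ≤ r → ‖vf β μ n U - vf β μ n V‖ ≤ K * ‖U - V‖ := by
  set A := Aop μ n
  set D := Dop n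
  set Q := Pb (2 * n)
  set La := Rm (2 * n) (lam β μ)
  refine ⟨‖D‖ + ‖A‖ * (2 * ‖Q‖ * r) + ‖A‖ * ‖La‖, by positivity, fun U V hU hV => ?_⟩
  have u1 := (norm_fst_le U).trans hU
  have u2 := (norm_snd_le U).trans hU
  have v1 := (norm_fst_le V).trans hV
  have v2 := (norm_snd_le V).trans hV
  have d1 := norm_fst_le (U - V)
  have d2 := norm_snd_le (U - V)
  set d := ‖U - V‖ with hd
  have hd0 : 0 ≤ d := norm_nonneg _
  have b1 := norm_bilin_sub_le Q d1 d2 v1 u2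
  have b2 := norm_bilin_sub_le Q d2 d2 v2 u2
  have c1 : ‖A (Q U.1 U.2) - A (Q V.1 V.2)‖ ≤ ‖A‖ * (2 * ‖Q‖ * r * d) := by
    rw [← map_sub]; exact (A.le_opNorm _).trans (by gcongr)
  have c2 : ‖A (Q U.2 U.2) - A (Q V.2 V.2)‖ ≤ ‖A‖ * (2 * ‖Q‖ * r * d) := by
    rw [← map_sub]; exact (A.le_opNorm _).trans (by gcongr)
  have c3 : ‖D U.2 - D V.2‖ ≤ ‖D‖ * d := by
    rw [← map_sub]; exact (D.le_opNorm _).trans (by gcongr; exact d2)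
  have c4 : ‖A (La U.1) - A (La V.1)‖ ≤ ‖A‖ * (‖La‖ * d) := by
    rw [← map_sub, ← map_sub]
    exact (A.le_opNorm _).trans (by gcongr; exact (La.le_opNorm _).trans (by gcongr; exact d1))
  have p1 : 0 ≤ ‖A‖ * (2 * ‖Q‖ * r * d) := by positivity
  have p2 : 0 ≤ ‖D‖ * d := by positivity
  have p3 : 0 ≤ ‖A‖ * (‖La‖ * d) := by positivity
  refine max_le ?_ ?_
  · have e : (vf β μ n U - vf β μ n V).1
        = -((D U.2 - D V.2) + (A (Q U.1 U.2) - A (Q V.1 V.2))) := by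
      simp only [vf, Prod.fst_sub]; abel
    rw [e, norm_neg]
    refine (norm_add_le _ _).trans ?_
    linarith
  · have e : (vf β μ n U - vf β μ n V).2 = -((A (La U.1) - A (La V.1))
        + (1 / 2 : ℝ) • (A (Q U.2 U.2) - A (Q V.2 V.2))) := by
      simp only [vf, Prod.snd_sub]; module
    rw [e, norm_neg]
    refine (norm_add_le _ _).trans ?_
    rw [norm_smul, Real.norm_of_nonneg (by norm_num)]
    linarith

/-- The radial retraction makes the quadratic field bounded and globally Lipschitz. It is removed
later by an a priori bound that keeps the solution inside the ball. -/
theorem exists_truncated_flow (β μ n : ℝ) {r : ℝ} (hr : 0 < r) (U₀ : RealL2 × RealL2) {τ : ℝ}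
    (hτ : 0 ≤ τ) : ∃ U : ℝ → RealL2 × RealL2, U 0 = U₀ ∧
      ∀ t ∈ Icc 0 τ, HasDerivWithinAt U (vf β μ n (radial r (U t))) (Icc 0 τ) t := by
  obtain ⟨K, hK, hlip⟩ := exists_vf_lipschitz β μ n hr.le
  refine exists_solution_of_lipschitz (f := fun U => vf β μ n (radial r U)) (K := K * 2)
    (L := K * r) (fun U V => ?_) (fun U => ?_) U₀ hτ
  · refine (hlip _ _ (norm_radial_le hr U) (norm_radial_le hr V)).trans ?_
    rw [mul_assoc]
    exact mul_le_mul_of_nonneg_left (norm_radial_sub_le hr U V) hK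
  · have := hlip (radial r U) 0 (norm_radial_le hr U) (by simpa using hr.le)
    rw [vf_zero, sub_zero, sub_zero] at this
    exact this.trans (mul_le_mul_of_nonneg_left (norm_radial_le hr U) hK)

/-- The component at frequencies beyond `R` has zero derivative and vanishes initially. -/
theorem band_of_deriv {R τ : ℝ} {f f' : ℝ → RealL2}
    (hf : ∀ t ∈ Icc 0 τ, HasDerivWithinAt f (f' t) (Icc 0 τ) t) (hb : ∀ t ∈ Icc 0 τ, Band R (f' t))
    (h0 : Band R (f 0)) {t : ℝ} (ht : t ∈ Icc 0 τ) : Band R (f t) := by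
  have h := norm_sub_le_of_deriv (f := fun t => f t - Rm R (fun _ => 1) (f t))
    (f' := fun _ => 0) (C := 0) (fun t ht => ?_) (by simp) ht
  · rw [zero_mul, norm_le_zero_iff] at h
    have h0' : Rm R (fun _ => 1) (f 0) = f 0 := h0
    rw [h0', sub_self, sub_zero, sub_eq_zero] at h
    exact h.symm
  · have hb' : Rm R (fun _ => 1) (f' t) = f' t := hb t ht
    have := (hf t ht).sub (hasDerivWithinAt_clm (L := Rm R (fun _ => 1)) (hf t ht))
    rwa [hb', sub_self] at this

/-- The time derivative of `ζ` is bounded in the norm `‖ζ̂‖_{L¹}` by `α + 2α²`, so `ζ` decreases at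
most linearly in time. The mean value inequality is applied in `L¹` on the Fourier side, where the
supremum norm is controlled. -/
theorem le_fst_of_vf {α τ a : ℝ} (hμ : 0 < μ) (hα : 0 ≤ α) {U : ℝ → RealL2 × RealL2}
    (hU : ∀ t ∈ Icc 0 τ, HasDerivWithinAt U (vf β μ n (U t)) (Icc 0 τ) t)
    (h1 : ∀ t ∈ Icc 0 τ, Band (2 * n) (U t).1)
    (hα1 : ∀ t ∈ Icc 0 τ, aN jb (U t).1 ≤ ENNReal.ofReal α)
    (hα2 : ∀ t ∈ Icc 0 τ, aN jb (U t).2 ≤ ENNReal.ofReal α)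
    (h0 : ∀ᵐ x, a ≤ (U 0).1 x) {t : ℝ} (ht : t ∈ Icc 0 τ) :
    ∀ᵐ x, a - (α + 2 * α ^ 2) * t ≤ (U t).1 x := by
  obtain ⟨T, hT⟩ := exists_fourier_L1 (2 * n)
  have h00 : (0 : ℝ) ∈ Icc 0 τ := left_mem_Icc.2 (ht.1.trans ht.2)
  have hC : 0 ≤ α + 2 * α ^ 2 := by positivity
  have h := norm_sub_le_of_deriv (f := fun t => T (U t).1) (f' := fun t => T (vf β μ n (U t)).1)
    (C := α + 2 * α ^ 2)
    (fun t ht => T.hasFDerivAt.comp_hasDerivWithinAt t (hU t ht).fst) (fun t ht => ?_) ht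
  · rw [← map_sub] at h
    refine le_of_aN_sub_le (mul_nonneg hC ht.1) h0 ?_
    rw [← aN_neg, neg_sub, ← hT _ ((h1 t ht).sub (h1 0 h00)), ← ofReal_norm]
    exact ENNReal.ofReal_le_ofReal h
  · have h2 := aN_vf_fst_le (β := β) hμ hα (h1 t ht) (hα1 t ht) (hα2 t ht)
    rw [← hT _ (band_vf hμ _).1, ← ofReal_norm, ENNReal.ofReal_le_ofReal_iff hC] at h2
    exact h2

end Regularized

/-! ### Uniform bounds for the regularized solutions -/

/-- `U` solves the regularized system on `[0,τ]` with initial datum `W` (truncated), with bounds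
in all the weighted norms and with non-cavitation. -/
structure RegSol (s β μ n h M τ : ℝ) (W : RealL2 × RealL2) (U : ℝ → RealL2 × RealL2) : Prop where
  initial : U 0 = PX n W
  deriv : ∀ t ∈ Icc 0 τ, HasDerivWithinAt U (vf β μ n (U t)) (Icc 0 τ) t
  band : ∀ t ∈ Icc 0 τ, Band (2 * n) (U t).1 ∧ Band (2 * n) (U t).2
  -- One constant `M` for all `ρ` and `L`: the solution inherits the tail bounds of its own datum.
  bound : ∀ t ∈ Icc 0 τ, ∀ ρ L : ℝ, 0 < ρ → 1 ≤ L →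
    XW β μ (wt s ρ L) (U t) ≤ ENNReal.ofReal M * XW β μ (wt s ρ L) W
  lower : ∀ t ∈ Icc 0 τ, ∀ᵐ x, h - 1 ≤ (U t).1 x

theorem aN_jb_le_of_XW {s K β μ x : ℝ} (hβ : 0 < β) (hμ : 0 < μ) (hK : 0 ≤ K)
    (hKs : ∀ f : RealL2, aN jb f ≤ ENNReal.ofReal K * wN (fun ξ => jb ξ ^ s) f)
    {U : RealL2 × RealL2} (hU : XW β μ (fun ξ => jb ξ ^ s) U ≤ ENNReal.ofReal x) :
    aN jb U.1 ≤ ENNReal.ofReal (K * x) ∧ aN jb U.2 ≤ ENNReal.ofReal (K * x) := by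
  rw [ENNReal.ofReal_mul hK]
  exact ⟨(hKs _).trans (mul_le_mul_right ((wN_fst_le_XW hβ hμ U).trans hU) _),
    (hKs _).trans (mul_le_mul_right ((wN_snd_le_XW hμ U).trans hU) _)⟩

/-- As long as the norm is at most `2Mδ`, the energy grows by a factor at most `2` and `ζ` loses
little of its lower bound up to time `c/δ`. Coercivity then improves the norm bound, closing a
bootstrap that is uniform in `n`. -/
theorem exists_regSol {s : ℝ} (hs : 3 / 2 < s) {h c₀ : ℝ} (hh : 0 < h) (hh1 : h ≤ 1)
    (hc₀ : 0 < c₀) : ∃ M : ℝ, 1 ≤ M ∧ ∀ B : ℝ, 0 < B → ∃ c : ℝ, 0 < c ∧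
      ∀ β μ δ : ℝ, 0 < β → β ≤ B → 0 < μ → 0 < δ → δ ≤ c₀ → ∃ n₀ : ℝ, 0 < n₀ ∧
      ∀ W : RealL2 × RealL2, XW β μ (fun ξ => jb ξ ^ s) W ≤ ENNReal.ofReal δ →
        (∀ᵐ x, h - 1 ≤ W.1 x) → ∀ n, n₀ ≤ n →
        ∃ U, RegSol s β μ n (h / 2) M (c / δ) W U := by
  obtain ⟨K, hK1, hKs⟩ := exists_aN_jb_le hs
  obtain ⟨C, hC⟩ := adm_wt (s := s) (by linarith)
  have hK0 : 0 < K := by linarith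
  have hC0 : 0 ≤ C := (hC 1 1 one_pos le_rfl).const_nonneg
  -- Growth factor `2`, upper constant `1 + Kc₀` of the energy and lower constant `h/2` combine into
  -- `q`. Taking the root and adding the two components of `XW` gives `M = 2√q`.
  set q := 2 * (1 + K * c₀) / (h / 2) with hq
  have hq1 : 1 ≤ q := by
    rw [hq, one_le_div (by linarith)]
    nlinarith [mul_pos hK0 hc₀]
  set M := 2 * √q with hM
  have hsq1 : 1 ≤ √q := Real.one_le_sqrt.2 hq1
  have hM1 : 1 ≤ M := by linarith
  have hMsq : (M / 2) ^ 2 = q := by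
    rw [hM, mul_div_cancel_left₀ _ two_ne_zero, Real.sq_sqrt (by linarith)]
  -- `M` is fixed before `B`: only the time constant `c` is allowed to depend on the bound for `β`.
  refine ⟨M, hM1, fun B hB => ?_⟩
  -- Under the bootstrap hypothesis `α = κ₀δ` bounds the norms `aN jb` of both components.
  set κ₀ := K * (2 * M) with hκ₀
  have hκ₀0 : 0 < κ₀ := by positivity
  set κ := (14 + B + 8 * (2 + B) * C) * (1 + κ₀ * c₀) * κ₀ / (h / 2) with hκ
  have hκ0 : 0 < κ := by positivity
  set ν := κ₀ + 2 * κ₀ ^ 2 * c₀ with hν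
  have hν0 : 0 < ν := by positivity
  -- The first entry keeps the Gronwall factor below `2`, the second keeps the decrease of `ζ` below
  -- `h/4`.
  set c := min (Real.log 2 / κ) (h / 4 / ν) with hc
  have hlog : 0 < Real.log 2 := Real.log_pos (by norm_num)
  have hc0 : 0 < c := lt_min (by positivity) (by positivity)
  have hcκ : κ * c ≤ Real.log 2 := by
    have := min_le_left (Real.log 2 / κ) (h / 4 / ν)
    rw [le_div_iff₀ hκ0] at this
    rw [mul_comm]; exact this
  have hcν : ν * c ≤ h / 4 := by
    have := min_le_right (Real.log 2 / κ) (h / 4 / ν)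
    rw [le_div_iff₀ hν0] at this
    rw [mul_comm]; exact this
  refine ⟨c, hc0, fun β μ δ hβ hβB hμ hδ hδc => ?_⟩
  have hτ : 0 ≤ c / δ := by positivity
  -- For such `n` truncating the datum costs at most `h/4` in the lower bound. With the `h/4` lost
  -- in time, `h/2` remains.
  refine ⟨max 1 (4 * K * δ / h), one_pos.trans_le (le_max_left _ _), fun W hW hWl n hn => ?_⟩
  have hn0 : 0 < n := one_pos.trans_le ((le_max_left _ _).trans hn)
  have hnK : 4 * K * δ / h ≤ n := (le_max_right _ _).trans hn
  set α := κ₀ * δ with hα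
  have hα0 : 0 < α := by positivity
  have hj := evenS_jb_rpow s
  have hPW : XW β μ (fun ξ => jb ξ ^ s) (PX n W) ≤ ENNReal.ofReal δ := (XW_PX_le _ _ _ _ _).trans hW
  have hP0 : ∀ᵐ x, h - 1 - h / 4 ≤ (PX n W).1 x := by
    refine le_of_aN_sub_le (by positivity) hWl ?_
    refine (aN_one_sub_proj_le hn0 W.1).trans ?_
    refine (mul_le_mul_right (aN_jb_le_of_XW hβ hμ hK0.le hKs hW).1 _).trans ?_
    rw [← ENNReal.ofReal_mul (by positivity)]
    apply ENNReal.ofReal_le_ofReal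
    rw [inv_mul_le_iff₀ hn0]
    rw [div_le_iff₀ hh] at hnK
    linarith
  -- consequences of the bootstrap assumption
  have step : ∀ (U : ℝ → RealL2 × RealL2) (t : ℝ), 0 ≤ t → t ≤ c / δ → U 0 = PX n W →
      (∀ r ∈ Icc 0 t, HasDerivWithinAt U (vf β μ n (U r)) (Icc 0 t) r) →
      (∀ r ∈ Icc 0 t, Band (2 * n) (U r).1 ∧ Band (2 * n) (U r).2) →
      (∀ r ∈ Icc 0 t, XW β μ (fun ξ => jb ξ ^ s) (U r) ≤ ENNReal.ofReal (2 * M * δ)) →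
      (∀ r ∈ Icc 0 t, ∀ᵐ x, h / 2 - 1 ≤ (U r).1 x) ∧
      ∀ ρ L x : ℝ, 0 < ρ → 1 ≤ L → 0 ≤ x → XW β μ (wt s ρ L) W ≤ ENNReal.ofReal x →
        eN β μ (2 * n) (Rm (2 * n) (wt s ρ L) (U t).1) (Rm (2 * n) (wt s ρ L) (U t).2)
          ≤ (M / 2 * x) ^ 2 := by
    intro U t ht0 htc hU0 hU hb hX
    have ha : ∀ r ∈ Icc 0 t, aN jb (U r).1 ≤ ENNReal.ofReal α ∧ aN jb (U r).2 ≤ ENNReal.ofReal α :=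
      fun r hr => by
        have := aN_jb_le_of_XW hβ hμ hK0.le hKs (hX r hr)
        rwa [← mul_assoc] at this
    have hlow : ∀ r ∈ Icc 0 t, ∀ᵐ x, h / 2 - 1 ≤ (U r).1 x := fun r hr => by
      have h1 := le_fst_of_vf hμ hα0.le hU (fun r hr => (hb r hr).1) (fun r hr => (ha r hr).1)
        (fun r hr => (ha r hr).2) (a := h - 1 - h / 4) (by rw [hU0]; exact hP0) hr
      filter_upwards [h1] with x hx
      refine le_trans ?_ hx
      have h2 : (α + 2 * α ^ 2) * r ≤ h / 4 := by
        calc (α + 2 * α ^ 2) * r ≤ (α + 2 * α ^ 2) * (c / δ) := by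
              gcongr; exact hr.2.trans htc
          _ = (κ₀ + 2 * κ₀ ^ 2 * δ) * c := by rw [hα]; field_simp
          _ ≤ (κ₀ + 2 * κ₀ ^ 2 * c₀) * c := by gcongr
          _ ≤ h / 4 := hcν
      linarith
    refine ⟨hlow, fun ρ L x hρ hL hx hWx => ?_⟩
    have h1 := weighted_energy_bound (α₀ := K * δ) (h := h / 2) hβ hβB hμ hn0 (hC ρ L hρ hL) hα0.le
      (by positivity)
      (by linarith) (by linarith) hU (fun r hr => (hb r hr).1) (fun r hr => (hb r hr).2)
      (fun r hr => (ha r hr).1) (fun r hr => (ha r hr).2) hlow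
      (by rw [hU0]; exact (aN_jb_le_of_XW hβ hμ hK0.le hKs hPW).1) (right_mem_Icc.2 ht0)
    have h2 := sqrt_eN_le hμ (evenS_wt s ρ L) (2 * n) hx ((XW_PX_le β μ (wt s ρ L) n W).trans hWx)
    rw [← hU0] at h2
    have h3 : Real.exp ((14 + B + 8 * (2 + B) * C) * (1 + α) * α / (h / 2) * t) ≤ 2 := by
      rw [← Real.le_log_iff_exp_le (by norm_num)]
      refine le_trans ?_ hcκ
      calc (14 + B + 8 * (2 + B) * C) * (1 + α) * α / (h / 2) * t
          ≤ (14 + B + 8 * (2 + B) * C) * (1 + κ₀ * c₀) * α / (h / 2) * (c / δ) := by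
            gcongr; exact mul_le_mul_of_nonneg_left hδc hκ₀0.le
        _ = κ * c := by rw [hα, hκ]; field_simp
    have h4 := eN_nonneg β μ (2 * n) (Rm (2 * n) (wt s ρ L) (U 0).1) (Rm (2 * n) (wt s ρ L) (U 0).2)
    have h5 : h / 2 * eN β μ (2 * n) (Rm (2 * n) (wt s ρ L) (U t).1)
        (Rm (2 * n) (wt s ρ L) (U t).2) ≤ 2 * ((1 + K * c₀) * x ^ 2) := by
      refine h1.trans ?_
      have : K * δ ≤ K * c₀ := by gcongr
      gcongr
    rw [mul_pow, hMsq, hq, div_mul_eq_mul_div, le_div_iff₀ (by linarith)]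
    linarith
  -- The retraction radius is the bootstrap bound, so the retraction is inactive wherever that bound
  -- holds.
  have hr : 0 < 2 * M * δ := by positivity
  obtain ⟨U, hU0, hU⟩ := exists_truncated_flow β μ n hr (PX n W) hτ
  have hb : ∀ t ∈ Icc 0 (c / δ), Band (2 * n) (U t).1 ∧ Band (2 * n) (U t).2 := fun t ht => by
    refine ⟨band_of_deriv (fun t ht => (hU t ht).fst) (fun t ht => (band_vf hμ _).1) ?_ ht,
      band_of_deriv (fun t ht => (hU t ht).snd) (fun t ht => (band_vf hμ _).2) ?_ ht⟩
    · rw [hU0]; exact (band_Rm (evenS_const 1) n W.1).mono (by linarith)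
    · rw [hU0]; exact (band_Rm (evenS_const 1) n W.2).mono (by linarith)
  set y : ℝ → ℝ := fun t => eN β μ (2 * n) (Rm (2 * n) (fun ξ => jb ξ ^ s) (U t).1)
    (Rm (2 * n) (fun ξ => jb ξ ^ s) (U t).2) with hy
  -- The improved bootstrap level. The assumed level `2N` is below `(Mδ)²`, which still gives the
  -- norm bound `2Mδ`.
  set N := (M / 2 * δ) ^ 2 with hN
  have hN0 : 0 < N := by positivity
  have hXy : ∀ t ∈ Icc 0 (c / δ), y t ≤ 2 * N →
      XW β μ (fun ξ => jb ξ ^ s) (U t) ≤ ENNReal.ofReal (2 * M * δ) := fun t ht hyt => by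
    have h1 : y t ≤ (M * δ) ^ 2 := by
      refine hyt.trans ?_
      rw [hN]; nlinarith [mul_pos (one_pos.trans_le hM1) hδ]
    have := XW_le_of_eN hμ hj (hb t ht).1 (hb t ht).2 (by positivity) h1
    rwa [← mul_assoc] at this
  have hUc : ∀ t ∈ Icc 0 (c / δ), ContinuousWithinAt U (Icc 0 (c / δ)) t :=
    fun t ht => (hU t ht).continuousWithinAt
  have hyc : ContinuousOn y (Icc 0 (c / δ)) := by
    intro t ht
    have c1 := (hUc t ht).fst
    have c2 := (hUc t ht).snd
    have l : ∀ (L : RealL2 →L[ℝ] RealL2) {f : ℝ → RealL2},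
        ContinuousWithinAt f (Icc 0 (c / δ)) t →
        ContinuousWithinAt (fun r => L (f r)) (Icc 0 (c / δ)) t := fun L f hf =>
      L.continuous.continuousAt.comp_continuousWithinAt hf
    exact ((l _ (l _ c1)).norm.pow 2).add ((l _ (l _ c2)).norm.pow 2)
  have hfree : ∀ t ∈ Icc 0 (c / δ), (∀ r ∈ Icc 0 t, y r ≤ 2 * N) →
      ∀ r ∈ Icc 0 t, HasDerivWithinAt U (vf β μ n (U r)) (Icc 0 t) r := fun t ht hyt r hr' => by
    have hr2 : r ∈ Icc 0 (c / δ) := ⟨hr'.1, hr'.2.trans ht.2⟩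
    have h1 := norm_le_of_XW hβ hμ (one_le_jb_rpow (by linarith : 0 ≤ s)) hr.le
      (hXy r hr2 (hyt r hr'))
    have h2 := (hU r hr2).mono (Icc_subset_Icc_right ht.2)
    rwa [radial_eq hr h1] at h2
  have hbound : ∀ t ∈ Icc 0 (c / δ), y t ≤ N := by
    refine le_of_bootstrap hN0 hyc ?_ fun t ht hyt => ?_
    · have := sqrt_eN_le hμ hj (2 * n) hδ.le hPW
      rw [← hU0] at this
      refine this.trans ?_
      rw [hN]
      have : 1 * δ ≤ M / 2 * δ := by
        gcongr; linarith
      exact pow_le_pow_left₀ hδ.le (by linarith) 2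
    · have hsub : ∀ r ∈ Icc 0 t, r ∈ Icc 0 (c / δ) := fun r hr => ⟨hr.1, hr.2.trans ht.2⟩
      have := (step U t ht.1 ht.2 hU0 (hfree t ht hyt) (fun r hr => hb r (hsub r hr))
        (fun r hr => hXy r (hsub r hr) (hyt r hr))).2 1 1 δ one_pos le_rfl hδ.le
        (by rw [wt_one]; exact hW)
      rwa [wt_one] at this
  have hy2 : ∀ t ∈ Icc 0 (c / δ), y t ≤ 2 * N := fun t ht => (hbound t ht).trans (by linarith)
  have fin : ∀ t ∈ Icc 0 (c / δ), _ := fun t ht => step U t ht.1 ht.2 hU0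
    (hfree t ht fun r hr => hy2 r ⟨hr.1, hr.2.trans ht.2⟩)
    (fun r hr => hb r ⟨hr.1, hr.2.trans ht.2⟩)
    (fun r hr => hXy r ⟨hr.1, hr.2.trans ht.2⟩ (hy2 r ⟨hr.1, hr.2.trans ht.2⟩))
  refine ⟨U, hU0, hfree _ (right_mem_Icc.2 hτ) hy2, hb, fun t ht ρ L hρ hL => ?_, fun t ht =>
    (fin t ht).1 t (right_mem_Icc.2 ht.1)⟩
  have hfin : XW β μ (wt s ρ L) W ≠ ∞ := by
    refine ((XW_mono (c := L) (m' := fun ξ => jb ξ ^ s) (fun ξ => ?_) W).trans_lt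
      (ENNReal.mul_lt_top (by simp) (hW.trans_lt (by simp)))).ne
    have := jb_pos ξ
    rw [abs_of_pos (wt_pos s ρ L ξ), abs_of_pos (by positivity)]
    exact wt_le hL ξ
  have h1 := (fin t ht).2 ρ L (XW β μ (wt s ρ L) W).toReal hρ hL ENNReal.toReal_nonneg
    (ENNReal.ofReal_toReal hfin).ge
  have h2 := XW_le_of_eN hμ (evenS_wt s ρ L) (hb t ht).1 (hb t ht).2
    (by positivity) h1
  refine h2.trans (le_of_eq ?_)
  rw [← mul_assoc, mul_div_cancel₀ _ two_ne_zero, ENNReal.ofReal_mul (by linarith),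
    ENNReal.ofReal_toReal hfin]

/-! ### Truncations of the exact vector field -/

/-- The frequencies `≤ R` of the right-hand side of the system. -/
def Fr (β μ R : ℝ) (U : RealL2 × RealL2) : RealL2 × RealL2 :=
  (-(Sm R (fun ξ => ξ) U.2 + Sm R (aS μ) (pr U.1 U.2)),
    -(Sm R (fun ξ => aS μ ξ * lam β μ ξ) U.1 + (1 / 2 : ℝ) • Sm R (aS μ) (pr U.2 U.2)))

theorem oddS_aS_mul_lam {β μ : ℝ} (hμ : 0 < μ) : OddS (fun ξ => aS μ ξ * lam β μ ξ) := by
  have := (evenS_lam β μ).mul_odd (oddS_aS hμ)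
  simpa only [mul_comm] using this

theorem proj_Sm {w u : ℝ → ℝ} (hw : OddS w) (hu : OddS u) {R R' : ℝ} (hR : R ≤ R')
    (h : ∀ ξ, |ξ| ≤ R → w ξ = u ξ) (f : RealL2) : Rm R (fun _ => 1) (Sm R' w f) = Sm R u f := by
  apply eq_of_hat_ae_eq
  filter_upwards [hat_Rm (evenS_const 1) R (Sm R' w f), hat_Sm hw R' f, hat_Sm hu R f]
    with k h1 h2 h3
  rw [h1, h2, h3]
  unfold cut
  split_ifs with h4 h5 h5
  · rw [h _ h4]; simp
  · exact absurd (h4.trans hR) h5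
  · simp
  · simp

theorem Sm_proj {w u : ℝ → ℝ} (hw : OddS w) (hu : OddS u) {R R' : ℝ} (hR : R ≤ R')
    (h : ∀ ξ, |ξ| ≤ R → w ξ = u ξ) (f : RealL2) : Sm R' w (Rm R (fun _ => 1) f) = Sm R u f := by
  apply eq_of_hat_ae_eq
  filter_upwards [hat_Rm (evenS_const 1) R f, hat_Sm hw R' (Rm R (fun _ => 1) f), hat_Sm hu R f]
    with k h1 h2 h3
  rw [h2, h1, h3]
  unfold cut
  split_ifs with h4 h5 h5
  · rw [h _ h5]; simp
  · simp
  · exact absurd (h5.trans hR) h4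
  · simp

section
variable {β μ n : ℝ}

theorem Aop_Rm_lam (hμ : 0 < μ) (f : RealL2) : Aop μ n (Rm (2 * n) (lam β μ) f)
    = Sm (2 * n) (fun ξ => lam β μ ξ * (chi n ξ * aS μ ξ)) f :=
  Sm_Rm (evenS_lam β μ) (oddS_chi_aS hμ) _ _

/-- The cutoff equals `1` up to frequency `n`, so at those frequencies the regularized field is the
exact one. -/
theorem PX_vf (hμ : 0 < μ) (hn : 0 < n) {R : ℝ} (hR : R ≤ n) {U : RealL2 × RealL2}
    (h1 : Band (2 * n) U.1) (h2 : Band (2 * n) U.2) : PX R (vf β μ n U) = Fr β μ R U := by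
  have hR2 : R ≤ 2 * n := by linarith
  have hA : ∀ q, Rm R (fun _ => 1) (Aop μ n q) = Sm R (aS μ) q := fun q =>
    proj_Sm (oddS_chi_aS hμ) (oddS_aS hμ) hR2
      (fun ξ hξ => by rw [chi_eq_one hn (hξ.trans hR), one_mul]) q
  have hD : ∀ q, Rm R (fun _ => 1) (Dop n q) = Sm R (fun ξ => ξ) q := fun q =>
    proj_Sm oddS_chi_id oddS_id hR2 (fun ξ hξ => by rw [chi_eq_one hn (hξ.trans hR), one_mul]) q
  rw [PX_apply, vf, Fr, Pb_eq h1, Pb_eq h2, Aop_Rm_lam hμ]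
  simp only
  rw [map_neg, map_add, map_neg, map_add, map_smul, hA, hA, hD,
    proj_Sm ((evenS_lam β μ).mul_odd (oddS_chi_aS hμ)) (oddS_aS_mul_lam (β := β) hμ) hR2
      (fun ξ hξ => by rw [chi_eq_one hn (hξ.trans hR), one_mul, mul_comm])]

/-- The defect of a truncated solution in the regularized system. -/
def defect (μ n : ℝ) (U : RealL2 × RealL2) : RealL2 × RealL2 :=
  (-Aop μ n (Rm n (fun _ => 1) (pr U.1 U.2) - pr (Rm n (fun _ => 1) U.1) (Rm n (fun _ => 1) U.2)),
    -((1 / 2 : ℝ) • Aop μ n (Rm n (fun _ => 1) (pr U.2 U.2)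
      - pr (Rm n (fun _ => 1) U.2) (Rm n (fun _ => 1) U.2))))

/-- Truncation commutes with every linear term; the defect arises only because it does not commute
with products. -/
theorem Fr_eq_vf_add_defect (hμ : 0 < μ) (hn : 0 < n) (U : RealL2 × RealL2) :
    Fr β μ n U = vf β μ n (PX n U) + defect μ n U := by
  have hn2 : n ≤ 2 * n := by linarith
  have hA : ∀ q, Aop μ n (Rm n (fun _ => 1) q) = Sm n (aS μ) q := fun q =>
    Sm_proj (oddS_chi_aS hμ) (oddS_aS hμ) hn2 (fun ξ hξ => by rw [chi_eq_one hn hξ, one_mul]) q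
  have hD : ∀ q, Dop n (Rm n (fun _ => 1) q) = Sm n (fun ξ => ξ) q := fun q =>
    Sm_proj oddS_chi_id oddS_id hn2 (fun ξ hξ => by rw [chi_eq_one hn hξ, one_mul]) q
  have b1 := (band_Rm (evenS_const 1) n U.1).mono hn2
  have b2 := (band_Rm (evenS_const 1) n U.2).mono hn2
  rw [PX_apply, vf, Fr, defect]
  simp only
  rw [Pb_eq b1, Pb_eq b2, Aop_Rm_lam hμ,
    Sm_proj ((evenS_lam β μ).mul_odd (oddS_chi_aS hμ)) (oddS_aS_mul_lam (β := β) hμ) hn2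
      (fun ξ hξ => by rw [chi_eq_one hn hξ, one_mul, mul_comm]), map_sub, map_sub, hA, hA, hD]
  refine Prod.ext ?_ ?_
  · simp only [Prod.fst_add]; abel
  · simp only [Prod.snd_add]; module

theorem norm_Sm_id_le {R x : ℝ} {q : RealL2} (hx : 0 ≤ x) (h : wN jb q ≤ ENNReal.ofReal x) :
    ‖Sm R (fun ξ => ξ) q‖ ≤ x := by
  refine norm_le_of_enorm_le hx (le_trans ?_ h)
  rw [enorm_Sm oddS_id]
  refine wN_mono_of_abs_le (fun ξ => (abs_cut_le _ _ _).trans ?_) q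
  rw [abs_of_pos (jb_pos ξ)]; exact abs_le_jb ξ

theorem aN_one_toReal_le {f : RealL2} {x : ℝ} (h : aN jb f ≤ ENNReal.ofReal x) :
    aN (fun _ => 1) f ≤ ENNReal.ofReal x := (aN_one_le_jb f).trans h

theorem wN_trunc_pr_le' {s K x : ℝ} (hs : 1 ≤ s) (hn : 0 < n) (hx : 0 ≤ x) (hK : 0 ≤ K)
    {f g : RealL2} (hf : aN jb f ≤ ENNReal.ofReal (K * x)) (hg : aN jb g ≤ ENNReal.ofReal (K * x))
    (hf' : wN (fun ξ => jb ξ ^ s) f ≤ ENNReal.ofReal x)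
    (hg' : wN (fun ξ => jb ξ ^ s) g ≤ ENNReal.ofReal x) :
    wN jb (Rm n (fun _ => 1) (pr f g) - pr (Rm n (fun _ => 1) f) (Rm n (fun _ => 1) g)) ≤
      ENNReal.ofReal (2 * (n / 2) ^ (1 - s) * (2 * K * x ^ 2)) := by
  refine (wN_trunc_pr_le hs hn (Wiener.of_jb hf) (Wiener.of_jb hg)).trans ?_
  rw [ENNReal.ofReal_mul (p := 2 * (n / 2) ^ (1 - s)) (q := 2 * K * x ^ 2) (by positivity)]
  refine mul_le_mul' le_rfl ?_
  calc aN (fun _ => 1) f * wN (fun ξ => jb ξ ^ s) g + wN (fun ξ => jb ξ ^ s) f * aN (fun _ => 1) g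
      ≤ ENNReal.ofReal (K * x) * ENNReal.ofReal x + ENNReal.ofReal x * ENNReal.ofReal (K * x) := by
        gcongr
        · exact aN_one_toReal_le hf
        · exact aN_one_toReal_le hg
    _ = _ := by
        rw [← ENNReal.ofReal_mul (by positivity), ← ENNReal.ofReal_mul hx,
          ← ENNReal.ofReal_add (by positivity) (by positivity)]
        congr 1; ring

theorem norm_defect_le {s K x B : ℝ} (hβ : 0 < β) (hB : β ≤ B) (hμ : 0 < μ) (hs : 1 ≤ s)
    (hn : 0 < n) (hx : 0 ≤ x) (hK : 0 ≤ K)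
    (hKs : ∀ f : RealL2, aN jb f ≤ ENNReal.ofReal K * wN (fun ξ => jb ξ ^ s) f)
    {U : RealL2 × RealL2} (hU : XW β μ (fun ξ => jb ξ ^ s) U ≤ ENNReal.ofReal x) :
    ‖Rm (2 * n) (fun ξ => √(lam β μ ξ)) (defect μ n U).1‖
        ≤ (2 + B) * (2 * (n / 2) ^ (1 - s) * (2 * K * x ^ 2)) ∧
      ‖Rm (2 * n) (fun ξ => √(tau μ ξ)) (defect μ n U).2‖
        ≤ (2 + B) * (2 * (n / 2) ^ (1 - s) * (2 * K * x ^ 2)) := by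
  have hB0 : 0 < B := hβ.trans_le hB
  obtain ⟨a1, a2⟩ := aN_jb_le_of_XW hβ hμ hK hKs hU
  have w1 := (wN_fst_le_XW (m := fun ξ => jb ξ ^ s) hβ hμ U).trans hU
  have w2 := (wN_snd_le_XW (m := fun ξ => jb ξ ^ s) (β := β) hμ U).trans hU
  have h0 : 0 ≤ 2 * (n / 2) ^ (1 - s) * (2 * K * x ^ 2) := by positivity
  constructor
  · simp only [defect]
    rw [map_neg, norm_neg]
    refine (norm_lam_Aop_le hβ hB hμ _).trans (mul_le_mul_of_nonneg_left ?_ (by linarith))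
    exact norm_Sm_id_le h0 (wN_trunc_pr_le' hs hn hx hK a1 a2 w1 w2)
  · simp only [defect]
    rw [map_neg, norm_neg, map_smul, norm_smul, Real.norm_of_nonneg (by norm_num)]
    have h1 := (norm_tau_Aop_le hμ (n := n) _).trans
      (norm_Sm_id_le h0 (wN_trunc_pr_le' hs hn hx hK a2 a2 w2 w2))
    nlinarith [norm_nonneg (Rm (2 * n) (fun ξ => √(tau μ ξ)) (Aop μ n
      (Rm n (fun _ => 1) (pr U.2 U.2) - pr (Rm n (fun _ => 1) U.2) (Rm n (fun _ => 1) U.2))))]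

theorem norm_sq_le_eN {R : ℝ} (hβ : 0 < β) (hμ : 0 < μ) {U : RealL2 × RealL2}
    (h1 : Band R U.1) (h2 : Band R U.2) : ‖U‖ ^ 2 ≤ eN β μ R U.1 U.2 := by
  have b1 := norm_le_sqrt_Rm (evenS_lam β μ) (one_le_lam hβ hμ) h1
  have b2 := norm_le_sqrt_Rm (evenS_tau hμ) (one_le_tau hμ) h2
  have c1 : ‖U.1‖ ^ 2 ≤ ‖Rm R (fun ξ => √(lam β μ ξ)) U.1‖ ^ 2 := by gcongr
  have c2 : ‖U.2‖ ^ 2 ≤ ‖Rm R (fun ξ => √(tau μ ξ)) U.2‖ ^ 2 := by gcongr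
  have p1 := sq_nonneg ‖U.1‖
  have p2 := sq_nonneg ‖U.2‖
  unfold eN
  rw [Prod.norm_def]
  rcases max_choice ‖U.1‖ ‖U.2‖ with h | h <;> rw [h] <;> linarith

/-- Comparison of a regularized solution with a truncated approximate solution. -/
theorem exists_norm_sub_le {s B h M x τ : ℝ} (hs : 3 / 2 < s) (hβ : 0 < β) (hB : β ≤ B)
    (hμ : 0 < μ) (hh : 0 < h) (hh1 : h ≤ 1) (hx : 0 ≤ x) :
    ∃ A : ℝ, 0 ≤ A ∧ ∀ (n : ℝ) (Z : RealL2 × RealL2) (U W : ℝ → RealL2 × RealL2), 0 < n →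
      RegSol s β μ n h M τ Z U →
      (∀ t ∈ Icc 0 τ, XW β μ (fun ξ => jb ξ ^ s) (U t) ≤ ENNReal.ofReal x) →
      (∀ t ∈ Icc 0 τ, XW β μ (fun ξ => jb ξ ^ s) (W t) ≤ ENNReal.ofReal x) →
      (∀ t ∈ Icc 0 τ, HasDerivWithinAt (fun t => PX n (W t)) (Fr β μ n (W t)) (Icc 0 τ) t) →
      ∀ x₀ : ℝ, 0 ≤ x₀ → XW β μ (fun _ => 1) (U 0 - PX n (W 0)) ≤ ENNReal.ofReal x₀ →
      ∀ t ∈ Icc 0 τ, ‖U t - PX n (W t)‖ ≤ A * (x₀ + (n / 2) ^ (1 - s)) := by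
  obtain ⟨K, hK1, hKs⟩ := exists_aN_jb_le hs
  have hK0 : 0 ≤ K := by linarith
  have hB0 : 0 < B := hβ.trans_le hB
  set α := K * x with hα
  have hα0 : 0 ≤ α := by positivity
  set κ := (1 + α) ^ 2 * (50 + 20 * B) / h with hκ
  have hκ0 : 0 < κ := by positivity
  set D := (2 + B) * (2 * (2 * K * x ^ 2)) with hD
  have hD0 : 0 ≤ D := by positivity
  refine ⟨√(Real.exp (κ * τ) / h) * ((1 + α) + D), by positivity, ?_⟩
  intro n Z U W hn hU hUx hWx hW x₀ hx₀ hi t ht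
  have hn2 : n ≤ 2 * n := by linarith
  have h00 : (0 : ℝ) ∈ Icc 0 τ := left_mem_Icc.2 (ht.1.trans ht.2)
  set p := (n / 2) ^ (1 - s) with hp
  have hp0 : 0 ≤ p := by positivity
  have hb1 : ∀ r, Band (2 * n) (PX n (W r)).1 := fun r =>
    (band_Rm (evenS_const 1) n (W r).1).mono hn2
  have hb2 : ∀ r, Band (2 * n) (PX n (W r)).2 := fun r =>
    (band_Rm (evenS_const 1) n (W r).2).mono hn2
  -- Adding the constant `(Dp)²` turns the inhomogeneous differential inequality into a homogeneous
  -- one, ready for Gronwall.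
  set y : ℝ → ℝ := fun r => EnL β μ (2 * n) (U r).1 ((U r).1 - (PX n (W r)).1)
    ((U r).2 - (PX n (W r)).2) + (D * p) ^ 2 with hy
  -- Coercivity uses the lower bound on the background `U` alone. The competitor `W` need not be
  -- non-cavitating, which is what uniqueness requires.
  have hle : ∀ r ∈ Icc 0 τ, h * eN β μ (2 * n) ((U r).1 - (PX n (W r)).1)
      ((U r).2 - (PX n (W r)).2) ≤ EnL β μ (2 * n) (U r).1 ((U r).1 - (PX n (W r)).1)
      ((U r).2 - (PX n (W r)).2) := fun r hr =>
    le_EnL hβ hμ hh1 (hU.band r hr).1 ((hU.band r hr).2.sub (hb2 r)) (hU.lower r hr)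
  have d1 : ∀ r ∈ Icc 0 τ, HasDerivWithinAt (fun r => (U r).1 - (PX n (W r)).1)
      ((vf β μ n (U r)).1 - (Fr β μ n (W r)).1) (Icc 0 τ) r := fun r hr =>
    HasDerivWithinAt.sub (hU.deriv r hr).fst (hW r hr).fst
  have d2 : ∀ r ∈ Icc 0 τ, HasDerivWithinAt (fun r => (U r).2 - (PX n (W r)).2)
      ((vf β μ n (U r)).2 - (Fr β μ n (W r)).2) (Icc 0 τ) r := fun r hr =>
    HasDerivWithinAt.sub (hU.deriv r hr).snd (hW r hr).snd
  have key := le_exp_mul_of_deriv_le (y := y) (κ := κ) (fun r hr =>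
    (hasDerivWithinAt_EnL (β := β) (R := 2 * n) hμ (hU.deriv r hr).fst (d1 r hr)
      (d2 r hr)).add_const ((D * p) ^ 2)) (fun r hr => ?_) ht
  · set e := eN β μ (2 * n) ((U t).1 - (PX n (W t)).1) ((U t).2 - (PX n (W t)).2) with he
    have h1 : h * e ≤ y t := (hle t ht).trans (le_add_of_nonneg_right (sq_nonneg _))
    have h2 : y 0 ≤ (1 + α) * x₀ ^ 2 + (D * p) ^ 2 := by
      refine add_le_add ((EnL_le hβ hμ hα0 (hU.band 0 h00).1 ((hU.band 0 h00).2.sub (hb2 0))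
        (aN_jb_le_of_XW hβ hμ hK0 hKs (hUx 0 h00)).1).trans ?_) le_rfl
      refine mul_le_mul_of_nonneg_left ?_ (by linarith)
      have := sqrt_eN_le hμ (evenS_const 1) (2 * n) hx₀ hi
      have e1 : Rm (2 * n) (fun _ => 1) (U 0 - PX n (W 0)).1 = (U 0).1 - (PX n (W 0)).1 :=
        (hU.band 0 h00).1.sub (hb1 0)
      have e2 : Rm (2 * n) (fun _ => 1) (U 0 - PX n (W 0)).2 = (U 0).2 - (PX n (W 0)).2 :=
        (hU.band 0 h00).2.sub (hb2 0)
      rwa [e1, e2] at this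
    have h3 : Real.exp (κ * t) ≤ Real.exp (κ * τ) := Real.exp_le_exp.2 (by
      gcongr; exact ht.2)
    have h4 : ‖U t - PX n (W t)‖ ^ 2 ≤ e :=
      norm_sq_le_eN hβ hμ ((hU.band t ht).1.sub (hb1 t)) ((hU.band t ht).2.sub (hb2 t))
    have h5 : e ≤ Real.exp (κ * τ) / h * (((1 + α) + D) * (x₀ + p)) ^ 2 := by
      rw [div_mul_eq_mul_div, le_div_iff₀ hh, mul_comm e]
      refine (h1.trans key).trans ?_
      have h6 : (1 + α) * x₀ ^ 2 + (D * p) ^ 2 ≤ (((1 + α) + D) * (x₀ + p)) ^ 2 := by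
        have q1 : (1 + α) * x₀ ^ 2 ≤ ((1 + α) * x₀) ^ 2 := by
          rw [mul_pow]; gcongr; nlinarith
        have q2 : ((1 + α) * x₀) ^ 2 + (D * p) ^ 2 ≤ ((1 + α) * x₀ + D * p) ^ 2 := by
          have : 0 ≤ (1 + α) * x₀ * (D * p) := by positivity
          nlinarith
        have q3 : (1 + α) * x₀ + D * p ≤ ((1 + α) + D) * (x₀ + p) := by
          have a1 : 0 ≤ (1 + α) * p := by positivity
          have a2 : 0 ≤ D * x₀ := by positivity
          nlinarith
        have q4 : 0 ≤ (1 + α) * x₀ + D * p := by positivity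
        have q5 := pow_le_pow_left₀ q4 q3 2
        linarith
      calc Real.exp (κ * t) * y 0 ≤ Real.exp (κ * t) * (((1 + α) + D) * (x₀ + p)) ^ 2 := by
            gcongr; exact h2.trans h6
        _ ≤ _ := by gcongr
    have h7 := Real.abs_le_sqrt (h4.trans h5)
    rw [abs_of_nonneg (norm_nonneg _), Real.sqrt_mul (by positivity), Real.sqrt_sq (by positivity),
      ← mul_assoc] at h7
    exact h7
  · have hPx := (XW_PX_le β μ (fun ξ => jb ξ ^ s) n (W r)).trans (hWx r hr)
    obtain ⟨d1, d2⟩ := norm_defect_le (n := n) hβ hB hμ (by linarith) hn hx hK0 hKs (hWx r hr)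
    have eD : (2 + B) * (2 * (n / 2) ^ (1 - s) * (2 * K * x ^ 2)) = D * p := by
      rw [hD, hp]; ring
    rw [eD] at d1 d2
    have hd2 : Band (2 * n) (defect μ n (W r)).2 :=
      ((band_Sm (oddS_chi_aS hμ) _ _).smul _).neg
    have main := difference_energy_estimate (U := U r) (V := PX n (W r)) hβ hB hμ hn hα0
      (hU.band r hr).1 (hU.band r hr).2 (hb1 r) (hb2 r)
      (aN_jb_le_of_XW hβ hμ hK0 hKs (hUx r hr)).1 (aN_jb_le_of_XW hβ hμ hK0 hKs (hUx r hr)).2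
      (aN_jb_le_of_XW hβ hμ hK0 hKs hPx).1 (aN_jb_le_of_XW hβ hμ hK0 hKs hPx).2 hd2 d1 d2
    have e1 : (Fr β μ n (W r)).1 = (vf β μ n (PX n (W r))).1 + (defect μ n (W r)).1 := by
      rw [Fr_eq_vf_add_defect hμ hn]; rfl
    have e2 : (Fr β μ n (W r)).2 = (vf β μ n (PX n (W r))).2 + (defect μ n (W r)).2 := by
      rw [Fr_eq_vf_add_defect hμ hn]; rfl
    rw [← e1, ← e2] at main
    refine main.trans ?_
    have h1 := hle r hr
    have h2 : (1 + α) ^ 2 * ((50 + 20 * B) * (EnL β μ (2 * n) (U r).1 ((U r).1 - (PX n (W r)).1)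
      ((U r).2 - (PX n (W r)).2)) + (D * p) ^ 2) ≤ (1 + α) ^ 2 * (50 + 20 * B) * y r := by
      rw [mul_assoc _ _ (y r)]
      refine mul_le_mul_of_nonneg_left ?_ (by positivity : (0 : ℝ) ≤ (1 + α) ^ 2)
      change _ ≤ (50 + 20 * B) * (EnL β μ (2 * n) (U r).1 ((U r).1 - (PX n (W r)).1)
        ((U r).2 - (PX n (W r)).2) + (D * p) ^ 2)
      have : 0 ≤ (49 + 20 * B) * (D * p) ^ 2 := by positivity
      linarith
    rw [hκ, div_mul_eq_mul_div, le_div_iff₀ hh]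
    refine le_trans ?_ h2
    rw [mul_assoc]
    refine mul_le_mul_of_nonneg_left ?_ (by positivity)
    have h3 : h * (D * p) ^ 2 ≤ 1 * (D * p) ^ 2 := by gcongr
    have h4 := mul_le_mul_of_nonneg_left h1 (by positivity : (0 : ℝ) ≤ 50 + 20 * B)
    linarith

end

/-! ### Passage to the limit -/

/-- On a ball where `g'` oscillates by less than `ε`, the mean value inequality for `f n - (· -
t)g'(t)` has constant `e n + ε`; then `n → ∞`. -/
theorem hasDerivWithinAt_of_tendsto {E : Type*} [NormedAddCommGroup E] [NormedSpace ℝ E]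
    {f f' : ℕ → ℝ → E} {g g' : ℝ → E} {τ : ℝ} {e : ℕ → ℝ}
    (hf : ∀ᶠ n in atTop, ∀ t ∈ Icc 0 τ, HasDerivWithinAt (f n) (f' n t) (Icc 0 τ) t)
    (hg : ∀ t ∈ Icc 0 τ, Tendsto (fun n => f n t) atTop (𝓝 (g t))) (he : Tendsto e atTop (𝓝 0))
    (hg' : ∀ n, ∀ t ∈ Icc 0 τ, ‖f' n t - g' t‖ ≤ e n) (hc : ContinuousOn g' (Icc 0 τ)) {t : ℝ}
    (ht : t ∈ Icc 0 τ) : HasDerivWithinAt g (g' t) (Icc 0 τ) t := by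
  rw [hasDerivWithinAt_iff_isLittleO, Asymptotics.isLittleO_iff]
  intro ε hε
  obtain ⟨d, hd, hball⟩ := Metric.continuousWithinAt_iff.1 (hc t ht) ε hε
  have hmem : Icc 0 τ ∩ Metric.ball t d ∈ 𝓝[Icc 0 τ] t :=
    inter_mem_nhdsWithin _ (Metric.ball_mem_nhds t hd)
  filter_upwards [hmem] with r hr
  have key : ∀ᶠ n in atTop, ‖f n r - f n t - (r - t) • g' t‖ ≤ (e n + ε) * ‖r - t‖ := by
    filter_upwards [hf] with n hn
    have hconv : Convex ℝ (Icc 0 τ ∩ Metric.ball t d) := (convex_Icc 0 τ).inter (convex_ball t d)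
    have h1 := hconv.norm_image_sub_le_of_norm_hasDerivWithin_le
      (f := fun r => f n r - (r - t) • g' t) (f' := fun r => f' n r - g' t) (C := e n + ε)
      (x := t) (y := r) (fun q hq => ?_) (fun q hq => ?_) ⟨ht, Metric.mem_ball_self hd⟩ hr
    · simp only [sub_self, zero_smul, sub_zero] at h1
      convert h1 using 2
      abel
    · have h2 := ((hasDerivWithinAt_id q (Icc 0 τ)).sub_const t).smul_const (g' t)
      rw [one_smul] at h2
      exact (HasDerivWithinAt.sub (hn q hq.1) h2).mono inter_subset_left
    · have h3 := hg' n q hq.1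
      have h4 := (hball hq.1 hq.2).le
      rw [dist_eq_norm] at h4
      calc ‖f' n q - g' t‖ = ‖(f' n q - g' q) + (g' q - g' t)‖ := by congr 1; abel
        _ ≤ _ := (norm_add_le _ _).trans (add_le_add h3 h4)
  have l1 : Tendsto (fun n => ‖f n r - f n t - (r - t) • g' t‖) atTop
      (𝓝 ‖g r - g t - (r - t) • g' t‖) := (((hg r hr.1).sub (hg t ht)).sub_const _).norm
  have l2 : Tendsto (fun n => (e n + ε) * ‖r - t‖) atTop (𝓝 ((0 + ε) * ‖r - t‖)) :=
    (he.add_const ε).mul_const _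
  have := le_of_tendsto_of_tendsto l1 l2 key
  rwa [zero_add] at this

section
variable {β μ : ℝ}

theorem norm_pr_sub_pr_le {α : ℝ} (hα : 0 ≤ α) {f g f' g' : RealL2}
    (hf' : aN jb f' ≤ ENNReal.ofReal α) (hg : aN jb g ≤ ENNReal.ofReal α) :
    ‖pr f g - pr f' g'‖ ≤ α * (‖f - f'‖ + ‖g - g'‖) := by
  have e : pr f g - pr f' g' = pr g (f - f') + pr f' (g - g') := by
    rw [sub_eq_add_neg f f', sub_eq_add_neg g g', pr_add (Wiener.of_jb hg),
      pr_add (Wiener.of_jb hf'), ← neg_one_smul ℝ f', ← neg_one_smul ℝ g',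
      pr_smul (Wiener.of_jb hg), pr_smul (Wiener.of_jb hf'), pr_comm g f, pr_comm g f']
    module
  rw [e, mul_add]
  exact (norm_add_le _ _).trans (add_le_add (norm_pr_le_of_jb hα hg _) (norm_pr_le_of_jb hα hf' _))

/-- At a fixed cutoff `R` the derivatives are bounded operators, so convergence in `L²` with bounded
`aN jb` norms passes to the limit in the truncated equations. -/
theorem exists_Fr_lipschitz (β μ R : ℝ) {α : ℝ} (hα : 0 ≤ α) : ∃ K : ℝ, 0 ≤ K ∧
    ∀ U V : RealL2 × RealL2, aN jb U.1 ≤ ENNReal.ofReal α → aN jb U.2 ≤ ENNReal.ofReal α →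
      aN jb V.1 ≤ ENNReal.ofReal α → aN jb V.2 ≤ ENNReal.ofReal α →
      ‖Fr β μ R U - Fr β μ R V‖ ≤ K * ‖U - V‖ := by
  set D := Sm R (fun ξ => ξ)
  set A := Sm R (aS μ)
  set G := Sm R (fun ξ => aS μ ξ * lam β μ ξ)
  refine ⟨‖D‖ + ‖A‖ * (α * 2) + ‖G‖, by positivity, fun U V u1 u2 v1 v2 => ?_⟩
  have d1 := norm_fst_le (U - V)
  have d2 := norm_snd_le (U - V)
  set d := ‖U - V‖ with hd
  have hd0 : 0 ≤ d := norm_nonneg _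
  rw [Prod.fst_sub] at d1
  rw [Prod.snd_sub] at d2
  have c1 : ‖A (pr U.1 U.2) - A (pr V.1 V.2)‖ ≤ ‖A‖ * (α * (d + d)) := by
    rw [← map_sub]
    refine (A.le_opNorm _).trans (mul_le_mul_of_nonneg_left ?_ (norm_nonneg _))
    refine (norm_pr_sub_pr_le hα v1 u2).trans ?_
    gcongr
  have c2 : ‖A (pr U.2 U.2) - A (pr V.2 V.2)‖ ≤ ‖A‖ * (α * (d + d)) := by
    rw [← map_sub]
    refine (A.le_opNorm _).trans (mul_le_mul_of_nonneg_left ?_ (norm_nonneg _))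
    refine (norm_pr_sub_pr_le hα v2 u2).trans ?_
    gcongr
  have c3 : ‖D U.2 - D V.2‖ ≤ ‖D‖ * d := by
    rw [← map_sub]; exact (D.le_opNorm _).trans (by gcongr)
  have c4 : ‖G U.1 - G V.1‖ ≤ ‖G‖ * d := by
    rw [← map_sub]; exact (G.le_opNorm _).trans (by gcongr)
  have p1 : 0 ≤ ‖A‖ * (α * (d + d)) := by positivity
  have p2 : 0 ≤ ‖D‖ * d := by positivity
  have p3 : 0 ≤ ‖G‖ * d := by positivity
  refine max_le ?_ ?_
  · have e : (Fr β μ R U - Fr β μ R V).1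
        = -((D U.2 - D V.2) + (A (pr U.1 U.2) - A (pr V.1 V.2))) := by
      simp only [Fr, Prod.fst_sub]; abel
    rw [e, norm_neg]
    refine (norm_add_le _ _).trans ?_
    linarith
  · have e : (Fr β μ R U - Fr β μ R V).2 = -((G U.1 - G V.1)
        + (1 / 2 : ℝ) • (A (pr U.2 U.2) - A (pr V.2 V.2))) := by
      simp only [Fr, Prod.snd_sub]; module
    rw [e, norm_neg]
    refine (norm_add_le _ _).trans ?_
    rw [norm_smul, Real.norm_of_nonneg (by norm_num)]
    linarith

theorem norm_sub_proj_le {s n x : ℝ} (hs : 1 ≤ s) (hn : 0 < n) (hx : 0 ≤ x) {f : RealL2}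
    (hf : wN (fun ξ => jb ξ ^ s) f ≤ ENNReal.ofReal x) : ‖f - Rm n (fun _ => 1) f‖ ≤ n⁻¹ * x := by
  refine norm_le_of_enorm_le (by positivity) ?_
  rw [← wN_one, ENNReal.ofReal_mul (by positivity)]
  refine le_trans (wN_le_of_hat_le (w' := fun ξ => jb ξ ^ s) (g := f) (c := n⁻¹) ?_)
    (mul_le_mul' le_rfl hf)
  rw [hat_sub]
  filter_upwards [hat_Rm (evenS_const 1) n f,
    Lp.coeFn_sub (hat f) (hat (Rm n (fun _ => 1) f))] with k h1 h2
  rw [h2, Pi.sub_apply, h1, cut]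
  have hj := jb_pos (2 * Real.pi * k)
  split_ifs with h
  · simp only [Complex.ofReal_one, one_mul, sub_self, norm_zero]; positivity
  · rw [Complex.ofReal_one, Complex.ofReal_zero, zero_mul, sub_zero, one_mul, norm_mul,
      Complex.norm_real, Real.norm_of_nonneg (by positivity), ← mul_assoc]
    refine le_mul_of_one_le_left (norm_nonneg _) ?_
    rw [← div_eq_inv_mul, one_le_div hn]
    calc n ≤ jb (2 * Real.pi * k) := (not_le.1 h).le.trans (abs_le_jb _)
      _ = jb (2 * Real.pi * k) ^ (1 : ℝ) := (Real.rpow_one _).symm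
      _ ≤ _ := Real.rpow_le_rpow_of_exponent_le (one_le_jb _) hs

theorem norm_sub_PX_le {s n x : ℝ} (hβ : 0 < β) (hμ : 0 < μ) (hs : 1 ≤ s) (hn : 0 < n)
    (hx : 0 ≤ x) {U : RealL2 × RealL2}
    (hU : XW β μ (fun ξ => jb ξ ^ s) U ≤ ENNReal.ofReal x) : ‖U - PX n U‖ ≤ n⁻¹ * x :=
  max_le (norm_sub_proj_le hs hn hx ((wN_fst_le_XW hβ hμ U).trans hU))
    (norm_sub_proj_le hs hn hx ((wN_snd_le_XW hμ U).trans hU))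

/-- The equations hold for all frequency truncations. -/
def WeakDeriv (β μ τ : ℝ) (W : ℝ → RealL2 × RealL2) : Prop :=
  ∀ R : ℝ, 0 < R → ∀ t ∈ Icc 0 τ,
    HasDerivWithinAt (fun t => PX R (W t)) (Fr β μ R (W t)) (Icc 0 τ) t

/-- Weak solutions on `[0,τ]` with bounds in all weighted norms. -/
structure WeakSol (s β μ M τ : ℝ) (W : RealL2 × RealL2) (U : ℝ → RealL2 × RealL2) : Prop where
  initial : U 0 = W
  bound : ∀ t ∈ Icc 0 τ, ∀ ρ L : ℝ, 0 < ρ → 1 ≤ L →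
    XW β μ (wt s ρ L) (U t) ≤ ENNReal.ofReal M * XW β μ (wt s ρ L) W
  cont : ContinuousOn U (Icc 0 τ)
  deriv : WeakDeriv β μ τ U

theorem RegSol.weakDeriv {s n h M τ : ℝ} {Z : RealL2 × RealL2} {U : ℝ → RealL2 × RealL2}
    (hU : RegSol s β μ n h M τ Z U) (hμ : 0 < μ) (hn : 0 < n) {R : ℝ} (hR : R ≤ n) :
    ∀ t ∈ Icc 0 τ, HasDerivWithinAt (fun t => PX R (U t)) (Fr β μ R (U t)) (Icc 0 τ) t := by
  intro t ht
  have h := (PX R).hasFDerivAt.comp_hasDerivWithinAt t (hU.deriv t ht)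
  rw [PX_vf hμ hn hR (hU.band t ht).1 (hU.band t ht).2] at h
  exact h

theorem PX_PX {n k : ℝ} (h : n ≤ k) (W : RealL2 × RealL2) : PX n (PX k W) = PX n W := by
  have key : ∀ f : RealL2, Rm n (fun _ => 1) (Rm k (fun _ => 1) f) = Rm n (fun _ => 1) f := by
    intro f
    apply eq_of_hat_ae_eq
    filter_upwards [hat_Rm (evenS_const 1) n (Rm k (fun _ => 1) f), hat_Rm (evenS_const 1) k f,
      hat_Rm (evenS_const 1) n f] with q h1 h2 h3
    rw [h1, h2, h3]
    unfold cut
    split_ifs with h4 h5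
    · simp
    · exact absurd (h4.trans h) h5
    · simp
    · simp
  simp only [PX_apply, key]

/-- For `j ≤ k`, the `k`-th regularized solution truncated at `n₀ + j` satisfies the exact equations
up to that frequency, so comparison with the `j`-th solution gives a Cauchy sequence. Letting `j →
∞` in the comparison with an arbitrary bounded weak solution yields the stability estimate. -/
theorem exists_weakSol {s : ℝ} (hs : 3 / 2 < s) {h c₀ : ℝ} (hh : 0 < h) (hh1 : h ≤ 1)
    (hc₀ : 0 < c₀) : ∃ M : ℝ, 1 ≤ M ∧ ∀ B : ℝ, 0 < B → ∃ c : ℝ, 0 < c ∧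
      ∀ β μ δ : ℝ, 0 < β → β ≤ B → 0 < μ → 0 < δ → δ ≤ c₀ → ∃ A : ℝ → ℝ, (∀ x, 0 ≤ A x) ∧
      ∀ W : RealL2 × RealL2, XW β μ (fun ξ => jb ξ ^ s) W ≤ ENNReal.ofReal δ →
        (∀ᵐ x, h - 1 ≤ W.1 x) → ∃ U, WeakSol s β μ M (c / δ) W U ∧
        ∀ (x : ℝ) (V : ℝ → RealL2 × RealL2), WeakDeriv β μ (c / δ) V →
          (∀ t ∈ Icc 0 (c / δ), XW β μ (fun ξ => jb ξ ^ s) (V t) ≤ ENNReal.ofReal x) →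
          ∀ x₀ : ℝ, 0 ≤ x₀ → XW β μ (fun _ => 1) (W - V 0) ≤ ENNReal.ofReal x₀ →
          ∀ t ∈ Icc 0 (c / δ), ‖U t - V t‖ ≤ A x * x₀ := by
  obtain ⟨M, hM1, hreg⟩ := exists_regSol hs hh hh1 hc₀
  refine ⟨M, hM1, fun B hB => ?_⟩
  obtain ⟨c, hc, hreg⟩ := hreg B hB
  refine ⟨c, hc, fun β μ δ hβ hβB hμ hδ hδc => ?_⟩
  obtain ⟨n₀, hn₀, hreg⟩ := hreg β μ δ hβ hβB hμ hδ hδc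
  set τ := c / δ with hτ
  have hτ0 : 0 ≤ τ := by positivity
  have hMδ : 0 < M * δ := by positivity
  -- The comparison constant must accommodate both the competitor, of size `x`, and the regularized
  -- solutions, of size `Mδ`.
  have hA : ∀ x : ℝ, ∃ A : ℝ, 0 ≤ A ∧ _ := fun x =>
    exists_norm_sub_le (s := s) (β := β) (B := B) (h := h / 2) (M := M) (μ := μ)
      (x := max x (M * δ)) (τ := τ) hs hβ hβB hμ
      (by linarith) (by linarith) (hMδ.le.trans (le_max_right _ _))
  choose A hA0 hA using hA
  refine ⟨A, hA0, fun W hW hWl => ?_⟩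
  have hex : ∀ j : ℕ, ∃ U, RegSol s β μ (n₀ + j) (h / 2) M τ W U := fun j =>
    hreg W hW hWl (n₀ + j) (by simp)
  choose U hU using hex
  have hn : ∀ j : ℕ, 0 < n₀ + j := fun j => by positivity
  have hUx : ∀ j, ∀ t ∈ Icc 0 τ,
      XW β μ (fun ξ => jb ξ ^ s) (U j t) ≤ ENNReal.ofReal (M * δ) := fun j t ht => by
    have := (hU j).bound t ht 1 1 one_pos le_rfl
    rw [wt_one] at this
    refine this.trans ?_
    rw [ENNReal.ofReal_mul (by linarith)]
    exact mul_le_mul' le_rfl hW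
  set p : ℕ → ℝ := fun j => ((n₀ + j) / 2) ^ (1 - s) with hp
  have hn_top : Tendsto (fun j : ℕ => n₀ + (j : ℝ)) atTop atTop :=
    tendsto_atTop_add_const_left _ _ tendsto_natCast_atTop_atTop
  have hp0 : Tendsto p atTop (𝓝 0) := by
    have h1 := (tendsto_rpow_neg_atTop (y := s - 1) (by linarith)).comp
      (hn_top.atTop_div_const (by norm_num : (0 : ℝ) < 2))
    rw [neg_sub] at h1
    exact h1
  have hinv : ∀ y : ℝ, Tendsto (fun j : ℕ => (n₀ + (j : ℝ))⁻¹ * y) atTop (𝓝 0) := fun y => by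
    have := hn_top.inv_tendsto_atTop.mul_const y
    rwa [zero_mul] at this
  -- the comparison estimate
  have comp : ∀ (x : ℝ) (V : ℝ → RealL2 × RealL2) (j : ℕ),
      (∀ t ∈ Icc 0 τ, HasDerivWithinAt (fun t => PX (n₀ + j) (V t)) (Fr β μ (n₀ + j) (V t))
        (Icc 0 τ) t) →
      (∀ t ∈ Icc 0 τ, XW β μ (fun ξ => jb ξ ^ s) (V t) ≤ ENNReal.ofReal x) →
      ∀ x₀ : ℝ, 0 ≤ x₀ → XW β μ (fun _ => 1) (PX (n₀ + j) W - PX (n₀ + j) (V 0))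
        ≤ ENNReal.ofReal x₀ → ∀ t ∈ Icc 0 τ,
      ‖U j t - PX (n₀ + j) (V t)‖ ≤ A x * (x₀ + p j) := by
    intro x V j hV hVx x₀ hx₀ hi t ht
    refine hA x (n₀ + j) W (U j) V (hn j) (hU j)
      (fun t ht => (hUx j t ht).trans (ENNReal.ofReal_le_ofReal (le_max_right _ _)))
      (fun t ht => (hVx t ht).trans (ENNReal.ofReal_le_ofReal (le_max_left _ _))) hV x₀ hx₀ ?_ t ht
    rw [(hU j).initial]; exact hi
  set a := A (M * δ) with ha
  -- The first term is the defect with equal truncated data; the second is the part of the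
  -- competitor beyond frequency `n₀ + j`.
  set e : ℕ → ℝ := fun j => a * (0 + p j) + (n₀ + (j : ℝ))⁻¹ * (M * δ) with he
  have he0 : Tendsto e atTop (𝓝 0) := by
    have := ((hp0.const_add 0).const_mul a).add (hinv (M * δ))
    rw [add_zero, add_zero, mul_zero] at this
    exact this
  have hdiff : ∀ t ∈ Icc 0 τ, ∀ j k : ℕ, j ≤ k → ‖U j t - U k t‖ ≤ e j := fun t ht j k hjk => by
    have hnk : n₀ + (j : ℝ) ≤ n₀ + k := by gcongr
    have h1 := comp (M * δ) (U k) j ((hU k).weakDeriv hμ (hn k) hnk) (hUx k) 0 le_rfl (by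
      rw [(hU k).initial, PX_PX hnk, sub_self]; simp [XW, wN_zero]) t ht
    have h2 := norm_sub_PX_le (n := n₀ + j) hβ hμ (by linarith) (hn j) hMδ.le (hUx k t ht)
    calc ‖U j t - U k t‖
        = ‖(U j t - PX (n₀ + j) (U k t)) - (U k t - PX (n₀ + j) (U k t))‖ := by congr 1; abel
      _ ≤ _ := (norm_sub_le _ _).trans (add_le_add h1 h2)
  have hlim : ∀ t ∈ Icc 0 τ, ∃ l, Tendsto (fun j => U j t) atTop (𝓝 l) := fun t ht => by
    refine cauchySeq_tendsto_of_complete (cauchySeq_of_le_tendsto_0 (fun j => 2 * e j)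
      (fun j k N hj hk => ?_) (by simpa using he0.const_mul 2))
    have h1 := hdiff t ht N j hj
    have h2 := hdiff t ht N k hk
    rw [dist_eq_norm]
    calc ‖U j t - U k t‖ = ‖(U N t - U k t) - (U N t - U j t)‖ := by congr 1; abel
      _ ≤ _ := (norm_sub_le _ _).trans (by linarith)
  choose! Φ hΦ using hlim
  have hΦe : ∀ t ∈ Icc 0 τ, ∀ j, ‖U j t - Φ t‖ ≤ e j := fun t ht j => by
    refine le_of_tendsto ((hΦ t ht).const_sub (U j t)).norm ?_
    filter_upwards [eventually_ge_atTop j] with k hk using hdiff t ht j k hk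
  have hPX : ∀ {x : ℝ}, 0 ≤ x → ∀ Z : RealL2 × RealL2,
      XW β μ (fun ξ => jb ξ ^ s) Z ≤ ENNReal.ofReal x →
      Tendsto (fun j : ℕ => PX (n₀ + j) Z) atTop (𝓝 Z) := by
    intro x hx Z hZ
    rw [tendsto_iff_norm_sub_tendsto_zero]
    refine squeeze_zero (fun _ => norm_nonneg _) (fun j => ?_) (hinv x)
    rw [norm_sub_rev]
    exact norm_sub_PX_le hβ hμ (by linarith) (hn j) hx hZ
  have hcont : ContinuousOn Φ (Icc 0 τ) := by
    have hu : TendstoUniformlyOn U Φ atTop (Icc 0 τ) := by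
      rw [Metric.tendstoUniformlyOn_iff]
      intro ε hε
      filter_upwards [he0.eventually_lt_const hε] with j hj t ht
      rw [dist_comm, dist_eq_norm]
      exact (hΦe t ht j).trans_lt hj
    exact hu.continuousOn
      (Frequently.of_forall fun j t ht => ((hU j).deriv t ht).continuousWithinAt)
  have hΦb : ∀ t ∈ Icc 0 τ, ∀ ρ L : ℝ, 0 < ρ → 1 ≤ L →
      XW β μ (wt s ρ L) (Φ t) ≤ ENNReal.ofReal M * XW β μ (wt s ρ L) W := fun t ht ρ L hρ hL =>
    XW_le_of_tendsto hμ (evenS_wt s ρ L) (hΦ t ht)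
      (Eventually.of_forall fun j => (hU j).bound t ht ρ L hρ hL)
  have hΦx : ∀ t ∈ Icc 0 τ, XW β μ (fun ξ => jb ξ ^ s) (Φ t) ≤ ENNReal.ofReal (M * δ) :=
    fun t ht => XW_le_of_tendsto hμ (evenS_jb_rpow s) (hΦ t ht)
      (Eventually.of_forall fun j => hUx j t ht)
  obtain ⟨K, hK1, hKs⟩ := exists_aN_jb_le hs
  have hK0 : 0 ≤ K := by linarith
  refine ⟨Φ, ⟨?_, hΦb, hcont, fun R hR t ht => ?_⟩, ?_⟩
  · refine tendsto_nhds_unique (hΦ 0 (left_mem_Icc.2 hτ0)) ?_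
    simp only [(hU _).initial]
    exact hPX hδ.le W hW
  · obtain ⟨L, hL0, hL⟩ := exists_Fr_lipschitz β μ R (α := K * (M * δ)) (by positivity)
    have hLU : ∀ {Z Y : RealL2 × RealL2}, XW β μ (fun ξ => jb ξ ^ s) Z ≤ ENNReal.ofReal (M * δ) →
        XW β μ (fun ξ => jb ξ ^ s) Y ≤ ENNReal.ofReal (M * δ) →
        ‖Fr β μ R Z - Fr β μ R Y‖ ≤ L * ‖Z - Y‖ := fun {Z Y} hZ hY => by
      obtain ⟨z1, z2⟩ := aN_jb_le_of_XW hβ hμ hK0 hKs hZ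
      obtain ⟨y1, y2⟩ := aN_jb_le_of_XW hβ hμ hK0 hKs hY
      exact hL Z Y z1 z2 y1 y2
    refine hasDerivWithinAt_of_tendsto (f := fun j t => PX R (U j t))
      (f' := fun j t => Fr β μ R (U j t)) (g' := fun t => Fr β μ R (Φ t))
      (e := fun j => L * e j) ?_ (fun t ht => ((PX R).continuous.tendsto _).comp (hΦ t ht))
      (by simpa using he0.const_mul L) (fun j t ht => ?_) ?_ ht
    · filter_upwards [hn_top.eventually_ge_atTop R] with j hj
      exact (hU j).weakDeriv hμ (hn j) hj
    · exact (hLU (hUx j t ht) (hΦx t ht)).trans (mul_le_mul_of_nonneg_left (hΦe t ht j) hL0)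
    · intro t ht
      have h1 : Tendsto (fun r => L * ‖Φ r - Φ t‖) (𝓝[Icc 0 τ] t) (𝓝 0) := by
        have := ((hcont t ht).sub_const (Φ t)).norm.const_mul L
        simpa using this
      change Tendsto _ _ _
      rw [tendsto_iff_norm_sub_tendsto_zero]
      refine squeeze_zero' (Eventually.of_forall fun _ => norm_nonneg _) ?_ h1
      filter_upwards [self_mem_nhdsWithin] with r hr using hLU (hΦx r hr) (hΦx t ht)
  · intro x V hV hVx x₀ hx₀ hi t ht
    have h1 : ∀ j : ℕ, ‖U j t - PX (n₀ + j) (V t)‖ ≤ A x * (x₀ + p j) := fun j =>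
      comp x V j (hV _ (hn j)) hVx x₀ hx₀ (by
        rw [← map_sub]; exact (XW_PX_le _ _ _ _ _).trans hi) t ht
    have h2 := ((hΦ t ht).sub (hPX (le_max_left 0 x) (V t) ((hVx t ht).trans
      (ENNReal.ofReal_le_ofReal (le_max_right _ _))))).norm
    have h3 : Tendsto (fun j => A x * (x₀ + p j)) atTop (𝓝 (A x * (x₀ + 0))) :=
      (hp0.const_add x₀).const_mul _
    rw [add_zero] at h3
    exact le_of_tendsto_of_tendsto' h2 h3 h1

end

/-! ### The norm of `X^s` and the weighted norms -/

theorem wN_sq (w : ℝ → ℝ) (f : RealL2) :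
    wN w f ^ 2 = ∫⁻ k : ℝ, ENNReal.ofReal (w (2 * Real.pi * k) ^ 2 * ‖hat f k‖ ^ 2) := by
  rw [wN, eLpNorm_two_sq]
  refine lintegral_congr fun k => ?_
  rw [← ofReal_norm, ← ENNReal.ofReal_pow (norm_nonneg _), norm_mul, mul_pow, Complex.norm_real,
    Real.norm_eq_abs, sq_abs]

theorem jb_rpow_sq (s ξ : ℝ) : (jb ξ ^ s) ^ 2 = (1 + ξ ^ 2) ^ s := by
  have h0 : 0 ≤ 1 + ξ ^ 2 := by positivity
  rw [← Real.rpow_natCast, ← Real.rpow_mul (jb_pos ξ).le, mul_comm, Real.rpow_mul (jb_pos ξ).le,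
    Real.rpow_natCast, jb_sq]

theorem sobolevSq_eq (s : ℝ) (f : RealL2) : sobolevSq s f = wN (fun ξ => jb ξ ^ s) f ^ 2 := by
  rw [wN_sq, sobolevSq]
  simp only [jb_rpow_sq]

theorem measurable_ofReal_weight {w : ℝ → ℝ} (hw : Measurable w) (f : RealL2) :
    Measurable fun k : ℝ => ENNReal.ofReal (w (2 * Real.pi * k) * ‖hat f k‖ ^ 2) :=
  ((hw.comp (measurable_const.mul measurable_id)).mul
    ((measurable_hat f).norm.pow_const 2)).ennreal_ofReal

theorem sobolevSq_add_homSobolevSq {s r c : ℝ} (hc : 0 ≤ c) {u : ℝ → ℝ} (f : RealL2)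
    (hu : ∀ ξ, u ξ ^ 2 = 1 + c * |ξ| ^ (2 * r)) :
    sobolevSq s f + ENNReal.ofReal c * homSobolevSq r s f
      = wN (fun ξ => jb ξ ^ s * u ξ) f ^ 2 := by
  have hm : Measurable fun ξ : ℝ => (1 + ξ ^ 2) ^ s :=
    (measurable_const.add (measurable_id.pow_const 2)).pow_const s
  rw [wN_sq, sobolevSq, homSobolevSq, ← lintegral_const_mul' _ _ (by simp),
    ← lintegral_add_left (measurable_ofReal_weight hm f)]
  refine lintegral_congr fun k => ?_
  rw [← ENNReal.ofReal_mul hc, ← ENNReal.ofReal_add (by positivity) (by positivity),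
    mul_pow (jb _ ^ s), jb_rpow_sq, hu]
  congr 1; ring

/-- The weight `(1 + √μ|ξ|)^{1/2}`. -/
def sig (μ ξ : ℝ) : ℝ := √(1 + √μ * |ξ|)

theorem XNorm_eq {s β μ : ℝ} (hβ : 0 < β) (hμ : 0 < μ) (U : RealL2 × RealL2) :
    XNorm s β μ U = (wN (fun ξ => jb ξ ^ s * √(lam β μ ξ)) U.1 ^ 2
      + wN (fun ξ => jb ξ ^ s * sig μ ξ) U.2 ^ 2) ^ (1 / 2 : ℝ) := by
  rw [XNorm, add_assoc, sobolevSq_add_homSobolevSq (u := fun ξ => √(lam β μ ξ)) (by positivity),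
    sobolevSq_add_homSobolevSq (u := sig μ) (by positivity)]
  · intro ξ
    rw [sig, Real.sq_sqrt (by positivity)]
    norm_num
  · intro ξ
    rw [Real.sq_sqrt (lam_pos hβ hμ ξ).le, lam]
    norm_num

theorem rpow_half_le {a b : ℝ≥0∞} : (a ^ 2 + b ^ 2) ^ (1 / 2 : ℝ) ≤ a + b := by
  have h : a ^ 2 + b ^ 2 ≤ (a + b) ^ 2 := by
    rw [add_sq]; exact add_le_add_left le_self_add _
  calc (a ^ 2 + b ^ 2) ^ (1 / 2 : ℝ) ≤ ((a + b) ^ 2) ^ (1 / 2 : ℝ) :=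
        ENNReal.rpow_le_rpow h (by norm_num)
    _ = a + b := by
      rw [← ENNReal.rpow_natCast, ← ENNReal.rpow_mul]; norm_num

theorem le_rpow_half {a c : ℝ≥0∞} (h : a ^ 2 ≤ c) : a ≤ c ^ (1 / 2 : ℝ) := by
  calc a = (a ^ 2) ^ (1 / 2 : ℝ) := by rw [← ENNReal.rpow_natCast, ← ENNReal.rpow_mul]; norm_num
    _ ≤ _ := ENNReal.rpow_le_rpow h (by norm_num)

section
variable {s β μ : ℝ}

/-- The only discrepancy is `1 + √μ|ξ|` against `𝒯_μ⁻¹` on the second component, and these are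
comparable uniformly in `μ`. -/
theorem XNorm_le_XW (hβ : 0 < β) (hμ : 0 < μ) (U : RealL2 × RealL2) :
    XNorm s β μ U ≤ 2 * XW β μ (fun ξ => jb ξ ^ s) U := by
  rw [XNorm_eq hβ hμ, XW, mul_add]
  refine rpow_half_le.trans (add_le_add (le_mul_of_one_le_left' (by norm_num)) ?_)
  have := wN_mono (w := fun ξ => jb ξ ^ s * sig μ ξ) (w' := fun ξ => jb ξ ^ s * √(tau μ ξ))
    (c := 2) (fun ξ => ?_) U.2
  · simpa using this
  · have h := jb_pos ξ
    rw [abs_of_nonneg (by unfold sig; positivity), abs_of_nonneg (by positivity), mul_left_comm]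
    refine mul_le_mul_of_nonneg_left ?_ (by positivity)
    rw [sig, Real.sqrt_le_left (by positivity), mul_pow, Real.sq_sqrt (tau_pos hμ ξ).le]
    linarith [le_two_tau hμ ξ, tau_pos hμ ξ]

theorem XW_le_XNorm (hβ : 0 < β) (hμ : 0 < μ) (U : RealL2 × RealL2) :
    XW β μ (fun ξ => jb ξ ^ s) U ≤ 2 * XNorm s β μ U := by
  rw [XNorm_eq hβ hμ, XW, two_mul]
  refine add_le_add (le_rpow_half le_self_add) ((wN_mono_of_abs_le (fun ξ => ?_) _).trans
    (le_rpow_half le_add_self))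
  have h := jb_pos ξ
  rw [abs_of_nonneg (by positivity), abs_of_nonneg (by unfold sig; positivity)]
  exact mul_le_mul_of_nonneg_left (Real.sqrt_le_sqrt (tau_le hμ ξ)) (by positivity)

theorem XNorm_smul (hβ : 0 < β) (hμ : 0 < μ) (c : ℝ) (U : RealL2 × RealL2) :
    XNorm s β μ (c • U) = ‖c‖ₑ * XNorm s β μ U := by
  rw [XNorm_eq hβ hμ, XNorm_eq hβ hμ, Prod.smul_fst, Prod.smul_snd, wN_smul, wN_smul, mul_pow,
    mul_pow, ← mul_add, ENNReal.mul_rpow_of_nonneg _ _ (by norm_num), ← ENNReal.rpow_natCast,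
    ← ENNReal.rpow_mul]
  norm_num

theorem enorm_le_XW (hβ : 0 < β) (hμ : 0 < μ) {m : ℝ → ℝ} (hm : ∀ ξ, 1 ≤ m ξ)
    (U : RealL2 × RealL2) : ‖U‖ₑ ≤ XW β μ m U := by
  by_cases h : XW β μ m U = ∞
  · rw [h]; exact le_top
  · rw [← ENNReal.ofReal_toReal h, ← ofReal_norm]
    exact ENNReal.ofReal_le_ofReal (norm_le_of_XW hβ hμ hm ENNReal.toReal_nonneg
      (ENNReal.ofReal_toReal h).ge)

theorem enorm_le_XNorm (hs : 0 ≤ s) (hβ : 0 < β) (hμ : 0 < μ) (U : RealL2 × RealL2) :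
    ‖U‖ₑ ≤ 2 * XNorm s β μ U :=
  (enorm_le_XW hβ hμ (one_le_jb_rpow hs) U).trans (XW_le_XNorm hβ hμ U)

end

/-! ### Unbounded multipliers -/

theorem exists_isMultiplier {σ : ℝ → ℂ} (hm : Measurable σ)
    (hh : ∀ ξ, σ (-ξ) = (starRingEnd ℂ) (σ ξ)) {w : ℝ → ℝ} {C : ℝ} (hw : ∀ ξ, ‖σ ξ‖ ≤ C * |w ξ|)
    {f : RealL2} (hf : wN w f < ∞) : ∃ g, IsMultiplier σ f g := by
  have hmeas : Measurable fun k : ℝ => σ (2 * Real.pi * k) * hat f k :=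
    (hm.comp (measurable_const.mul measurable_id)).mul (measurable_hat f)
  have hL : MemLp (fun k : ℝ => σ (2 * Real.pi * k) * hat f k) 2 volume := by
    refine ⟨hmeas.aestronglyMeasurable, ?_⟩
    refine (eLpNorm_le_mul_eLpNorm_of_ae_le_mul (c := C)
      (g := fun k : ℝ => (w (2 * Real.pi * k) : ℂ) * hat f k) (ae_of_all _ fun k => ?_) 2).trans_lt
      (ENNReal.mul_lt_top (by simp) hf)
    rw [norm_mul, norm_mul, Complex.norm_real, ← mul_assoc]
    exact mul_le_mul_of_nonneg_right (hw _) (norm_nonneg _)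
  set G : Lp ℂ 2 (volume : Measure ℝ) := hL.toLp _ with hGdef
  have hG : ∀ᵐ k, G (-k) = (starRingEnd ℂ) (G k) := by
    have h1 := (Measure.measurePreserving_neg (volume : Measure ℝ)).quasiMeasurePreserving.ae
      hL.coeFn_toLp
    filter_upwards [hL.coeFn_toLp, h1, hat_neg_freq f] with k h1 h2 h3
    rw [h1, h2, h3, map_mul, ← hh]
    congr 2; ring
  refine ⟨reL (𝓕⁻ G), ?_⟩
  unfold IsMultiplier
  rw [exists_hat_eq G hG]
  exact hL.coeFn_toLp

theorem IsMultiplier.proj_eq {w : ℝ → ℝ} (hw : OddS w) {σ : ℝ → ℂ}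
    (hσ : ∀ ξ, σ ξ = Complex.I * (w ξ : ℂ)) {f g : RealL2} (h : IsMultiplier σ f g) (R : ℝ) :
    Rm R (fun _ => 1) g = Sm R w f := by
  apply eq_of_hat_ae_eq
  filter_upwards [h, hat_Rm (evenS_const 1) R g, hat_Sm hw R f] with k h1 h2 h3
  rw [h2, h3, h1, hσ]
  unfold cut
  split_ifs <;> simp

/-- The identity `v v' = (v²)'/2` on the Fourier side. -/
theorem hat_pr_deriv {v dv : RealL2} (hv : Wiener v) (hdv : Wiener dv)
    (h : IsMultiplier symD v dv) :
    ∀ᵐ k : ℝ, hat (pr v dv) k = (1 / 2 : ℂ) * (symD (2 * Real.pi * k) * hat (pr v v) k) := by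
  filter_upwards [hat_pr hv hdv, hat_pr hv hv] with k h1 h2
  set I := ∫ l : ℝ, hat v (k - l) * hat dv l with hI
  have h' : ∀ᵐ l : ℝ, hat dv (k - l) = symD (2 * Real.pi * (k - l)) * hat v (k - l) :=
    (Measure.measurePreserving_sub_left (volume : Measure ℝ) k).quasiMeasurePreserving.ae h
  -- The substitution `l ↦ k - l` puts the derivative on the other factor. Adding the two forms
  -- produces `(k - l) + l = k`, the derivative of the square.
  have e1 : I = ∫ l : ℝ, hat dv (k - l) * hat v l := by
    rw [hI, ← integral_sub_left_eq_self (fun l => hat v (k - l) * hat dv l) volume k]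
    simp [mul_comm]
  have e2 : I + I = symD (2 * Real.pi * k) * ∫ l : ℝ, hat v (k - l) * hat v l := by
    nth_rw 2 [e1]
    rw [hI, ← integral_add (integrable_conv v dv k) (integrable_conv dv v k), ← integral_const_mul]
    apply integral_congr_ae
    filter_upwards [h, h'] with l h3 h4
    rw [h3, h4]
    unfold symD
    push_cast; ring
  rw [h1, h2, ← e2]; ring

section
variable {s β μ : ℝ}

theorem symT_mul_symD (μ ξ : ℝ) : (symT μ ξ : ℂ) * symD ξ = Complex.I * (aS μ ξ : ℂ) := by
  unfold symD aS; push_cast; ring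

theorem symK_mul_symD (β μ ξ : ℝ) :
    (symK β μ ξ : ℂ) * symD ξ = Complex.I * ((aS μ ξ * lam β μ ξ : ℝ) : ℂ) := by
  unfold symK symD aS lam; push_cast; ring

theorem good_symT (hμ : 0 < μ) : Good (fun ξ => (symT μ ξ : ℂ)) := by
  refine ⟨Complex.measurable_ofReal.comp (evenS_symT hμ).cont.measurable, ⟨1, fun ξ => ?_⟩,
    fun ξ => ?_⟩
  · rw [Complex.norm_real, Real.norm_of_nonneg (symT_pos hμ ξ).le]; exact symT_le_one hμ ξ
  · rw [(evenS_symT hμ).even, Complex.conj_ofReal]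

theorem wiener_of_XW {K : ℝ} (hβ : 0 < β) (hμ : 0 < μ) (hK : 0 ≤ K)
    (hKs : ∀ f : RealL2, aN jb f ≤ ENNReal.ofReal K * wN (fun ξ => jb ξ ^ s) f)
    {U : RealL2 × RealL2} (hU : XW β μ (fun ξ => jb ξ ^ s) U < ∞) :
    aN jb U.1 < ∞ ∧ aN jb U.2 < ∞ := by
  have h := aN_jb_le_of_XW hβ hμ hK hKs (ENNReal.ofReal_toReal hU.ne).ge
  exact ⟨h.1.trans_lt (by simp), h.2.trans_lt (by simp)⟩

theorem wiener_deriv {v dv : RealL2} (hv : aN jb v < ∞) (h : IsMultiplier symD v dv) :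
    Wiener dv := by
  refine lt_of_le_of_lt (aN_le_of_hat_le (w' := jb) (g := v) (c := 1) ?_)
    (ENNReal.mul_lt_top (by simp) hv)
  filter_upwards [h] with k hk
  rw [hk, one_mul, Complex.ofReal_one, one_mul, norm_mul, norm_mul, symD, norm_mul, Complex.norm_I,
    one_mul, Complex.norm_real, Complex.norm_real, Real.norm_of_nonneg (jb_pos _).le]
  exact mul_le_mul_of_nonneg_right (abs_le_jb _) (norm_nonneg _)

/-- The truncations of the time derivative given by the equations. -/
theorem Equations.PX_eq (hs : 3 / 2 < s) (hβ : 0 < β) (hμ : 0 < μ) {U V : RealL2 × RealL2}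
    (hU : XW β μ (fun ξ => jb ξ ^ s) U < ∞) (h : Equations β μ 1 U V) (R : ℝ) :
    PX R V = Fr β μ R U := by
  obtain ⟨K, hK1, hKs⟩ := exists_aN_jb_le hs
  obtain ⟨a1, a2⟩ := wiener_of_XW hβ hμ (by linarith) hKs hU
  obtain ⟨dv, p, Tdp, Kdζ, q, Tq, h1, h2, h3, h4, h5, h6, h7, h8⟩ := h
  rw [one_smul] at h7 h8
  have e7 : V.1 = -(dv + Tdp) := by rw [eq_neg_iff_add_eq_zero, ← add_assoc]; exact h7
  have e8 : V.2 = -(Kdζ + Tq) := by rw [eq_neg_iff_add_eq_zero, ← add_assoc]; exact h8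
  have hW2 : Wiener U.2 := (aN_one_le_jb _).trans_lt a2
  rw [h2.eq_pr] at h3
  rw [h5.eq_pr] at h6
  have hT : Rm R (fun _ => 1) Tq = (1 / 2 : ℝ) • Sm R (aS μ) (pr U.2 U.2) := by
    apply eq_of_hat_ae_eq
    rw [hat_smul]
    filter_upwards [h6, hat_pr_deriv hW2 (wiener_deriv a2 h1) h1, hat_Rm (evenS_const 1) R Tq,
      hat_Sm (oddS_aS hμ) R (pr U.2 U.2),
      Lp.coeFn_smul (1 / 2 : ℝ) (hat (Sm R (aS μ) (pr U.2 U.2)))] with k g1 g2 g3 g4 g5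
    rw [g5, Pi.smul_apply, g3, g4, g1, g2, Complex.real_smul]
    unfold cut
    split_ifs
    · have := symT_mul_symD μ (2 * Real.pi * k)
      push_cast
      linear_combination (1 / 2 : ℂ) * hat (pr U.2 U.2) k * this
    · simp
  rw [PX_apply, Fr, e7, e8]
  rw [map_neg, map_add, map_neg, map_add, hT, h1.proj_eq oddS_id (fun ξ => rfl) R,
    h3.proj_eq (oddS_aS hμ) (symT_mul_symD μ) R,
    h4.proj_eq (oddS_aS_mul_lam hμ) (symK_mul_symD β μ) R]

theorem abs_aS_mul_sqrt_lam_le (hβ : 0 < β) (hμ : 0 < μ) (ξ : ℝ) :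
    |aS μ ξ| * √(lam β μ ξ) ≤ (1 + √β) * jb ξ := by
  have h1 := sqrt_lam_le hβ hμ ξ
  have h2 := sqrt_mul_abs_aS_le hμ ξ
  have h3 := abs_aS_le hμ ξ
  have h4 := abs_le_jb ξ
  have hb := Real.sqrt_nonneg β
  calc |aS μ ξ| * √(lam β μ ξ) ≤ |aS μ ξ| * (1 + √β * √μ * |ξ|) := by gcongr
    _ = |aS μ ξ| + √β * |ξ| * (√μ * |aS μ ξ|) := by ring
    _ ≤ |ξ| + √β * |ξ| * 1 := by gcongr
    _ = (1 + √β) * |ξ| := by ring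
    _ ≤ _ := by gcongr

/-- The equations themselves define `V`; only square integrability of each term is at stake. The
critical one is `𝒦_μ ∂ₓζ`, handled by `|aS|√Λ ≲ ⟨ξ⟩`. -/
theorem exists_equations (hs : 3 / 2 < s) (hβ : 0 < β) (hμ : 0 < μ) {U : RealL2 × RealL2}
    (hU : XW β μ (fun ξ => jb ξ ^ s) U < ∞) : ∃ V, Equations β μ 1 U V := by
  obtain ⟨K, hK1, hKs⟩ := exists_aN_jb_le hs
  obtain ⟨a1, a2⟩ := wiener_of_XW hβ hμ (by linarith) hKs hU
  have hW1 : Wiener U.1 := (aN_one_le_jb _).trans_lt a1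
  have hW2 : Wiener U.2 := (aN_one_le_jb _).trans_lt a2
  have w1 := (wN_fst_le_XW (m := fun ξ => jb ξ ^ s) hβ hμ U).trans_lt hU
  have w2 := (wN_snd_le_XW (m := fun ξ => jb ξ ^ s) (β := β) hμ U).trans_lt hU
  have hjs : ∀ ξ, jb ξ ≤ |jb ξ ^ s| := fun ξ => by
    have h := jb_pos ξ
    rw [abs_of_pos (by positivity)]
    nth_rw 1 [← Real.rpow_one (jb ξ)]
    exact Real.rpow_le_rpow_of_exponent_le (one_le_jb _) (by linarith)
  have odd : ∀ {w : ℝ → ℝ} {σ : ℝ → ℂ}, OddS w → (∀ ξ, σ ξ = Complex.I * (w ξ : ℂ)) →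
      ∀ ξ, σ (-ξ) = (starRingEnd ℂ) (σ ξ) := fun hw hσ ξ => by
    rw [hσ, hσ, hw.odd, map_mul, Complex.conj_I, Complex.conj_ofReal]; push_cast; ring
  have meas : ∀ {w : ℝ → ℝ} {σ : ℝ → ℂ}, OddS w → (∀ ξ, σ ξ = Complex.I * (w ξ : ℂ)) →
      Measurable σ := fun hw hσ => by
    rw [show _ = _ from funext hσ]
    exact measurable_const.mul (Complex.measurable_ofReal.comp hw.cont.measurable)
  have nrm : ∀ {w : ℝ → ℝ} {σ : ℝ → ℂ}, (∀ ξ, σ ξ = Complex.I * (w ξ : ℂ)) → ∀ ξ, ‖σ ξ‖ = |w ξ| :=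
    fun hσ ξ => by rw [hσ, norm_mul, Complex.norm_I, one_mul, Complex.norm_real, Real.norm_eq_abs]
  have sD : ∀ ξ, symD ξ = Complex.I * (ξ : ℂ) := fun ξ => rfl
  obtain ⟨dv, h1⟩ := exists_isMultiplier (σ := symD) (w := fun ξ => jb ξ ^ s) (C := 1)
    (meas oddS_id sD) (odd oddS_id sD)
    (fun ξ => by rw [nrm sD, one_mul]; exact (abs_le_jb ξ).trans (hjs ξ)) w2
  have hp : wN (fun ξ => jb ξ ^ s) (pr U.1 U.2) < ∞ := by
    refine (wN_pr_le (by linarith) hW1 hW2).trans_lt (ENNReal.mul_lt_top (by simp) ?_)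
    exact ENNReal.add_lt_top.2 ⟨ENNReal.mul_lt_top hW1 w2, ENNReal.mul_lt_top w1 hW2⟩
  obtain ⟨Tdp, h3⟩ := exists_isMultiplier (σ := fun ξ => (symT μ ξ : ℂ) * symD ξ)
    (w := fun ξ => jb ξ ^ s) (C := 1) (meas (oddS_aS hμ) (symT_mul_symD μ))
    (odd (oddS_aS hμ) (symT_mul_symD μ))
    (fun ξ => by
      rw [nrm (symT_mul_symD μ), one_mul]
      exact (abs_aS_le hμ ξ).trans ((abs_le_jb ξ).trans (hjs ξ))) hp
  obtain ⟨Kdζ, h4⟩ := exists_isMultiplier (σ := fun ξ => (symK β μ ξ : ℂ) * symD ξ)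
    (w := fun ξ => jb ξ ^ s * √(lam β μ ξ)) (C := 1 + √β)
    (meas (oddS_aS_mul_lam hμ) (symK_mul_symD β μ)) (odd (oddS_aS_mul_lam hμ) (symK_mul_symD β μ))
    (fun ξ => by
      rw [nrm (symK_mul_symD β μ), abs_mul, abs_of_pos (lam_pos hβ hμ ξ), abs_mul,
        abs_of_nonneg (Real.sqrt_nonneg _), ← mul_assoc]
      nth_rw 1 [← Real.mul_self_sqrt (lam_pos hβ hμ ξ).le]
      rw [← mul_assoc]
      refine mul_le_mul_of_nonneg_right ((abs_aS_mul_sqrt_lam_le hβ hμ ξ).trans ?_)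
        (Real.sqrt_nonneg _)
      exact mul_le_mul_of_nonneg_left (hjs ξ) (by positivity))
    (f := U.1) (lt_of_le_of_lt le_self_add hU)
  exact ⟨(-(dv + Tdp), -(Kdζ + mult (fun ξ => (symT μ ξ : ℂ)) (pr U.2 dv))), dv, pr U.1 U.2, Tdp,
    Kdζ, pr U.2 dv, mult (fun ξ => (symT μ ξ : ℂ)) (pr U.2 dv), h1, hW1.isProduct _, h3, h4,
    hW2.isProduct _, isMultiplier_mult (good_symT hμ) _, by simp only [one_smul]; abel,
    by simp only [one_smul]; abel⟩

end

/-! ### Continuity of the time derivative -/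

theorem wN_le_of_enorm_Rm {w : ℝ → ℝ} (hw : EvenS w) {f : RealL2} {c : ℝ≥0∞}
    (h : ∀ R : ℝ, 0 < R → ‖Rm R w f‖ₑ ≤ c) : wN w f ≤ c := by
  refine wN_le_of_cut hw.cont.measurable fun R => ?_
  refine le_trans ?_ (h (max R 1) (by positivity))
  rw [enorm_Rm hw]
  refine wN_mono_of_abs_le (fun ξ => ?_) f
  unfold cut
  split_ifs with h1 h2 h2
  · exact le_rfl
  · exact absurd (h1.trans (le_max_left _ _)) h2
  · simp
  · simp

theorem Rm_proj {w : ℝ → ℝ} (hw : EvenS w) (R : ℝ) (f : RealL2) :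
    Rm R w (Rm R (fun _ => 1) f) = Rm R w f := by
  rw [Rm_Rm hw (evenS_const 1)]
  simp only [mul_one]

theorem enorm_Rm_le {w : ℝ → ℝ} (hw : EvenS w) (R : ℝ) (f : RealL2) : ‖Rm R w f‖ₑ ≤ wN w f := by
  rw [enorm_Rm hw]
  exact wN_mono_of_abs_le (fun ξ => abs_cut_le _ _ _) f

theorem wN_le_of_proj {w : ℝ → ℝ} (hw : EvenS w) {f : RealL2} {c : ℝ≥0∞}
    (h : ∀ R : ℝ, 0 < R → wN w (Rm R (fun _ => 1) f) ≤ c) : wN w f ≤ c :=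
  wN_le_of_enorm_Rm hw fun R hR => by
    rw [← Rm_proj hw]; exact (enorm_Rm_le hw R _).trans (h R hR)

theorem wN_Sm_le {w w' a : ℝ → ℝ} (ha : OddS a) {c : ℝ}
    (h : ∀ ξ, |w ξ| * |a ξ| ≤ c * |w' ξ|) (R : ℝ) (f : RealL2) :
    wN w (Sm R a f) ≤ ENNReal.ofReal c * wN w' f := by
  refine wN_le_of_hat_le ?_
  filter_upwards [hat_Sm ha R f] with k hk
  rw [hk, norm_mul, norm_mul, norm_mul, norm_mul, Complex.norm_I, one_mul, Complex.norm_real,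
    Complex.norm_real, Complex.norm_real, Real.norm_eq_abs, Real.norm_eq_abs, Real.norm_eq_abs,
    ← mul_assoc, ← mul_assoc]
  refine mul_le_mul_of_nonneg_right (le_trans ?_ (h _)) (norm_nonneg _)
  exact mul_le_mul_of_nonneg_left (abs_cut_le _ _ _) (abs_nonneg _)

section
variable {s β μ : ℝ}

/-- The weight on the second component costs half a derivative; this is where `μ < 1` enters. -/
theorem sqrt_tau_le (hμ : 0 < μ) (hμ1 : μ < 1) (ξ : ℝ) : √(tau μ ξ) ≤ 2 * √(jb ξ) := by
  rw [Real.sqrt_le_left (by positivity), mul_pow, Real.sq_sqrt (jb_pos ξ).le]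
  have h1 : √μ ≤ 1 := Real.sqrt_le_one.2 hμ1.le
  have h2 : √μ * |ξ| ≤ 1 * jb ξ := mul_le_mul h1 (abs_le_jb ξ) (abs_nonneg _) zero_le_one
  linarith [tau_le hμ ξ, one_le_jb ξ]

theorem jb_rpow_split (s ξ : ℝ) : jb ξ ^ (s - 3 / 2) * (jb ξ * √(jb ξ)) = jb ξ ^ s := by
  have h := jb_pos ξ
  rw [Real.sqrt_eq_rpow, ← Real.rpow_one_add' h.le (by norm_num), ← Real.rpow_add h]
  norm_num

theorem jb_rpow_mul_jb_le (s ξ : ℝ) : jb ξ ^ (s - 3 / 2) * jb ξ ≤ jb ξ ^ s := by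
  have h := jb_pos ξ
  rw [← jb_rpow_split s ξ, ← mul_assoc]
  exact le_mul_of_one_le_right (by positivity) (Real.one_le_sqrt.2 (one_le_jb ξ))

theorem wN_pr_le_mul {K : ℝ} (hs : 0 ≤ s)
    (hKs : ∀ f : RealL2, aN jb f ≤ ENNReal.ofReal K * wN (fun ξ => jb ξ ^ s) f)
    {f g : RealL2} (hf : wN (fun ξ => jb ξ ^ s) f < ∞) (hg : wN (fun ξ => jb ξ ^ s) g < ∞) :
    wN (fun ξ => jb ξ ^ s) (pr f g) ≤ ENNReal.ofReal (2 ^ s) * (2 * ENNReal.ofReal K) *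
      (wN (fun ξ => jb ξ ^ s) f * wN (fun ξ => jb ξ ^ s) g) := by
  have h1 := fun f => (aN_one_le_jb f).trans (hKs f)
  have hf' : Wiener f := (h1 f).trans_lt (ENNReal.mul_lt_top (by simp) hf)
  have hg' : Wiener g := (h1 g).trans_lt (ENNReal.mul_lt_top (by simp) hg)
  refine (wN_pr_le hs hf' hg').trans ?_
  rw [mul_assoc]
  refine mul_le_mul_right ?_ _
  calc _ ≤ (ENNReal.ofReal K * wN (fun ξ => jb ξ ^ s) f) * wN (fun ξ => jb ξ ^ s) g
        + wN (fun ξ => jb ξ ^ s) f * (ENNReal.ofReal K * wN (fun ξ => jb ξ ^ s) g) := by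
        gcongr
        · exact h1 f
        · exact h1 g
    _ = _ := by ring

theorem pr_sub_pr {f g f' g' : RealL2} (hf' : Wiener f') (hg : Wiener g) :
    pr f g - pr f' g' = pr g (f - f') + pr f' (g - g') := by
  rw [sub_eq_add_neg f f', sub_eq_add_neg g g', pr_add hg, pr_add hf', ← neg_one_smul ℝ f',
    ← neg_one_smul ℝ g', pr_smul hg, pr_smul hf', pr_comm g f, pr_comm g f']
  module

/-- `|aS|√Λ` costs one derivative and `√(𝒯_μ⁻¹)` another half. The total of `3/2` explains the space
in which the time derivative lives. -/
theorem exists_XW_deriv_sub_le (hs : 3 / 2 < s) (hβ : 0 < β) (hμ : 0 < μ) (hμ1 : μ < 1)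
    {x : ℝ≥0∞} (hx : x < ∞) : ∃ C : ℝ≥0∞, C < ∞ ∧ ∀ U U' V V' : RealL2 × RealL2,
      (∀ R : ℝ, 0 < R → PX R V = Fr β μ R U) → (∀ R : ℝ, 0 < R → PX R V' = Fr β μ R U') →
      XW β μ (fun ξ => jb ξ ^ s) U ≤ x → XW β μ (fun ξ => jb ξ ^ s) U' ≤ x →
      XW β μ (fun ξ => jb ξ ^ (s - 3 / 2)) (V - V')
        ≤ C * XW β μ (fun ξ => jb ξ ^ s) (U - U') := by
  obtain ⟨K, hK1, hKs⟩ := exists_aN_jb_le hs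
  have hK0 : 0 ≤ K := by linarith
  set κ : ℝ := 2 * (1 + √β) with hκ
  have hb := Real.sqrt_nonneg β
  set P : ℝ≥0∞ := ENNReal.ofReal (2 ^ s) * (2 * ENNReal.ofReal K) * x with hP
  have hPt : P < ∞ := ENNReal.mul_lt_top (ENNReal.mul_lt_top (by simp)
    (ENNReal.mul_lt_top (by simp) (by simp))) hx
  refine ⟨ENNReal.ofReal κ * (1 + 4 * P), ENNReal.mul_lt_top (by simp)
    (ENNReal.add_lt_top.2 ⟨by simp, ENNReal.mul_lt_top (by simp) hPt⟩),
    fun U U' V V' hV hV' hU hU' => ?_⟩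
  set D := U - U' with hD
  by_cases hDt : XW β μ (fun ξ => jb ξ ^ s) D = ∞
  · rw [hDt, ENNReal.mul_top]
    · exact le_top
    · simp only [ne_eq, mul_eq_zero, ENNReal.ofReal_eq_zero, not_or, not_le]
      exact ⟨by positivity, by simp⟩
  have hDt' := lt_top_iff_ne_top.2 hDt
  have n1 : ∀ Z : RealL2 × RealL2, wN (fun ξ => jb ξ ^ s) Z.1 ≤ XW β μ (fun ξ => jb ξ ^ s) Z :=
    fun Z => wN_fst_le_XW (m := fun ξ => jb ξ ^ s) hβ hμ Z
  have n2 : ∀ Z : RealL2 × RealL2, wN (fun ξ => jb ξ ^ s) Z.2 ≤ XW β μ (fun ξ => jb ξ ^ s) Z :=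
    fun Z => wN_snd_le_XW (m := fun ξ => jb ξ ^ s) hμ Z
  obtain ⟨u1, u2⟩ := wiener_of_XW hβ hμ hK0 hKs (hU.trans_lt hx)
  obtain ⟨v1, v2⟩ := wiener_of_XW hβ hμ hK0 hKs (hU'.trans_lt hx)
  have hprod : ∀ {f d : RealL2}, wN (fun ξ => jb ξ ^ s) f ≤ x →
      wN (fun ξ => jb ξ ^ s) d < ∞ → wN (fun ξ => jb ξ ^ s) (pr f d)
        ≤ P * wN (fun ξ => jb ξ ^ s) d := by
    intro f d hf hd
    refine (wN_pr_le_mul (by linarith) hKs (hf.trans_lt hx) hd).trans ?_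
    rw [hP, mul_assoc _ x]
    gcongr
  have hj := (evenS_jb_rpow s).cont.measurable
  have d1 : wN (fun ξ => jb ξ ^ s) (U.1 - U'.1) ≤ XW β μ (fun ξ => jb ξ ^ s) D := n1 D
  have d2 : wN (fun ξ => jb ξ ^ s) (U.2 - U'.2) ≤ XW β μ (fun ξ => jb ξ ^ s) D := n2 D
  have q1 : wN (fun ξ => jb ξ ^ s) (pr U.1 U.2 - pr U'.1 U'.2)
      ≤ 2 * P * XW β μ (fun ξ => jb ξ ^ s) D := by
    rw [pr_sub_pr ((aN_one_le_jb _).trans_lt v1) ((aN_one_le_jb _).trans_lt u2)]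
    refine (wN_add_le hj _ _).trans ?_
    calc _ ≤ P * XW β μ (fun ξ => jb ξ ^ s) D + P * XW β μ (fun ξ => jb ξ ^ s) D := by
          refine add_le_add ((hprod ((n2 U).trans hU) (d1.trans_lt hDt')).trans ?_)
            ((hprod ((n1 U').trans hU') (d2.trans_lt hDt')).trans ?_)
          · gcongr
          · gcongr
      _ = _ := by ring
  have q2 : wN (fun ξ => jb ξ ^ s) (pr U.2 U.2 - pr U'.2 U'.2)
      ≤ 2 * P * XW β μ (fun ξ => jb ξ ^ s) D := by
    rw [pr_sub_pr ((aN_one_le_jb _).trans_lt v2) ((aN_one_le_jb _).trans_lt u2)]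
    refine (wN_add_le hj _ _).trans ?_
    calc _ ≤ P * XW β μ (fun ξ => jb ξ ^ s) D + P * XW β μ (fun ξ => jb ξ ^ s) D := by
          refine add_le_add ((hprod ((n2 U).trans hU) (d2.trans_lt hDt')).trans ?_)
            ((hprod ((n2 U').trans hU') (d2.trans_lt hDt')).trans ?_)
          · gcongr
          · gcongr
      _ = _ := by ring
  -- the symbols
  have hκ0 : 0 ≤ κ := by positivity
  have hr := evenS_jb_rpow (s - 3 / 2)
  have abs1 : ∀ {a b : ℝ}, 0 ≤ a → 0 ≤ b → |a * b| = a * b := fun ha hb =>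
    abs_of_nonneg (mul_nonneg ha hb)
  have pos : ∀ (p ξ : ℝ), 0 ≤ jb ξ ^ p := fun p ξ => Real.rpow_nonneg (jb_pos ξ).le p
  have s0 := sqrt_tau_le hμ hμ1
  have s1 := abs_aS_mul_sqrt_lam_le hβ hμ
  -- The key rewriting is `|ξ| = √τ · √τ · |aS|`: one root is the weight of the second component,
  -- the other costs `⟨ξ⟩^{1/2}`.
  have b1 : ∀ ξ, |jb ξ ^ (s - 3 / 2) * √(lam β μ ξ)| * |ξ| ≤ κ * |jb ξ ^ s * √(tau μ ξ)| := by
    intro ξ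
    rw [abs1 (pos _ _) (Real.sqrt_nonneg _), abs1 (pos _ _) (Real.sqrt_nonneg _)]
    have e : |ξ| = √(tau μ ξ) * √(tau μ ξ) * |aS μ ξ| := by
      rw [Real.mul_self_sqrt (tau_pos hμ ξ).le]
      nth_rw 1 [← tau_mul_aS hμ ξ]
      rw [abs_mul, abs_of_pos (tau_pos hμ ξ)]
    rw [e]
    have t0 := Real.sqrt_nonneg (tau μ ξ)
    have hp := pos (s - 3 / 2) ξ
    have := jb_pos ξ
    calc _ = jb ξ ^ (s - 3 / 2) * ((|aS μ ξ| * √(lam β μ ξ)) *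
          (√(tau μ ξ) * √(tau μ ξ))) := by ring
      _ ≤ jb ξ ^ (s - 3 / 2) * (((1 + √β) * jb ξ) * (2 * √(jb ξ) * √(tau μ ξ))) := by
          exact mul_le_mul_of_nonneg_left (mul_le_mul (s1 ξ)
            (mul_le_mul_of_nonneg_right (s0 ξ) t0) (by positivity) (by positivity)) hp
      _ = κ * (jb ξ ^ (s - 3 / 2) * (jb ξ * √(jb ξ)) * √(tau μ ξ)) := by ring
      _ = _ := by rw [jb_rpow_split]
  have b2 : ∀ ξ, |jb ξ ^ (s - 3 / 2) * √(lam β μ ξ)| * |aS μ ξ| ≤ κ * |jb ξ ^ s| := by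
    intro ξ
    rw [abs1 (pos _ _) (Real.sqrt_nonneg _), abs_of_nonneg (pos _ _)]
    have hp := pos (s - 3 / 2) ξ
    have := pos s ξ
    calc _ = jb ξ ^ (s - 3 / 2) * (|aS μ ξ| * √(lam β μ ξ)) := by ring
      _ ≤ jb ξ ^ (s - 3 / 2) * ((1 + √β) * jb ξ) := by
          exact mul_le_mul_of_nonneg_left (s1 ξ) hp
      _ = (1 + √β) * (jb ξ ^ (s - 3 / 2) * jb ξ) := by ring
      _ ≤ (1 + √β) * jb ξ ^ s := by gcongr; exact jb_rpow_mul_jb_le s ξ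
      _ ≤ _ := by rw [hκ]; gcongr; linarith
  have b3 : ∀ ξ, |jb ξ ^ (s - 3 / 2) * √(tau μ ξ)| * |aS μ ξ * lam β μ ξ|
      ≤ κ * |jb ξ ^ s * √(lam β μ ξ)| := by
    intro ξ
    rw [abs1 (pos _ _) (Real.sqrt_nonneg _), abs1 (pos _ _) (Real.sqrt_nonneg _), abs_mul,
      abs_of_pos (lam_pos hβ hμ ξ)]
    nth_rw 1 [← Real.mul_self_sqrt (lam_pos hβ hμ ξ).le]
    have t0 := Real.sqrt_nonneg (lam β μ ξ)
    have hp := pos (s - 3 / 2) ξ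
    have := jb_pos ξ
    calc _ = jb ξ ^ (s - 3 / 2) * ((|aS μ ξ| * √(lam β μ ξ)) *
          (√(tau μ ξ) * √(lam β μ ξ))) := by ring
      _ ≤ jb ξ ^ (s - 3 / 2) * (((1 + √β) * jb ξ) * (2 * √(jb ξ) * √(lam β μ ξ))) := by
          exact mul_le_mul_of_nonneg_left (mul_le_mul (s1 ξ)
            (mul_le_mul_of_nonneg_right (s0 ξ) t0) (by positivity) (by positivity)) hp
      _ = κ * (jb ξ ^ (s - 3 / 2) * (jb ξ * √(jb ξ)) * √(lam β μ ξ)) := by ring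
      _ = _ := by rw [jb_rpow_split]
  have b4 : ∀ ξ, |jb ξ ^ (s - 3 / 2) * √(tau μ ξ)| * |aS μ ξ| ≤ κ * |jb ξ ^ s| := by
    intro ξ
    rw [abs1 (pos _ _) (Real.sqrt_nonneg _), abs_of_nonneg (pos _ _)]
    have := pos (s - 3 / 2) ξ
    have := pos s ξ
    have := jb_pos ξ
    calc _ ≤ jb ξ ^ (s - 3 / 2) * (2 * √(jb ξ)) * jb ξ := by
          gcongr
          · exact s0 ξ
          · exact (abs_aS_le hμ ξ).trans (abs_le_jb ξ)
      _ = 2 * (jb ξ ^ (s - 3 / 2) * (jb ξ * √(jb ξ))) := by ring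
      _ = 2 * jb ξ ^ s := by rw [jb_rpow_split]
      _ ≤ _ := by rw [hκ]; gcongr; linarith
  set E := XW β μ (fun ξ => jb ξ ^ s) D with hE
  have m1 := (evenS_mul_sqrt_lam β μ hr).cont.measurable
  have m2 := (evenS_mul_sqrt_tau hμ hr).cont.measurable
  have c1 : wN (fun ξ => jb ξ ^ (s - 3 / 2) * √(lam β μ ξ)) (V - V').1 ≤
      ENNReal.ofReal κ * wN (fun ξ => jb ξ ^ s * √(tau μ ξ)) D.2
        + ENNReal.ofReal κ * (2 * P * E) := by
    refine wN_le_of_proj (evenS_mul_sqrt_lam β μ hr) fun R hR => ?_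
    have e := congrArg Prod.fst (congrArg₂ (· - ·) (hV R hR) (hV' R hR))
    simp only [PX_apply, Fr, Prod.fst_sub] at e
    rw [Prod.fst_sub, map_sub, e, show
      (-((Sm R fun ξ => ξ) U.2 + (Sm R (aS μ)) (pr U.1 U.2))
        - -((Sm R fun ξ => ξ) U'.2 + (Sm R (aS μ)) (pr U'.1 U'.2)))
        = -(Sm R (fun ξ => ξ) D.2 + Sm R (aS μ) (pr U.1 U.2 - pr U'.1 U'.2)) by
        rw [hD, Prod.snd_sub, map_sub, map_sub]; abel, wN_neg]
    refine (wN_add_le m1 _ _).trans (add_le_add (wN_Sm_le oddS_id b1 R _) ?_)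
    exact (wN_Sm_le (oddS_aS hμ) b2 R _).trans (mul_le_mul_right q1 _)
  have c2 : wN (fun ξ => jb ξ ^ (s - 3 / 2) * √(tau μ ξ)) (V - V').2 ≤
      ENNReal.ofReal κ * wN (fun ξ => jb ξ ^ s * √(lam β μ ξ)) D.1
        + 2⁻¹ * (ENNReal.ofReal κ * (2 * P * E)) := by
    refine wN_le_of_proj (evenS_mul_sqrt_tau hμ hr) fun R hR => ?_
    have e := congrArg Prod.snd (congrArg₂ (· - ·) (hV R hR) (hV' R hR))
    simp only [PX_apply, Fr, Prod.snd_sub] at e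
    rw [Prod.snd_sub, map_sub, e, show
      (-((Sm R fun ξ => aS μ ξ * lam β μ ξ) U.1 + (1 / 2 : ℝ) • (Sm R (aS μ)) (pr U.2 U.2))
        - -((Sm R fun ξ => aS μ ξ * lam β μ ξ) U'.1 + (1 / 2 : ℝ) • (Sm R (aS μ)) (pr U'.2 U'.2)))
        = -(Sm R (fun ξ => aS μ ξ * lam β μ ξ) D.1
          + (1 / 2 : ℝ) • Sm R (aS μ) (pr U.2 U.2 - pr U'.2 U'.2)) by
        rw [hD, Prod.fst_sub, map_sub, map_sub]; module, wN_neg]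
    refine (wN_add_le m2 _ _).trans (add_le_add (wN_Sm_le (oddS_aS_mul_lam hμ) b3 R _) ?_)
    rw [wN_smul]
    refine mul_le_mul' (le_of_eq ?_)
      ((wN_Sm_le (oddS_aS hμ) b4 R _).trans (mul_le_mul_right q2 _))
    rw [← ofReal_norm, Real.norm_of_nonneg (by norm_num), one_div,
      ENNReal.ofReal_inv_of_pos (by norm_num)]
    norm_num
  have e3 : E = wN (fun ξ => jb ξ ^ s * √(lam β μ ξ)) D.1
      + wN (fun ξ => jb ξ ^ s * √(tau μ ξ)) D.2 := rfl
  have h4 : 2⁻¹ * (ENNReal.ofReal κ * (2 * P * E)) ≤ ENNReal.ofReal κ * (2 * P * E) :=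
    mul_le_of_le_one_left' (by norm_num)
  refine (add_le_add c1 (c2.trans (add_le_add_right h4 _))).trans (le_of_eq ?_)
  calc _ = ENNReal.ofReal κ * (wN (fun ξ => jb ξ ^ s * √(lam β μ ξ)) D.1
        + wN (fun ξ => jb ξ ^ s * √(tau μ ξ)) D.2) + ENNReal.ofReal κ * (4 * P * E) := by ring
    _ = _ := by rw [← e3]; ring

end

/-! ### From weak solutions to solutions -/

section
variable {s β μ : ℝ}

theorem tendsto_XNorm_iff {ι : Type*} {l : Filter ι} (hβ : 0 < β) (hμ : 0 < μ)
    {U : ι → RealL2 × RealL2} : Tendsto (fun i => XNorm s β μ (U i)) l (𝓝 0) ↔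
      Tendsto (fun i => XW β μ (fun ξ => jb ξ ^ s) (U i)) l (𝓝 0) := by
  constructor
  · intro h
    have h2 := ENNReal.Tendsto.const_mul (a := 2) h (Or.inr (by simp))
    rw [mul_zero] at h2
    exact tendsto_of_tendsto_of_tendsto_of_le_of_le tendsto_const_nhds h2 (fun _ => zero_le)
      fun i => XW_le_XNorm hβ hμ _
  · intro h
    have h2 := ENNReal.Tendsto.const_mul (a := 2) h (Or.inr (by simp))
    rw [mul_zero] at h2
    exact tendsto_of_tendsto_of_tendsto_of_le_of_le tendsto_const_nhds h2 (fun _ => zero_le)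
      fun i => XNorm_le_XW hβ hμ _

theorem memX_iff (hβ : 0 < β) (hμ : 0 < μ) {U : RealL2 × RealL2} :
    MemX s β μ U ↔ XW β μ (fun ξ => jb ξ ^ s) U < ∞ :=
  ⟨fun h => (XW_le_XNorm hβ hμ U).trans_lt (ENNReal.mul_lt_top (by simp) h),
    fun h => (XNorm_le_XW hβ hμ U).trans_lt (ENNReal.mul_lt_top (by simp) h)⟩

/-- Two states whose weighted norms are controlled by those of nearby data, and which are close in
`L²`, are close in `X^s`. -/
theorem exists_XW_sub_le (hμ : 0 < μ) {M : ℝ} (hM : 0 ≤ M) {W : RealL2 × RealL2}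
    (hW : XW β μ (fun ξ => jb ξ ^ s) W < ∞) {δ : ℝ} (hδ : 0 < δ) : ∃ γ : ℝ, 0 < γ ∧
    ∀ W' Y Y' : RealL2 × RealL2, XW β μ (fun ξ => jb ξ ^ s) (W' - W) ≤ ENNReal.ofReal γ →
      (∀ ρ L : ℝ, 0 < ρ → 1 ≤ L →
        XW β μ (wt s ρ L) Y ≤ ENNReal.ofReal M * XW β μ (wt s ρ L) W') →
      (∀ ρ L : ℝ, 0 < ρ → 1 ≤ L →
        XW β μ (wt s ρ L) Y' ≤ ENNReal.ofReal M * XW β μ (wt s ρ L) W) →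
      ‖Y - Y'‖ ≤ γ → XW β μ (fun ξ => jb ξ ^ s) (Y - Y') ≤ ENNReal.ofReal δ := by
  set N := (XW β μ (fun ξ => jb ξ ^ s) W).toReal with hN
  have hN0 : 0 ≤ N := ENNReal.toReal_nonneg
  have hWN : XW β μ (fun ξ => jb ξ ^ s) W = ENNReal.ofReal N :=
    (ENNReal.ofReal_toReal hW.ne).symm
  -- Order of choices: `Q` bounds the amplified norm of the difference, `L` makes `Q/L ≤ δ/2`, then
  -- `ρ` is adapted to `W`, which fixes the low-frequency constant `K`; `γ` comes last. The bracket
  -- is `(N + 2) + (N + 1)`, from `W'` and `W`.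
  set Q := M * (2 * N + 3) with hQ
  have hQ0 : 0 ≤ Q := by positivity
  set L := max 1 (2 * Q / δ) with hL
  have hL1 : 1 ≤ L := le_max_left _ _
  have hL0 : 0 < L := by linarith
  obtain ⟨ρ, hρ, hρW⟩ := exists_XW_wt_le hμ hW hL1
  obtain ⟨K, hK0, hK⟩ := XW_le_low_add_high hμ β s hρ hL0
  refine ⟨min L⁻¹ (δ / (4 * (K + 1))), lt_min (by positivity) (by positivity),
    fun W' Y Y' hW' hY hY' hYY => ?_⟩
  have hwt := evenS_wt s ρ L
  have h1 : XW β μ (wt s ρ L) W ≤ ENNReal.ofReal (N + 1) := by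
    rw [ENNReal.ofReal_add hN0 zero_le_one, ENNReal.ofReal_one, ← hWN]; exact hρW
  have h2 : XW β μ (wt s ρ L) (W' - W) ≤ ENNReal.ofReal 1 := by
    refine (XW_mono (c := L) (m' := fun ξ => jb ξ ^ s) (fun ξ => ?_) _).trans
      ((mul_le_mul_right (hW'.trans (ENNReal.ofReal_le_ofReal (min_le_left _ _))) _).trans ?_)
    · have := jb_pos ξ
      rw [abs_of_pos (wt_pos s ρ L ξ), abs_of_pos (by positivity)]
      exact wt_le hL1 ξ
    · rw [← ENNReal.ofReal_mul hL0.le, mul_inv_cancel₀ hL0.ne']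
  have h3 : XW β μ (wt s ρ L) W' ≤ ENNReal.ofReal (N + 2) := by
    refine (XW_le_add_sub hμ hwt W' W).trans ((add_le_add h1 h2).trans (le_of_eq ?_))
    rw [← ENNReal.ofReal_add (by positivity) zero_le_one]
    congr 1; ring
  have h4 : XW β μ (wt s ρ L) (Y - Y') ≤ ENNReal.ofReal Q := by
    refine (XW_sub_le hμ hwt _ _).trans ((add_le_add
      ((hY ρ L hρ hL1).trans (mul_le_mul_right h3 _))
      ((hY' ρ L hρ hL1).trans (mul_le_mul_right h1 _))).trans (le_of_eq ?_))
    rw [← ENNReal.ofReal_mul hM, ← ENNReal.ofReal_mul hM, ← ENNReal.ofReal_add (by positivity)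
      (by positivity)]
    congr 1; ring
  have h5 : ‖Y - Y'‖ ≤ δ / (4 * (K + 1)) := hYY.trans (min_le_right _ _)
  have h6 : ‖(Y - Y').1‖ₑ + ‖(Y - Y').2‖ₑ ≤ ENNReal.ofReal (2 * (δ / (4 * (K + 1)))) := by
    rw [two_mul, ENNReal.ofReal_add (by positivity) (by positivity), ← ofReal_norm, ← ofReal_norm]
    exact add_le_add (ENNReal.ofReal_le_ofReal ((norm_fst_le _).trans h5))
      (ENNReal.ofReal_le_ofReal ((norm_snd_le _).trans h5))
  refine (hK _).trans ((add_le_add (mul_le_mul_right h6 _) (mul_le_mul_right h4 _)).trans ?_)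
  rw [← ENNReal.ofReal_mul hK0, ← ENNReal.ofReal_mul (by positivity), ← ENNReal.ofReal_add
    (by positivity) (by positivity)]
  refine ENNReal.ofReal_le_ofReal ?_
  have e1 : K * (2 * (δ / (4 * (K + 1)))) ≤ δ / 2 := by
    rw [← mul_assoc, mul_div_assoc', div_le_div_iff₀ (by positivity) (by norm_num)]
    nlinarith
  have e2 : L⁻¹ * Q ≤ δ / 2 := by
    have : 2 * Q / δ ≤ L := le_max_right _ _
    rw [inv_mul_le_iff₀ hL0]
    rw [div_le_iff₀ hδ] at this
    linarith
  linarith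

/-- Continuity in `L²` is upgraded by `exists_XW_sub_le` with both data equal to `W`, since all
states share the tail bounds of `W`. -/
theorem WeakSol.continuousInX {M τ : ℝ} {W : RealL2 × RealL2} {U : ℝ → RealL2 × RealL2}
    (hU : WeakSol s β μ M τ W U) (hβ : 0 < β) (hμ : 0 < μ) (hM : 0 ≤ M)
    (hW : XW β μ (fun ξ => jb ξ ^ s) W < ∞) : ContinuousInX s β μ τ U := by
  intro t ht
  refine ⟨(memX_iff hβ hμ).2 ?_, (tendsto_XNorm_iff hβ hμ).2 ?_⟩
  · have := hU.bound t ht 1 1 one_pos le_rfl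
    rw [wt_one] at this
    exact this.trans_lt (ENNReal.mul_lt_top (by simp) hW)
  · refine ENNReal.tendsto_nhds_zero.2 fun ε hε => ?_
    obtain ⟨δ, hδ, hδε⟩ : ∃ δ : ℝ, 0 < δ ∧ ENNReal.ofReal δ ≤ ε := by
      by_cases h : ε = ∞
      · exact ⟨1, one_pos, h ▸ le_top⟩
      · exact ⟨ε.toReal, ENNReal.toReal_pos hε.ne' h, (ENNReal.ofReal_toReal h).le⟩
    obtain ⟨γ, hγ, key⟩ := exists_XW_sub_le hμ hM hW hδ
    have h1 := (Metric.tendsto_nhds.1 (hU.cont t ht)) γ hγ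
    filter_upwards [h1, self_mem_nhdsWithin] with r hr hr'
    refine (key W (U r) (U t) ?_ (hU.bound r hr') (hU.bound t ht) ?_).trans hδε
    · rw [sub_self]; simp [XW, wN_zero]
    · rw [← dist_eq_norm]; exact hr.le

theorem ContinuousInX.exists_XW_le {τ : ℝ} {U : ℝ → RealL2 × RealL2}
    (hU : ContinuousInX s β μ τ U) (hβ : 0 < β) (hμ : 0 < μ) : ∃ x : ℝ, 0 ≤ x ∧
      ∀ t ∈ Icc 0 τ, XW β μ (fun ξ => jb ξ ^ s) (U t) ≤ ENNReal.ofReal x := by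
  refine IsCompact.induction_on (p := fun S => ∃ x : ℝ, 0 ≤ x ∧
      ∀ t ∈ S, XW β μ (fun ξ => jb ξ ^ s) (U t) ≤ ENNReal.ofReal x) isCompact_Icc ?_ ?_ ?_ ?_
  · exact ⟨0, le_rfl, by simp⟩
  · rintro S S' h ⟨x, hx, h'⟩
    exact ⟨x, hx, fun t ht => h' t (h ht)⟩
  · rintro S S' ⟨x, hx, h⟩ ⟨x', hx', h'⟩
    refine ⟨max x x', hx.trans (le_max_left _ _), ?_⟩
    rintro t (ht | ht)
    · exact (h t ht).trans (ENNReal.ofReal_le_ofReal (le_max_left _ _))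
    · exact (h' t ht).trans (ENNReal.ofReal_le_ofReal (le_max_right _ _))
  · intro t ht
    obtain ⟨h1, h2⟩ := hU t ht
    have h3 := ((tendsto_XNorm_iff hβ hμ).1 h2).eventually_le_const (zero_lt_one)
    set N := (XW β μ (fun ξ => jb ξ ^ s) (U t)).toReal with hN
    have hN0 : 0 ≤ N := ENNReal.toReal_nonneg
    refine ⟨_, h3, N + 1, by positivity, fun r hr => ?_⟩
    rw [ENNReal.ofReal_add hN0 zero_le_one, hN,
      ENNReal.ofReal_toReal ((memX_iff hβ hμ).1 h1).ne, ENNReal.ofReal_one]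
    exact (XW_le_add_sub hμ (evenS_jb_rpow s) _ _).trans (add_le_add_right hr _)

/-- Mean value estimate in a weighted norm. -/
theorem wN_sub_smul_le {w : ℝ → ℝ} (hw : EvenS w) {S : Set ℝ} (hS : Convex ℝ S)
    {f f' : ℝ → RealL2} {t : ℝ} {η : ℝ} (hη : 0 ≤ η) (hd : ∀ R : ℝ, 0 < R → ∀ r ∈ S,
      HasDerivWithinAt (fun r => Rm R (fun _ => 1) (f r)) (Rm R (fun _ => 1) (f' r)) S r)
    (hc : ∀ r ∈ S, wN w (f' r - f' t) ≤ ENNReal.ofReal η) (ht : t ∈ S) {r : ℝ} (hr : r ∈ S) :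
    wN w (f r - f t - (r - t) • f' t) ≤ ENNReal.ofReal (η * |r - t|) := by
  refine wN_le_of_enorm_Rm hw fun R hR => ?_
  have h := hS.norm_image_sub_le_of_norm_hasDerivWithin_le
    (f := fun q => Rm R w (f q) - (q - t) • Rm R w (f' t)) (f' := fun q => Rm R w (f' q - f' t))
    (C := η) (x := t) (y := r) (fun q hq => ?_) (fun q hq => ?_) ht hr
  · rw [← ofReal_norm]
    refine ENNReal.ofReal_le_ofReal ?_
    rw [map_sub, map_sub, map_smul]
    refine le_trans (le_of_eq ?_) h
    congr 1
    simp only [sub_self, zero_smul, sub_zero]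
    abel
  · have h1 := hasDerivWithinAt_clm (L := Rm R w) (hd R hR q hq)
    simp only [Rm_proj hw] at h1
    have h2 := ((hasDerivWithinAt_id q S).sub_const t).smul_const (Rm R w (f' t))
    rw [one_smul] at h2
    rw [map_sub]
    exact HasDerivWithinAt.sub h1 h2
  · exact norm_le_of_enorm_le hη ((enorm_Rm_le hw R _).trans (hc q hq))

/-- Under each frequency cutoff the mean value inequality holds in the weighted norm, with constant
the oscillation of `V` in `X^s`. The bound does not depend on the cutoff, which is then removed. -/
theorem hasTimeDerivInX_of_proj {τ : ℝ} (hβ : 0 < β) (hμ : 0 < μ) {U V : ℝ → RealL2 × RealL2}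
    (hV : ContinuousInX s β μ τ V) (hd : ∀ R : ℝ, 0 < R → ∀ t ∈ Icc 0 τ,
      HasDerivWithinAt (fun t => PX R (U t)) (PX R (V t)) (Icc 0 τ) t) :
    HasTimeDerivInX s β μ τ U V := by
  intro t ht
  have hj := evenS_jb_rpow s
  have hm1 := evenS_mul_sqrt_lam β μ hj
  have hm2 := evenS_mul_sqrt_tau hμ hj
  rw [tendsto_XNorm_iff hβ hμ]
  refine ENNReal.tendsto_nhds_zero.2 fun ε hε => ?_
  obtain ⟨η, hη, hηε⟩ : ∃ η : ℝ, 0 < η ∧ ENNReal.ofReal (2 * η) ≤ ε := by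
    by_cases h : ε = ∞
    · exact ⟨1, one_pos, h ▸ le_top⟩
    · refine ⟨ε.toReal / 2, half_pos (ENNReal.toReal_pos hε.ne' h), ?_⟩
      rw [mul_div_cancel₀ _ two_ne_zero, ENNReal.ofReal_toReal h]
  have h1 := ((tendsto_XNorm_iff hβ hμ).1 (hV t ht).2).eventually_le_const
    (ENNReal.ofReal_pos.2 hη)
  rw [Filter.Eventually, mem_nhdsWithin_iff_exists_mem_nhds_inter] at h1
  obtain ⟨u, hu, hsub⟩ := h1
  obtain ⟨d, hd0, hball⟩ := Metric.mem_nhds_iff.1 hu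
  set S := Metric.ball t d ∩ Icc 0 τ with hS
  have hSc : Convex ℝ S := (convex_ball t d).inter (convex_Icc 0 τ)
  have htS : t ∈ S := ⟨Metric.mem_ball_self hd0, ht⟩
  have hVS : ∀ r ∈ S, XW β μ (fun ξ => jb ξ ^ s) (V r - V t) ≤ ENNReal.ofReal η := fun r hr =>
    hsub ⟨hball hr.1, hr.2⟩
  have hmem : Metric.ball t d ∈ 𝓝[Icc 0 τ \ {t}] t := mem_nhdsWithin_of_mem_nhds
    (Metric.ball_mem_nhds t hd0)
  filter_upwards [hmem, self_mem_nhdsWithin] with r hr hr'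
  have hrS : r ∈ S := ⟨hr, hr'.1⟩
  have hrt : r - t ≠ 0 := sub_ne_zero.2 hr'.2
  have k1 := wN_sub_smul_le (f := fun r => (U r).1) (f' := fun r => (V r).1) hm1 hSc hη.le
    (fun R hR q hq => ((ContinuousLinearMap.fst ℝ RealL2 RealL2).hasFDerivAt.comp_hasDerivWithinAt q
      (hd R hR q hq.2)).mono inter_subset_right) (fun q hq => le_trans le_self_add (hVS q hq)) htS hrS
  have k2 := wN_sub_smul_le (f := fun r => (U r).2) (f' := fun r => (V r).2) hm2 hSc hη.le
    (fun R hR q hq => ((ContinuousLinearMap.snd ℝ RealL2 RealL2).hasFDerivAt.comp_hasDerivWithinAt q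
      (hd R hR q hq.2)).mono inter_subset_right) (fun q hq => le_trans le_add_self (hVS q hq)) htS hrS
  have e : (r - t)⁻¹ • (U r - U t) - V t = (r - t)⁻¹ • (U r - U t - (r - t) • V t) := by
    rw [smul_sub (r - t)⁻¹ (U r - U t), smul_smul, inv_mul_cancel₀ hrt, one_smul]
  rw [e, XW_smul]
  refine le_trans (mul_le_mul_right (add_le_add k1 k2) _) (le_trans (le_of_eq ?_) hηε)
  rw [← ENNReal.ofReal_add (by positivity) (by positivity), ← ofReal_norm,
    ← ENNReal.ofReal_mul (norm_nonneg _), norm_inv, Real.norm_eq_abs]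
  congr 1
  have := abs_ne_zero.2 hrt
  field_simp
  ring

theorem pr_zero : pr 0 0 = 0 := by
  refine (IsProduct.eq_pr ?_).symm
  unfold IsProduct
  filter_upwards [Lp.coeFn_zero ℝ 2 (volume : Measure ℝ)] with x hx
  rw [hx]; simp

theorem WeakSol.isSolution {M τ : ℝ} {W : RealL2 × RealL2} {U : ℝ → RealL2 × RealL2}
    (hU : WeakSol s β μ M τ W U) (hs : 3 / 2 < s) (hβ : 0 < β) (hμ : 0 < μ) (hμ1 : μ < 1)
    (hM : 0 ≤ M) (hW : XW β μ (fun ξ => jb ξ ^ s) W < ∞) : IsSolution s β μ 1 τ W U := by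
  have hc := hU.continuousInX hβ hμ hM hW
  obtain ⟨x, hx0, hx⟩ := hc.exists_XW_le hβ hμ
  have hex : ∀ t ∈ Icc 0 τ, ∃ V, Equations β μ 1 (U t) V := fun t ht =>
    exists_equations hs hβ hμ ((hx t ht).trans_lt (by simp))
  choose! V hV using hex
  have hP : ∀ t ∈ Icc 0 τ, ∀ R : ℝ, 0 < R → PX R (V t) = Fr β μ R (U t) := fun t ht R _ =>
    (hV t ht).PX_eq hs hβ hμ ((hx t ht).trans_lt (by simp)) R
  obtain ⟨C, hC, hCle⟩ := exists_XW_deriv_sub_le hs hβ hμ hμ1 (x := ENNReal.ofReal x) (by simp)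
  have hVc : ContinuousInX (s - 3 / 2) β μ τ V := by
    intro t ht
    refine ⟨(memX_iff hβ hμ).2 ?_, (tendsto_XNorm_iff hβ hμ).2 ?_⟩
    -- Comparison with the zero state, whose time derivative is zero, turns the difference estimate
    -- into membership.
    · have := hCle (U t) 0 (V t) 0 (hP t ht) (fun R _ => by simp [Fr, pr_zero]; rfl) (hx t ht)
        (by simp [XW, wN_zero])
      rw [sub_zero, sub_zero] at this
      exact this.trans_lt (ENNReal.mul_lt_top hC ((hx t ht).trans_lt (by simp)))
    · have h1 := ENNReal.Tendsto.const_mul (a := C) ((tendsto_XNorm_iff hβ hμ).1 (hc t ht).2)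
        (Or.inr hC.ne)
      rw [mul_zero] at h1
      refine tendsto_of_tendsto_of_tendsto_of_le_of_le' tendsto_const_nhds h1
        (Eventually.of_forall fun _ => zero_le) ?_
      filter_upwards [self_mem_nhdsWithin] with r hr
      exact hCle _ _ _ _ (hP r hr) (hP t ht) (hx r hr) (hx t ht)
  refine ⟨hU.initial, hc, V, hVc, hasTimeDerivInX_of_proj hβ hμ hVc fun R hR t ht => ?_, hV⟩
  rw [hP t ht R hR]
  exact hU.deriv R hR t ht

/-! ### From solutions to weak solutions -/

theorem HasTimeDerivInX.hasDerivWithinAt {τ : ℝ} {U V : ℝ → RealL2 × RealL2}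
    (h : HasTimeDerivInX s β μ τ U V) (hs : 0 ≤ s) (hβ : 0 < β) (hμ : 0 < μ) :
    ∀ t ∈ Icc 0 τ, HasDerivWithinAt U (V t) (Icc 0 τ) t := by
  intro t ht
  rw [hasDerivWithinAt_iff_tendsto_slope, tendsto_iff_norm_sub_tendsto_zero]
  have h2 := ENNReal.Tendsto.const_mul (a := 2) (h t ht) (Or.inr (by simp))
  rw [mul_zero] at h2
  have h3 : Tendsto (fun r => ‖slope U t r - V t‖ₑ) (𝓝[Icc 0 τ \ {t}] t) (𝓝 0) :=
    tendsto_of_tendsto_of_tendsto_of_le_of_le tendsto_const_nhds h2 (fun _ => zero_le)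
      fun r => enorm_le_XNorm hs hβ hμ _
  have h4 := (ENNReal.tendsto_toReal ENNReal.zero_ne_top).comp h3
  exact h4.congr fun r => toReal_enorm _

/-- Since `s - 3/2 ≥ 0`, the time derivative exists in `L²` and can be truncated. Every solution of
the class thus falls under the stability estimate of `exists_weakSol`. -/
theorem IsSolution.weakDeriv {τ : ℝ} {W : RealL2 × RealL2} {U : ℝ → RealL2 × RealL2}
    (hU : IsSolution s β μ 1 τ W U) (hs : 3 / 2 < s) (hβ : 0 < β) (hμ : 0 < μ) :
    WeakDeriv β μ τ U := by
  obtain ⟨V, hVc, hd, hE⟩ := hU.equation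
  intro R hR t ht
  have h := (PX R).hasFDerivAt.comp_hasDerivWithinAt t
    (hd.hasDerivWithinAt (by linarith) hβ hμ t ht)
  rw [(hE t ht).PX_eq hs hβ hμ ((memX_iff hβ hμ).1 (hU.continuous t ht).1) R] at h
  exact h

/-! ### Scaling -/

theorem IsProduct.smul_smul {f g p : RealL2} (h : IsProduct f g p) (a b : ℝ) :
    IsProduct (a • f) (b • g) ((a * b) • p) := by
  unfold IsProduct
  filter_upwards [h, Lp.coeFn_smul a f, Lp.coeFn_smul b g, Lp.coeFn_smul (a * b) p]
    with x h1 h2 h3 h4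
  rw [h4, h3, h2, Pi.smul_apply, Pi.smul_apply, Pi.smul_apply, h1]
  simp only [smul_eq_mul]
  ring

theorem IsMultiplier.smul {σ : ℝ → ℂ} {f g : RealL2} (h : IsMultiplier σ f g) (a : ℝ) :
    IsMultiplier σ (a • f) (a • g) := by
  unfold IsMultiplier
  rw [hat_smul, hat_smul]
  filter_upwards [h, Lp.coeFn_smul a (hat f), Lp.coeFn_smul a (hat g)] with x h1 h2 h3
  rw [h2, h3, Pi.smul_apply, Pi.smul_apply, h1, mul_smul_comm]

/-- The nonlinear terms are quadratic, so scaling the state by `c` divides `ε` by `c`. This reduces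
everything to `ε = 1`. -/
theorem Equations.smul {ε c : ℝ} (hc : c ≠ 0) {U V : RealL2 × RealL2}
    (h : Equations β μ ε U V) : Equations β μ (ε / c) (c • U) (c • V) := by
  obtain ⟨dv, p, Tdp, Kdζ, q, Tq, h1, h2, h3, h4, h5, h6, h7, h8⟩ := h
  refine ⟨c • dv, (c * c) • p, (c * c) • Tdp, c • Kdζ, (c * c) • q, (c * c) • Tq, h1.smul c,
    h2.smul_smul c c, h3.smul _, h4.smul c, h5.smul_smul c c, h6.smul _, ?_, ?_⟩
  · have e : ε / c * (c * c) = c * ε := by field_simp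
    rw [Prod.smul_fst, smul_smul, e, mul_smul, ← smul_add, ← smul_add, h7, smul_zero]
  · have e : ε / c * (c * c) = c * ε := by field_simp
    rw [Prod.smul_snd, smul_smul, e, mul_smul, ← smul_add, ← smul_add, h8, smul_zero]

theorem tendsto_XNorm_smul {ι : Type*} {l : Filter ι} (hβ : 0 < β) (hμ : 0 < μ)
    {U : ι → RealL2 × RealL2} (h : Tendsto (fun i => XNorm s β μ (U i)) l (𝓝 0)) (c : ℝ) :
    Tendsto (fun i => XNorm s β μ (c • U i)) l (𝓝 0) := by
  simp only [XNorm_smul hβ hμ]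
  have h2 := ENNReal.Tendsto.const_mul (a := ‖c‖ₑ) h (Or.inr (by simp))
  rwa [mul_zero] at h2

theorem ContinuousInX.smul {τ : ℝ} {U : ℝ → RealL2 × RealL2} (hU : ContinuousInX s β μ τ U)
    (hβ : 0 < β) (hμ : 0 < μ) (c : ℝ) : ContinuousInX s β μ τ (fun t => c • U t) := by
  intro t ht
  obtain ⟨h1, h2⟩ := hU t ht
  refine ⟨?_, ?_⟩
  · unfold MemX
    rw [XNorm_smul hβ hμ]
    exact ENNReal.mul_lt_top (by simp) h1
  · simp only [← smul_sub]
    exact tendsto_XNorm_smul hβ hμ h2 c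

theorem IsSolution.smul {ε τ c : ℝ} (hc : c ≠ 0) (hβ : 0 < β) (hμ : 0 < μ) {W : RealL2 × RealL2}
    {U : ℝ → RealL2 × RealL2} (hU : IsSolution s β μ ε τ W U) :
    IsSolution s β μ (ε / c) τ (c • W) (fun t => c • U t) := by
  obtain ⟨V, hVc, hd, hE⟩ := hU.equation
  refine ⟨by rw [hU.initial], hU.continuous.smul hβ hμ c, fun t => c • V t, hVc.smul hβ hμ c,
    fun t ht => ?_, fun t ht => (hE t ht).smul hc⟩
  have := tendsto_XNorm_smul hβ hμ (hd t ht) c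
  simp only [smul_sub, smul_comm c] at this
  simpa only [smul_sub] using this

theorem IsUniqueSolution.smul {ε τ c : ℝ} (hc : c ≠ 0) (hβ : 0 < β) (hμ : 0 < μ)
    {W : RealL2 × RealL2} {U : ℝ → RealL2 × RealL2} (hU : IsUniqueSolution s β μ ε τ W U) :
    IsUniqueSolution s β μ (ε / c) τ (c • W) (fun t => c • U t) := by
  refine ⟨hU.1.smul hc hβ hμ, fun U' hU' t ht => ?_⟩
  have h1 := hU'.smul (inv_ne_zero hc) hβ hμ
  rw [smul_smul, inv_mul_cancel₀ hc, one_smul, div_inv_eq_mul, div_mul_cancel₀ _ hc] at h1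
  have h2 : c⁻¹ • U' t = U t := hU.2 _ h1 ht
  change U' t = c • U t
  rw [← h2, smul_smul, mul_inv_cancel₀ hc, one_smul]

end

/-! ### Well-posedness -/

/-- Uniqueness is the `L²` stability estimate with zero initial difference. Continuity of the flow
combines that estimate with the shared tail bounds, through `exists_XW_sub_le`. -/
theorem exists_flow {s : ℝ} (hs : 3 / 2 < s) {h c₀ : ℝ} (hh : 0 < h) (hh1 : h ≤ 1)
    (hc₀ : 0 < c₀) : ∃ M : ℝ, 1 ≤ M ∧ ∀ B : ℝ, 0 < B → ∃ c : ℝ, 0 < c ∧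
      ∀ β μ δ : ℝ, 0 < β → β ≤ B → 0 < μ → μ < 1 → 0 < δ → δ ≤ c₀ →
      ∃ Φ : RealL2 × RealL2 → ℝ → RealL2 × RealL2,
        (∀ W : RealL2 × RealL2, XW β μ (fun ξ => jb ξ ^ s) W ≤ ENNReal.ofReal δ →
          (∀ᵐ x, h - 1 ≤ W.1 x) → IsUniqueSolution s β μ 1 (c / δ) W (Φ W) ∧
          ∀ t ∈ Icc 0 (c / δ), XW β μ (fun ξ => jb ξ ^ s) (Φ W t)
            ≤ ENNReal.ofReal M * XW β μ (fun ξ => jb ξ ^ s) W) ∧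
        ∀ W : RealL2 × RealL2, XW β μ (fun ξ => jb ξ ^ s) W ≤ ENNReal.ofReal δ →
          (∀ᵐ x, h - 1 ≤ W.1 x) → ∀ η : ℝ, 0 < η → ∃ γ : ℝ, 0 < γ ∧
          ∀ Z : RealL2 × RealL2, XW β μ (fun ξ => jb ξ ^ s) Z ≤ ENNReal.ofReal δ →
            (∀ᵐ x, h - 1 ≤ Z.1 x) → XW β μ (fun ξ => jb ξ ^ s) (Z - W) ≤ ENNReal.ofReal γ →
            ∀ t ∈ Icc 0 (c / δ),
              XW β μ (fun ξ => jb ξ ^ s) (Φ Z t - Φ W t) ≤ ENNReal.ofReal η := by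
  obtain ⟨M, hM1, H⟩ := exists_weakSol hs hh hh1 hc₀
  refine ⟨M, hM1, fun B hB => ?_⟩
  obtain ⟨c, hc, H⟩ := H B hB
  refine ⟨c, hc, fun β μ δ hβ hβB hμ hμ1 hδ hδc => ?_⟩
  obtain ⟨A, hA0, H⟩ := H β μ δ hβ hβB hμ hδ hδc
  have hM0 : 0 ≤ M := by linarith
  choose! Φ hΦ hstab using H
  have hb : ∀ W : RealL2 × RealL2, XW β μ (fun ξ => jb ξ ^ s) W ≤ ENNReal.ofReal δ →
      (∀ᵐ x, h - 1 ≤ W.1 x) → ∀ t ∈ Icc 0 (c / δ), XW β μ (fun ξ => jb ξ ^ s) (Φ W t)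
        ≤ ENNReal.ofReal M * XW β μ (fun ξ => jb ξ ^ s) W := fun W hW hl t ht => by
    have := (hΦ W hW hl).bound t ht 1 1 one_pos le_rfl
    rwa [wt_one] at this
  refine ⟨Φ, fun W hW hl => ⟨⟨(hΦ W hW hl).isSolution hs hβ hμ hμ1 hM0
    (hW.trans_lt (by simp)), fun U' hU' t ht => ?_⟩, hb W hW hl⟩, fun W hW hl η hη => ?_⟩
  · obtain ⟨x, hx0, hx⟩ := hU'.continuous.exists_XW_le hβ hμ
    have := hstab W hW hl x U' (hU'.weakDeriv hs hβ hμ) hx 0 le_rfl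
      (by rw [hU'.initial, sub_self]; simp [XW, wN_zero]) t ht
    rw [mul_zero, norm_le_zero_iff, sub_eq_zero] at this
    exact this.symm
  · obtain ⟨γ, hγ, key⟩ := exists_XW_sub_le hμ hM0 (hW.trans_lt (by simp)) hη
    have hA := hA0 (M * δ)
    set a := A (M * δ) with ha
    -- The flow is Lipschitz in `L²` with constant `a`, so an initial distance `γ/(a + 1)` keeps the
    -- solutions within `γ` of each other.
    refine ⟨min γ (γ / (a + 1)), lt_min hγ (by positivity), fun Z hZ hZl hZW t ht => ?_⟩
    refine key Z (Φ Z t) (Φ W t) (hZW.trans (ENNReal.ofReal_le_ofReal (min_le_left _ _)))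
      ((hΦ Z hZ hZl).bound t ht) ((hΦ W hW hl).bound t ht) ?_
    have h1 : XW β μ (fun _ => 1) (Z - Φ W 0) ≤ ENNReal.ofReal (γ / (a + 1)) := by
      rw [(hΦ W hW hl).initial]
      exact ((XW_mono_of_le (fun _ => zero_le_one) (one_le_jb_rpow (by linarith)) _).trans
        hZW).trans (ENNReal.ofReal_le_ofReal (min_le_right _ _))
    refine (hstab Z hZ hZl (M * δ) (Φ W) (hΦ W hW hl).deriv (fun t ht => ?_) (γ / (a + 1))
      (by positivity) h1 t ht).trans ?_
    · refine (hb W hW hl t ht).trans ?_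
      rw [ENNReal.ofReal_mul hM0]
      exact mul_le_mul_right hW _
    · rw [mul_div_assoc', div_le_iff₀ (by positivity)]
      nlinarith

theorem enorm_eq_ofReal_of_pos {c : ℝ} (hc : 0 < c) : ‖c‖ₑ = ENNReal.ofReal c :=
  Real.enorm_of_nonneg hc.le

/-- Scaling of `exists_flow`: solutions for parameter `ε` are `ε⁻¹` times solutions for `ε = 1`. The
radius of the ball of data is chosen so that size and non-cavitation degrade by controlled factors
and the time interval is common. -/
theorem exists_wellPosed {s : ℝ} (hs : 3 / 2 < s) {h₀ : ℝ} (hh₀ : 0 < h₀) (hh₀' : h₀ < 1)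
    {c₀ : ℝ} (hc₀ : 0 < c₀) : ∃ C : ℝ, 0 < C ∧ ∀ B : ℝ, 0 < B → ∃ c : ℝ, 0 < c ∧
      ∀ β μ ε : ℝ, 0 < β → β ≤ B → 0 < μ → μ < 1 → 0 < ε →
      ∀ U₀ : RealL2 × RealL2, U₀ ≠ 0 → MemX s β μ U₀ → NonCavitation h₀ ε U₀.1 →
      ε ≤ c₀ / (XNorm s β μ U₀).toReal →
      ∀ T : ℝ, T = c / (XNorm s β μ U₀).toReal →
        (∃ U : ℝ → RealL2 × RealL2, IsUniqueSolution s β μ ε (T / ε) U₀ U ∧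
          ∀ t ∈ Icc 0 (T / ε), XNorm s β μ (U t) ≤ ENNReal.ofReal C * XNorm s β μ U₀) ∧
        (∃ r : ℝ, 0 < r ∧ ∃ Φ : RealL2 × RealL2 → ℝ → RealL2 × RealL2,
          (∀ W₀ : RealL2 × RealL2, XNorm s β μ (W₀ - U₀) < ENNReal.ofReal r →
            IsUniqueSolution s β μ ε (T / ε) W₀ (Φ W₀)) ∧
          (∀ W₀ : RealL2 × RealL2, XNorm s β μ (W₀ - U₀) < ENNReal.ofReal r →
            ∀ δ : ℝ, 0 < δ → ∃ γ : ℝ, 0 < γ ∧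
              ∀ Z₀ : RealL2 × RealL2, XNorm s β μ (Z₀ - U₀) < ENNReal.ofReal r →
                XNorm s β μ (Z₀ - W₀) < ENNReal.ofReal γ →
                ∀ t ∈ Icc 0 (T / ε),
                  XNorm s β μ (Φ Z₀ t - Φ W₀ t) ≤ ENNReal.ofReal δ)) := by
  -- Nearby data keep half of `h₀` and at most twice the norm. Another factor `2` comes from
  -- comparing `XW` with `XNorm`, hence `4c₀`.
  obtain ⟨M, hM1, H⟩ := exists_flow hs (h := h₀ / 2) (c₀ := 4 * c₀) (by positivity) (by linarith)
    (by positivity)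
  obtain ⟨K, hK1, hKs⟩ := exists_aN_jb_le hs
  have hK0 : 0 < K := by linarith
  refine ⟨4 * M, by linarith, fun B hB => ?_⟩
  obtain ⟨c, hc, H⟩ := H B hB
  refine ⟨c / 4, by positivity, fun β μ ε hβ hβB hμ hμ1 hε U₀ hU₀ hmem hnc hεc T hT => ?_⟩
  set N := (XNorm s β μ U₀).toReal with hN
  have hNe : XNorm s β μ U₀ = ENNReal.ofReal N := (ENNReal.ofReal_toReal hmem.ne).symm
  have hN0 : 0 < N := by
    refine ENNReal.toReal_pos (fun h => hU₀ ?_) hmem.ne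
    have := enorm_le_XNorm (s := s) (by linarith) hβ hμ U₀
    rw [h, mul_zero] at this
    simpa using this
  have hδ : 4 * (ε * N) ≤ 4 * c₀ := by
    rw [le_div_iff₀ hN0] at hεc; linarith
  obtain ⟨Φ, hΦ, hΦc⟩ := H β μ (4 * (ε * N)) hβ hβB hμ hμ1 (by positivity) hδ
  -- With size `δ = 4εN` the time `c/δ` is exactly `T/ε`, which is why the witness above is `c/4`.
  have hτ : c / (4 * (ε * N)) = T / ε := by rw [hT]; field_simp
  rw [hτ] at hΦ hΦc
  -- The first entry at most doubles the norm. The second, through the embedding constant `K`, keeps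
  -- `εW₀` within `h₀/2` of `εU₀` pointwise.
  set r := min N (h₀ / (4 * ε * K)) with hr
  have hr0 : 0 < r := lt_min hN0 (by positivity)
  have hj := evenS_jb_rpow s
  have hXWr : ∀ {Z : RealL2 × RealL2} {a : ℝ}, XNorm s β μ Z ≤ ENNReal.ofReal a →
      XW β μ (fun ξ => jb ξ ^ s) Z ≤ ENNReal.ofReal (2 * a) := fun {Z a} h => by
    rw [ENNReal.ofReal_mul zero_le_two, ENNReal.ofReal_ofNat]
    exact (XW_le_XNorm hβ hμ Z).trans (mul_le_mul_right h _)
  have hXWε : ∀ {Z : RealL2 × RealL2} {a : ℝ}, XNorm s β μ Z ≤ ENNReal.ofReal a →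
      XW β μ (fun ξ => jb ξ ^ s) (ε • Z) ≤ ENNReal.ofReal (ε * (2 * a)) := fun {Z a} h => by
    rw [XW_smul, enorm_eq_ofReal_of_pos hε, ENNReal.ofReal_mul hε.le]
    exact mul_le_mul_right (hXWr h) _
  have size : ∀ W₀ : RealL2 × RealL2, XNorm s β μ (W₀ - U₀) < ENNReal.ofReal r →
      XW β μ (fun ξ => jb ξ ^ s) (ε • W₀) ≤ ENNReal.ofReal (4 * (ε * N)) := fun W₀ hW => by
    have h1 : XW β μ (fun ξ => jb ξ ^ s) (ε • U₀) ≤ ENNReal.ofReal (ε * (2 * N)) := hXWε hNe.le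
    have h2 := hXWε hW.le
    rw [smul_sub] at h2
    refine (XW_le_add_sub hμ hj _ _).trans ((add_le_add h1 h2).trans ?_)
    rw [← ENNReal.ofReal_add (by positivity) (by positivity)]
    refine ENNReal.ofReal_le_ofReal ?_
    have : ε * r ≤ ε * N := mul_le_mul_of_nonneg_left (min_le_left _ _) hε.le
    linarith
  have hnc' : ∀ᵐ x, h₀ - 1 ≤ (ε • U₀).1 x := by
    filter_upwards [hnc, Lp.coeFn_smul ε U₀.1] with x h1 h2
    rw [Prod.smul_fst, h2, Pi.smul_apply, smul_eq_mul]
    linarith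
  have lower : ∀ W₀ : RealL2 × RealL2, XNorm s β μ (W₀ - U₀) < ENNReal.ofReal r →
      ∀ᵐ x, h₀ / 2 - 1 ≤ (ε • W₀).1 x := fun W₀ hW => by
    have h2 := hXWε hW.le
    rw [smul_sub, XW_sub_comm] at h2
    have h3 := (aN_one_le_jb _).trans ((hKs (ε • U₀ - ε • W₀).1).trans
      (mul_le_mul_right ((wN_fst_le_XW (m := fun ξ => jb ξ ^ s) hβ hμ _).trans h2) _))
    rw [← ENNReal.ofReal_mul hK0.le] at h3
    have h4 := le_of_aN_sub_le (f := (ε • U₀).1) (g := (ε • W₀).1) (by positivity) hnc' h3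
    filter_upwards [h4] with x hx
    have h5 : r ≤ h₀ / (4 * ε * K) := min_le_right _ _
    rw [le_div_iff₀ (by positivity)] at h5
    linarith
  have hεne : ε⁻¹ ≠ 0 := inv_ne_zero hε.ne'
  have uniq : ∀ W₀ : RealL2 × RealL2, XNorm s β μ (W₀ - U₀) < ENNReal.ofReal r →
      IsUniqueSolution s β μ ε (T / ε) W₀ (fun t => ε⁻¹ • Φ (ε • W₀) t) := fun W₀ hW => by
    have := (hΦ _ (size W₀ hW) (lower W₀ hW)).1.smul hεne hβ hμ
    rwa [smul_smul, inv_mul_cancel₀ hε.ne', one_smul, one_div, inv_inv] at this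
  have hUU : XNorm s β μ (U₀ - U₀) < ENNReal.ofReal r := by
    rw [sub_self, ← zero_smul ℝ (0 : RealL2 × RealL2), XNorm_smul hβ hμ]
    simpa using hr0
  have hback : ∀ {Z : RealL2 × RealL2}, XNorm s β μ (ε⁻¹ • Z)
      ≤ ENNReal.ofReal (ε⁻¹ * 2) * XW β μ (fun ξ => jb ξ ^ s) Z := fun {Z} => by
    rw [XNorm_smul hβ hμ, enorm_eq_ofReal_of_pos (inv_pos.2 hε), ENNReal.ofReal_mul (by positivity),
      ENNReal.ofReal_ofNat, mul_assoc]
    exact mul_le_mul_right (XNorm_le_XW hβ hμ Z) _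
  refine ⟨⟨_, uniq U₀ hUU, fun t ht => ?_⟩, r, hr0, fun W₀ t => ε⁻¹ • Φ (ε • W₀) t, uniq,
    fun W₀ hW δ hδ0 => ?_⟩
  · refine hback.trans ((mul_le_mul_right ((hΦ _ (size U₀ hUU) (lower U₀ hUU)).2 t ht) _).trans ?_)
    refine (mul_le_mul_right (mul_le_mul_right (hXWε hNe.le) _) _).trans (le_of_eq ?_)
    rw [hNe, ← ENNReal.ofReal_mul (by positivity), ← ENNReal.ofReal_mul (by positivity),
      ← ENNReal.ofReal_mul (by positivity)]
    congr 1
    field_simp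
    ring
  · obtain ⟨γ, hγ, key⟩ := hΦc _ (size W₀ hW) (lower W₀ hW) (ε * δ / 2) (by positivity)
    refine ⟨γ / (2 * ε), by positivity, fun Z₀ hZ hZW t ht => ?_⟩
    have h1 := hXWε hZW.le
    rw [smul_sub, show ε * (2 * (γ / (2 * ε))) = γ by field_simp] at h1
    have h2 := key _ (size Z₀ hZ) (lower Z₀ hZ) h1 t ht
    rw [← smul_sub]
    refine hback.trans ((mul_le_mul_right h2 _).trans (le_of_eq ?_))
    rw [← ENNReal.ofReal_mul (by positivity)]
    congr 1
    field_simp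

/-! ### Coercivity of the energy -/

theorem norm_symJ (s ξ : ℝ) : ‖symJ s ξ‖ = jb ξ ^ s := by
  rw [symJ, Complex.norm_real, Real.norm_of_nonneg (by positivity), jb, Real.sqrt_eq_rpow,
    ← Real.rpow_mul (by positivity)]
  congr 1; ring

theorem integral_hat_symJ {s : ℝ} {f a : RealL2} (h : IsMultiplier (symJ s) f a) {v : ℝ → ℝ}
    (hv : Measurable v) (hv0 : ∀ ξ, 0 ≤ v ξ) :
    ∫ k : ℝ, v (2 * Real.pi * k) * ‖hat a k‖ ^ 2
      = (wN (fun ξ => jb ξ ^ s * √(v ξ)) f ^ 2).toReal := by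
  rw [integral_eq_lintegral_of_nonneg_ae (ae_of_all _ fun k => mul_nonneg (hv0 _) (sq_nonneg _))
    (Measurable.aestronglyMeasurable (Measurable.mul
      (hv.comp (f := fun k : ℝ => 2 * Real.pi * k) (measurable_const.mul measurable_id))
      ((measurable_hat a).norm.pow_const 2))), wN_sq]
  congr 1
  refine lintegral_congr_ae ?_
  filter_upwards [h] with k hk
  rw [hk, norm_mul, norm_symJ, mul_pow, mul_pow, Real.sq_sqrt (hv0 _)]
  congr 1; ring

theorem norm_sq_of_symJ {s : ℝ} {f a : RealL2} (h : IsMultiplier (symJ s) f a) :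
    ‖a‖ₑ = wN (fun ξ => jb ξ ^ s) f := by
  rw [enorm_eq_eLpNorm_hat]
  apply eLpNorm_congr_norm_ae
  filter_upwards [h] with k hk
  have := jb_pos (2 * Real.pi * k)
  rw [hk, norm_mul, norm_mul, norm_symJ, Complex.norm_real, Real.norm_of_nonneg (by positivity)]

theorem integral_mul_sq_eq_inner {f : RealL2} (hf : Wiener f) (b : RealL2) :
    ∫ x, f x * b x ^ 2 = inner ℝ (pr f b) b := by
  rw [L2.inner_def]
  apply integral_congr_ae
  filter_upwards [hf.isProduct b] with x hx
  simp only [hx, RCLike.inner_apply, conj_trivial]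
  ring

/-- After `J^s` only `⟨b, (𝒯_μ⁻¹ + η)b⟩` matters. Its lower bound uses `η ≥ h₀ - 1` and `𝒯_μ⁻¹ ≥ 1`,
the upper one the embedding of `H^s` into bounded functions, and `𝒯_μ⁻¹` is comparable to `1 +
√μ|ξ|` independently of `μ`. -/
theorem energy_coercive {s : ℝ} (hs : 3 / 2 < s) {h₀ : ℝ} (hh₀ : 0 < h₀) (hh₀' : h₀ < 1) {h₁ : ℝ}
    (hh₁ : 0 < h₁) : ∃ m M : ℝ, 0 < m ∧ 0 < M ∧
      ∀ β μ : ℝ, 0 < β → 0 < μ → μ < 1 →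
      ∀ η u a b : RealL2, MemX s β μ (η, u) →
        IsMultiplier (symJ s) η a → IsMultiplier (symJ s) u b →
        (∀ᵐ x : ℝ, h₀ - 1 ≤ η x) →
        sobolevSq s η + sobolevSq s u ≤ ENNReal.ofReal (h₁ ^ 2) →
          m * (XNorm s β μ (η, u)).toReal ^ 2 ≤ energy β μ η a b ∧
          energy β μ η a b ≤ M * (XNorm s β μ (η, u)).toReal ^ 2 := by
  obtain ⟨K, hK1, hKs⟩ := exists_aN_jb_le hs
  have hK0 : 0 < K := by linarith
  -- The factor `1/2` is lost in `1 + √μ|ξ| ≤ 2𝒯_μ⁻¹`; `K * h₁` bounds `|η|`.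
  refine ⟨h₀ / 2, 1 + K * h₁, by positivity, by positivity,
    fun β μ hβ hμ _ η u a b hm ha hb hl hn => ?_⟩
  have hη : wN (fun ξ => jb ξ ^ s) η ≤ ENNReal.ofReal h₁ := by
    rw [sobolevSq_eq, sobolevSq_eq, ENNReal.ofReal_pow hh₁.le] at hn
    exact (ENNReal.pow_le_pow_left_iff two_ne_zero).1 (le_self_add.trans hn)
  have haN : aN (fun _ => 1) η ≤ ENNReal.ofReal (K * h₁) := by
    rw [ENNReal.ofReal_mul hK0.le]
    exact (aN_one_le_jb _).trans ((hKs η).trans (mul_le_mul_right hη _))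
  have hW : Wiener η := haN.trans_lt (by simp)
  set A := wN (fun ξ => jb ξ ^ s * √(lam β μ ξ)) η with hA
  set S := wN (fun ξ => jb ξ ^ s * sig μ ξ) u with hS
  set T := wN (fun ξ => jb ξ ^ s * √(tau μ ξ)) u with hT
  have hX : XNorm s β μ (η, u) ^ 2 = A ^ 2 + S ^ 2 := by
    rw [XNorm_eq hβ hμ, ← ENNReal.rpow_natCast, ← ENNReal.rpow_mul]
    norm_num [hA, hS]
  have hfin : A ^ 2 + S ^ 2 < ∞ := by
    rw [← hX]; exact ENNReal.pow_lt_top hm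
  have hA2 : A ^ 2 ≠ ∞ := (le_self_add.trans_lt hfin).ne
  have hS2 : S ^ 2 ≠ ∞ := (le_add_self.trans_lt hfin).ne
  have hXr : (XNorm s β μ (η, u)).toReal ^ 2 = A.toReal ^ 2 + S.toReal ^ 2 := by
    rw [← ENNReal.toReal_pow, hX, ENNReal.toReal_add hA2 hS2, ENNReal.toReal_pow,
      ENNReal.toReal_pow]
  have hSt : S ≠ ∞ := fun h => hS2 (by rw [h]; rfl)
  have hTS : T ≤ S := wN_mono_of_abs_le (fun ξ => by
    have h := jb_pos ξ
    rw [abs_of_nonneg (by positivity), abs_of_nonneg (by unfold sig; positivity)]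
    exact mul_le_mul_of_nonneg_left (Real.sqrt_le_sqrt (tau_le hμ ξ)) (by positivity)) u
  have hST : S ≤ ENNReal.ofReal (√2) * T := wN_mono (fun ξ => by
    have h := jb_pos ξ
    rw [abs_of_nonneg (by unfold sig; positivity), abs_of_nonneg (by positivity), mul_left_comm]
    refine mul_le_mul_of_nonneg_left ?_ (by positivity)
    rw [sig, ← Real.sqrt_mul zero_le_two]
    exact Real.sqrt_le_sqrt (le_two_tau hμ ξ)) u
  have hTt : T ≠ ∞ := (hTS.trans_lt hSt.lt_top).ne
  have r1 : T.toReal ^ 2 ≤ S.toReal ^ 2 :=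
    pow_le_pow_left₀ ENNReal.toReal_nonneg (ENNReal.toReal_mono hSt hTS) 2
  have r2 : S.toReal ^ 2 ≤ 2 * T.toReal ^ 2 := by
    have h := ENNReal.toReal_mono (ENNReal.mul_ne_top (by simp) hTt) hST
    rw [ENNReal.toReal_mul, ENNReal.toReal_ofReal (by positivity)] at h
    refine (pow_le_pow_left₀ ENNReal.toReal_nonneg h 2).trans ?_
    rw [mul_pow, Real.sq_sqrt zero_le_two]
  have e1 : ∫ k : ℝ, (1 + β * μ * (2 * Real.pi * k) ^ 2) * ‖hat a k‖ ^ 2 = A.toReal ^ 2 := by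
    rw [← ENNReal.toReal_pow]
    exact integral_hat_symJ ha (evenS_lam β μ).cont.measurable fun ξ => (lam_pos hβ hμ ξ).le
  have e2 : ∫ k : ℝ, (symT μ (2 * Real.pi * k))⁻¹ * ‖hat b k‖ ^ 2 = T.toReal ^ 2 := by
    rw [← ENNReal.toReal_pow]
    exact integral_hat_symJ hb (evenS_tau hμ).cont.measurable fun ξ => (tau_pos hμ ξ).le
  have hbT : ‖b‖ ^ 2 ≤ T.toReal ^ 2 := by
    refine pow_le_pow_left₀ (norm_nonneg _) (norm_le_of_enorm_le ENNReal.toReal_nonneg ?_) 2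
    rw [ENNReal.ofReal_toReal hTt, norm_sq_of_symJ hb]
    refine wN_mono_of_abs_le (fun ξ => ?_) u
    rw [abs_mul, abs_of_nonneg (Real.sqrt_nonneg _)]
    exact le_mul_of_one_le_right (abs_nonneg _) (Real.one_le_sqrt.2 (one_le_tau hμ ξ))
  have l1 := le_inner_pr hW hl b
  have l2 : inner ℝ (pr η b) b ≤ K * h₁ * ‖b‖ ^ 2 := by
    refine (real_inner_le_norm _ _).trans ?_
    have := norm_pr_le hW b
    have h2 := ENNReal.toReal_le_of_le_ofReal (by positivity) haN
    nlinarith [norm_nonneg b, mul_le_mul_of_nonneg_right h2 (norm_nonneg b)]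
  rw [energy, e1, e2, integral_mul_sq_eq_inner hW, hXr]
  have hA0 := sq_nonneg A.toReal
  constructor
  · have k1 : (1 - h₀) * ‖b‖ ^ 2 ≤ (1 - h₀) * T.toReal ^ 2 :=
      mul_le_mul_of_nonneg_left hbT (by linarith)
    have k2 : h₀ * S.toReal ^ 2 ≤ h₀ * (2 * T.toReal ^ 2) := mul_le_mul_of_nonneg_left r2 hh₀.le
    have k3 : h₀ * A.toReal ^ 2 ≤ 1 * A.toReal ^ 2 := mul_le_mul_of_nonneg_right hh₀'.le hA0
    linarith
  · have : K * h₁ * ‖b‖ ^ 2 ≤ K * h₁ * T.toReal ^ 2 := by gcongr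
    have : K * h₁ * T.toReal ^ 2 ≤ K * h₁ * S.toReal ^ 2 := by gcongr
    have : 0 ≤ K * h₁ * A.toReal ^ 2 := by positivity
    linarith

end WhithamBoussinesq

end

open WhithamBoussinesq in
theorem theorem1p7 (s : ℝ) (hs : 3 / 2 < s) (h₀ : ℝ) (hh₀ : 0 < h₀) (hh₀' : h₀ < 1) :
    -- well-posedness on the time interval `[0, T/ε]`, `T = c / ‖(ζ₀,v₀)‖`
    (∀ c₀ : ℝ, 0 < c₀ → ∃ C : ℝ, 0 < C ∧ ∀ B : ℝ, 0 < B → ∃ c : ℝ, 0 < c ∧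
      ∀ β μ ε : ℝ, 0 < β → β ≤ B → 0 < μ → μ < 1 → 0 < ε →
      ∀ U₀ : RealL2 × RealL2, U₀ ≠ 0 → MemX s β μ U₀ → NonCavitation h₀ ε U₀.1 →
      ε ≤ c₀ / (XNorm s β μ U₀).toReal →
      ∀ T : ℝ, T = c / (XNorm s β μ U₀).toReal →
        -- a unique solution, bounded by the datum
        (∃ U : ℝ → RealL2 × RealL2, IsUniqueSolution s β μ ε (T / ε) U₀ U ∧
          ∀ t ∈ Set.Icc 0 (T / ε), XNorm s β μ (U t) ≤ ENNReal.ofReal C * XNorm s β μ U₀) ∧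
        -- the flow map is defined and continuous on a neighbourhood of the datum
        (∃ r : ℝ, 0 < r ∧ ∃ Φ : RealL2 × RealL2 → ℝ → RealL2 × RealL2,
          (∀ W₀ : RealL2 × RealL2, XNorm s β μ (W₀ - U₀) < ENNReal.ofReal r →
            IsUniqueSolution s β μ ε (T / ε) W₀ (Φ W₀)) ∧
          (∀ W₀ : RealL2 × RealL2, XNorm s β μ (W₀ - U₀) < ENNReal.ofReal r →
            ∀ δ : ℝ, 0 < δ → ∃ γ : ℝ, 0 < γ ∧
              ∀ Z₀ : RealL2 × RealL2, XNorm s β μ (Z₀ - U₀) < ENNReal.ofReal r →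
                XNorm s β μ (Z₀ - W₀) < ENNReal.ofReal γ →
                ∀ t ∈ Set.Icc 0 (T / ε),
                  XNorm s β μ (Φ Z₀ t - Φ W₀ t) ≤ ENNReal.ofReal δ))) ∧
    -- coercivity of the energy, uniformly in `β` (and `μ`)
    (∀ h₁ : ℝ, 0 < h₁ → ∃ m M : ℝ, 0 < m ∧ 0 < M ∧
      ∀ β μ : ℝ, 0 < β → 0 < μ → μ < 1 →
      ∀ η u a b : RealL2, MemX s β μ (η, u) →
        IsMultiplier (symJ s) η a → IsMultiplier (symJ s) u b →
        (∀ᵐ x : ℝ, h₀ - 1 ≤ η x) →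
        sobolevSq s η + sobolevSq s u ≤ ENNReal.ofReal (h₁ ^ 2) →
          m * (XNorm s β μ (η, u)).toReal ^ 2 ≤ energy β μ η a b ∧
          energy β μ η a b ≤ M * (XNorm s β μ (η, u)).toReal ^ 2) := by
  exact ⟨fun _ hc₀ => exists_wellPosed hs hh₀ hh₀' hc₀, fun _ hh₁ => energy_coercive hs hh₀ hh₀' hh₁⟩
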